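/- Let $\mathbb K=\mathbb R$ or $\mathbb C$, let $\mathfrak g$ be a finite-dimensional Lie algebra over $\mathbb K$ with a reductive decomposition $\mathfrak g=\mathfrak l\oplus\mathfrak m$ ($\mathfrak l$ a subalgebra, $[\mathfrak l,\mathfrak m]\subset\mathfrak m$), inclusion $i:\mathfrak l\to\mathfrak g$, projection $p_{\mathfrak l}:\mathfrak g\to\mathfrak l$ along $\mathfrak m$, and $s=(p_{\mathfrak l})^*:\mathfrak l^*\to\mathfrak g^*$. Let $\mathrm{ad}^*_x$ be the transpose of $\mathrm{ad}_x$, and $\mathcal A(\mathfrak g^*,\mathfrak g)$ the space of skew-symmetric linear maps $\mathfrak g^*\to\mathfrak g$. Let $\mathcal G=(\mathfrak g,[\,,],\varpi,\varphi)$ be a Lie quasi-bialgebra: $\varpi:\mathfrak g\to\mathcal A(\mathfrak g^*,\mathfrak g)$ is a 1-cocycle, $\varphi\in\wedge^3\mathfrak g$, and $\mathfrak d=\mathfrak g\oplus\mathfrak g^*$ is a Lie algebra for the bracket extending that of $\mathfrak g$ with $[x,\xi]=\varpi_x\xi-\mathrm{ad}^*_x\xi$ and $[\xi,\eta]=\langle\eta,\varpi_\bullet\xi\rangle+\langle\xi\otimes\eta\otimes1,\varphi\rangle$.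 Assume that $\mathcal G$ is compatible with the decomposition: $\varpi|_{\mathfrak l}=0$, $\langle\mathfrak m^\perp,\varpi_\bullet\mathfrak m^\perp\rangle=0$, and $\varphi\in\mathrm{Alt}(\mathfrak l\otimes\mathfrak l\otimes\mathfrak l\oplus\mathfrak l\otimes\mathfrak m\otimes\mathfrak m\oplus\mathfrak m\otimes\mathfrak m\otimes\mathfrak m)$. For $t\in\mathcal A(\mathfrak g^*,\mathfrak g)$ let $\mathcal G^t=(\mathfrak g,[\,,],\varpi^t,\varphi^t)$ be the twist, $\varpi^t_x=\varpi_x+\mathrm{ad}_xt+t\,\mathrm{ad}^*_x$ and $\langle\xi\otimes\eta\otimes\zeta,\varphi^t\rangle=\langle\xi\otimes\eta\otimes\zeta,\varphi\rangle+\mathrm{Cycl}_{(\xi,\eta,\zeta)}\langle\zeta,[t\xi,t\eta]+\varpi_{t\xi}\eta\rangle$. Let $\mathbb D$ be the formal neighbourhood of $0$ in $\mathfrak l^*$ and $\mathrm{Dynl}(\mathbb D,\mathcal G)$ the set of formal maps $l:\mathbb D\to\mathcal A(\mathfrak g^*,\mathfrak g)$ such that $$\mathrm{Cycl}_{(\xi,\eta,\zeta)}\big(\langle\zeta,d_pl(i^*\xi)\eta\rangle-\langle\zeta,[l_p\xi,l_p\eta]\rangle-\langle\zeta,\varpi_{l_p\xi}\eta\rangle\big)=\langle\xi\otimes\eta\otimes\zeta,\varphi\rangle,$$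 $$d_pl(\mathrm{ad}^*_zp)+\varpi_{iz}+\mathrm{ad}_{iz}l_p+l_p\,\mathrm{ad}^*_{iz}=0\qquad(z\in\mathfrak l).$$ Let $G$ be a Lie group with Lie algebra $\mathfrak g$. The group of $\mathfrak l$-equivariant formal maps $\sigma:\mathbb D\to G$ with $\sigma_0=1$ (that is, $\sigma=e^\Sigma$ with $\Sigma:\mathbb D\to\mathfrak g$ formal, $\Sigma_0=0$, $d_p\Sigma(\mathrm{ad}^*_zp)=-[z,\Sigma_p]$) acts on it by $$l^\sigma_p=\mathrm{Ad}_{\sigma_p}l_p\mathrm{Ad}^*_{\sigma_p}+A_p\,i^*\mathrm{Ad}^*_{\sigma_p}-A_p^*+\pi_{\sigma_p},\qquad A_p=\tfrac{e^{\mathrm{ad}\Sigma_p}-1}{\mathrm{ad}\Sigma_p}\,d_p\Sigma,$$ where $A_p$ is the right logarithmic derivative of $\sigma$ and $\pi$ is the group 1-cocycle integrating $\varpi$. Let $\mathcal M(\mathcal G,\mathfrak l)$ be the quotient of $\mathrm{Dynl}(\mathbb D,\mathcal G)$ by gauge equivalence, and $$\mathcal M_{\mathcal G,\mathfrak l,\mathfrak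 m}=\{t\in(\wedge^2\mathfrak m)^{\mathfrak l}\;:\;\varphi^t\equiv0\bmod\mathfrak l\}.$$ Then gauge equivalence ($l\sim l'$ iff $l'=l^\sigma$ for some such $\sigma$) is an equivalence relation, every class in $\mathcal M(\mathcal G,\mathfrak l)$ has a representative $l$ with $l_0\mathfrak m^\perp=0$ and $l_0\mathfrak l^\perp\subset\mathfrak m$, and sending the class of such an $l$ to $l_0$ gives a well-defined bijection $\mathcal M(\mathcal G,\mathfrak l)\to\mathcal M_{\mathcal G,\mathfrak l,\mathfrak m}$. Moreover, for $\rho\in\mathcal M_{\mathcal G,\mathfrak l,\mathfrak m}$, the class mapped to $\rho$ is represented by the Taylor series at $0$ of $l^{can}+\rho$, where $l^{can}$ is formed from $\mathcal G^\rho$, with double $\mathfrak d^\rho$, by $$l^{can}_p(s\alpha+\xi)=F(\mathrm{ad}_p)\alpha-\big(p_{\mathfrak g}e^{-\mathrm{ad}_{sp}}i_{\mathfrak g}\big)^{-1}p_{\mathfrak g}e^{-\mathrm{ad}_{sp}}\xi\qquad(\alpha\in\mathfrak l^*,\ \xi\in\mathfrak l^\perp);$$ here $F(z)=\coth z-1/z$,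 $\mathrm{ad}_p$ acts on the double $\mathfrak l\oplus\mathfrak l^*$ of the Lie quasi-bialgebra $(\mathfrak l,[\,,],0,p_{\mathfrak l}^{(3)}\varphi^\rho)$, $\mathrm{ad}_{sp}$ acts on $\mathfrak d^\rho=\mathfrak g\oplus\mathfrak g^*$, and $p_{\mathfrak g},i_{\mathfrak g}$ are the projection to and inclusion of $\mathfrak g$. The map $l^{can}$ is analytic on the open set $U\ni0$ of those $p\in\mathfrak l^*$ such that the complex spectrum of $\mathrm{ad}_p$ on $\mathfrak l\oplus\mathfrak l^*$ does not meet $i\pi\mathbb Z\setminus\{0\}$ and $0$ is not in the spectrum of $p_{\mathfrak g}e^{-\mathrm{ad}_{sp}}i_{\mathfrak g}$. -/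

import Mathlib

open Module Finset Topology

noncomputable section

namespace DynLie

/-! ### Lie quasi-bialgebras -/

section QuasiBialgebra

variable (K : Type*) [Field K] (𝔤 : Type*) [LieRing 𝔤] [LieAlgebra K 𝔤]

/-- The transpose `ad*_x : 𝔤* → 𝔤*` of `ad_x` (no sign): `ad*_x ξ = ξ ∘ ad_x`. -/
def coad : 𝔤 →ₗ[K] End K (Dual K 𝔤) := Dual.transpose ∘ₗ (LieAlgebra.ad K 𝔤 : 𝔤 →ₗ[K] End K 𝔤)

/-- The space `𝒜(𝔤*, 𝔤)` of skew-symmetric linear maps from `𝔤*` to `𝔤`. -/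
def skewMaps : Submodule K (Dual K 𝔤 →ₗ[K] 𝔤) where
  carrier := {t | ∀ ξ η : Dual K 𝔤, ξ (t η) = -η (t ξ)}
  add_mem' := by
    intro s t hs ht ξ η
    simp only [Set.mem_ofPred_eq, LinearMap.add_apply, map_add] at *
    rw [hs ξ η, ht ξ η]; ring
  zero_mem' := by intro ξ η; simp
  smul_mem' := by
    intro c t ht ξ η
    simp only [Set.mem_ofPred_eq, LinearMap.smul_apply, map_smul, smul_eq_mul] at *
    rw [ht ξ η]; ring

/-- The natural action of `𝔤` on linear maps `𝔤* → 𝔤`: `x · T = ad_x T + T ad*_x`. -/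
def adjAct : 𝔤 →ₗ[K] End K (Dual K 𝔤 →ₗ[K] 𝔤) :=
  LinearMap.mk₂ K (fun x T => LieAlgebra.ad K 𝔤 x ∘ₗ T + T ∘ₗ coad K 𝔤 x)
    (by intro x y T; ext ξ; simp; abel)
    (by intro c x T; ext ξ; simp)
    (by intro x S T; ext ξ; simp; abel)
    (by intro c x T; ext ξ; simp)

/-- A pair `(ϖ, φ)` consisting of a linear map `ϖ : 𝔤 → 𝒜(𝔤*, 𝔤)` and an element `φ ∈ ⋀³ 𝔤`,
the latter given as the alternating trilinear form `(ξ, η, ζ) ↦ ⟨ξ ⊗ η ⊗ ζ, φ⟩` on `𝔤*`. -/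
structure QuasiData where
  /-- the map `ϖ` -/
  cocycle : 𝔤 →ₗ[K] Dual K 𝔤 →ₗ[K] 𝔤
  cocycle_skew : ∀ x, cocycle x ∈ skewMaps K 𝔤
  /-- the associator `φ` -/
  assoc : Dual K 𝔤 →ₗ[K] Dual K 𝔤 →ₗ[K] Dual K 𝔤 →ₗ[K] K
  assoc_self_left : ∀ ξ ζ, assoc ξ ξ ζ = 0
  assoc_self_right : ∀ ξ η, assoc ξ η η = 0

variable {K 𝔤}

namespace QuasiData

variable (G : QuasiData K 𝔤)

/-- The bracket of the double `𝔡 = 𝔤 ⊕ 𝔤*`: it extends that of `𝔤`,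
`[x, ξ] = ϖ_x ξ - ad*_x ξ` and `[ξ, η] = ⟨η, ϖ_• ξ⟩ + ⟨ξ ⊗ η ⊗ 1, φ⟩`. -/
def doubleBracket [FiniteDimensional K 𝔤] (X Y : 𝔤 × Dual K 𝔤) : 𝔤 × Dual K 𝔤 :=
  (⁅X.1, Y.1⁆ + G.cocycle X.1 Y.2 - G.cocycle Y.1 X.2
      + (evalEquiv K 𝔤).symm (G.assoc X.2 Y.2),
    -coad K 𝔤 X.1 Y.2 + coad K 𝔤 Y.1 X.2 + Y.2 ∘ₗ G.cocycle.flip X.2)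

/-- `(𝔤, [ , ], ϖ, φ)` is a Lie quasi-bialgebra: `ϖ` is a Lie algebra 1-cocycle and the bracket of
the double is a Lie bracket. -/
structure IsLieQuasiBialgebra [FiniteDimensional K 𝔤] : Prop where
  cocycle_lie : ∀ x y : 𝔤, G.cocycle ⁅x, y⁆ =
    adjAct K 𝔤 x (G.cocycle y) - adjAct K 𝔤 y (G.cocycle x)
  double_self : ∀ X : 𝔤 × Dual K 𝔤, G.doubleBracket X X = 0
  double_jacobi : ∀ X Y Z : 𝔤 × Dual K 𝔤, G.doubleBracket X (G.doubleBracket Y Z) =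
    G.doubleBracket (G.doubleBracket X Y) Z + G.doubleBracket Y (G.doubleBracket X Z)

/-- The endomorphism `ad^𝔡_X` of the double. -/
def adDouble [FiniteDimensional K 𝔤] (X : 𝔤 × Dual K 𝔤) : End K (𝔤 × Dual K 𝔤) where
  toFun := G.doubleBracket X
  map_add' := by
    intro Y Z
    ext
    · simp [doubleBracket]; abel
    · simp [doubleBracket]; abel
  map_smul' := by
    intro c Y
    ext
    · simp [doubleBracket, smul_add, smul_sub]
    · simp [doubleBracket]

/-- `⟨ζ, [tξ, tη] + ϖ_{tξ} η⟩`, as a trilinear form in `(ξ, η, ζ)`. -/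
def twistForm (t : Dual K 𝔤 →ₗ[K] 𝔤) :
    Dual K 𝔤 →ₗ[K] Dual K 𝔤 →ₗ[K] Dual K 𝔤 →ₗ[K] K :=
  LinearMap.mk₂ K (fun ξ η => Dual.eval K 𝔤 (⁅t ξ, t η⁆ + G.cocycle (t ξ) η))
    (by intro ξ ξ' η; ext ζ; simp; abel)
    (by intro c ξ η; ext ζ; simp)
    (by intro ξ η η'; ext ζ; simp; abel)
    (by intro c ξ η; ext ζ; simp)

/-- The twisted associator `φ^t`, see `twistAssoc_apply`. -/
def twistAssoc (t : Dual K 𝔤 →ₗ[K] 𝔤) :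
    Dual K 𝔤 →ₗ[K] Dual K 𝔤 →ₗ[K] Dual K 𝔤 →ₗ[K] K :=
  LinearMap.mk₂ K
    (fun ξ η => G.assoc ξ η + G.twistForm t ξ η + (G.twistForm t η).flip ξ
      + ((G.twistForm t).flip ξ).flip η)
    (by intro ξ ξ' η; ext ζ; simp; abel)
    (by intro c ξ η; ext ζ; simp)
    (by intro ξ η η'; ext ζ; simp; abel)
    (by intro c ξ η; ext ζ; simp)

/-- `⟨ξ⊗η⊗ζ, φ^t⟩ = ⟨ξ⊗η⊗ζ, φ⟩ + Cycl_{(ξ,η,ζ)} ⟨ζ, [tξ, tη] + ϖ_{tξ} η⟩`. -/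
theorem twistAssoc_apply (t : Dual K 𝔤 →ₗ[K] 𝔤) (ξ η ζ : Dual K 𝔤) :
    G.twistAssoc t ξ η ζ = G.assoc ξ η ζ
      + (ζ (⁅t ξ, t η⁆ + G.cocycle (t ξ) η) + ξ (⁅t η, t ζ⁆ + G.cocycle (t η) ζ)
        + η (⁅t ζ, t ξ⁆ + G.cocycle (t ζ) ξ)) := by
  simp [twistAssoc, twistForm]; ring

/-- The twist `G^t = (𝔤, [ , ], ϖ^t, φ^t)`, where `ϖ^t_x = ϖ_x + ad_x t + t ad*_x`. -/
def twist [CharZero K] (t : skewMaps K 𝔤) : QuasiData K 𝔤 where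
  cocycle := G.cocycle + (adjAct K 𝔤).flip t
  cocycle_skew := by
    intro x ξ η
    have h1 := G.cocycle_skew x ξ η
    have h2 := t.2 (coad K 𝔤 x ξ) η
    have h3 := t.2 ξ (coad K 𝔤 x η)
    simp only [coad, LinearMap.comp_apply, Dual.transpose_apply, LieHom.coe_toLinearMap,
      LieAlgebra.ad_apply] at h2 h3
    simp only [adjAct, coad, LinearMap.add_apply, map_add, LinearMap.flip_apply,
      LinearMap.mk₂_apply, LinearMap.comp_apply, Dual.transpose_apply, LieHom.coe_toLinearMap,
      LieAlgebra.ad_apply, h1, h2, h3]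
    ring
  assoc := G.twistAssoc t
  assoc_self_left := by
    intro ξ ζ
    have h1 := G.cocycle_skew ((t : Dual K 𝔤 →ₗ[K] 𝔤) ξ) ξ ζ
    have h2 := G.cocycle_skew ((t : Dual K 𝔤 →ₗ[K] 𝔤) ζ) ξ ξ
    have h3 := lie_skew ((t : Dual K 𝔤 →ₗ[K] 𝔤) ξ) ((t : Dual K 𝔤 →ₗ[K] 𝔤) ζ)
    rw [twistAssoc_apply, G.assoc_self_left, ← h3]
    simp only [map_add, map_neg, lie_self, map_zero, h1]
    linear_combination (1 / 2 : K) * h2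
  assoc_self_right := by
    intro ξ η
    have h1 := G.cocycle_skew ((t : Dual K 𝔤 →ₗ[K] 𝔤) η) η ξ
    have h2 := G.cocycle_skew ((t : Dual K 𝔤 →ₗ[K] 𝔤) ξ) η η
    have h3 := lie_skew ((t : Dual K 𝔤 →ₗ[K] 𝔤) ξ) ((t : Dual K 𝔤 →ₗ[K] 𝔤) η)
    rw [twistAssoc_apply, G.assoc_self_right, ← h3]
    simp only [map_add, map_neg, lie_self, map_zero, h1]
    linear_combination (1 / 2 : K) * h2

end QuasiData

end QuasiBialgebra

/-! ### Formal maps on the formal neighbourhood of `0` in `𝔩*`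

Fix a basis `b` of `𝔩`, with index set `ι`. The coordinates of `p ∈ 𝔩*` are `x_j = ⟨p, b_j⟩`. A formal
map `𝔻 → V` on the formal neighbourhood `𝔻` of `0 ∈ 𝔩*` is a formal power series in the `x_j` with
coefficients in the vector space `V`. -/

section Formal

variable {K : Type*} [Field K] {ι : Type*}

/-- `V`-valued formal power series in variables indexed by `ι`. -/
abbrev FormalMap (ι V : Type*) := (ι →₀ ℕ) → V

namespace FormalMap

variable {V W Z : Type*} [AddCommGroup V] [Module K V] [AddCommGroup W] [Module K W]
  [AddCommGroup Z] [Module K Z]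

/-- Apply a linear map to the values of a formal map. -/
def mapLin (L : V →ₗ[K] W) (f : FormalMap ι V) : FormalMap ι W := fun n => L (f n)

/-- The constant formal map. -/
def const [DecidableEq ι] (v : V) : FormalMap ι V := fun n => if n = 0 then v else 0

/-- Apply a bilinear map pointwise to two formal maps (Cauchy product). -/
def map₂ [DecidableEq ι] (B : V →ₗ[K] W →ₗ[K] Z) (f : FormalMap ι V) (h : FormalMap ι W) :
    FormalMap ι Z :=
  fun n => ∑ q ∈ antidiagonal n, B (f q.1) (h q.2)

/-- The formal map `p ↦ (∑_k c_k B(S_p)^k) f_p`, where `B` assigns endomorphisms of `V` to elements of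
`W` and `S` has no constant term; since the `k`-th summand only has terms of degree `≥ k`, the terms
with `k ≤ |n|` determine the coefficient at `n`. -/
def opSeries [DecidableEq ι] (c : ℕ → K) (B : W →ₗ[K] End K V) (S : FormalMap ι W)
    (f : FormalMap ι V) : FormalMap ι V :=
  fun n => ∑ k ∈ range (n.degree + 1), c k • ((map₂ B S)^[k] f) n

end FormalMap

/-- The coefficients of `e^z`. -/
def expCoeff (K : Type*) [Field K] (k : ℕ) : K := (k.factorial : K)⁻¹

/-- The coefficients of `(e^z - 1) / z`. -/
def expSubOneDivCoeff (K : Type*) [Field K] (k : ℕ) : K := ((k + 1).factorial : K)⁻¹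

end Formal

/-! ### Formal dynamical `ℓ`-matrices and gauge transformations -/

section Dynamical

variable {K : Type*} [Field K] {𝔤 : Type*} [LieRing 𝔤] [LieAlgebra K 𝔤]
  {ι : Type*} [Fintype ι] [DecidableEq ι] {𝔩 : LieSubalgebra K 𝔤} (b : Basis ι K 𝔩)

/-- The point of `𝔩*` with coordinates `x`. -/
def point (x : ι → K) : Dual K 𝔩 := ∑ j, x j • b.coord j

/-- The tautological formal map `p ↦ p`. -/
def tautological : FormalMap ι (Dual K 𝔩) :=
  fun n => ∑ j, if n = Finsupp.single j 1 then b.coord j else 0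

/-- The differential `p ↦ d_p f ∈ L(𝔩*, V)` of a formal map `f` with values in `V`. -/
def differential {V : Type*} [AddCommGroup V] [Module K V] (f : FormalMap ι V) :
    FormalMap ι (Dual K 𝔩 →ₗ[K] V) :=
  fun n => ∑ j, (Dual.eval K 𝔩 (b j)).smulRight (((n j : K) + 1) • f (n + Finsupp.single j 1))

/-- The formal map `p ↦ d_p f (ad*_z p)`, for `z ∈ 𝔩`. -/
def derivAlong {V : Type*} [AddCommGroup V] [Module K V] (z : 𝔩) (f : FormalMap ι V) :
    FormalMap ι V :=
  FormalMap.map₂ LinearMap.id (differential b f)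
    (FormalMap.mapLin (coad K 𝔩 z) (tautological b))

/-- The restriction `i* : 𝔤* → 𝔩*`. -/
def restr (𝔩 : LieSubalgebra K 𝔤) : Dual K 𝔤 →ₗ[K] Dual K 𝔩 := 𝔩.toSubmodule.subtype.dualMap

/-- The bracket of `𝔤` as a bilinear map. -/
def lieBilin (K 𝔤 : Type*) [Field K] [LieRing 𝔤] [LieAlgebra K 𝔤] : 𝔤 →ₗ[K] 𝔤 →ₗ[K] 𝔤 :=
  (LieAlgebra.ad K 𝔤 : 𝔤 →ₗ[K] End K 𝔤)

namespace QuasiData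

variable (G : QuasiData K 𝔤)

/-- `p ↦ ⟨ζ, d_p l(i*ξ) η⟩ - ⟨ζ, [l_p ξ, l_p η]⟩ - ⟨ζ, ϖ_{l_p ξ} η⟩`. -/
def cdybeTerm (l : FormalMap ι (Dual K 𝔤 →ₗ[K] 𝔤)) (ξ η ζ : Dual K 𝔤) : FormalMap ι K :=
  fun n => ζ (differential b l n (restr 𝔩 ξ) η)
    - ζ (FormalMap.map₂ (lieBilin K 𝔤) (fun k => l k ξ) (fun k => l k η) n)
    - ζ (G.cocycle (l n ξ) η)

/-- `l` is a formal dynamical `ℓ`-matrix at `0 ∈ 𝔩*` associated with `G`. -/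
structure IsFormalDynl (l : FormalMap ι (Dual K 𝔤 →ₗ[K] 𝔤)) : Prop where
  skew : ∀ n, l n ∈ skewMaps K 𝔤
  cdybe : ∀ ξ η ζ : Dual K 𝔤,
    G.cdybeTerm b l ξ η ζ + G.cdybeTerm b l η ζ ξ + G.cdybeTerm b l ζ ξ η
      = FormalMap.const (G.assoc ξ η ζ)
  equivariant : ∀ z : 𝔩,
    derivAlong b z l + FormalMap.const (G.cocycle z)
      + FormalMap.mapLin (adjAct K 𝔤 (z : 𝔤)) l = 0

/-- The set `Dynl(𝔻, G)` of formal dynamical `ℓ`-matrices. -/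
abbrev Dynl := {l : FormalMap ι (Dual K 𝔤 →ₗ[K] 𝔤) // G.IsFormalDynl b l}

end QuasiData

/-- An element `σ = e^Σ` of the formal gauge group `Map₀(𝔻, G)^𝔩`. Every formal map `σ` from `𝔻` to a
Lie group with Lie algebra `𝔤` such that `σ_0 = 1` is `e^Σ` for a unique formal map `Σ : 𝔻 → 𝔤` with
`Σ_0 = 0`, and `σ` is `𝔩`-equivariant if and only if `Σ` is: `d_pΣ(ad*_z p) = -[z, Σ_p]`. -/
structure IsGaugeExponent (S : FormalMap ι 𝔤) : Prop where
  zero : S 0 = 0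
  equivariant : ∀ z : 𝔩,
    derivAlong b z S = -FormalMap.mapLin (LieAlgebra.ad K 𝔤 (z : 𝔤)) S

/-- For `σ = e^Σ`, the right logarithmic derivative `p ↦ r_{σ_p⁻¹} T_pσ ∈ L(𝔩*, 𝔤)`, which is
`((e^{ad Σ_p} - 1) / ad Σ_p) d_pΣ`. -/
def logDeriv (S : FormalMap ι 𝔤) : FormalMap ι (Dual K 𝔩 →ₗ[K] 𝔤) :=
  FormalMap.opSeries (expSubOneDivCoeff K)
    (LinearMap.llcomp K (Dual K 𝔩) 𝔤 𝔤 ∘ₗ lieBilin K 𝔤) S (differential b S)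

/-- The transpose `A ↦ i ∘ A*` from `L(𝔩*, 𝔤)` to `L(𝔤*, 𝔤)`, where `A* : 𝔤* → 𝔩** = 𝔩`. -/
def transposeIncl [FiniteDimensional K 𝔤] (𝔩 : LieSubalgebra K 𝔤) (A : Dual K 𝔩 →ₗ[K] 𝔤) :
    Dual K 𝔤 →ₗ[K] 𝔤 :=
  𝔩.toSubmodule.subtype ∘ₗ (evalEquiv K 𝔩).symm.toLinearMap ∘ₗ A.dualMap

/-- For `σ = e^Σ`, the formal map
`θ^σ_p = (r_{σ_p⁻¹} T_pσ) i* Ad*_{σ_p} - (T_pσ)* r*_{σ_p⁻¹}`, where `Ad*_{σ_p} = e^{ad*_{Σ_p}}`. -/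
def gaugeTheta [FiniteDimensional K 𝔤] (S : FormalMap ι 𝔤) :
    FormalMap ι (Dual K 𝔤 →ₗ[K] 𝔤) :=
  FormalMap.opSeries (expCoeff K)
      ((LinearMap.llcomp K (Dual K 𝔤) (Dual K 𝔤) 𝔤).flip ∘ₗ coad K 𝔤) S
      (fun n => logDeriv b S n ∘ₗ restr 𝔩)
    - fun n => transposeIncl 𝔩 (logDeriv b S n)

namespace QuasiData

variable (G : QuasiData K 𝔤)

/-- For `σ = e^Σ`, the formal map `p ↦ π_{σ_p}`, where `π` is the group 1-cocycle integrating `ϖ`: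
`π_{e^x} = ∫₀¹ Ad_{e^{tx}} ϖ_x Ad*_{e^{tx}} dt = ∑_k (1 / (k+1)!) x^k · ϖ_x`. -/
def gaugePi (S : FormalMap ι 𝔤) : FormalMap ι (Dual K 𝔤 →ₗ[K] 𝔤) :=
  FormalMap.opSeries (expSubOneDivCoeff K) (adjAct K 𝔤) S (FormalMap.mapLin G.cocycle S)

/-- The gauge transformation `l^σ_p = Ad_{σ_p} l_p Ad*_{σ_p} + θ^σ_p + π_{σ_p}` for `σ = e^Σ`. -/
def gaugeTransform [FiniteDimensional K 𝔤] (S : FormalMap ι 𝔤)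
    (l : FormalMap ι (Dual K 𝔤 →ₗ[K] 𝔤)) : FormalMap ι (Dual K 𝔤 →ₗ[K] 𝔤) :=
  FormalMap.opSeries (expCoeff K) (adjAct K 𝔤) S l + gaugeTheta b S + G.gaugePi S

/-- `l` and `l'` lie in the same orbit of the formal gauge group: `l' = l^σ` for some `σ`. -/
def GaugeEquiv [FiniteDimensional K 𝔤] (l l' : G.Dynl b) : Prop :=
  ∃ S : FormalMap ι 𝔤, IsGaugeExponent b S ∧ l'.1 = G.gaugeTransform b S l.1

/-- The moduli space `ℳ(G, 𝔩) = Dynl(𝔻, G) / Map₀(𝔻, G)^𝔩`. -/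
abbrev Moduli [FiniteDimensional K 𝔤] := Quot (G.GaugeEquiv b)

end QuasiData

end Dynamical

/-! ### Reductive decompositions -/

section Reductive

/-- A reductive decomposition `𝔤 = 𝔩 ⊕ 𝔪`: `𝔩` is a subalgebra and `[𝔩, 𝔪] ⊆ 𝔪`. -/
structure ReductiveDecomposition (K 𝔤 : Type*) [Field K] [LieRing 𝔤] [LieAlgebra K 𝔤] where
  /-- the subalgebra `𝔩` -/
  sub : LieSubalgebra K 𝔤
  /-- the complement `𝔪` -/
  compl : Submodule K 𝔤
  isCompl : IsCompl sub.toSubmodule compl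
  lie_mem : ∀ z ∈ sub, ∀ u ∈ compl, ⁅z, u⁆ ∈ compl

namespace ReductiveDecomposition

variable {K : Type*} [Field K] {𝔤 : Type*} [LieRing 𝔤] [LieAlgebra K 𝔤]
  (R : ReductiveDecomposition K 𝔤)

/-- The orthogonal `𝔩^⊥ ⊆ 𝔤*`. -/
def subPerp : Submodule K (Dual K 𝔤) := R.sub.toSubmodule.dualAnnihilator

/-- The orthogonal `𝔪^⊥ ⊆ 𝔤*`. -/
def complPerp : Submodule K (Dual K 𝔤) := R.compl.dualAnnihilator

/-- The projection `p_𝔩 : 𝔤 → 𝔩` along `𝔪`. -/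
def proj : 𝔤 →ₗ[K] R.sub := R.sub.toSubmodule.projectionOnto R.compl R.isCompl

/-- `s = (p_𝔩)* : 𝔩* → 𝔤*`. -/
def sec : Dual K R.sub →ₗ[K] Dual K 𝔤 := R.proj.dualMap

/-- `G` is compatible with `𝔤 = 𝔩 ⊕ 𝔪`: `ϖ` vanishes on `𝔩`, `⟨𝔪^⊥, ϖ_• 𝔪^⊥⟩ = 0`, and
`φ ∈ Alt(𝔩⊗𝔩⊗𝔩 ⊕ 𝔩⊗𝔪⊗𝔪 ⊕ 𝔪⊗𝔪⊗𝔪)`, i.e. `φ` has no component in `Alt(𝔩⊗𝔩⊗𝔪)`. -/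
structure IsCompatible (G : QuasiData K 𝔤) : Prop where
  cocycle_sub : ∀ z ∈ R.sub, G.cocycle z = 0
  cocycle_complPerp : ∀ x, ∀ ξ ∈ R.complPerp, ∀ η ∈ R.complPerp, ξ (G.cocycle x η) = 0
  assoc_mixed : ∀ ξ ∈ R.complPerp, ∀ η ∈ R.complPerp, ∀ ζ ∈ R.subPerp, G.assoc ξ η ζ = 0

/-- `t 𝔪^⊥ = 0` and `t 𝔩^⊥ ⊆ 𝔪`. -/
def IsNormalized (t : Dual K 𝔤 →ₗ[K] 𝔤) : Prop :=
  (∀ ξ ∈ R.complPerp, t ξ = 0) ∧ ∀ ξ ∈ R.subPerp, t ξ ∈ R.compl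

/-- The variety `ℳ_{G,𝔩,𝔪} = {t ∈ (⋀² 𝔪)^𝔩 | φ^t ≡ 0 mod 𝔩}`. -/
def variety (G : QuasiData K 𝔤) : Set (skewMaps K 𝔤) :=
  {t | R.IsNormalized t ∧ (∀ z ∈ R.sub, adjAct K 𝔤 z t = 0) ∧
    ∀ ξ ∈ R.subPerp, ∀ η ∈ R.subPerp, ∀ ζ ∈ R.subPerp, G.twistAssoc t ξ η ζ = 0}

/-- The quasi-bialgebra data `(𝔩, [ , ]_𝔩, 0, p_𝔩^{(3)} φ)`. -/
def subData (G : QuasiData K 𝔤) : QuasiData K R.sub where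
  cocycle := 0
  cocycle_skew := by intro x; simp
  assoc := LinearMap.mk₂ K (fun α β => G.assoc (R.sec α) (R.sec β) ∘ₗ R.sec)
    (by intro α α' β; ext γ; simp)
    (by intro c α β; ext γ; simp)
    (by intro α β β'; ext γ; simp)
    (by intro c α β; ext γ; simp)
  assoc_self_left := by intro α γ; simp [G.assoc_self_left]
  assoc_self_right := by intro α β; simp [G.assoc_self_right]

end ReductiveDecomposition

end Reductive

/-! ### The canonical analytic `ℓ`-matrix -/

section Canonical

variable {K : Type*} [RCLike K]

/-- The value `∑_k c_k T^k` of an entire function with Taylor coefficients `c_k` at an endomorphism `T`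
of a finite-dimensional vector space (convergence is that of the matrix entries in some basis). -/
def entireFn {V : Type*} [AddCommGroup V] [Module K V] [FiniteDimensional K V]
    (c : ℕ → K) (T : End K V) : End K V :=
  Matrix.toLin (finBasis K V) (finBasis K V)
    (Matrix.of fun i j =>
      ∑' k : ℕ, c k * LinearMap.toMatrix (finBasis K V) (finBasis K V) (T ^ k) i j)

/-- The Taylor coefficients of `sinh z / z`. -/
def sinhDivCoeff (K : Type*) [RCLike K] (k : ℕ) : K :=
  if Even k then ((k + 1).factorial : K)⁻¹ else 0

/-- The Taylor coefficients of `(z cosh z - sinh z) / z²`. -/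
def coshSubSinhCoeff (K : Type*) [RCLike K] (k : ℕ) : K :=
  if Odd k then ((k + 1).factorial : K)⁻¹ - ((k + 2).factorial : K)⁻¹ else 0

/-- `F(T)` for the meromorphic function `F(z) = coth z - 1/z`, written as the quotient of the entire
functions `(z cosh z - sinh z) / z²` and `sinh z / z`. -/
def cothSubInv {V : Type*} [AddCommGroup V] [Module K V] [FiniteDimensional K V]
    (T : End K V) : End K V :=
  Ring.inverse (entireFn (sinhDivCoeff K) T) * entireFn (coshSubSinhCoeff K) T

/-- The complex spectrum of `T` does not meet `iπℤ ∖ {0}`: no `iπk` with `k ≠ 0` is a root of the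
characteristic polynomial of `T`, viewed over `ℂ`. -/
def SpectrumAvoids {V : Type*} [AddCommGroup V] [Module K V] [FiniteDimensional K V]
    (T : End K V) : Prop :=
  ∀ k : ℤ, k ≠ 0 →
    T.charpoly.sum (fun n a => RCLike.map K ℂ a * (Complex.I * Real.pi * k) ^ n) ≠ 0

variable {𝔤 : Type*} [LieRing 𝔤] [LieAlgebra K 𝔤] [FiniteDimensional K 𝔤]

namespace QuasiData

variable (G : QuasiData K 𝔤)

/-- The Alekseev--Meinrenken `r`-matrix `r^AM_p = F(ad^𝔡_p) : 𝔤* → 𝔤`, for `p ∈ 𝔤*`. -/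
def rAM (p : Dual K 𝔤) : Dual K 𝔤 →ₗ[K] 𝔤 :=
  LinearMap.fst K 𝔤 (Dual K 𝔤) ∘ₗ cothSubInv (G.adDouble (0, p)) ∘ₗ LinearMap.inr K 𝔤 (Dual K 𝔤)

variable (R : ReductiveDecomposition K 𝔤)

/-- `Ad^𝔡_{e^{-sp}} = e^{-ad^𝔡_{sp}}`. -/
def AdExpNegSec (p : Dual K R.sub) : End K (𝔤 × Dual K 𝔤) :=
  entireFn (expCoeff K) (-G.adDouble (0, R.sec p))

/-- `p_𝔤 Ad^𝔡_{e^{-sp}} i_𝔤 : 𝔤 → 𝔤`. -/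
def adBlock (p : Dual K R.sub) : End K 𝔤 :=
  LinearMap.fst K 𝔤 (Dual K 𝔤) ∘ₗ G.AdExpNegSec R p ∘ₗ LinearMap.inl K 𝔤 (Dual K 𝔤)

/-- The domain `U ⊆ 𝔩*` of `l^can`: the points `p` such that the spectrum of `ad_p` on `𝔩 ⊕ 𝔩*` does
not meet `iπℤ ∖ {0}` and `0` is not in the spectrum of `p_𝔤 Ad^𝔡_{e^{-sp}} i_𝔤`. -/
def lcanDomain : Set (Dual K R.sub) :=
  {p | SpectrumAvoids ((R.subData G).adDouble (0, p)) ∧ 0 ∉ spectrum K (G.adBlock R p)}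

/-- The canonical `ℓ`-matrix: for `α ∈ 𝔩*` and `ξ ∈ 𝔩^⊥`,
`l^can_p (sα + ξ) = r^AM_p α - (p_𝔤 Ad^𝔡_{e^{-sp}} i_𝔤)⁻¹ p_𝔤 Ad^𝔡_{e^{-sp}} ξ`, where `r^AM` is that
of `(𝔩, [ , ]_𝔩, 0, p_𝔩^{(3)} φ)`. The components of `η ∈ 𝔤*` are `α = i*η` and `ξ = η - s i*η`. -/
def lcan (p : Dual K R.sub) : Dual K 𝔤 →ₗ[K] 𝔤 :=
  R.sub.toSubmodule.subtype ∘ₗ (R.subData G).rAM p ∘ₗ restr R.sub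
    - Ring.inverse (G.adBlock R p) ∘ₗ
      (LinearMap.fst K 𝔤 (Dual K 𝔤) ∘ₗ G.AdExpNegSec R p ∘ₗ LinearMap.inr K 𝔤 (Dual K 𝔤)) ∘ₗ
      (LinearMap.id - R.sec ∘ₗ restr R.sub)

end QuasiData

variable {ι : Type*} [Fintype ι] {𝔩 : LieSubalgebra K 𝔤} (b : Basis ι K 𝔩)

/-- `f : 𝔩* → L(𝔤*, 𝔤)` is analytic on the open set `U` (in the coordinates `x` of `𝔩*`, and through
the matrix coefficients `⟨ζ, f_p ξ⟩`). -/
def IsAnalyticOnOpen (f : Dual K 𝔩 → Dual K 𝔤 →ₗ[K] 𝔤) (U : Set (Dual K 𝔩)) : Prop :=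
  IsOpen {x : ι → K | point b x ∈ U} ∧
    ∀ ξ ζ : Dual K 𝔤,
      AnalyticOnNhd K (fun x : ι → K => ζ (f (point b x) ξ)) {x : ι → K | point b x ∈ U}

/-- The formal map `l` is the Taylor series at `0` of `f : 𝔩* → L(𝔤*, 𝔤)`: near `0`, the series
`∑_n x^n l_n` converges to `f`. -/
def IsTaylorSeries (f : Dual K 𝔩 → Dual K 𝔤 →ₗ[K] 𝔤) (l : FormalMap ι (Dual K 𝔤 →ₗ[K] 𝔤)) : Prop :=
  ∀ᶠ x in 𝓝 (0 : ι → K), ∀ ξ ζ : Dual K 𝔤,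
    HasSum (fun n : ι →₀ ℕ => (∏ j, x j ^ n j) * ζ (l n ξ)) (ζ (f (point b x) ξ))

end Canonical

end DynLie

/-!
The argument takes place in formal power series. A formal map `𝔻 → V` is an element of `FM ι V`, the
power series in the coordinates on `𝔩*` with coefficients in `V`; bilinear maps act on such series by
Cauchy products, and a power series `c` is applied to an operator `T` that raises the degree by
`ser T c`, so that `e^{ad Σ}` and its relatives need no convergence.

*The double.* A formal map `l` with values in linear maps `𝔤* → 𝔤` is encoded by the sections
`S_ξ = l ξ + ξ` of the double `𝔡 = 𝔤 ⊕ 𝔤*` (`graph`). Skew-symmetry of `l` says that the `S_ξ` span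
an isotropic family, and the dynamical equation becomes
`Cycl ⟪∂_{i*ξ} S_η, S_ζ⟫ = ⟪[S_ξ, S_η], S_ζ⟫` (`cycl_graph`). In this form only the invariant
pairing and the Jacobi identity of `𝔡` enter.

*Gauge invariance.* The transforms `l^{e^{τΣ}}` form a family `gaugeFlow` whose derivative in `τ` is
the infinitesimal gauge transformation by `Σ` (`hasD_gaugeFlow`). Under the latter the failure of the
dynamical equation changes by the coadjoint action of `Σ` on its three arguments
(`defectVar_infGauge`). Hence it solves a linear differential equation in `τ` whose coefficients
vanish at the origin; induction on the degree shows that it stays zero if it is zero at `τ = 0`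
(`eq_zero_of_hasD`, `IsFormalDynl.gaugeTransform`).

*Gauge equivalence is decided at the origin.* Two dynamical `ℓ`-matrices are gauge equivalent if and
only if `l'_0 - l_0 = A i* - i A*` for some `𝔩`-equivariant linear map `A : 𝔩* → 𝔤`
(`gaugeEquiv_iff`). The exponent is built degree by degree (`exists_gaugeFlow_eq`): if two dynamical
`ℓ`-matrices agree in degrees `< k`, with `k > 0`, then the leading term of their difference is
closed and equivariant, and Cartan's formula for the contraction with the Euler vector field provides
an equivariant primitive (`linGauge_homotopy`), which corrects the exponent in degree `k + 1` and
removes this term. At the origin what remains is linear algebra: `A` can be chosen to normalize `l_0`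
(`exists_isNormalized`), two normalized values that differ by `A i* - i A*` are equal
(`eq_of_isNormalized`), and the dynamical equation at the origin places a normalized value in the
variety (`mem_variety`). This yields the equivalence relation, the normalized representatives, and an
injective map to the variety; it is surjective as soon as every point of the variety is the value at
the origin of some dynamical `ℓ`-matrix (`exists_moduli_bijection`).

*Existence.* Adding the constant `ρ` exchanges dynamical `ℓ`-matrices for the twist by `ρ` and for the
original structure (`IsFormalDynl.add_cst`), and twisting by a point of the variety preserves the
hypotheses, so one may assume `ρ = 0`, that is `φ ≡ 0 mod 𝔩`. Then `𝔩 ⊕ 𝔩^⊥` is an isotropic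
subalgebra of `𝔡` (`lagr`). For the canonical `ℓ`-matrix, `e^{-ad_{sp}} S_ξ` is the sum of the left
Maurer--Cartan form of `e^{sp}` in the direction `i*ξ` and of a section of `𝔩 ⊕ 𝔩^⊥`
(`graph_eq_exp`, `corr_mem_lagr`); this is the identity
`e^{-z} (1 + F(z)) = (1 - e^{-z}) / z + (1 / sinh z - 1 / z)` together with the observation that
`ad_{sp}` exchanges `𝔩` and `𝔪^⊥`, so that even and odd functions of it have a definite parity. The
dynamical equation follows from the Maurer--Cartan equation and from a transgression of the Cartan
three-form, which is verified by applying the Euler operator (`cyclic_identity`).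

*Analyticity.* Away from `iπℤ ∖ {0}` in the spectrum the operator `sinh T / T` is invertible
(`spectrumAvoids_iff`), so `l^can` is built by inversion from entire functions of operators depending
linearly on `p`, hence is analytic (`isAnalyticOnOpen_lcan`). The Taylor series of an entire function
of a linear family of operators is the corresponding formal operator series
(`FM.HasTaylor.ser_entireFn`), so the Taylor series of `l^can` satisfies the defining relations of the
formal canonical `ℓ`-matrix (`isCanonical_of_hasTaylor`, `exists_canonical_dynl`).
-/

set_option linter.unusedSectionVars false

open Module Finset Topology

namespace DynLie

/-! ### The calculus of formal maps -/

section FormalCalculus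

variable {K : Type*} [Field K] {ι : Type*}

theorem sum_antidiagonal_assoc {M X : Type*} [AddCommMonoid M] [HasAntidiagonal M]
    [AddCommMonoid X] (F : M → M → M → X) (n : M) :
    ∑ q ∈ antidiagonal n, ∑ r ∈ antidiagonal q.1, F r.1 r.2 q.2 =
      ∑ q ∈ antidiagonal n, ∑ r ∈ antidiagonal q.2, F q.1 r.1 r.2 := by
  rw [Finset.sum_sigma', Finset.sum_sigma']
  refine Finset.sum_nbij' (fun p => ⟨(p.2.1, p.2.2 + p.1.2), (p.2.2, p.1.2)⟩)
    (fun p => ⟨(p.1.1 + p.2.1, p.2.2), (p.1.1, p.2.1)⟩) ?_ ?_ ?_ ?_ ?_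
  · rintro ⟨⟨a, b⟩, ⟨c, d⟩⟩ h
    simp only [mem_sigma, HasAntidiagonal.mem_antidiagonal] at h ⊢
    exact ⟨by rw [← add_assoc, h.2, h.1], trivial⟩
  · rintro ⟨⟨a, b⟩, ⟨c, d⟩⟩ h
    simp only [mem_sigma, HasAntidiagonal.mem_antidiagonal] at h ⊢
    exact ⟨by rw [add_assoc, h.2, h.1], trivial⟩
  · rintro ⟨⟨a, b⟩, ⟨c, d⟩⟩ h
    simp only [mem_sigma, HasAntidiagonal.mem_antidiagonal] at h
    obtain ⟨h1, h2⟩ := h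
    subst h2; rfl
  · rintro ⟨⟨a, b⟩, ⟨c, d⟩⟩ h
    simp only [mem_sigma, HasAntidiagonal.mem_antidiagonal] at h
    obtain ⟨h1, h2⟩ := h
    subst h2; rfl
  · rintro ⟨⟨a, b⟩, ⟨c, d⟩⟩ h
    rfl

/-- The space of formal maps `𝔻 → V`, as a type on which the ring of formal functions acts and which
inherits a Lie bracket from `V`. It wraps `FormalMap ι V`, whose instances are those of a function
type and would give the coefficientwise bracket. -/
structure FM (ι V : Type*) where
  /-- the coefficients of the formal map -/
  toFun : FormalMap ι V

namespace FM

instance {V : Type*} : FunLike (FM ι V) (ι →₀ ℕ) V where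
  coe f := f.toFun
  coe_injective := by rintro ⟨f⟩ ⟨g⟩ h; exact congrArg FM.mk h

@[ext] theorem ext {V : Type*} {f g : FM ι V} (h : ∀ n, f n = g n) : f = g := DFunLike.ext f g h

@[simp] theorem mk_apply {V : Type*} (f : FormalMap ι V) (n) : (FM.mk f) n = f n := rfl

variable {V W Z U Y : Type*} [AddCommGroup V] [Module K V] [AddCommGroup W] [Module K W]
  [AddCommGroup Z] [Module K Z] [AddCommGroup U] [Module K U] [AddCommGroup Y] [Module K Y]

instance : Add (FM ι V) := ⟨fun f g => ⟨f.toFun + g.toFun⟩⟩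
instance : Zero (FM ι V) := ⟨⟨0⟩⟩
instance : Neg (FM ι V) := ⟨fun f => ⟨-f.toFun⟩⟩
instance : Sub (FM ι V) := ⟨fun f g => ⟨f.toFun - g.toFun⟩⟩
instance {R : Type*} [SMul R V] : SMul R (FM ι V) := ⟨fun c f => ⟨c • f.toFun⟩⟩

instance : AddCommGroup (FM ι V) :=
  Function.Injective.addCommGroup (fun f : FM ι V => (f.toFun : (ι →₀ ℕ) → V))
    DFunLike.coe_injective rfl (fun _ _ => rfl) (fun _ => rfl) (fun _ _ => rfl) (fun _ _ => rfl)
    (fun _ _ => rfl)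

/-- The coefficients, as an additive map. -/
def toFunHom (ι V : Type*) [AddCommGroup V] : FM ι V →+ ((ι →₀ ℕ) → V) where
  toFun f := f.toFun
  map_zero' := rfl
  map_add' _ _ := rfl

instance : Module K (FM ι V) :=
  Function.Injective.module K (toFunHom ι V) DFunLike.coe_injective (fun _ _ => rfl)

@[simp] theorem add_coeff (f g : FM ι V) (n) : (f + g) n = f n + g n := rfl
@[simp] theorem sub_coeff (f g : FM ι V) (n) : (f - g) n = f n - g n := rfl
@[simp] theorem neg_coeff (f : FM ι V) (n) : (-f) n = -f n := rfl
@[simp] theorem zero_coeff (n) : (0 : FM ι V) n = 0 := rfl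
@[simp] theorem smul_coeff (c : K) (f : FM ι V) (n) : (c • f) n = c • f n := rfl
@[simp] theorem sum_coeff {α : Type*} (s : Finset α) (f : α → FM ι V) (n) :
    (∑ i ∈ s, f i) n = ∑ i ∈ s, f i n := by
  have := congrFun (map_sum (toFunHom ι V) f s) n
  rwa [Finset.sum_apply] at this

/-- Apply a linear map to the values of a formal map. -/
def lin (L : V →ₗ[K] W) : FM ι V →ₗ[K] FM ι W where
  toFun f := ⟨FormalMap.mapLin L f.toFun⟩
  map_add' f g := by ext n; exact map_add L _ _
  map_smul' c f := by ext n; exact map_smul L _ _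

@[simp] theorem lin_coeff (L : V →ₗ[K] W) (f : FM ι V) (n) : lin L f n = L (f n) := rfl

theorem lin_lin (L : V →ₗ[K] W) (M : W →ₗ[K] Z) (f : FM ι V) :
    lin M (lin L f) = lin (M ∘ₗ L) f := rfl

variable [DecidableEq ι]

/-- Constant formal maps. -/
def cst (K : Type*) [Field K] {ι V : Type*} [AddCommGroup V] [Module K V] [DecidableEq ι] :
    V →ₗ[K] FM ι V where
  toFun v := ⟨FormalMap.const v⟩
  map_add' v w := by ext n; by_cases h : n = 0 <;> simp [FormalMap.const, h]
  map_smul' c v := by ext n; by_cases h : n = 0 <;> simp [FormalMap.const, h]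

theorem cst_coeff (v : V) (n : ι →₀ ℕ) : cst K v n = if n = 0 then v else 0 := rfl

@[simp] theorem cst_zero_coeff (v : V) : cst K v (0 : ι →₀ ℕ) = v := by simp [cst_coeff]

@[simp] theorem lin_cst (L : V →ₗ[K] W) (v : V) : lin L (cst K v : FM ι V) = cst K (L v) := by
  ext n; by_cases h : n = 0 <;> simp [cst_coeff, h]

/-- The Cauchy product of formal maps along a bilinear map, as a `K`-bilinear map. -/
def mul₂ (B : V →ₗ[K] W →ₗ[K] Z) : FM ι V →ₗ[K] FM ι W →ₗ[K] FM ι Z :=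
  LinearMap.mk₂ K (fun f g => ⟨FormalMap.map₂ B f.toFun g.toFun⟩)
    (by intro f f' g; ext n
        simp only [FormalMap.map₂, mk_apply, add_coeff, ← Finset.sum_add_distrib]
        exact Finset.sum_congr rfl fun q _ => by rw [← LinearMap.add_apply, ← map_add]; rfl)
    (by intro c f g; ext n
        simp only [FormalMap.map₂, mk_apply, smul_coeff, Finset.smul_sum]
        exact Finset.sum_congr rfl fun q _ => by rw [← LinearMap.smul_apply, ← map_smul]; rfl)
    (by intro f g g'; ext n
        simp only [FormalMap.map₂, mk_apply, add_coeff, ← Finset.sum_add_distrib]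
        exact Finset.sum_congr rfl fun q _ => by rw [← map_add]; rfl)
    (by intro c f g; ext n
        simp only [FormalMap.map₂, mk_apply, smul_coeff, Finset.smul_sum]
        exact Finset.sum_congr rfl fun q _ => by rw [← map_smul]; rfl)

theorem mul₂_coeff (B : V →ₗ[K] W →ₗ[K] Z) (f : FM ι V) (g : FM ι W) (n) :
    mul₂ B f g n = ∑ q ∈ antidiagonal n, B (f q.1) (g q.2) := rfl

theorem mul₂_flip (B : V →ₗ[K] W →ₗ[K] Z) (f : FM ι V) (g : FM ι W) :
    mul₂ B.flip g f = mul₂ B f g := by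
  ext n
  simp only [mul₂_coeff, LinearMap.flip_apply]
  exact Finset.sum_nbij' Prod.swap Prod.swap (by simp [add_comm]) (by simp [add_comm])
    (by simp) (by simp) (by simp)

/-- An associativity law between bilinear maps passes to formal maps. -/
theorem mul₂_assoc {B : U →ₗ[K] Z →ₗ[K] Y} {C : V →ₗ[K] W →ₗ[K] U}
    {X : Type*} [AddCommGroup X] [Module K X]
    {B' : V →ₗ[K] X →ₗ[K] Y} {C' : W →ₗ[K] Z →ₗ[K] X}
    (h : ∀ v w z, B (C v w) z = B' v (C' w z)) (f : FM ι V) (g : FM ι W) (k : FM ι Z) :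
    mul₂ B (mul₂ C f g) k = mul₂ B' f (mul₂ C' g k) := by
  ext n
  simp only [mul₂_coeff, map_sum, LinearMap.sum_apply, h]
  exact sum_antidiagonal_assoc (fun a b c => B' (f a) (C' (g b) (k c))) n

theorem mul₂_lin_lin {X : Type*} [AddCommGroup X] [Module K X]
    {B : W →ₗ[K] U →ₗ[K] Y} {C : V →ₗ[K] Z →ₗ[K] X} {L : V →ₗ[K] W} {M : Z →ₗ[K] U} {N : X →ₗ[K] Y}
    (h : ∀ v z, B (L v) (M z) = N (C v z)) (f : FM ι V) (g : FM ι Z) :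
    mul₂ B (lin L f) (lin M g) = lin N (mul₂ C f g) := by
  ext n; simp [mul₂_coeff, h]

theorem lin_mul₂ (B : V →ₗ[K] W →ₗ[K] Z) (N : Z →ₗ[K] U) (f : FM ι V) (g : FM ι W) :
    lin N (mul₂ B f g) = mul₂ (B.compr₂ N) f g := by
  ext n; simp [mul₂_coeff]

theorem mul₂_lin_left (B : U →ₗ[K] W →ₗ[K] Z) (N : V →ₗ[K] U) (f : FM ι V) (g : FM ι W) :
    mul₂ B (lin N f) g = mul₂ (B ∘ₗ N) f g := rfl

theorem mul₂_lin_right (B : V →ₗ[K] U →ₗ[K] Z) (N : W →ₗ[K] U) (f : FM ι V) (g : FM ι W) :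
    mul₂ B f (lin N g) = mul₂ (B.compl₂ N) f g := rfl

theorem mul₂_cst_left (B : V →ₗ[K] W →ₗ[K] Z) (v : V) (g : FM ι W) :
    mul₂ B (cst K v) g = lin (B v) g := by
  ext n
  rw [mul₂_coeff, Finset.sum_eq_single (0, n)]
  · simp
  · rintro ⟨a, b⟩ hq hne
    have : a ≠ 0 := by
      rintro rfl
      simp only [HasAntidiagonal.mem_antidiagonal, zero_add] at hq
      exact hne (by rw [hq])
    simp [cst_coeff, this]
  · simp

theorem mul₂_cst_right (B : V →ₗ[K] W →ₗ[K] Z) (f : FM ι V) (w : W) :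
    mul₂ B f (cst K w) = lin (B.flip w) f := by
  rw [← mul₂_flip, mul₂_cst_left]

/-- Pointwise equality of bilinear maps passes to formal maps. -/
theorem mul₂_congr {B C : V →ₗ[K] W →ₗ[K] Z} (h : ∀ v w, B v w = C v w) (f : FM ι V) (g : FM ι W) :
    mul₂ B f g = mul₂ C f g := by
  ext n; simp [mul₂_coeff, h]

/-- A scalar formal map as an element of the ring of formal functions. -/
def toSer (f : FM ι K) : MvPowerSeries ι K := f.toFun

/-- An element of the ring of formal functions as a scalar formal map. -/
def ofSer (a : MvPowerSeries ι K) : FM ι K := ⟨a⟩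

@[simp] theorem ofSer_toSer (f : FM ι K) : ofSer (toSer f) = f := rfl

theorem ofSer_coeff (a : MvPowerSeries ι K) (n) : ofSer a n = MvPowerSeries.coeff n a := rfl

theorem ofSer_add (a b : MvPowerSeries ι K) : ofSer (a + b) = ofSer a + ofSer b := rfl

theorem ofSer_zero : ofSer (0 : MvPowerSeries ι K) = 0 := rfl

theorem ofSer_one : ofSer (1 : MvPowerSeries ι K) = cst K (1 : K) := by
  ext n; exact MvPowerSeries.coeff_one (R := K) (n := n)

theorem ofSer_mul (a b : MvPowerSeries ι K) :
    ofSer (a * b) = mul₂ (LinearMap.lsmul K K) (ofSer a) (ofSer b) := by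
  ext n; exact MvPowerSeries.coeff_mul n a b

/-- Formal maps form a module over the ring of formal functions. -/
instance : SMul (MvPowerSeries ι K) (FM ι V) :=
  ⟨fun a f => mul₂ (LinearMap.lsmul K V) (ofSer a) f⟩

theorem ser_smul_def (a : MvPowerSeries ι K) (f : FM ι V) :
    a • f = mul₂ (LinearMap.lsmul K V) (ofSer a) f := rfl

theorem ser_smul_coeff (a : MvPowerSeries ι K) (f : FM ι V) (n) :
    (a • f) n = ∑ q ∈ antidiagonal n, ofSer a q.1 • f q.2 := rfl

instance : Module (MvPowerSeries ι K) (FM ι V) where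
  one_smul f := by
    rw [ser_smul_def, ofSer_one, mul₂_cst_left]
    ext n; simp
  mul_smul a b f := by
    simp only [ser_smul_def, ofSer_mul]
    exact mul₂_assoc (fun v w z => smul_assoc v w z) _ _ _
  smul_zero a := by simp [ser_smul_def]
  smul_add a f g := by simp [ser_smul_def]
  add_smul a b f := by simp [ser_smul_def, ofSer_add]
  zero_smul f := by simp [ser_smul_def, ofSer_zero]

theorem lin_ser_smul (L : V →ₗ[K] W) (a : MvPowerSeries ι K) (f : FM ι V) :
    lin L (a • f) = a • lin L f := by
  ext n; simp [ser_smul_coeff]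

theorem mul₂_ser_smul_left (B : V →ₗ[K] W →ₗ[K] Z) (a : MvPowerSeries ι K) (f : FM ι V)
    (g : FM ι W) : mul₂ B (a • f) g = a • mul₂ B f g := by
  simp only [ser_smul_def]
  exact mul₂_assoc (by intro v w z; simp) _ _ _

theorem mul₂_ser_smul_right (B : V →ₗ[K] W →ₗ[K] Z) (a : MvPowerSeries ι K) (f : FM ι V)
    (g : FM ι W) : mul₂ B f (a • g) = a • mul₂ B f g := by
  rw [← mul₂_flip, mul₂_ser_smul_left, mul₂_flip]

/-- The Cauchy product along a bilinear map is bilinear over the ring of formal functions. -/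
def bil (B : V →ₗ[K] W →ₗ[K] Z) :
    FM ι V →ₗ[MvPowerSeries ι K] FM ι W →ₗ[MvPowerSeries ι K] FM ι Z :=
  LinearMap.mk₂ _ (fun f g => mul₂ B f g)
    (by intros; simp) (by intros; rw [mul₂_ser_smul_left]) (by intros; simp)
    (by intros; rw [mul₂_ser_smul_right])

@[simp] theorem bil_apply (B : V →ₗ[K] W →ₗ[K] Z) (f : FM ι V) (g : FM ι W) :
    bil B f g = mul₂ B f g := rfl

theorem cst_smul (c : K) (f : FM ι V) : toSer (cst K c : FM ι K) • f = c • f := by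
  rw [ser_smul_def, ofSer_toSer, mul₂_cst_left]
  ext n; simp

/-- A formal map is a combination of the vectors of a basis. -/
theorem eq_sum_basis {κ : Type*} [Fintype κ] (e : Basis κ K V) (f : FM ι V) :
    f = ∑ i, toSer (lin (e.coord i) f) • cst K (e i) := by
  ext n
  rw [sum_coeff]
  simp_rw [ser_smul_def, mul₂_cst_right]
  simp [e.sum_repr (f n)]

/-- Maps that are linear over the ring of formal functions agree if they agree on constants. -/
theorem linearMap_ext [FiniteDimensional K V] {X : Type*} [AddCommGroup X]
    [Module (MvPowerSeries ι K) X] {φ ψ : FM ι V →ₗ[MvPowerSeries ι K] X}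
    (h : ∀ v : V, φ (cst K v) = ψ (cst K v)) : φ = ψ := by
  ext f
  rw [eq_sum_basis (finBasis K V) f]
  simp only [map_sum, map_smul, h]

end FM

end FormalCalculus

/-! ### Derivatives and the Euler operator -/

section FormalDerivative

variable {K : Type*} [Field K] {ι : Type*} [DecidableEq ι]
  {V W Z U : Type*} [AddCommGroup V] [Module K V] [AddCommGroup W] [Module K W]
  [AddCommGroup Z] [Module K Z] [AddCommGroup U] [Module K U]

namespace FM

/-- The partial derivative `∂/∂x_j`. -/
def pd (K : Type*) [Field K] {ι V : Type*} [AddCommGroup V] [Module K V] (j : ι) :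
    FM ι V →ₗ[K] FM ι V where
  toFun f := ⟨fun n => ((n j : K) + 1) • f (n + Finsupp.single j 1)⟩
  map_add' f g := by ext n; simp
  map_smul' c f := by ext n; exact smul_comm _ c _

theorem pd_coeff (j : ι) (f : FM ι V) (n) :
    pd K j f n = ((n j : K) + 1) • f (n + Finsupp.single j 1) := rfl

theorem pd_lin (j : ι) (L : V →ₗ[K] W) (f : FM ι V) : pd K j (lin L f) = lin L (pd K j f) := by
  ext n; simp [pd_coeff]

@[simp] theorem pd_cst (j : ι) (v : V) : pd K j (cst K v) = 0 := by
  ext n; simp [pd_coeff, cst_coeff]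

theorem pd_comm (i j : ι) (f : FM ι V) : pd K i (pd K j f) = pd K j (pd K i f) := by
  ext n
  simp only [pd_coeff, smul_smul, add_right_comm n]
  congr 1
  by_cases h : i = j
  · subst h; ring
  · simp [h, Ne.symm h]; ring

theorem sum_antidiagonal_add_single {X : Type*} [AddCommMonoid X] (j : ι) (n : ι →₀ ℕ)
    (F : (ι →₀ ℕ) → (ι →₀ ℕ) → X) (h : ∀ a b, a j = 0 → F a b = 0) :
    ∑ q ∈ antidiagonal (n + Finsupp.single j 1), F q.1 q.2 =
      ∑ q ∈ antidiagonal n, F (q.1 + Finsupp.single j 1) q.2 := by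
  symm
  refine Finset.sum_of_injOn (fun q => (q.1 + Finsupp.single j 1, q.2)) ?_ ?_ ?_ (fun _ _ => rfl)
  · rintro ⟨a, b⟩ _ ⟨c, d⟩ _ h
    simpa using h
  · rintro ⟨a, b⟩ hq
    simp only [mem_coe, HasAntidiagonal.mem_antidiagonal] at hq ⊢
    rw [← hq, add_right_comm]
  · rintro ⟨a, b⟩ hq hn
    apply h
    by_contra h0
    change a j ≠ 0 at h0
    refine hn ⟨(a - Finsupp.single j 1, b), ?_, ?_⟩
    · simp only [mem_coe, HasAntidiagonal.mem_antidiagonal] at hq ⊢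
      ext i
      have := DFunLike.congr_fun hq i
      simp only [Finsupp.add_apply, Finsupp.tsub_apply] at this ⊢
      by_cases hi : j = i
      · subst hi; simp only [Finsupp.single_eq_same] at this ⊢; omega
      · simpa [Finsupp.single_apply, hi] using this
    · ext i
      · simp only [Finsupp.add_apply, Finsupp.tsub_apply]
        by_cases hi : j = i
        · subst hi; simp only [Finsupp.single_eq_same]; omega
        · simp [hi]
      · rfl

/-- The Leibniz rule. -/
theorem pd_mul₂ (j : ι) (B : V →ₗ[K] W →ₗ[K] Z) (f : FM ι V) (g : FM ι W) :
    pd K j (mul₂ B f g) = mul₂ B (pd K j f) g + mul₂ B f (pd K j g) := by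
  ext n
  have h1 := sum_antidiagonal_add_single j n (fun a b => (a j : K) • B (f a) (g b))
    (by intro a b h; simp [h])
  have h2 := sum_antidiagonal_add_single j n (fun a b => (a j : K) • B.flip (g a) (f b))
    (by intro a b h; simp [h])
  have hsw : ∀ (m : ι →₀ ℕ) (F : (ι →₀ ℕ) → (ι →₀ ℕ) → Z),
      ∑ q ∈ antidiagonal m, F q.1 q.2 = ∑ q ∈ antidiagonal m, F q.2 q.1 := fun m F =>
    Finset.sum_nbij' Prod.swap Prod.swap (by simp [add_comm]) (by simp [add_comm])
      (by simp) (by simp) (by simp)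
  replace h2 := (hsw _ (fun b a => (a j : K) • B.flip (g a) (f b))).trans (h2.trans
    (hsw _ (fun a b => (((a + Finsupp.single j 1 : ι →₀ ℕ) j : ℕ) : K) • B.flip (g (a + Finsupp.single j 1)) (f b))))
  rw [pd_coeff, add_coeff, mul₂_coeff, mul₂_coeff, mul₂_coeff]
  have h3 : ((n j : K) + 1) • ∑ q ∈ antidiagonal (n + Finsupp.single j 1), B (f q.1) (g q.2) =
      ∑ q ∈ (antidiagonal (n + Finsupp.single j 1) : Finset ((ι →₀ ℕ) × (ι →₀ ℕ))), (q.1 j : K) • B (f q.1) (g q.2) +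
      ∑ q ∈ (antidiagonal (n + Finsupp.single j 1) : Finset ((ι →₀ ℕ) × (ι →₀ ℕ))), (q.2 j : K) • B (f q.1) (g q.2) := by
    rw [Finset.smul_sum, ← Finset.sum_add_distrib]
    refine Finset.sum_congr rfl fun q hq => ?_
    rw [← add_smul]
    congr 1
    have := DFunLike.congr_fun (HasAntidiagonal.mem_antidiagonal.1 hq) j
    simp only [Finsupp.add_apply, Finsupp.single_eq_same] at this
    rw [← Nat.cast_add, this]; simp
  rw [h3, h1]
  simp only [LinearMap.flip_apply] at h2
  rw [h2]
  simp [pd_coeff]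

/-- The Euler operator `f ↦ ∑ x_j ∂f/∂x_j`. -/
def eul (K : Type*) [Field K] {ι V : Type*} [AddCommGroup V] [Module K V] :
    FM ι V →ₗ[K] FM ι V where
  toFun f := ⟨fun n => (n.degree : K) • f n⟩
  map_add' f g := by ext n; simp
  map_smul' c f := by ext n; exact smul_comm _ c _

theorem eul_coeff (f : FM ι V) (n) : eul K f n = (n.degree : K) • f n := rfl

@[simp] theorem eul_cst (v : V) : eul K (cst K v : FM ι V) = 0 := by
  ext n; by_cases h : n = 0 <;> simp [eul_coeff, cst_coeff, h]

theorem eul_mul₂ (B : V →ₗ[K] W →ₗ[K] Z) (f : FM ι V) (g : FM ι W) :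
    eul K (mul₂ B f g) = mul₂ B (eul K f) g + mul₂ B f (eul K g) := by
  ext n
  rw [eul_coeff, add_coeff, mul₂_coeff, mul₂_coeff, mul₂_coeff, Finset.smul_sum,
    ← Finset.sum_add_distrib]
  refine Finset.sum_congr rfl fun q hq => ?_
  rw [← HasAntidiagonal.mem_antidiagonal.1 hq]
  simp [eul_coeff, add_smul]

theorem pd_eul (j : ι) (f : FM ι V) : pd K j (eul K f) = eul K (pd K j f) + pd K j f := by
  ext n
  simp only [pd_coeff, eul_coeff, add_coeff, map_add, Finsupp.degree_single, smul_smul, ← add_smul]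
  congr 1
  push_cast; ring

/-- The coordinate function `x_j`. -/
def var (j : ι) : MvPowerSeries ι K := MvPowerSeries.X j

theorem ofSer_var (j : ι) (n : ι →₀ ℕ) :
    ofSer (var j : MvPowerSeries ι K) n = if n = Finsupp.single j 1 then 1 else 0 :=
  MvPowerSeries.coeff_X n j

theorem var_smul_add_single (j : ι) (f : FM ι V) (n) :
    ((var j : MvPowerSeries ι K) • f) (n + Finsupp.single j 1) = f n := by
  rw [ser_smul_coeff, Finset.sum_eq_single (Finsupp.single j 1, n)]
  · simp [ofSer_var]
  · rintro ⟨a, c⟩ hq hne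
    have : a ≠ Finsupp.single j 1 := by
      rintro rfl
      simp only [HasAntidiagonal.mem_antidiagonal, add_comm n] at hq
      exact hne (by rw [add_left_cancel hq])
    simp [ofSer_var, this]
  · intro h; exact absurd (by simp [add_comm]) h

theorem var_smul_of_eq_zero (j : ι) (f : FM ι V) (n) (h : n j = 0) :
    ((var j : MvPowerSeries ι K) • f) n = 0 := by
  rw [ser_smul_coeff]
  refine Finset.sum_eq_zero ?_
  rintro ⟨a, c⟩ hq
  have : a ≠ Finsupp.single j 1 := by
    rintro rfl
    have := DFunLike.congr_fun (HasAntidiagonal.mem_antidiagonal.1 hq) j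
    simp [h] at this
  simp [ofSer_var, this]

theorem exists_eq_add_single {j : ι} {n : ι →₀ ℕ} (h : n j ≠ 0) :
    ∃ m, n = m + Finsupp.single j 1 := by
  refine ⟨n - Finsupp.single j 1, ?_⟩
  ext i
  by_cases hi : j = i
  · subst hi; simp; omega
  · simp [hi]

theorem eul_eq_sum [Fintype ι] (f : FM ι V) :
    eul K f = ∑ j, (var j : MvPowerSeries ι K) • pd K j f := by
  ext n
  rw [eul_coeff, sum_coeff, Finsupp.degree_eq_sum, Nat.cast_sum, Finset.sum_smul]
  refine Finset.sum_congr rfl fun j _ => ?_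
  by_cases h : n j = 0
  · rw [var_smul_of_eq_zero j _ n h, h]; simp
  · obtain ⟨m, rfl⟩ := exists_eq_add_single h
    rw [var_smul_add_single, pd_coeff]; simp

theorem pd_ser_smul_cst (j : ι) (a : FM ι K) (v : V) :
    pd K j (toSer a • (cst K v : FM ι V)) = toSer (pd K j a) • cst K v := by
  simp only [ser_smul_def, ofSer_toSer, pd_mul₂, pd_cst, map_zero, add_zero]

/-! ### Power series of operators that raise the degree -/

/-- `f` vanishes to order `k`: it has no terms of degree `< k`. -/
def Vanish (k : ℕ) (f : FM ι V) : Prop := ∀ n : ι →₀ ℕ, n.degree < k → f n = 0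

theorem Vanish.mono {k l : ℕ} (h : l ≤ k) {f : FM ι V} (hf : Vanish k f) : Vanish l f :=
  fun n hn => hf n (hn.trans_le h)

theorem vanish_zero (f : FM ι V) : Vanish 0 f := fun _ hn => absurd hn (Nat.not_lt_zero _)

theorem eq_zero_of_vanish {f : FM ι V} (h : ∀ k, Vanish k f) : f = 0 := by
  ext n; exact h (n.degree + 1) n (Nat.lt_succ_self _)

theorem vanish_one {f : FM ι V} (h : f 0 = 0) : Vanish 1 f := by
  intro n hn
  rw [Nat.lt_one_iff, Finsupp.degree_eq_zero_iff] at hn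
  rw [hn, h]

theorem Vanish.add {k : ℕ} {f g : FM ι V} (hf : Vanish k f) (hg : Vanish k g) :
    Vanish k (f + g) := fun n hn => by rw [add_coeff, hf n hn, hg n hn, add_zero]

theorem Vanish.smul {k : ℕ} {f : FM ι V} (hf : Vanish k f) (c : K) :
    Vanish k (c • f) := fun n hn => by rw [smul_coeff, hf n hn, smul_zero]

theorem Vanish.mul₂ {k l : ℕ} (B : V →ₗ[K] W →ₗ[K] Z) {f : FM ι V} {g : FM ι W}
    (hf : Vanish k f) (hg : Vanish l g) : Vanish (k + l) (FM.mul₂ B f g) := by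
  intro n hn
  rw [mul₂_coeff]
  refine Finset.sum_eq_zero fun q hq => ?_
  rw [← HasAntidiagonal.mem_antidiagonal.1 hq, map_add] at hn
  by_cases h : q.1.degree < k
  · simp [hf _ h]
  · rw [hg q.2 (by omega), map_zero]

/-- An operator on formal maps is local if it does not lower the degree. -/
def IsLocal (Φ : FM ι V →ₗ[K] FM ι W) : Prop := ∀ k f, Vanish k f → Vanish k (Φ f)

theorem IsLocal.congr {Φ : FM ι V →ₗ[K] FM ι W} (h : IsLocal Φ) {f g : FM ι V} {N : ℕ}
    (hfg : ∀ n : ι →₀ ℕ, n.degree < N → f n = g n) (n : ι →₀ ℕ) (hn : n.degree < N) :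
    Φ f n = Φ g n := by
  have := h N (f - g) (fun n hn => by rw [sub_coeff, hfg n hn, sub_self]) n hn
  rwa [map_sub, sub_coeff, sub_eq_zero] at this

theorem isLocal_lin (L : V →ₗ[K] W) : IsLocal (lin (ι := ι) L) := fun k f hf n hn => by
  rw [lin_coeff, hf n hn, map_zero]

theorem isLocal_mul₂_left (B : V →ₗ[K] W →ₗ[K] Z) (f : FM ι V) : IsLocal (mul₂ B f) :=
  fun k g hg => by simpa using (vanish_zero f).mul₂ B hg

theorem isLocal_mul₂_right (B : V →ₗ[K] W →ₗ[K] Z) (g : FM ι W) : IsLocal ((mul₂ B).flip g) :=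
  fun k f hf => by simpa using hf.mul₂ B (vanish_zero g)

theorem isLocal_eul : IsLocal (eul K (ι := ι) (V := V)) := fun k f hf n hn => by
  rw [eul_coeff, hf n hn, smul_zero]

/-- An operator on formal maps raises the degree. -/
def Raises (T : End K (FM ι V)) : Prop := ∀ k f, Vanish k f → Vanish (k + 1) (T f)

theorem raises_mul₂ (B : W →ₗ[K] End K V) {S : FM ι W} (hS : S 0 = 0) :
    Raises (mul₂ (B : W →ₗ[K] V →ₗ[K] V) S : End K (FM ι V)) := fun k f hf => by
  simpa [add_comm] using (vanish_one hS).mul₂ (B : W →ₗ[K] V →ₗ[K] V) hf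

theorem Raises.pow {T : End K (FM ι V)} (hT : Raises T) (i : ℕ) :
    ∀ k f, Vanish k f → Vanish (k + i) ((T ^ i) f) := by
  induction i with
  | zero => intro k f hf; simpa using hf
  | succ i ih =>
    intro k f hf
    rw [pow_succ', Module.End.mul_apply, ← add_assoc]
    exact hT _ _ (ih k f hf)

theorem Raises.neg {T : End K (FM ι V)} (hT : Raises T) : Raises (-T) := fun k f hf n hn => by
  rw [LinearMap.neg_apply, neg_coeff, hT k f hf n hn, neg_zero]

/-- An operator equation `T f = f` with `T` raising the degree has only the zero solution. -/
theorem Raises.eq_zero {T : End K (FM ι V)} (hT : Raises T) {f : FM ι V} (h : T f = f) : f = 0 := by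
  refine eq_zero_of_vanish fun k => ?_
  induction k with
  | zero => exact vanish_zero f
  | succ k ih => rw [← h]; exact hT k f ih

theorem Raises.aeval {T : End K (FM ι V)} (hT : Raises T) {N : ℕ} {p : Polynomial K}
    (hp : ∀ i < N, p.coeff i = 0) (f : FM ι V) : Vanish N (Polynomial.aeval T p f) := by
  obtain ⟨q, rfl⟩ := Polynomial.X_pow_dvd_iff.2 hp
  rw [map_mul, map_pow, Polynomial.aeval_X, Module.End.mul_apply]
  simpa using hT.pow N 0 _ (vanish_zero _)

theorem Raises.aeval_congr {T : End K (FM ι V)} (hT : Raises T) {N : ℕ} {p q : Polynomial K}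
    (h : ∀ i < N, p.coeff i = q.coeff i) (f : FM ι V) (n : ι →₀ ℕ) (hn : n.degree < N) :
    Polynomial.aeval T p f n = Polynomial.aeval T q f n := by
  have := hT.aeval (p := p - q) (N := N) (fun i hi => by simp [h i hi]) f n hn
  rwa [map_sub, LinearMap.sub_apply, sub_coeff, sub_eq_zero] at this

theorem Raises.isLocal_aeval {T : End K (FM ι V)} (hT : Raises T) (p : Polynomial K) :
    IsLocal (Polynomial.aeval T p : End K (FM ι V)) := by
  intro k f hf n hn
  have : (Polynomial.aeval T p) f = ∑ i ∈ range (p.natDegree + 1), p.coeff i • (T ^ i) f := by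
    rw [Polynomial.aeval_eq_sum_range]; simp
  rw [this, sum_coeff]
  refine Finset.sum_eq_zero fun i _ => ?_
  rw [smul_coeff, hT.pow i k f hf n (by omega), smul_zero]

/-- The operator `∑_k c_k T^k`, for an operator `T` on formal maps that raises the degree: the
coefficient of degree `d` is that of `∑_{k ≤ d} c_k T^k`, to which further terms do not contribute. -/
def ser (T : End K (FM ι V)) (c : PowerSeries K) : End K (FM ι V) where
  toFun f := ⟨fun n => Polynomial.aeval T (PowerSeries.trunc (n.degree + 1) c) f n⟩
  map_add' f g := by ext n; simp
  map_smul' r f := by ext n; simp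

theorem ser_coeff {T : End K (FM ι V)} (hT : Raises T) (c : PowerSeries K) (f : FM ι V)
    (n : ι →₀ ℕ) {N : ℕ} (hN : n.degree < N) :
    ser T c f n = Polynomial.aeval T (PowerSeries.trunc N c) f n :=
  hT.aeval_congr (N := n.degree + 1) (fun i hi => by
    rw [PowerSeries.coeff_trunc, PowerSeries.coeff_trunc, if_pos hi, if_pos (by omega)]) f n
    (Nat.lt_succ_self _)

theorem aeval_trunc_apply (T : End K (FM ι V)) (c : PowerSeries K) (f : FM ι V) (N : ℕ) :
    Polynomial.aeval T (PowerSeries.trunc N c) f =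
      ∑ k ∈ range N, PowerSeries.coeff k c • (T ^ k) f := by
  rw [PowerSeries.trunc_apply, map_sum, LinearMap.sum_apply, ← Finset.range_eq_Ico]
  simp [Polynomial.aeval_monomial]

theorem ser_coeff_sum {T : End K (FM ι V)} (hT : Raises T) (c : PowerSeries K) (f : FM ι V)
    (n : ι →₀ ℕ) {N : ℕ} (hN : n.degree < N) :
    ser T c f n = ∑ k ∈ range N, PowerSeries.coeff k c • ((T ^ k) f) n := by
  rw [ser_coeff hT c f n hN, aeval_trunc_apply]; simp

theorem isLocal_ser {T : End K (FM ι V)} (hT : Raises T) (c : PowerSeries K) :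
    IsLocal (ser T c : End K (FM ι V)) :=
  fun k f hf n hn => hT.isLocal_aeval _ k f hf n hn

theorem ser_add (T : End K (FM ι V)) (c d : PowerSeries K) : ser T (c + d) = ser T c + ser T d := by
  ext f n
  simp [ser]

theorem ser_smul (T : End K (FM ι V)) (r : K) (d : PowerSeries K) :
    ser T (r • d) = r • ser T d := by
  ext f n
  simp [ser]

theorem ser_neg (T : End K (FM ι V)) (d : PowerSeries K) : ser T (-d) = -ser T d := by
  rw [← neg_one_smul K d, ser_smul, neg_one_smul]

theorem ser_sub (T : End K (FM ι V)) (c d : PowerSeries K) : ser T (c - d) = ser T c - ser T d := by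
  rw [sub_eq_add_neg, ser_add, ser_neg, ← sub_eq_add_neg]

theorem ser_one (T : End K (FM ι V)) : ser T 1 = 1 := by
  ext f n
  simp [ser, PowerSeries.trunc_one]

theorem ser_X {T : End K (FM ι V)} (hT : Raises T) : ser T PowerSeries.X = T := by
  ext f n
  rw [ser_coeff hT _ f n (N := n.degree + 2) (by omega), PowerSeries.trunc_X]
  simp

theorem ser_mul {T : End K (FM ι V)} (hT : Raises T) (c d : PowerSeries K) :
    ser T (c * d) = ser T c * ser T d := by
  ext f n
  have hn : n.degree < n.degree + 1 := Nat.lt_succ_self _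
  rw [Module.End.mul_apply, ser_coeff hT c _ n hn,
    (hT.isLocal_aeval _).congr (g := Polynomial.aeval T (PowerSeries.trunc (n.degree + 1) d) f)
      (fun m hm => ser_coeff hT d f m hm) n hn, ← Module.End.mul_apply, ← map_mul,
    ser_coeff hT _ f n hn]
  refine hT.aeval_congr (N := n.degree + 1) (fun i hi => ?_) f n hn
  rw [PowerSeries.coeff_trunc, if_pos hi, PowerSeries.coeff_mul_eq_coeff_trunc_mul_trunc _ _ hi,
    ← Polynomial.coeff_coe, Polynomial.coe_mul]

theorem ser_comp_apply {T : End K (FM ι V)} (hT : Raises T) (c d : PowerSeries K) (f : FM ι V) :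
    ser T c (ser T d f) = ser T (c * d) f := by rw [ser_mul hT, Module.End.mul_apply]

theorem pow_intertwine {T : End K (FM ι V)} {T' : End K (FM ι W)} {Φ : FM ι V →ₗ[K] FM ι W}
    (h : ∀ f, Φ (T f) = T' (Φ f)) (k : ℕ) (f : FM ι V) : Φ ((T ^ k) f) = (T' ^ k) (Φ f) := by
  induction k with
  | zero => simp
  | succ k ih => rw [pow_succ', pow_succ', Module.End.mul_apply, Module.End.mul_apply, h, ih]

/-- A local operator that intertwines `T` and `T'` intertwines their power series. -/
theorem ser_intertwine {T : End K (FM ι V)} {T' : End K (FM ι W)} (hT : Raises T) (hT' : Raises T')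
    {Φ : FM ι V →ₗ[K] FM ι W} (hΦ : IsLocal Φ) (h : ∀ f, Φ (T f) = T' (Φ f)) (c : PowerSeries K)
    (f : FM ι V) : Φ (ser T c f) = ser T' c (Φ f) := by
  ext n
  have hn : n.degree < n.degree + 1 := Nat.lt_succ_self _
  rw [hΦ.congr (g := Polynomial.aeval T (PowerSeries.trunc (n.degree + 1) c) f)
      (fun m hm => ser_coeff hT c f m hm) n hn, ser_coeff hT' c _ n hn, aeval_trunc_apply,
      aeval_trunc_apply, map_sum]
  simp only [map_smul, pow_intertwine h]

/-- The adjoint of a power series of operators with respect to a bilinear map. -/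
theorem ser_adjoint {T : End K (FM ι V)} {T' : End K (FM ι W)} (hT : Raises T) (hT' : Raises T')
    (B : V →ₗ[K] W →ₗ[K] Z) (h : ∀ f g, mul₂ B (T f) g = mul₂ B f (T' g)) (c : PowerSeries K)
    (f : FM ι V) (g : FM ι W) : mul₂ B (ser T c f) g = mul₂ B f (ser T' c g) := by
  have hk : ∀ k f g, mul₂ B ((T ^ k) f) g = mul₂ B f ((T' ^ k) g) := by
    intro k
    induction k with
    | zero => intro f g; simp
    | succ k ih =>
      intro f g
      rw [pow_succ, pow_succ', Module.End.mul_apply, Module.End.mul_apply, ih, h]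
  ext n
  have hn : n.degree < n.degree + 1 := Nat.lt_succ_self _
  have h1 := (isLocal_mul₂_right B g).congr (f := ser T c f)
    (g := Polynomial.aeval T (PowerSeries.trunc (n.degree + 1) c) f)
      (fun m hm => ser_coeff hT c f m hm) n hn
  have h2 := (isLocal_mul₂_left B f).congr (f := ser T' c g)
    (g := Polynomial.aeval T' (PowerSeries.trunc (n.degree + 1) c) g)
      (fun m hm => ser_coeff hT' c g m hm) n hn
  rw [LinearMap.flip_apply, LinearMap.flip_apply] at h1
  rw [h1, h2, aeval_trunc_apply, aeval_trunc_apply]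
  simp only [map_sum, LinearMap.sum_apply, map_smul, LinearMap.smul_apply, hk]

theorem ser_neg_op {T : End K (FM ι V)} (c : PowerSeries K) :
    ser (-T) c = ser T (PowerSeries.evalNegHom c) := by
  ext f n
  change Polynomial.aeval (-T) _ f n = Polynomial.aeval T _ f n
  rw [aeval_trunc_apply, aeval_trunc_apply, sum_coeff, sum_coeff]
  refine Finset.sum_congr rfl fun k _ => ?_
  rw [neg_pow, PowerSeries.evalNegHom, PowerSeries.coeff_rescale]
  rcases Nat.even_or_odd k with hk | hk <;> simp [hk.neg_one_pow]

/-- The formal maps `map₂ B S` iterated as in the definition of `FormalMap.opSeries`. -/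
theorem iterate_eq_pow (B : W →ₗ[K] End K V) (S : FormalMap ι W) (k : ℕ) (f : FormalMap ι V) :
    (FM.mk ((FormalMap.map₂ (B : W →ₗ[K] V →ₗ[K] V) S)^[k] f)) =
      ((mul₂ (B : W →ₗ[K] V →ₗ[K] V) ⟨S⟩ : End K (FM ι V)) ^ k) ⟨f⟩ := by
  induction k with
  | zero => rfl
  | succ k ih =>
    rw [pow_succ', Module.End.mul_apply, ← ih, Function.iterate_succ_apply']
    rfl

theorem opSeries_eq_ser (c : ℕ → K) (B : W →ₗ[K] End K V) (S : FormalMap ι W) (f : FormalMap ι V)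
    (hS : S 0 = 0) :
    FM.mk (FormalMap.opSeries c B S f) =
      ser (mul₂ (B : W →ₗ[K] V →ₗ[K] V) ⟨S⟩) (PowerSeries.mk c) ⟨f⟩ := by
  ext n
  change FormalMap.opSeries c B S f n = _
  rw [FormalMap.opSeries, ser_coeff_sum (raises_mul₂ B (S := ⟨S⟩) hS) _ _ n (Nat.lt_succ_self _)]
  refine Finset.sum_congr rfl fun k _ => ?_
  rw [PowerSeries.coeff_mk, ← iterate_eq_pow]
  rfl

theorem eul_pow {T : End K (FM ι V)} (hE : ∀ f, eul K (T f) = T (eul K f) + T f) (k : ℕ)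
    (f : FM ι V) : eul K ((T ^ k) f) = (T ^ k) (eul K f) + (k : K) • (T ^ k) f := by
  induction k with
  | zero => simp
  | succ k ih =>
    rw [pow_succ', Module.End.mul_apply, hE, ih, Module.End.mul_apply, map_add, map_smul]
    push_cast
    module

/-- The Euler operator and a power series `c(T)`, for `T` homogeneous of degree `1`:
`E c(T) = c(T) E + (z c')(T)`. -/
theorem eul_ser {T : End K (FM ι V)} (hT : Raises T) (hE : ∀ f, eul K (T f) = T (eul K f) + T f)
    (c : PowerSeries K) (f : FM ι V) :
    eul K (ser T c f) = ser T c (eul K f) +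
      ser T (PowerSeries.X * PowerSeries.derivative K c) f := by
  ext n
  have hn : n.degree < n.degree + 1 := Nat.lt_succ_self _
  rw [isLocal_eul.congr (g := Polynomial.aeval T (PowerSeries.trunc (n.degree + 1) c) f)
      (fun m hm => ser_coeff hT c f m hm) n hn, aeval_trunc_apply, add_coeff,
      ser_coeff_sum hT _ _ n hn, ser_coeff_sum hT _ _ n hn, map_sum, sum_coeff,
      ← Finset.sum_add_distrib]
  refine Finset.sum_congr rfl fun k _ => ?_
  rw [map_smul, eul_pow hE, smul_add, add_coeff, smul_coeff, smul_coeff, smul_coeff, smul_smul]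
  congr 2
  cases k with
  | zero => simp
  | succ k => rw [PowerSeries.coeff_succ_X_mul, PowerSeries.coeff_derivative]; push_cast; ring

end FM

end FormalDerivative

/-! ### Lie algebras of formal maps and the exponential of an inner derivation -/

section FormalLie

variable {K : Type*} [Field K] {ι : Type*} [DecidableEq ι]
  {V W Z : Type*} [AddCommGroup V] [Module K V] [AddCommGroup W] [Module K W]
  [AddCommGroup Z] [Module K Z]

namespace FM

section LieRing

variable {L : Type*} [LieRing L]

instance : Bracket (FM ι L) (FM ι L) := ⟨fun f g => ⟨fun n => ∑ q ∈ antidiagonal n, ⁅f q.1, g q.2⁆⟩⟩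

theorem lie_coeff (f g : FM ι L) (n) : ⁅f, g⁆ n = ∑ q ∈ antidiagonal n, ⁅f q.1, g q.2⁆ := rfl

theorem sum_antidiagonal_swap' {X : Type*} [AddCommMonoid X] (m : ι →₀ ℕ)
    (F : (ι →₀ ℕ) → (ι →₀ ℕ) → X) :
    ∑ q ∈ antidiagonal m, F q.1 q.2 = ∑ q ∈ antidiagonal m, F q.2 q.1 :=
  Finset.sum_nbij' Prod.swap Prod.swap (by simp [add_comm]) (by simp [add_comm])
    (by simp) (by simp) (by simp)

instance : LieRing (FM ι L) where
  add_lie f g h := by ext n; simp [lie_coeff, Finset.sum_add_distrib]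
  lie_add f g h := by ext n; simp [lie_coeff, Finset.sum_add_distrib]
  lie_self f := by
    ext n
    refine Finset.sum_involution (fun q _ => q.swap) ?_ ?_ ?_ ?_
    · intro q _
      simp only [Prod.fst_swap, Prod.snd_swap]
      rw [← lie_skew, neg_add_cancel]
    · intro q _ h1 h2
      have : q.1 = q.2 := congrArg Prod.snd h2
      rw [this, lie_self] at h1
      exact h1 rfl
    · intro q hq; simpa [add_comm] using hq
    · intro q _; simp
  leibniz_lie f g h := by
    ext n
    have h1 : ⁅f, ⁅g, h⁆⁆ n = ∑ q ∈ antidiagonal n, ∑ r ∈ antidiagonal q.2,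
        (⁅⁅f q.1, g r.1⁆, h r.2⁆ + ⁅g r.1, ⁅f q.1, h r.2⁆⁆) := by
      simp only [lie_coeff, lie_sum]
      exact Finset.sum_congr rfl fun q _ => Finset.sum_congr rfl fun r _ => leibniz_lie _ _ _
    have h2 : ⁅⁅f, g⁆, h⁆ n = ∑ q ∈ antidiagonal n, ∑ r ∈ antidiagonal q.2,
        ⁅⁅f q.1, g r.1⁆, h r.2⁆ := by
      simp only [lie_coeff, sum_lie]
      exact sum_antidiagonal_assoc (fun a b c => ⁅⁅f a, g b⁆, h c⁆) n
    have h3 : ⁅g, ⁅f, h⁆⁆ n = ∑ q ∈ antidiagonal n, ∑ r ∈ antidiagonal q.2,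
        ⁅g r.1, ⁅f q.1, h r.2⁆⁆ := by
      simp only [lie_coeff, lie_sum]
      rw [← sum_antidiagonal_assoc (fun a b c => ⁅g a, ⁅f b, h c⁆⁆) n,
        ← sum_antidiagonal_assoc (fun a b c => ⁅g b, ⁅f a, h c⁆⁆) n]
      exact Finset.sum_congr rfl fun q _ =>
        sum_antidiagonal_swap' q.1 (fun a b => ⁅g a, ⁅f b, h q.2⁆⁆)
    rw [add_coeff, h1, h2, h3]
    simp only [Finset.sum_add_distrib]

end LieRing

variable {L : Type*} [LieRing L] [LieAlgebra K L]

theorem lie_eq_mul₂ (f g : FM ι L) : ⁅f, g⁆ = mul₂ (lieBilin K L) f g := rfl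

instance : LieAlgebra (MvPowerSeries ι K) (FM ι L) where
  lie_smul c f g := by
    rw [lie_eq_mul₂ (K := K), mul₂_ser_smul_right, ← lie_eq_mul₂]

theorem eul_lie (f g : FM ι L) : eul K ⁅f, g⁆ = ⁅eul K f, g⁆ + ⁅f, eul K g⁆ :=
  eul_mul₂ (lieBilin K L) f g

theorem lie_cst_cst (v w : L) : ⁅(cst K v : FM ι L), cst K w⁆ = (cst K ⁅v, w⁆ : FM ι L) := by
  rw [lie_eq_mul₂ (K := K), mul₂_cst_left, lin_cst]; rfl

theorem lie_cst_coeff (v : L) (f : FM ι L) (n) : ⁅(cst K v : FM ι L), f⁆ n = ⁅v, f n⁆ := by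
  rw [lie_eq_mul₂ (K := K), mul₂_cst_left]; rfl

/-- The derivative in the direction `α`. -/
def dird [Fintype ι] (α : ι → K) : FM ι V →ₗ[K] FM ι V := ∑ j, α j • pd K j

section Dird

variable [Fintype ι]

theorem dird_apply (α : ι → K) (f : FM ι V) : dird α f = ∑ j, α j • pd K j f := by
  simp [dird]

theorem dird_mul₂ (α : ι → K) (B : V →ₗ[K] W →ₗ[K] Z) (f : FM ι V) (g : FM ι W) :
    dird α (mul₂ B f g) = mul₂ B (dird α f) g + mul₂ B f (dird α g) := by
  simp [dird_apply, pd_mul₂, Finset.sum_add_distrib]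

theorem dird_lie (α : ι → K) (f g : FM ι L) :
    dird α ⁅f, g⁆ = ⁅dird α f, g⁆ + ⁅f, dird α g⁆ := dird_mul₂ α (lieBilin K L) f g

@[simp] theorem dird_cst (α : ι → K) (v : V) : dird α (cst K v) = 0 := by simp [dird_apply]

theorem dird_lin (α : ι → K) (N : V →ₗ[K] W) (f : FM ι V) :
    dird α (lin N f) = lin N (dird α f) := by simp [dird_apply, pd_lin]

theorem dird_eul (α : ι → K) (f : FM ι V) : dird α (eul K f) = eul K (dird α f) + dird α f := by
  simp [dird_apply, pd_eul, Finset.sum_add_distrib]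

theorem dird_comm (α β : ι → K) (f : FM ι V) : dird α (dird β f) = dird β (dird α f) := by
  simp only [dird_apply, map_sum, map_smul, Finset.smul_sum]
  rw [Finset.sum_comm]
  refine Finset.sum_congr rfl fun i _ => Finset.sum_congr rfl fun j _ => ?_
  rw [pd_comm, smul_comm]

theorem dird_ser_smul (α : ι → K) (a : MvPowerSeries ι K) (f : FM ι V) :
    dird α (a • f) = toSer (dird α (ofSer a)) • f + a • dird α f := by
  simp only [ser_smul_def, dird_mul₂, ofSer_toSer]

end Dird

end FM

end FormalLie

section FormalExp

variable {K : Type*} [Field K] [CharZero K] {ι : Type*} [DecidableEq ι]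
  {V W Z : Type*} [AddCommGroup V] [Module K V] [AddCommGroup W] [Module K W]
  [AddCommGroup Z] [Module K Z]

/-- The series `e^z`. -/
def expS (K : Type*) [Field K] : PowerSeries K := PowerSeries.mk (expCoeff K)

theorem expS_eq : expS K = PowerSeries.exp K := by
  ext n
  simp [expS, expCoeff, PowerSeries.coeff_exp]

/-- The series `e^{-z}`. -/
def expNegS (K : Type*) [Field K] : PowerSeries K := PowerSeries.evalNegHom (expS K)

theorem expS_mul_expNegS : expS K * expNegS K = 1 := by
  rw [expNegS, expS_eq, PowerSeries.exp_mul_exp_neg_eq_one]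

theorem coeff_evalNegHom (c : PowerSeries K) (n : ℕ) :
    PowerSeries.coeff n (PowerSeries.evalNegHom c) = (-1) ^ n * PowerSeries.coeff n c := by
  rw [PowerSeries.evalNegHom, PowerSeries.coeff_rescale]

theorem derivative_expS : PowerSeries.derivative K (expS K) = expS K := by
  ext n
  rw [PowerSeries.coeff_derivative, expS, PowerSeries.coeff_mk, PowerSeries.coeff_mk, expCoeff,
    expCoeff, Nat.factorial_succ]
  have : ((n : K) + 1) ≠ 0 := by exact_mod_cast Nat.succ_ne_zero n
  have h2 : (n.factorial : K) ≠ 0 := by exact_mod_cast n.factorial_ne_zero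
  push_cast
  field_simp

theorem derivative_expNegS : PowerSeries.derivative K (expNegS K) = -expNegS K := by
  ext n
  have := congrArg (PowerSeries.coeff n) (derivative_expS (K := K))
  rw [PowerSeries.coeff_derivative] at this
  rw [PowerSeries.coeff_derivative, expNegS, coeff_evalNegHom, map_neg, coeff_evalNegHom, ← this]
  ring

namespace FM

/-- An equation `E f + m f = T f` with `m > 0` and `T` raising the degree has only the zero
solution. -/
theorem eq_zero_of_eul {T : End K (FM ι V)} (hT : Raises T) {m : ℕ} (hm : 0 < m) {f : FM ι V}
    (h : eul K f + (m : K) • f = T f) : f = 0 := by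
  refine eq_zero_of_vanish fun k => ?_
  induction k with
  | zero => exact vanish_zero f
  | succ k ih =>
    intro n hn
    have h1 : eul K f n + (m : K) • f n = T f n := by rw [← h]; rfl
    rw [hT k f ih n hn, eul_coeff, ← add_smul] at h1
    refine (smul_eq_zero.1 h1).resolve_left ?_
    exact_mod_cast (by omega : n.degree + m ≠ 0)

theorem raises_zero : Raises (0 : End K (FM ι V)) := fun _ _ _ _ _ => rfl

/-- If `T₃ B(f, g) = B(T₁ f, g) + B(f, T₂ g)`, then the exponentials of these operators satisfy
`e^{T₃} B(f, g) = B(e^{T₁} f, e^{T₂} g)`. -/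
theorem exp_mul₂ {T₁ : End K (FM ι V)} {T₂ : End K (FM ι W)} {T₃ : End K (FM ι Z)}
    (h₁ : Raises T₁) (h₂ : Raises T₂) (h₃ : Raises T₃) (B : V →ₗ[K] W →ₗ[K] Z)
    (h : ∀ f g, T₃ (mul₂ B f g) = mul₂ B (T₁ f) g + mul₂ B f (T₂ g)) (f : FM ι V) (g : FM ι W) :
    mul₂ B (ser T₁ (expS K) f) (ser T₂ (expS K) g) = ser T₃ (expS K) (mul₂ B f g) := by
  set a : ℕ → FM ι V := fun i => expCoeff K i • (T₁ ^ i) f with ha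
  set c : ℕ → FM ι W := fun i => expCoeff K i • (T₂ ^ i) g with hc
  have hexp : ∀ i : ℕ, ((i + 1 : ℕ) : K) * expCoeff K (i + 1) = expCoeff K i := by
    intro i
    have : ((i : K) + 1) ≠ 0 := by exact_mod_cast Nat.succ_ne_zero i
    have h2 : (i.factorial : K) ≠ 0 := by exact_mod_cast i.factorial_ne_zero
    rw [expCoeff, expCoeff, Nat.factorial_succ]
    push_cast
    field_simp
  have haT : ∀ i : ℕ, ((i + 1 : ℕ) : K) • a (i + 1) = T₁ (a i) := by
    intro i
    simp only [ha, smul_smul, hexp, map_smul, pow_succ', Module.End.mul_apply]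
  have hcT : ∀ i : ℕ, ((i + 1 : ℕ) : K) • c (i + 1) = T₂ (c i) := by
    intro i
    simp only [hc, smul_smul, hexp, map_smul, pow_succ', Module.End.mul_apply]
  have hk : ∀ k : ℕ, ∑ p ∈ antidiagonal k, mul₂ B (a p.1) (c p.2) =
      expCoeff K k • (T₃ ^ k) (mul₂ B f g) := by
    intro k
    induction k with
    | zero => simp [ha, hc, expCoeff]
    | succ k ih =>
      have hk0 : ((k + 1 : ℕ) : K) ≠ 0 := by exact_mod_cast Nat.succ_ne_zero k
      apply smul_right_injective _ hk0
      change ((k + 1 : ℕ) : K) • _ = ((k + 1 : ℕ) : K) • _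
      rw [smul_smul, hexp, pow_succ', Module.End.mul_apply, ← map_smul, ← ih, map_sum]
      simp only [h, Finset.sum_add_distrib, ← haT, ← hcT]
      have e1 : ((k + 1 : ℕ) : K) • ∑ p ∈ antidiagonal (k + 1), mul₂ B (a p.1) (c p.2) =
          ∑ p ∈ antidiagonal (k + 1), mul₂ B ((p.1 : K) • a p.1) (c p.2) +
          ∑ p ∈ antidiagonal (k + 1), mul₂ B (a p.1) ((p.2 : K) • c p.2) := by
        rw [Finset.smul_sum, ← Finset.sum_add_distrib]
        refine Finset.sum_congr rfl fun p hp => ?_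
        rw [← HasAntidiagonal.mem_antidiagonal.1 hp]
        simp [add_smul]
      rw [e1, Finset.Nat.sum_antidiagonal_succ, Finset.Nat.sum_antidiagonal_succ']
      simp
  ext n
  set N := n.degree + 1 with hN
  have hn : n.degree < N := Nat.lt_succ_self _
  have h1 := (isLocal_mul₂_right B (ser T₂ (expS K) g)).congr (f := ser T₁ (expS K) f)
    (g := ∑ i ∈ range N, a i) (N := N) (fun m hm => by
      rw [ser_coeff_sum h₁ _ _ m hm]; simp [ha, expS]) n hn
  have h2 := (isLocal_mul₂_left B (∑ i ∈ range N, a i)).congr (f := ser T₂ (expS K) g)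
    (g := ∑ i ∈ range N, c i) (N := N) (fun m hm => by
      rw [ser_coeff_sum h₂ _ _ m hm]; simp [hc, expS]) n hn
  rw [LinearMap.flip_apply, LinearMap.flip_apply] at h1
  rw [h1, h2, ser_coeff_sum h₃ _ _ n hn]
  have h3 : ∀ k, PowerSeries.coeff k (expS K) • ((T₃ ^ k) (mul₂ B f g)) n =
      (∑ p ∈ antidiagonal k, mul₂ B (a p.1) (c p.2)) n := by
    intro k; rw [hk, smul_coeff, expS, PowerSeries.coeff_mk]
  simp only [h3, sum_coeff, map_sum, LinearMap.sum_apply]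
  rw [Finset.sum_comm]
  have hz : ∀ i j, N ≤ i + j → mul₂ B (a i) (c j) n = 0 := by
    intro i j hij
    have va : Vanish i (a i) := by
      have := (h₁.pow i 0 f (vanish_zero f)).smul (expCoeff K i)
      rwa [zero_add] at this
    have vc : Vanish j (c j) := by
      have := (h₂.pow j 0 g (vanish_zero g)).smul (expCoeff K j)
      rwa [zero_add] at this
    exact va.mul₂ B vc n (by omega)
  have e2 : ∀ k, ∑ p ∈ antidiagonal k, mul₂ B (a p.1) (c p.2) n =
      ∑ i ∈ range (k + 1), mul₂ B (a i) (c (k - i)) n := fun k =>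
    Finset.Nat.sum_antidiagonal_eq_sum_range_succ (fun i j => mul₂ B (a i) (c j) n) k
  simp only [e2]
  rw [Finset.sum_range_diag_flip N (fun i j => mul₂ B (a i) (c j) n)]
  apply Finset.sum_congr rfl
  intro i hi
  symm
  apply Finset.sum_subset (Finset.range_subset_range.2 (Nat.sub_le _ _))
  intro j _ hj
  rw [Finset.mem_range] at hi hj
  exact hz i j (by omega)

end FM

end FormalExp

/-! ### The Maurer--Cartan form along a linear family in a Lie algebra -/

section MaurerCartan

variable {K : Type*} [Field K] [CharZero K] {ι : Type*} [Fintype ι] [DecidableEq ι]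
  {L : Type*} [LieRing L] [LieAlgebra K L]

/-- The series `(1 - e^{-z}) / z`. -/
def mcS (K : Type*) [Field K] : PowerSeries K :=
  PowerSeries.evalNegHom (PowerSeries.mk (expSubOneDivCoeff K))

theorem X_mul_mcS : PowerSeries.X * mcS K = 1 - expNegS K := by
  ext n
  cases n with
  | zero => rw [PowerSeries.coeff_zero_X_mul, map_sub, expNegS, coeff_evalNegHom]; simp [expS, expCoeff]
  | succ n =>
    rw [PowerSeries.coeff_succ_X_mul, mcS, coeff_evalNegHom, PowerSeries.coeff_mk, map_sub,
      expNegS, coeff_evalNegHom, expS, PowerSeries.coeff_mk, PowerSeries.coeff_one, if_neg (by simp),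
      expSubOneDivCoeff, expCoeff]
    ring

theorem mcS_add_derivative : mcS K + PowerSeries.X * PowerSeries.derivative K (mcS K) =
    expNegS K := by
  have := congrArg (PowerSeries.derivative K) (X_mul_mcS (K := K))
  rw [Derivation.leibniz, map_sub, derivative_expNegS, PowerSeries.derivative_X] at this
  simp only [smul_eq_mul, mul_one, Derivation.map_one_eq_zero] at this
  linear_combination this

namespace FM

variable {V : Type*} [AddCommGroup V] [Module K V]

/-- The formal map `p ↦ ∑_j p_j c_j`. -/
def linFam (c : ι → V) : FM ι V := ⟨fun n => ∑ j, if n = Finsupp.single j 1 then c j else 0⟩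

theorem linFam_coeff (c : ι → V) (n) :
    linFam c n = ∑ j, if n = Finsupp.single j 1 then c j else 0 := rfl

variable (K) in
theorem linFam_eq (c : ι → V) : linFam c = ∑ j, (var j : MvPowerSeries ι K) • cst K (c j) := by
  ext n
  rw [linFam_coeff, sum_coeff]
  refine Finset.sum_congr rfl fun j _ => ?_
  rw [ser_smul_def, mul₂_cst_right, lin_coeff, ofSer_var]
  split_ifs <;> simp

theorem linFam_zero_coeff (c : ι → V) : linFam c 0 = 0 := by
  rw [linFam_coeff]
  refine Finset.sum_eq_zero fun j _ => if_neg ?_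
  intro h
  have := DFunLike.congr_fun h j
  simp at this

theorem eul_linFam (c : ι → V) : eul K (linFam c) = linFam c := by
  ext n
  rw [eul_coeff, linFam_coeff, Finset.smul_sum]
  refine Finset.sum_congr rfl fun j _ => ?_
  split_ifs with h
  · rw [h]; simp
  · simp

theorem pd_linFam (c : ι → V) (j : ι) : pd K j (linFam c) = cst K (c j) := by
  rw [linFam_eq K, map_sum]
  have h : ∀ i, pd K j ((var i : MvPowerSeries ι K) • (cst K (c i) : FM ι V)) =
      cst K ((if i = j then (1 : K) else 0) • c i) := by
    intro i
    have h2 := pd_ser_smul_cst (K := K) j (ofSer (var i : MvPowerSeries ι K)) (c i)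
    have h3 : pd K j (ofSer (var i : MvPowerSeries ι K)) = cst K (if i = j then (1 : K) else 0) := by
      ext n
      rw [pd_coeff, ofSer_var, cst_coeff]
      by_cases hn : n = 0
      · subst hn
        by_cases hij : i = j
        · subst hij; simp
        · have : Finsupp.single j 1 ≠ Finsupp.single i (1 : ℕ) := by
            rw [Ne, Finsupp.single_left_inj one_ne_zero]; exact Ne.symm hij
          simp [this, hij]
      · rw [if_neg hn, if_neg, smul_zero]
        intro h
        apply hn
        have := congrArg Finsupp.degree h
        simp only [map_add, Finsupp.degree_single] at this
        exact (Finsupp.degree_eq_zero_iff n).1 (by omega)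
    rw [h3, cst_smul] at h2
    rw [map_smul (cst K)]
    exact h2
  simp only [h, ← map_sum]
  simp

theorem dird_linFam (α : ι → K) (c : ι → V) : dird α (linFam c) = cst K (∑ j, α j • c j) := by
  simp [dird_apply, pd_linFam]

/-- The operator `ad_q`, where `q_p = ∑_j p_j c_j`. -/
def adFam (K : Type*) [Field K] {ι : Type*} [Fintype ι] [DecidableEq ι]
    {L : Type*} [LieRing L] [LieAlgebra K L] (c : ι → L) : End K (FM ι L) :=
  mul₂ (lieBilin K L) (linFam c)

variable (c : ι → L)

theorem adFam_apply (f : FM ι L) : adFam K c f = ⁅linFam c, f⁆ := rfl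

theorem raises_adFam : Raises (adFam K c) :=
  raises_mul₂ (LieAlgebra.ad K L : L →ₗ[K] End K L) (linFam_zero_coeff c)

theorem eul_adFam (f : FM ι L) : eul K (adFam K c f) = adFam K c (eul K f) + adFam K c f := by
  simp only [adFam_apply, eul_lie, eul_linFam]
  abel

/-- The left Maurer--Cartan form `e^{-q} d(e^q)`, evaluated on the direction in which `q` has
derivative `a`. -/
def mcForm (K : Type*) [Field K] {ι : Type*} [Fintype ι] [DecidableEq ι]
    {L : Type*} [LieRing L] [LieAlgebra K L] (c : ι → L) (a : L) : FM ι L :=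
  ser (adFam K c) (mcS K) (cst K a)

theorem eul_mcForm (a : L) :
    eul K (mcForm K c a) + mcForm K c a = cst K a - ⁅linFam c, mcForm K c a⁆ := by
  have hT := raises_adFam (K := K) c
  rw [mcForm, eul_ser hT (eul_adFam c), eul_cst, map_zero, zero_add, ← LinearMap.add_apply,
    ← ser_add, add_comm, mcS_add_derivative, ← adFam_apply (K := K)]
  nth_rw 2 [← ser_X hT]
  rw [ser_comp_apply hT, X_mul_mcS, ser_sub, ser_one]
  simp

theorem exp_lie (f g : FM ι L) : ser (adFam K c) (expS K) ⁅f, g⁆ =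
    ⁅ser (adFam K c) (expS K) f, ser (adFam K c) (expS K) g⁆ := by
  have hT := raises_adFam (K := K) c
  refine (exp_mul₂ hT hT hT (lieBilin K L) (fun f g => ?_) f g).symm
  exact leibniz_lie (linFam c) f g

theorem exp_pairing {Z : Type*} [AddCommGroup Z] [Module K Z] (B : L →ₗ[K] L →ₗ[K] Z)
    (hB : ∀ x y z : L, B ⁅x, y⁆ z = -B y ⁅x, z⁆) (f g : FM ι L) :
    mul₂ B (ser (adFam K c) (expS K) f) (ser (adFam K c) (expS K) g) = mul₂ B f g := by
  have hT := raises_adFam (K := K) c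
  rw [exp_mul₂ hT hT (raises_zero (K := K) (ι := ι)) B]
  · ext n
    rw [ser_coeff_sum raises_zero _ _ n (Nat.lt_succ_self _), Finset.sum_eq_single 0]
    · simp [expS, expCoeff]
    · intro k _ hk; simp [zero_pow hk]
    · simp
  · intro f g
    rw [LinearMap.zero_apply]
    have : mul₂ B (mul₂ (lieBilin K L) (linFam c) f) g +
        mul₂ B f (mul₂ (lieBilin K L) (linFam c) g) = 0 := by
      rw [← mul₂_flip (lieBilin K L) (linFam c) f, 
        mul₂_assoc (B := B) (C := (lieBilin K L).flip) (B' := -B) (C' := lieBilin K L)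
          (fun v w z => hB w v z)]
      have : mul₂ (-B) f = -mul₂ B f := by
        ext g n; simp [mul₂_coeff]
      rw [this]; simp
    exact this.symm

theorem exp_neg_exp (f : FM ι L) :
    ser (adFam K c) (expS K) (ser (adFam K c) (expNegS K) f) = f := by
  rw [ser_comp_apply (raises_adFam c), expS_mul_expNegS, ser_one]; rfl

/-- The Maurer--Cartan equation. -/
theorem mcForm_maurerCartan (α β : ι → K) :
    dird α (mcForm K c (∑ j, β j • c j)) - dird β (mcForm K c (∑ j, α j • c j)) +
      ⁅mcForm K c (∑ j, α j • c j), mcForm K c (∑ j, β j • c j)⁆ = 0 := by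
  set a := ∑ j, α j • c j
  set a' := ∑ j, β j • c j
  set B := mcForm K c a
  set B' := mcForm K c a'
  have e1 : eul K B = cst K a - ⁅linFam c, B⁆ - B := eq_sub_of_add_eq (eul_mcForm c a)
  have e2 : eul K B' = cst K a' - ⁅linFam c, B'⁆ - B' := eq_sub_of_add_eq (eul_mcForm c a')
  have d1 := dird_eul β B
  have d2 := dird_eul α B'
  rw [e1, map_sub, map_sub, dird_lie, dird_cst, dird_linFam] at d1
  rw [e2, map_sub, map_sub, dird_lie, dird_cst, dird_linFam] at d2
  refine eq_zero_of_eul (raises_adFam (K := K) c).neg (m := 2) (by norm_num) ?_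
  rw [map_add, map_sub, eul_lie, e1, e2, eq_sub_of_add_eq d1.symm, eq_sub_of_add_eq d2.symm]
  simp only [LinearMap.neg_apply, adFam_apply, lie_add, lie_sub, sub_lie, leibniz_lie (linFam c) B]
  have hs : ⁅(cst K a' : FM ι L), B⁆ = -⁅B, cst K a'⁆ := (lie_skew _ _).symm
  rw [hs]
  push_cast
  module

/-- The derivative of `e^{ad q}`: `d(e^{ad q} f) = e^{ad q}(df + [e^{-q} d(e^q), f])`. -/
theorem dird_exp [FiniteDimensional K L] (α : ι → K) (f : FM ι L) :
    dird α (ser (adFam K c) (expS K) f) =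
      ser (adFam K c) (expS K) (dird α f + ⁅mcForm K c (∑ j, α j • c j), f⁆) := by
  have hT := raises_adFam (K := K) c
  set a := ∑ j, α j • c j with ha
  set B := mcForm K c a with hB
  have hexp : ∀ g : FM ι L, eul K (ser (adFam K c) (expS K) g) =
      ser (adFam K c) (expS K) (eul K g) + ⁅linFam c, ser (adFam K c) (expS K) g⁆ := by
    intro g
    rw [eul_ser hT (eul_adFam c), derivative_expS, ← ser_comp_apply hT, ser_X hT]
    rfl
  -- both sides are compatible with multiplication by formal functions, so constants suffice
  have hsm : ∀ (r : MvPowerSeries ι K) (g : FM ι L),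
      ser (adFam K c) (expS K) (r • g) = r • ser (adFam K c) (expS K) g := fun r g =>
    (ser_intertwine hT hT (isLocal_mul₂_left (LinearMap.lsmul K L) (ofSer r))
      (fun h => (lie_smul r (linFam c) h).symm) (expS K) g).symm
  have hcst : ∀ v : L, dird α (ser (adFam K c) (expS K) (cst K v)) =
      ser (adFam K c) (expS K) ⁅B, cst K v⁆ := by
    intro v
    set e := ser (adFam K c) (expS K) with he
    rw [← sub_eq_zero]
    refine eq_zero_of_eul hT (m := 1) one_pos ?_
    have h1 := dird_eul α (e (cst K v))
    rw [hexp, eul_cst, map_zero, zero_add, dird_lie, dird_linFam, ← ha] at h1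
    have h2 := hexp ⁅B, cst K v⁆
    have e1 : eul K B = cst K a - ⁅linFam c, B⁆ - B := eq_sub_of_add_eq (eul_mcForm c a)
    have h3 : e (cst K a - ⁅linFam c, B⁆) = cst K a := by
      have : (cst K a - ⁅linFam c, B⁆ : FM ι L) = ser (adFam K c) (expNegS K) (cst K a) := by
        rw [hB, mcForm, ← adFam_apply (K := K)]
        nth_rw 1 [← ser_X hT]
        rw [ser_comp_apply hT, X_mul_mcS, ser_sub, ser_one]
        simp
      rw [this, he, exp_neg_exp]
    have h4 : e ⁅(cst K a - ⁅linFam c, B⁆ : FM ι L), cst K v⁆ = ⁅(cst K a : FM ι L), e (cst K v)⁆ := by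
      rw [he, exp_lie, ← he, h3]
    rw [eul_lie, eul_cst, lie_zero, add_zero, e1, sub_lie, map_sub, h4] at h2
    rw [map_sub, h2, eq_sub_of_add_eq h1.symm, map_sub, adFam_apply, adFam_apply]
    push_cast
    module
  rw [eq_sum_basis (finBasis K L) f]
  simp only [map_sum, hsm, dird_ser_smul, hcst, dird_cst, smul_zero, add_zero, lie_sum, lie_smul,
    map_add, Finset.sum_add_distrib]

end FM

end MaurerCartan

/-! ### The cyclic identity for the exponential image of an isotropic subalgebra -/

section Cyclic

variable {K : Type*} [Field K] [CharZero K] {ι : Type*} [Fintype ι] [DecidableEq ι]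
  {L : Type*} [LieRing L] [LieAlgebra K L] [FiniteDimensional K L]
  {V : Type*} [AddCommGroup V] [Module K V]

namespace FM

theorem dird_coeff_mem (H : Submodule K V) {f : FM ι V} (hf : ∀ n, f n ∈ H) (α : ι → K) (n) :
    dird α f n ∈ H := by
  rw [dird_apply, sum_coeff]
  exact H.sum_mem fun j _ => H.smul_mem _ (H.smul_mem _ (hf _))

theorem mul₂_eq_zero_of_isotropic (P : L →ₗ[K] L →ₗ[K] K) {H : Submodule K L}
    (h : ∀ x ∈ H, ∀ y ∈ H, P x y = 0) {f g : FM ι L} (hf : ∀ n, f n ∈ H) (hg : ∀ n, g n ∈ H) :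
    mul₂ P f g = 0 := by
  ext n
  rw [mul₂_coeff]
  exact Finset.sum_eq_zero fun q _ => h _ (hf _) _ (hg _)

theorem mul₂_lie_left (P : L →ₗ[K] L →ₗ[K] K) (hP : ∀ x y z : L, P ⁅x, y⁆ z = -P y ⁅x, z⁆)
    (f g h : FM ι L) : mul₂ P ⁅f, g⁆ h = -mul₂ P g ⁅f, h⁆ := by
  rw [lie_eq_mul₂ (K := K), lie_eq_mul₂ (K := K), ← mul₂_flip (lieBilin K L) f g,
    mul₂_assoc (B := P) (C := (lieBilin K L).flip) (B' := -P) (C' := lieBilin K L)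
      (fun v w z => hP w v z)]
  have : mul₂ (-P) g = -mul₂ P g := by
    ext g n; simp [mul₂_coeff]
  rw [this]; simp

theorem mul₂_symm (P : L →ₗ[K] L →ₗ[K] K) (hP : ∀ x y, P x y = P y x) (f g : FM ι L) :
    mul₂ P f g = mul₂ P g f := by
  rw [← mul₂_flip]; exact mul₂_congr (fun v w => hP w v) _ _

/-- Let `𝔥` be an isotropic subalgebra of a quadratic Lie algebra, let `B` be the Maurer--Cartan form
along `q`, and let `S = e^{ad q}(B + C)` with `C` valued in `𝔥`. If `S` and `B` are isotropic
families and `⟨B, C⟩` is the transgression of the Cartan three-form, then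
`Cycl ⟨dS, S⟩ = ⟨[S, S], S⟩`. -/
theorem cyclic_identity (c : ι → L) (P : L →ₗ[K] L →ₗ[K] K) (hPs : ∀ x y, P x y = P y x)
    (hPi : ∀ x y z : L, P ⁅x, y⁆ z = -P y ⁅x, z⁆) (H : Submodule K L)
    (hH : ∀ x ∈ H, ∀ y ∈ H, P x y = 0) (hHl : ∀ x ∈ H, ∀ y ∈ H, ⁅x, y⁆ ∈ H)
    {X : Type*} (α : X → ι → K) (B C S : X → FM ι L)
    (hB : ∀ x, B x = mcForm K c (∑ j, α x j • c j)) (hC : ∀ x n, C x n ∈ H)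
    (hS : ∀ x, S x = ser (adFam K c) (expS K) (B x + C x))
    (hBB : ∀ x y, mul₂ P (B x) (B y) = 0)
    (hBC : ∀ x y, mul₂ P (B x) (C y) = -mul₂ P (B y) (C x))
    (hE : ∀ x y, eul K (mul₂ P (B x) (C y)) + (2 : K) • mul₂ P (B x) (C y) =
      -mul₂ P (B x) (cst K (∑ j, α y j • c j))) (x y z : X) :
    mul₂ P (dird (α x) (S y)) (S z) + mul₂ P (dird (α y) (S z)) (S x) +
      mul₂ P (dird (α z) (S x)) (S y) = mul₂ P ⁅S x, S y⁆ (S z) := by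
  have hinv := mul₂_lie_left (ι := ι) P hPi
  have hsym := mul₂_symm (ι := ι) P hPs
  have t1 : ∀ f g h : FM ι L, mul₂ P ⁅f, g⁆ h = -mul₂ P ⁅g, f⁆ h := by
    intro f g h; rw [← lie_skew f g, map_neg, LinearMap.neg_apply]
  have t2 : ∀ f g h : FM ι L, mul₂ P ⁅f, g⁆ h = -mul₂ P ⁅f, h⁆ g := by
    intro f g h; rw [hinv, hsym]
  have t3 : ∀ f g h : FM ι L, mul₂ P ⁅f, g⁆ h = mul₂ P ⁅g, h⁆ f := by
    intro f g h; rw [t1, t2, neg_neg]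
  have hdS : ∀ u v w, mul₂ P (dird (α u) (S v)) (S w) =
      mul₂ P (dird (α u) (B v + C v) + ⁅B u, B v + C v⁆) (B w + C w) := by
    intro u v w
    rw [hS v, hS w, dird_exp, exp_pairing c P hPi, ← hB]
  have hSS : mul₂ P ⁅S x, S y⁆ (S z) = mul₂ P ⁅B x + C x, B y + C y⁆ (B z + C z) := by
    rw [hS, hS, hS, ← exp_lie, exp_pairing c P hPi]
  have mc : ∀ u v (f : FM ι L), mul₂ P ⁅B u, B v⁆ f =
      mul₂ P (dird (α v) (B u)) f - mul₂ P (dird (α u) (B v)) f := by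
    intro u v f
    have h := mcForm_maurerCartan c (α u) (α v)
    rw [← hB, ← hB] at h
    rw [eq_neg_of_add_eq_zero_right h]
    simp
  have hCC : ∀ u v, mul₂ P (C u) (C v) = 0 := fun u v =>
    mul₂_eq_zero_of_isotropic P hH (hC u) (hC v)
  have hdCC : ∀ w u v, mul₂ P (dird (α w) (C u)) (C v) = 0 := fun w u v =>
    mul₂_eq_zero_of_isotropic P hH (dird_coeff_mem H (hC u) _) (hC v)
  have hCCC : mul₂ P ⁅C x, C y⁆ (C z) = 0 := by
    refine mul₂_eq_zero_of_isotropic P hH (fun n => ?_) (hC z)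
    rw [lie_coeff]
    exact H.sum_mem fun q _ => hHl _ (hC x _) _ (hC y _)
  have dBB : ∀ w u v, mul₂ P (dird (α w) (B u)) (B v) + mul₂ P (B u) (dird (α w) (B v)) = 0 := by
    intro w u v
    rw [← dird_mul₂, hBB, map_zero]
  -- transgression: half the Cartan form is the differential of `⟨B, C⟩`
  have tr : ∀ u v w : X, (2 : K)⁻¹ • mul₂ P ⁅B u, B v⁆ (B w) =
      dird (α u) (mul₂ P (B v) (C w)) + dird (α v) (mul₂ P (B w) (C u)) +
      dird (α w) (mul₂ P (B u) (C v)) := by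
    intro u v w
    rw [← sub_eq_zero]
    refine eq_zero_of_eul (raises_zero (K := K)) (m := 3) (by norm_num) ?_
    have eB : ∀ x, eul K (B x) = cst K (∑ j, α x j • c j) - ⁅linFam c, B x⁆ - B x := fun x => by
      rw [hB]; exact eq_sub_of_add_eq (eul_mcForm c _)
    have e1 : ∀ p q r, dird (α p) (eul K (mul₂ P (B q) (C r))) =
        -dird (α p) (mul₂ P (B q) (cst K (∑ j, α r j • c j))) -
          (2 : K) • dird (α p) (mul₂ P (B q) (C r)) := by
      intro p q r
      rw [← map_neg, ← hE]; simp
    have e2 : ∀ p q r, eul K (dird (α p) (mul₂ P (B q) (C r))) =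
        -dird (α p) (mul₂ P (B q) (cst K (∑ j, α r j • c j))) -
          (3 : K) • dird (α p) (mul₂ P (B q) (C r)) := by
      intro p q r
      rw [eq_sub_of_add_eq (dird_eul (α p) (mul₂ P (B q) (C r))).symm, e1]
      module
    have hu : ∀ q r, mul₂ P (B q) (cst K (∑ j, α r j • c j)) =
        -mul₂ P (B r) (cst K (∑ j, α q j • c j)) := by
      intro q r
      have h1 := hE q r
      have h2 := hE r q
      rw [hBC q r, map_neg] at h1
      linear_combination (norm := module) h1 + h2
    have e3 : eul K (mul₂ P ⁅B u, B v⁆ (B w)) =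
        mul₂ P ⁅B u, B v⁆ (cst K (∑ j, α w j • c j)) + mul₂ P ⁅B v, B w⁆ (cst K (∑ j, α u j • c j)) +
        mul₂ P ⁅B w, B u⁆ (cst K (∑ j, α v j • c j)) - (3 : K) • mul₂ P ⁅B u, B v⁆ (B w) := by
      have i1 : mul₂ P ⁅⁅linFam c, B u⁆, B v⁆ (B w) + mul₂ P ⁅B u, ⁅linFam c, B v⁆⁆ (B w) +
          mul₂ P ⁅B u, B v⁆ ⁅linFam c, B w⁆ = 0 := by
        have := hinv (linFam c) ⁅B u, B v⁆ (B w)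
        rw [leibniz_lie, map_add, LinearMap.add_apply] at this
        rw [this]; simp
      rw [eul_mul₂, eul_lie, eB, eB, eB]
      simp only [sub_lie, lie_sub, map_sub, map_add, LinearMap.sub_apply, LinearMap.add_apply]
      rw [t3 (cst K (∑ j, α u j • c j)) (B v) (B w), ← t3 (B w) (B u) (cst K (∑ j, α v j • c j))]
      linear_combination (norm := module) -i1
    have e4 : ∀ p q r, mul₂ P ⁅B p, B q⁆ (cst K (∑ j, α r j • c j)) =
        dird (α q) (mul₂ P (B p) (cst K (∑ j, α r j • c j))) -
        dird (α p) (mul₂ P (B q) (cst K (∑ j, α r j • c j))) := by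
      intro p q r
      rw [mc, dird_mul₂, dird_mul₂, dird_cst]; simp
    rw [map_sub, map_add, map_add, map_smul, e3, e2, e2, e2, e4, e4, e4, hu u w, hu v u, hu w v]
    simp only [map_neg]
    push_cast
    rw [LinearMap.zero_apply]
    module
  have dω : ∀ u v w, dird (α u) (mul₂ P (B v) (C w)) =
      mul₂ P (dird (α u) (B v)) (C w) + mul₂ P (B v) (dird (α u) (C w)) := fun u v w => dird_mul₂ _ _ _ _
  have dωs : ∀ u v w, dird (α u) (mul₂ P (B v) (C w)) = -dird (α u) (mul₂ P (B w) (C v)) := by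
    intro u v w; rw [hBC v w, map_neg]
  rw [hdS, hdS, hdS, hSS]
  simp only [map_add, lie_add, add_lie, LinearMap.add_apply, hdCC, hCCC]
  rw [← t3 (B z) (B x) (C y), ← t3 (B x) (B y) (C z), ← t3 (B y) (B z) (C x), t3 (C x) (B y) (B z),
    t3 (C x) (B y) (C z), t3 (C x) (C y) (B z), t3 (C y) (B z) (C x), ← t3 (B x) (B y) (B z),
    t3 (B z) (B x) (B y)]
  have b1 := mc x y (B z)
  have b2 := mc y z (B x)
  have b3 := mc z x (B y)
  rw [← t3 (B x) (B y) (B z)] at b2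
  rw [t3 (B z) (B x) (B y)] at b3
  have k1 := dω x z y
  have k2 := dω y x z
  have k3 := dω z y x
  rw [dωs, hsym (B z)] at k1
  rw [dωs, hsym (B x)] at k2
  rw [dωs, hsym (B y)] at k3
  have l1 := dBB x y z
  have l2 := dBB y z x
  have l3 := dBB z x y
  rw [hsym (B y)] at l1
  rw [hsym (B z)] at l2
  rw [hsym (B x)] at l3
  linear_combination (norm := module) mc x y (C z) + mc y z (C x) + mc z x (C y) - k1 - k2 - k3 +
    tr x y z + (1 / 2 : K) • (b1 + b2 + b3) + (1 / 2 : K) • (l1 + l2 + l3)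

end FM

end Cyclic

/-! ### Formal vector fields on the dual of a subalgebra -/

section VectorField

variable {K : Type*} [Field K] [CharZero K] {𝔤 : Type*} [LieRing 𝔤] [LieAlgebra K 𝔤]
  {ι : Type*} [Fintype ι] [DecidableEq ι] {𝔩 : LieSubalgebra K 𝔤} (b : Basis ι K 𝔩)
  {V W Z : Type*} [AddCommGroup V] [Module K V] [AddCommGroup W] [Module K W]
  [AddCommGroup Z] [Module K Z]

namespace FM

/-- The tautological formal map. -/
def taut : FM ι (Dual K 𝔩) := ⟨tautological b⟩

theorem taut_eq : taut b = linFam b.coord := rfl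

/-- The differential of a formal map. -/
def diff (f : FM ι V) : FM ι (Dual K 𝔩 →ₗ[K] V) := ⟨differential b f.toFun⟩

theorem diff_coeff_apply (f : FM ι V) (n) (α : Dual K 𝔩) :
    diff b f n α = ∑ j, α (b j) • pd K j f n := by
  change differential b f.toFun n α = _
  rw [differential, LinearMap.sum_apply]
  rfl

/-- The derivative of a formal map along a formal vector field `v : 𝔻 → 𝔩*`. -/
def along (v : FM ι (Dual K 𝔩)) (f : FM ι V) : FM ι V := mul₂ LinearMap.id (diff b f) v

/-- The components of a formal covector field. -/
def comp (j : ι) (v : FM ι (Dual K 𝔩)) : MvPowerSeries ι K := toSer (lin (Dual.eval K 𝔩 (b j)) v)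

theorem along_eq (v : FM ι (Dual K 𝔩)) (f : FM ι V) :
    along b v f = ∑ j, comp b j v • pd K j f := by
  ext n
  rw [along, mul₂_coeff, sum_coeff]
  simp only [LinearMap.id_apply, diff_coeff_apply, ser_smul_coeff]
  rw [Finset.sum_comm]
  refine Finset.sum_congr rfl fun j _ => ?_
  rw [sum_antidiagonal_swap' n (fun p q => f.pd K j p |> fun x => (v q) (b j) • x)]
  rfl

theorem along_add (v : FM ι (Dual K 𝔩)) (f g : FM ι V) :
    along b v (f + g) = along b v f + along b v g := by
  simp [along_eq, Finset.sum_add_distrib]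

theorem along_smul (v : FM ι (Dual K 𝔩)) (c : K) (f : FM ι V) :
    along b v (c • f) = c • along b v f := by
  ext n; simp [along_eq, Finset.smul_sum, ser_smul_coeff, pd_coeff, smul_smul, mul_left_comm]

theorem along_lin (v : FM ι (Dual K 𝔩)) (N : V →ₗ[K] W) (f : FM ι V) :
    along b v (lin N f) = lin N (along b v f) := by
  simp [along_eq, pd_lin, lin_ser_smul]

@[simp] theorem along_cst (v : FM ι (Dual K 𝔩)) (x : V) : along b v (cst K x) = 0 := by
  simp [along_eq]

theorem along_mul₂ (v : FM ι (Dual K 𝔩)) (B : V →ₗ[K] W →ₗ[K] Z) (f : FM ι V) (g : FM ι W) :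
    along b v (mul₂ B f g) = mul₂ B (along b v f) g + mul₂ B f (along b v g) := by
  simp [along_eq, pd_mul₂, Finset.sum_add_distrib, mul₂_ser_smul_left, mul₂_ser_smul_right]

theorem along_field_add (v w : FM ι (Dual K 𝔩)) (f : FM ι V) :
    along b (v + w) f = along b v f + along b w f := by
  simp [along]

theorem along_field_neg (v : FM ι (Dual K 𝔩)) (f : FM ι V) :
    along b (-v) f = -along b v f := by
  simp [along]

theorem along_cst_field (α : Dual K 𝔩) (f : FM ι V) :
    along b (cst K α) f = dird (fun j => α (b j)) f := by
  rw [along, mul₂_cst_right]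
  ext n
  simp [diff_coeff_apply, dird_apply]

theorem sum_comp_smul_cst (v : FM ι (Dual K 𝔩)) :
    ∑ j, comp b j v • (cst K (b.coord j) : FM ι (Dual K 𝔩)) = v := by
  refine FM.ext fun n => b.ext fun i => ?_
  simp only [comp, sum_coeff, ser_smul_def, mul₂_cst_right, ofSer_toSer]
  simp

theorem along_taut (v : FM ι (Dual K 𝔩)) : along b v (taut b) = v := by
  have h : ∀ j, pd K j (taut b) = cst K (b.coord j) := fun j => pd_linFam _ j
  simp only [along_eq, h]
  exact sum_comp_smul_cst b v

theorem taut_zero : taut b 0 = 0 := linFam_zero_coeff _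

theorem pd_vanish {k : ℕ} {f : FM ι V} (hf : Vanish (k + 1) f) (j : ι) : Vanish k (pd K j f) := by
  intro n hn
  rw [pd_coeff, hf _ (by simpa using hn), smul_zero]

theorem ser_smul_vanish {k l : ℕ} {a : MvPowerSeries ι K} {f : FM ι V} (ha : Vanish k (ofSer a))
    (hf : Vanish l f) : Vanish (k + l) (a • f) := ha.mul₂ (LinearMap.lsmul K V) hf

theorem Vanish.sum {α : Type*} (s : Finset α) {k : ℕ} {f : α → FM ι V}
    (h : ∀ i ∈ s, Vanish k (f i)) : Vanish k (∑ i ∈ s, f i) := fun n hn => by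
  rw [sum_coeff]; exact Finset.sum_eq_zero fun i hi => h i hi n hn

/-- Differentiation along a vector field that vanishes at the origin does not lower the degree. -/
theorem along_vanish {v : FM ι (Dual K 𝔩)} (hv : v 0 = 0) {k : ℕ} {f : FM ι V} (hf : Vanish k f) :
    Vanish k (along b v f) := by
  rw [along_eq]
  refine Vanish.sum _ fun j _ => ?_
  have hc : Vanish 1 (ofSer (comp b j v)) := vanish_one (by
    change v 0 (b j) = 0
    rw [hv]; rfl)
  rcases k with _ | k
  · exact vanish_zero _
  · rw [add_comm]
    exact ser_smul_vanish hc (pd_vanish hf j)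

theorem pd_along (i : ι) (v : FM ι (Dual K 𝔩)) (f : FM ι V) :
    pd K i (along b v f) = along b (pd K i v) f + along b v (pd K i f) := by
  simp only [along_eq, map_sum, ser_smul_def, pd_mul₂, Finset.sum_add_distrib]
  congr 1
  refine Finset.sum_congr rfl fun j _ => ?_
  rw [pd_comm]

theorem dird_along (α : ι → K) (v : FM ι (Dual K 𝔩)) (f : FM ι V) :
    dird α (along b v f) = along b (dird α v) f + along b v (dird α f) := by
  simp only [dird_apply, pd_along, smul_add, Finset.sum_add_distrib]
  congr 1
  · simp only [along, map_sum, map_smul]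
  · simp only [along_eq, Finset.smul_sum, map_sum]
    rw [Finset.sum_comm]
    refine Finset.sum_congr rfl fun j _ => Finset.sum_congr rfl fun i _ => ?_
    simp only [ser_smul_def, map_smul]

/-- The formal vector field `p ↦ ad*_z p`. -/
def coadField (z : 𝔩) : FM ι (Dual K 𝔩) := lin (coad K 𝔩 z) (taut b)

theorem coadField_zero (z : 𝔩) : coadField b z 0 = 0 := by
  rw [coadField, lin_coeff, taut_zero, map_zero]

theorem derivAlong_eq (z : 𝔩) (f : FormalMap ι V) :
    FM.mk (derivAlong b z f) = along b (coadField b z) ⟨f⟩ := rfl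

theorem isGaugeExponent_iff (S : FormalMap ι 𝔤) : IsGaugeExponent b S ↔
    S 0 = 0 ∧ ∀ z : 𝔩, along b (coadField b z) ⟨S⟩ = -⁅(cst K (z : 𝔤) : FM ι 𝔤), FM.mk S⁆ := by
  constructor
  · rintro ⟨h0, h⟩
    refine ⟨h0, fun z => ?_⟩
    rw [← derivAlong_eq, h]
    ext n
    rw [neg_coeff, lie_cst_coeff (K := K)]
    rfl
  · rintro ⟨h0, h⟩
    refine ⟨h0, fun z => ?_⟩
    have := h z
    rw [← derivAlong_eq] at this
    have h2 := congrArg FM.toFun this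
    refine h2.trans ?_
    funext n
    have : (-⁅(cst K (z : 𝔤) : FM ι 𝔤), FM.mk S⁆) n = -⁅(z : 𝔤), S n⁆ := by
      rw [neg_coeff, lie_cst_coeff (K := K)]; rfl
    exact this

end FM

end VectorField

/-! ### The double of a Lie quasi-bialgebra -/

section DoubleAlgebra

variable {K : Type*} [Field K] {𝔤 : Type*} [LieRing 𝔤] [LieAlgebra K 𝔤]

@[simp] theorem coad_apply_apply (x : 𝔤) (ξ : Dual K 𝔤) (y : 𝔤) : coad K 𝔤 x ξ y = ξ ⁅x, y⁆ := rfl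

@[simp] theorem adjAct_apply_apply (x : 𝔤) (T : Dual K 𝔤 →ₗ[K] 𝔤) (ξ : Dual K 𝔤) :
    adjAct K 𝔤 x T ξ = ⁅x, T ξ⁆ + T (coad K 𝔤 x ξ) := rfl

theorem coad_lie (x y : 𝔤) (ξ : Dual K 𝔤) :
    coad K 𝔤 ⁅x, y⁆ ξ = coad K 𝔤 y (coad K 𝔤 x ξ) - coad K 𝔤 x (coad K 𝔤 y ξ) := by
  ext z
  simp only [coad_apply_apply, LinearMap.sub_apply, lie_lie, map_sub]

theorem adjAct_lie (x y : 𝔤) (T : Dual K 𝔤 →ₗ[K] 𝔤) :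
    adjAct K 𝔤 ⁅x, y⁆ T = adjAct K 𝔤 x (adjAct K 𝔤 y T) - adjAct K 𝔤 y (adjAct K 𝔤 x T) := by
  ext ξ
  simp only [adjAct_apply_apply, LinearMap.sub_apply, coad_lie, lie_lie, map_sub, lie_add]
  abel

theorem ext_dual [FiniteDimensional K 𝔤] {x y : 𝔤} (h : ∀ ζ : Dual K 𝔤, ζ x = ζ y) : x = y := by
  rw [← sub_eq_zero, ← Module.forall_dual_apply_eq_zero_iff K]
  intro ζ
  rw [map_sub, h, sub_self]

namespace QuasiData

variable (G : QuasiData K 𝔤)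

theorem assoc_swap_right (ξ η ζ : Dual K 𝔤) : G.assoc ξ η ζ = -G.assoc ξ ζ η := by
  have := G.assoc_self_right ξ (η + ζ)
  simp only [map_add, LinearMap.add_apply, G.assoc_self_right] at this
  linear_combination this

variable [FiniteDimensional K 𝔤]

@[simp] theorem apply_assocVec (ξ η ζ : Dual K 𝔤) :
    ζ ((evalEquiv K 𝔤).symm (G.assoc ξ η)) = G.assoc ξ η ζ :=
  apply_evalEquiv_symm_apply K 𝔤 ζ _

theorem doubleBracket_add_left (X Y Z : 𝔤 × Dual K 𝔤) :
    G.doubleBracket (X + Y) Z = G.doubleBracket X Z + G.doubleBracket Y Z := by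
  ext <;> simp [doubleBracket] <;> abel

theorem doubleBracket_smul_left (c : K) (X Y : 𝔤 × Dual K 𝔤) :
    G.doubleBracket (c • X) Y = c • G.doubleBracket X Y := by
  ext <;> simp [doubleBracket, smul_add, smul_sub]

theorem adDouble_apply (X Y : 𝔤 × Dual K 𝔤) : G.adDouble X Y = G.doubleBracket X Y := rfl

end QuasiData

variable [FiniteDimensional K 𝔤]

/-- The double `𝔡 = 𝔤 ⊕ 𝔤*` of a Lie quasi-bialgebra, as a type carrying its Lie bracket. -/
def Double {G : QuasiData K 𝔤} (_ : G.IsLieQuasiBialgebra) : Type _ := 𝔤 × Dual K 𝔤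

namespace Double

variable {G : QuasiData K 𝔤} (hG : G.IsLieQuasiBialgebra)

instance : AddCommGroup (Double hG) := inferInstanceAs (AddCommGroup (𝔤 × Dual K 𝔤))
instance : Module K (Double hG) := inferInstanceAs (Module K (𝔤 × Dual K 𝔤))
instance : FiniteDimensional K (Double hG) :=
  inferInstanceAs (FiniteDimensional K (𝔤 × Dual K 𝔤))

instance : LieRing (Double hG) where
  bracket := G.doubleBracket
  add_lie := G.doubleBracket_add_left
  lie_add X := (G.adDouble X).map_add
  lie_self := hG.double_self
  leibniz_lie := hG.double_jacobi

instance : LieAlgebra K (Double hG) where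
  lie_smul c X Y := (G.adDouble X).map_smul c Y

/-- The inclusion of `𝔤`. -/
def inl : 𝔤 →ₗ[K] Double hG := LinearMap.inl K 𝔤 (Dual K 𝔤)
/-- The inclusion of `𝔤*`. -/
def inr : Dual K 𝔤 →ₗ[K] Double hG := LinearMap.inr K 𝔤 (Dual K 𝔤)
/-- The projection to `𝔤`. -/
def fst : Double hG →ₗ[K] 𝔤 := LinearMap.fst K 𝔤 (Dual K 𝔤)
/-- The projection to `𝔤*`. -/
def snd : Double hG →ₗ[K] Dual K 𝔤 := LinearMap.snd K 𝔤 (Dual K 𝔤)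

@[simp] theorem fst_inl (x : 𝔤) : fst hG (inl hG x) = x := rfl
@[simp] theorem snd_inl (x : 𝔤) : snd hG (inl hG x) = 0 := rfl
@[simp] theorem fst_inr (ξ : Dual K 𝔤) : fst hG (inr hG ξ) = 0 := rfl
@[simp] theorem snd_inr (ξ : Dual K 𝔤) : snd hG (inr hG ξ) = ξ := rfl

theorem ext' {X Y : Double hG} (h1 : fst hG X = fst hG Y) (h2 : snd hG X = snd hG Y) : X = Y :=
  Prod.ext h1 h2

theorem fst_lie (X Y : Double hG) : fst hG ⁅X, Y⁆ = ⁅fst hG X, fst hG Y⁆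
    + G.cocycle (fst hG X) (snd hG Y) - G.cocycle (fst hG Y) (snd hG X)
    + (evalEquiv K 𝔤).symm (G.assoc (snd hG X) (snd hG Y)) := rfl

theorem snd_lie (X Y : Double hG) : snd hG ⁅X, Y⁆ = -coad K 𝔤 (fst hG X) (snd hG Y)
    + coad K 𝔤 (fst hG Y) (snd hG X) + snd hG Y ∘ₗ G.cocycle.flip (snd hG X) := rfl

theorem lie_inl_inl (x y : 𝔤) : ⁅inl hG x, inl hG y⁆ = inl hG ⁅x, y⁆ := by
  apply ext' hG
  · rw [fst_lie]; simp
  · rw [snd_lie]; ext; simp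

theorem lie_inl_inr (x : 𝔤) (ξ : Dual K 𝔤) :
    ⁅inl hG x, inr hG ξ⁆ = inl hG (G.cocycle x ξ) - inr hG (coad K 𝔤 x ξ) := by
  apply ext' hG
  · rw [fst_lie]; simp
  · rw [snd_lie]; ext; simp

/-- The canonical pairing `⟪x + ξ, y + η⟫ = ⟨ξ, y⟩ + ⟨η, x⟩` of the double. -/
def pair : Double hG →ₗ[K] Double hG →ₗ[K] K :=
  (LinearMap.id : Dual K 𝔤 →ₗ[K] Dual K 𝔤).compl₁₂ (snd hG) (fst hG)
    + ((LinearMap.id : Dual K 𝔤 →ₗ[K] Dual K 𝔤).compl₁₂ (snd hG) (fst hG)).flip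

theorem pair_apply (X Y : Double hG) :
    pair hG X Y = snd hG X (fst hG Y) + snd hG Y (fst hG X) := rfl

theorem pair_symm (X Y : Double hG) : pair hG X Y = pair hG Y X := by
  rw [pair_apply, pair_apply, add_comm]

/-- The pairing of the double is invariant. -/
theorem pair_lie (X Y Z : Double hG) : pair hG ⁅X, Y⁆ Z = -pair hG Y ⁅X, Z⁆ := by
  simp only [pair_apply, fst_lie, snd_lie, LinearMap.add_apply, LinearMap.neg_apply, map_add,
    map_sub, coad_apply_apply, LinearMap.comp_apply, LinearMap.flip_apply, QuasiData.apply_assocVec]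
  have h1 := G.cocycle_skew (fst hG X) (snd hG Y) (snd hG Z)
  have h4 := G.assoc_swap_right (snd hG X) (snd hG Y) (snd hG Z)
  have h5 := congrArg (snd hG X) (lie_skew (fst hG Y) (fst hG Z))
  rw [map_neg] at h5
  linear_combination h1 + h4 - h5

end Double

/-! ### Twists -/

namespace QuasiData

variable [CharZero K] (G : QuasiData K 𝔤) (t : skewMaps K 𝔤)

theorem twist_cocycle_apply (x : 𝔤) (ξ : Dual K 𝔤) : (G.twist t).cocycle x ξ =
    G.cocycle x ξ + (⁅x, t.1 ξ⁆ + t.1 (coad K 𝔤 x ξ)) := rfl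

theorem twist_cocycle (x : 𝔤) : (G.twist t).cocycle x = G.cocycle x + adjAct K 𝔤 x t.1 := rfl

/-- The linear automorphism `(x, ξ) ↦ (x + tξ, ξ)` of `𝔤 ⊕ 𝔤*`. -/
def shear : (𝔤 × Dual K 𝔤) →ₗ[K] 𝔤 × Dual K 𝔤 :=
  (LinearMap.fst K 𝔤 (Dual K 𝔤) + t.1 ∘ₗ LinearMap.snd K 𝔤 (Dual K 𝔤)).prod
    (LinearMap.snd K 𝔤 (Dual K 𝔤))

theorem shear_apply (X : 𝔤 × Dual K 𝔤) : shear t X = (X.1 + t.1 X.2, X.2) := rfl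

theorem shear_injective : Function.Injective (shear t) := by
  rintro ⟨x, ξ⟩ ⟨y, η⟩ h
  simp only [shear_apply, Prod.mk.injEq] at h
  obtain ⟨h1, rfl⟩ := h
  rw [add_right_cancel h1]

/-- Twisting does not change the isomorphism class of the double. -/
theorem shear_doubleBracket (X Y : 𝔤 × Dual K 𝔤) :
    shear t ((G.twist t).doubleBracket X Y) = G.doubleBracket (shear t X) (shear t Y) := by
  have key : ((G.twist t).doubleBracket X Y).2 = (G.doubleBracket (shear t X) (shear t Y)).2 := by
    ext z
    have h1 := t.2 (coad K 𝔤 z X.2) Y.2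
    have h2 := congrArg X.2 (lie_skew z (t.1 Y.2))
    have h3 := congrArg Y.2 (lie_skew z (t.1 X.2))
    simp only [coad_apply_apply, map_neg] at h1 h2 h3
    simp only [doubleBracket, shear_apply, LinearMap.add_apply, LinearMap.neg_apply,
      coad_apply_apply, LinearMap.comp_apply, LinearMap.flip_apply, twist_cocycle_apply, map_add,
      add_lie]
    linear_combination h1 - h3 + h2
  refine Prod.ext ?_ key
  rw [shear_apply]
  change _ + t.1 ((G.twist t).doubleBracket X Y).2 = _
  rw [key]
  refine ext_dual (K := K) fun ζ => ?_
  have e1 := t.2 (coad K 𝔤 (t.1 X.2) Y.2) ζ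
  have e2 := t.2 (coad K 𝔤 (t.1 Y.2) X.2) ζ
  have e3 := t.2 (Y.2 ∘ₗ G.cocycle.flip X.2) ζ
  have e4 := G.cocycle_skew (t.1 Y.2) X.2 ζ
  have e5 := congrArg Y.2 (lie_skew (t.1 ζ) (t.1 X.2))
  simp only [coad_apply_apply, LinearMap.comp_apply, LinearMap.flip_apply, map_neg] at e1 e2 e3 e5
  have e6 := congrArg ζ (lie_skew (t.1 X.2) Y.1)
  rw [map_neg] at e6
  simp only [doubleBracket, shear_apply, twist_cocycle_apply, map_add, map_sub, apply_assocVec,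
    add_lie, lie_add, LinearMap.add_apply, map_neg]
  have e7 : (G.twist t).assoc X.2 Y.2 ζ = _ := G.twistAssoc_apply t.1 X.2 Y.2 ζ
  rw [e7]
  simp only [map_add]
  linear_combination e4 - e5 + e6 + e2 + e3 - e1

/-- The twist of a Lie quasi-bialgebra is a Lie quasi-bialgebra, since the shear carries the bracket of
its double to the original one. -/
theorem IsLieQuasiBialgebra.twist {G : QuasiData K 𝔤} (hG : G.IsLieQuasiBialgebra)
    (t : skewMaps K 𝔤) : (G.twist t).IsLieQuasiBialgebra where
  cocycle_lie x y := by
    rw [twist_cocycle, twist_cocycle, twist_cocycle, hG.cocycle_lie, adjAct_lie, map_add, map_add]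
    abel
  double_self X := shear_injective t (by
    rw [shear_doubleBracket, hG.double_self, map_zero])
  double_jacobi X Y Z := shear_injective t (by
    simp only [map_add, shear_doubleBracket, hG.double_jacobi (shear t X)])

end QuasiData

namespace ReductiveDecomposition

variable [CharZero K] (R : ReductiveDecomposition K 𝔤) (G : QuasiData K 𝔤)

/-- Twisting by a point of the variety preserves compatibility: `ρ` is `𝔩`-invariant and kills `𝔪^⊥`. -/
theorem IsCompatible.twist {R : ReductiveDecomposition K 𝔤} {G : QuasiData K 𝔤}
    (h : R.IsCompatible G) (ρ : R.variety G) : R.IsCompatible (G.twist ρ) where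
  cocycle_sub z hz := by
    rw [QuasiData.twist_cocycle, h.cocycle_sub z hz, ρ.2.2.1 z hz, add_zero]
  cocycle_complPerp x ξ hξ η hη := by
    have h1 := ρ.1.2 ξ (coad K 𝔤 x η)
    rw [ρ.2.1.1 ξ hξ, map_zero, neg_zero] at h1
    rw [QuasiData.twist_cocycle_apply, ρ.2.1.1 η hη, map_add, map_add, lie_zero, map_zero, h1,
      h.cocycle_complPerp x ξ hξ η hη]
    simp
  assoc_mixed ξ hξ η hη ζ hζ := by
    refine (G.twistAssoc_apply ρ.1.1 ξ η ζ).trans ?_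
    rw [ρ.2.1.1 η hη, ρ.2.1.1 ξ hξ, h.assoc_mixed ξ hξ η hη ζ hζ]
    simp [h.cocycle_complPerp _ η hη ξ hξ]

end ReductiveDecomposition

end DoubleAlgebra

/-! ### The dynamical equation in the double -/

section Dynamical

variable {K : Type*} [Field K] [CharZero K] {𝔤 : Type*} [LieRing 𝔤] [LieAlgebra K 𝔤]
  {ι : Type*} [Fintype ι] [DecidableEq ι] {𝔩 : LieSubalgebra K 𝔤} (b : Basis ι K 𝔩)

namespace FM

/-- Evaluation of a formal family of linear maps at a vector. -/
def ev {V W : Type*} [AddCommGroup V] [Module K V] [AddCommGroup W] [Module K W] (v : V)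
    (l : FM ι (V →ₗ[K] W)) : FM ι W := lin (LinearMap.applyₗ v) l

/-- The derivative in the direction of `i*ξ`. -/
def dξ {V : Type*} [AddCommGroup V] [Module K V] (ξ : Dual K 𝔤) : FM ι V →ₗ[K] FM ι V :=
  dird (fun j => ξ (b j))

section
variable {V W : Type*} [AddCommGroup V] [Module K V] [AddCommGroup W] [Module K W]

@[simp] theorem ev_coeff (v : V) (l : FM ι (V →ₗ[K] W)) (n) : ev v l n = l n v := rfl

theorem ext_ev {l l' : FM ι (V →ₗ[K] W)} (h : ∀ v, ev v l = ev v l') : l = l' :=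
  FM.ext fun n => LinearMap.ext fun v => congrArg (fun f : FM ι W => f n) (h v)

theorem ev_add (v : V) (l l' : FM ι (V →ₗ[K] W)) : ev v (l + l') = ev v l + ev v l' := map_add _ _ _

theorem ev_cst (v : V) (T : V →ₗ[K] W) : ev v (cst K T : FM ι (V →ₗ[K] W)) = cst K (T v) := by
  rw [ev, lin_cst]; rfl

theorem dξ_lin (ξ : Dual K 𝔤) (N : V →ₗ[K] W) (f : FM ι V) : dξ b ξ (lin N f) = lin N (dξ b ξ f) :=
  dird_lin _ _ _

theorem dξ_cst (ξ : Dual K 𝔤) (v : V) : dξ b ξ (cst K v : FM ι V) = 0 := dird_cst _ _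

end

/-- The cyclic summand of the classical dynamical Yang--Baxter equation. -/
theorem cdybeTerm_eq (G : QuasiData K 𝔤) (l : FM ι (Dual K 𝔤 →ₗ[K] 𝔤)) (ξ η ζ : Dual K 𝔤) :
    FM.mk (G.cdybeTerm b l.toFun ξ η ζ) = lin ζ (dξ b ξ (ev η l)) - lin ζ ⁅ev ξ l, ev η l⁆
      - lin (ζ ∘ₗ G.cocycle.flip η) (ev ξ l) := by
  ext n
  simp only [sub_coeff]
  have h1 : lin ζ (dξ b ξ (ev η l)) n = ζ (differential b l.toFun n (restr 𝔩 ξ) η) := by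
    change ζ _ = ζ _
    congr 1
    have := diff_coeff_apply b l n (restr 𝔩 ξ)
    change differential b l.toFun n (restr 𝔩 ξ) = _ at this
    rw [this, LinearMap.sum_apply, dξ, dird_apply]
    exact sum_coeff _ _ _
  rw [h1]
  rfl

end FM

open FM

namespace QuasiData

variable (G : QuasiData K 𝔤)

theorem isFormalDynl_iff (l : FM ι (Dual K 𝔤 →ₗ[K] 𝔤)) : G.IsFormalDynl b l.toFun ↔
    (∀ ξ η : Dual K 𝔤, lin ξ (ev η l) = -lin η (ev ξ l)) ∧
    (∀ ξ η ζ : Dual K 𝔤, FM.mk (G.cdybeTerm b l.toFun ξ η ζ) + FM.mk (G.cdybeTerm b l.toFun η ζ ξ)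
      + FM.mk (G.cdybeTerm b l.toFun ζ ξ η) = cst K (G.assoc ξ η ζ)) ∧
    ∀ z : 𝔩, along b (coadField b z) l + cst K (G.cocycle z) + lin (adjAct K 𝔤 (z : 𝔤)) l = 0 := by
  constructor
  · rintro ⟨h1, h2, h3⟩
    exact ⟨fun ξ η => FM.ext fun n => h1 n ξ η, fun ξ η ζ => congrArg FM.mk (h2 ξ η ζ),
      fun z => congrArg FM.mk (h3 z)⟩
  · rintro ⟨h1, h2, h3⟩
    exact ⟨fun n ξ η => congrArg (fun f : FM ι K => f n) (h1 ξ η),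
      fun ξ η ζ => congrArg FM.toFun (h2 ξ η ζ), fun z => congrArg FM.toFun (h3 z)⟩

end QuasiData

end Dynamical

/-! ### The graph of a dynamical `ℓ`-matrix -/

section Dynamical

variable {K : Type*} [Field K] [CharZero K] {𝔤 : Type*} [LieRing 𝔤] [LieAlgebra K 𝔤]
  [FiniteDimensional K 𝔤]
  {ι : Type*} [Fintype ι] [DecidableEq ι] {𝔩 : LieSubalgebra K 𝔤} (b : Basis ι K 𝔩)

open FM

namespace Double

variable {G : QuasiData K 𝔤} (hG : G.IsLieQuasiBialgebra)

/-- The section `p ↦ l_p ξ + ξ` of the double; `l` is skew-symmetric if and only if its graph, which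
is swept out by these sections, is isotropic. -/
def graph (l : FM ι (Dual K 𝔤 →ₗ[K] 𝔤)) (ξ : Dual K 𝔤) : FM ι (Double hG) :=
  lin (inl hG) (ev ξ l) + cst K (inr hG ξ)

theorem lie_lin_inl (f g : FM ι 𝔤) :
    ⁅lin (inl hG) f, lin (inl hG) g⁆ = lin (inl hG) ⁅f, g⁆ := by
  rw [lie_eq_mul₂ (K := K), lie_eq_mul₂ (K := K)]
  exact mul₂_lin_lin (fun v z => lie_inl_inl hG v z) f g

theorem lie_lin_inl_cst_inr (f : FM ι 𝔤) (ξ : Dual K 𝔤) :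
    ⁅lin (inl hG) f, (cst K (inr hG ξ) : FM ι (Double hG))⁆ =
      lin (inl hG) (lin (G.cocycle.flip ξ) f) - lin (inr hG) (lin ((coad K 𝔤).flip ξ) f) := by
  rw [lie_eq_mul₂ (K := K), mul₂_cst_right]
  ext n
  exact lie_inl_inr hG (f n) ξ

theorem lie_cst_inr (ξ η : Dual K 𝔤) :
    ⁅(cst K (inr hG ξ) : FM ι (Double hG)), (cst K (inr hG η) : FM ι (Double hG))⁆ =
      cst K (inl hG ((evalEquiv K 𝔤).symm (G.assoc ξ η)) + inr hG (η ∘ₗ G.cocycle.flip ξ)) := by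
  rw [lie_cst_cst]
  congr 1
  apply ext' hG
  · rw [fst_lie]; simp
  · rw [snd_lie]; simp

theorem pair_lin_inl_lin_inl (f g : FM ι 𝔤) :
    mul₂ (pair hG) (lin (inl hG) f) (lin (inl hG) g) = 0 := by
  ext n
  rw [mul₂_coeff]
  exact Finset.sum_eq_zero fun q _ => by simp [pair_apply]

theorem pair_lin_inl_cst_inr (f : FM ι 𝔤) (ζ : Dual K 𝔤) :
    mul₂ (pair hG) (lin (inl hG) f) (cst K (inr hG ζ)) = lin ζ f := by
  rw [mul₂_cst_right]
  ext n
  simp [pair_apply]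

theorem pair_lin_inr_lin_inl (f : FM ι 𝔤) (ξ : Dual K 𝔤) (g : FM ι 𝔤) :
    mul₂ (pair hG) (lin (inr hG) (lin ((coad K 𝔤).flip ξ) f)) (lin (inl hG) g) =
      lin ξ ⁅f, g⁆ := by
  rw [lie_eq_mul₂ (K := K), lin_mul₂, lin_lin]
  ext n
  simp only [mul₂_coeff]
  refine Finset.sum_congr rfl fun q _ => ?_
  simp [pair_apply, lieBilin]

theorem pair_lin_inr_cst_inr (f : FM ι (Dual K 𝔤)) (ζ : Dual K 𝔤) :
    mul₂ (pair hG) (lin (inr hG) f) (cst K (inr hG ζ)) = 0 := by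
  rw [mul₂_cst_right]
  ext n
  simp [pair_apply]

theorem pair_cst_lin_inl (X : Double hG) (g : FM ι 𝔤) :
    mul₂ (pair hG) (cst K X) (lin (inl hG) g) = lin (snd hG X) g := by
  rw [mul₂_cst_left]
  ext n
  simp [pair_apply]

theorem pair_cst_cst (X Y : Double hG) :
    mul₂ (pair hG) (cst K X : FM ι (Double hG)) (cst K Y) = cst K (pair hG X Y) := by
  rw [mul₂_cst_left, lin_cst]

variable {hG} {l : FM ι (Dual K 𝔤 →ₗ[K] 𝔤)}

theorem pair_graph (hl : ∀ ξ η : Dual K 𝔤, lin ξ (ev η l) = -lin η (ev ξ l)) (ξ η : Dual K 𝔤) :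
    mul₂ (pair hG) (graph hG l ξ) (graph hG l η) = 0 := by
  simp only [graph, map_add, LinearMap.add_apply, pair_lin_inl_lin_inl, pair_lin_inl_cst_inr,
    pair_cst_lin_inl, pair_cst_cst, snd_inr, hl η ξ]
  simp [pair_apply]

theorem skew_of_pair_graph
    (h : ∀ ξ η, mul₂ (pair hG) (graph hG l ξ) (graph hG l η) = 0) (ξ η : Dual K 𝔤) :
    lin ξ (ev η l) = -lin η (ev ξ l) := by
  have := h ξ η
  simp only [graph, map_add, LinearMap.add_apply, pair_lin_inl_lin_inl, pair_lin_inl_cst_inr,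
    pair_cst_lin_inl, pair_cst_cst, snd_inr, pair_apply, fst_inr, map_zero] at this
  linear_combination (norm := module) this

/-- The left-hand side of the dynamical equation is the failure of `Cycl ⟪dS, S⟫ = ⟪[S, S], S⟫` for
the sections of the graph. -/
theorem cycl_graph (ξ η ζ : Dual K 𝔤) :
    FM.mk (G.cdybeTerm b l.toFun ξ η ζ) + FM.mk (G.cdybeTerm b l.toFun η ζ ξ)
      + FM.mk (G.cdybeTerm b l.toFun ζ ξ η) - cst K (G.assoc ξ η ζ) =
    mul₂ (pair hG) (dξ b ξ (graph hG l η)) (graph hG l ζ) +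
      mul₂ (pair hG) (dξ b η (graph hG l ζ)) (graph hG l ξ) +
      mul₂ (pair hG) (dξ b ζ (graph hG l ξ)) (graph hG l η) -
      mul₂ (pair hG) ⁅graph hG l ξ, graph hG l η⁆ (graph hG l ζ) := by
  have h1 : ∀ ξ η ζ, mul₂ (pair hG) (dξ b ξ (graph hG l η)) (graph hG l ζ) =
      lin ζ (dξ b ξ (ev η l)) := by
    intro ξ η ζ
    simp only [graph, map_add, dξ_lin, dξ_cst, add_zero, pair_lin_inl_lin_inl,
      pair_lin_inl_cst_inr, zero_add]
  rw [h1, h1, h1, cdybeTerm_eq, cdybeTerm_eq, cdybeTerm_eq]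
  set X := ev ξ l
  set Y := ev η l
  set Z := ev ζ l
  have h2 : ⁅graph hG l ξ, graph hG l η⁆ = lin (inl hG) ⁅X, Y⁆ +
      (lin (inl hG) (lin (G.cocycle.flip η) X) - lin (inr hG) (lin ((coad K 𝔤).flip η) X)) -
      (lin (inl hG) (lin (G.cocycle.flip ξ) Y) - lin (inr hG) (lin ((coad K 𝔤).flip ξ) Y)) +
      cst K (inl hG ((evalEquiv K 𝔤).symm (G.assoc ξ η)) + inr hG (η ∘ₗ G.cocycle.flip ξ)) := by
    rw [graph, graph, add_lie, lie_add, lie_add, lie_lin_inl, lie_lin_inl_cst_inr, lie_cst_inr,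
      ← lie_skew (cst K (inr hG ξ) : FM ι (Double hG)), lie_lin_inl_cst_inr]
    abel
  rw [h2, graph]
  simp only [map_add, map_sub, LinearMap.add_apply, LinearMap.sub_apply, pair_lin_inl_lin_inl,
    pair_lin_inl_cst_inr, pair_lin_inr_lin_inl, pair_lin_inr_cst_inr, pair_cst_lin_inl,
    pair_cst_cst, snd_inr]
  have e1 : lin ξ ⁅Y, Z⁆ = lin ξ ⁅Y, ev ζ l⁆ := rfl
  have e2 : lin η ⁅Z, X⁆ = -lin η ⁅X, ev ζ l⁆ := by rw [← lie_skew Z X, map_neg]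
  have e3 : lin (ξ ∘ₗ G.cocycle.flip ζ) Y = -lin ζ (lin (G.cocycle.flip ξ) Y) := by
    ext n; exact G.cocycle_skew (Y n) ξ ζ
  have e4 : lin (ζ ∘ₗ G.cocycle.flip η) X = lin ζ (lin (G.cocycle.flip η) X) := rfl
  have e5 : lin ((snd hG) (inl hG ((evalEquiv K 𝔤).symm (G.assoc ξ η)))) (ev ζ l) = 0 := by
    ext n; simp
  have e6 : pair hG (inl hG ((evalEquiv K 𝔤).symm (G.assoc ξ η))) (inr hG ζ) = G.assoc ξ η ζ := by
    simp [pair_apply]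
  have e7 : pair hG (inr hG (η ∘ₗ G.cocycle.flip ξ)) (inr hG ζ) = 0 := by simp [pair_apply]
  have e8 : lin (η ∘ₗ G.cocycle.flip ξ) Z = lin (η ∘ₗ G.cocycle.flip ξ) (ev ζ l) := rfl
  rw [e1, e2, e3, e4, e5, e6, e7, e8, map_zero]
  module

end Double

namespace QuasiData

variable {G : QuasiData K 𝔤}

/-- Adding the constant `ρ` turns dynamical `ℓ`-matrices for the twist by `ρ` into dynamical
`ℓ`-matrices. -/
theorem IsFormalDynl.add_cst {t : skewMaps K 𝔤} {l : FM ι (Dual K 𝔤 →ₗ[K] 𝔤)}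
    (h : (G.twist t).IsFormalDynl b l.toFun) : G.IsFormalDynl b (l + cst K t.1).toFun := by
  rw [isFormalDynl_iff] at h ⊢
  obtain ⟨h1, h2, h3⟩ := h
  refine ⟨fun ξ η => ?_, fun ξ η ζ => ?_, fun z => ?_⟩
  · rw [ev_add, ev_add, map_add, map_add, h1, ev_cst, ev_cst, lin_cst, lin_cst, t.2 ξ η, map_neg]
    abel
  · have key := h2 ξ η ζ
    have e : (G.twist t).assoc ξ η ζ = _ := G.twistAssoc_apply t.1 ξ η ζ
    have c1 : ∀ (f : FM ι 𝔤) (x : 𝔤), ⁅f, (cst K x : FM ι 𝔤)⁆ = -lin (LieAlgebra.ad K 𝔤 x : 𝔤 →ₗ[K] 𝔤) f := by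
      intro f x
      rw [← lie_skew f]; congr 1; ext n; exact lie_cst_coeff (K := K) x f n
    have c2 : ∀ (f : FM ι 𝔤) (x : 𝔤), ⁅(cst K x : FM ι 𝔤), f⁆ = lin (LieAlgebra.ad K 𝔤 x : 𝔤 →ₗ[K] 𝔤) f := by
      intro f x
      ext n; exact lie_cst_coeff (K := K) x f n
    have c3 : ∀ ξ η ζ : Dual K 𝔤, lin (ζ ∘ₗ (G.twist t).cocycle.flip η) (ev ξ l) =
        lin (ζ ∘ₗ G.cocycle.flip η) (ev ξ l) - lin ζ (lin (LieAlgebra.ad K 𝔤 (t.1 η) : 𝔤 →ₗ[K] 𝔤) (ev ξ l))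
          + lin η (lin (LieAlgebra.ad K 𝔤 (t.1 ζ) : 𝔤 →ₗ[K] 𝔤) (ev ξ l)) := by
      intro ξ η ζ
      ext n
      have s1 := t.2 ζ (coad K 𝔤 (l n ξ) η)
      have s2 := congrArg ζ (lie_skew (l n ξ) (t.1 η))
      have s3 := congrArg η (lie_skew (l n ξ) (t.1 ζ))
      rw [map_neg] at s2 s3
      simp only [sub_coeff, add_coeff, lin_coeff, ev_coeff, LinearMap.comp_apply,
        LinearMap.flip_apply, twist_cocycle_apply, map_add, s1, coad_apply_apply,
        LieAlgebra.ad_apply]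
      linear_combination s3 - s2
    simp only [cdybeTerm_eq, c3, e] at key
    simp only [cdybeTerm_eq, ev_add, ev_cst, map_add, dξ_cst, add_zero, add_lie, lie_add, c1,
      c2, lin_cst, LinearMap.comp_apply, LinearMap.flip_apply, map_neg]
    simp only [map_add] at key
    have c4 : ∀ ξ η ζ : Dual K 𝔤, (cst K (ζ ((LieAlgebra.ad K 𝔤 (t.1 η) : 𝔤 →ₗ[K] 𝔤) (t.1 ξ))) : FM ι K)
        = -cst K (ζ ⁅t.1 ξ, t.1 η⁆) := by
      intro ξ η ζ
      rw [← map_neg, ← map_neg, lie_skew]; rfl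
    linear_combination (norm := module) key + c4 ξ η ζ + c4 η ζ ξ + c4 ζ ξ η
  · rw [map_add, along_add, along_cst, lin_cst]
    have := h3 z
    rw [twist_cocycle, map_add] at this
    linear_combination (norm := module) this

end QuasiData

end Dynamical

/-! ### Power series of hyperbolic functions -/

section Hyperbolic

variable (K : Type*) [Field K]

/-- The power series of `sinh z / z`. -/
def sinhDivS : PowerSeries K :=
  PowerSeries.mk fun k => if Even k then ((k + 1).factorial : K)⁻¹ else 0

/-- The power series of `(cosh z - 1) / z`. -/
def coshDivS : PowerSeries K :=
  PowerSeries.mk fun k => if Odd k then ((k + 1).factorial : K)⁻¹ else 0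

/-- The power series of `(1 - sinh z / z) / z`. -/
def oneSubSinhS : PowerSeries K :=
  PowerSeries.mk fun k => if Odd k then -((k + 2).factorial : K)⁻¹ else 0

/-- The power series of `F(z) = coth z - 1 / z`. -/
def cothS : PowerSeries K := (coshDivS K + oneSubSinhS K) * (sinhDivS K)⁻¹

/-- The power series of `1 / sinh z - 1 / z`. -/
def cschS : PowerSeries K := oneSubSinhS K * (sinhDivS K)⁻¹

variable {K} [CharZero K]

theorem sinhDivS_mul_inv : sinhDivS K * (sinhDivS K)⁻¹ = 1 :=
  PowerSeries.mul_inv_cancel _ (by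
    rw [← PowerSeries.coeff_zero_eq_constantCoeff_apply, sinhDivS, PowerSeries.coeff_mk]; simp)

theorem evalNegHom_sinhDivS : PowerSeries.evalNegHom (sinhDivS K) = sinhDivS K := by
  ext k
  rw [coeff_evalNegHom, sinhDivS, PowerSeries.coeff_mk]
  split_ifs with h
  · rw [h.neg_one_pow, one_mul]
  · simp

theorem evalNegHom_coshDivS : PowerSeries.evalNegHom (coshDivS K) = -coshDivS K := by
  ext k
  rw [coeff_evalNegHom, map_neg, coshDivS, PowerSeries.coeff_mk]
  split_ifs with h
  · rw [h.neg_one_pow]; ring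
  · simp

theorem evalNegHom_oneSubSinhS : PowerSeries.evalNegHom (oneSubSinhS K) = -oneSubSinhS K := by
  ext k
  rw [coeff_evalNegHom, map_neg, oneSubSinhS, PowerSeries.coeff_mk]
  split_ifs with h
  · rw [h.neg_one_pow]; ring
  · simp

theorem evalNegHom_sinhDivS_inv :
    PowerSeries.evalNegHom (sinhDivS K)⁻¹ = (sinhDivS K)⁻¹ := by
  have h := congrArg (fun x : PowerSeries K => PowerSeries.evalNegHom x) (sinhDivS_mul_inv (K := K))
  simp only [map_mul, map_one, evalNegHom_sinhDivS] at h
  calc _ = (sinhDivS K * (sinhDivS K)⁻¹) * PowerSeries.evalNegHom (sinhDivS K)⁻¹ := by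
        rw [sinhDivS_mul_inv, one_mul]
    _ = (sinhDivS K)⁻¹ * (sinhDivS K * PowerSeries.evalNegHom (sinhDivS K)⁻¹) := by ring
    _ = _ := by rw [h, mul_one]

theorem evalNegHom_cothS : PowerSeries.evalNegHom (cothS K) = -cothS K := by
  rw [cothS, map_mul, map_add, evalNegHom_coshDivS, evalNegHom_oneSubSinhS, evalNegHom_sinhDivS_inv]
  ring

theorem evalNegHom_cschS : PowerSeries.evalNegHom (cschS K) = -cschS K := by
  rw [cschS, map_mul, evalNegHom_oneSubSinhS, evalNegHom_sinhDivS_inv]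
  ring

theorem cschS_mul_sinhDivS : sinhDivS K * cschS K = oneSubSinhS K := by
  rw [cschS, mul_left_comm, sinhDivS_mul_inv, mul_one]

theorem X_mul_oneSubSinhS : PowerSeries.X * oneSubSinhS K = 1 - sinhDivS K := by
  ext k
  cases k with
  | zero => simp [sinhDivS]
  | succ k =>
    rw [PowerSeries.coeff_succ_X_mul, oneSubSinhS, PowerSeries.coeff_mk, map_sub,
      PowerSeries.coeff_one, if_neg (Nat.succ_ne_zero k), sinhDivS, PowerSeries.coeff_mk]
    simp only [Nat.even_add_one, Nat.not_even_iff_odd]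
    split_ifs <;> simp

theorem expS_eq_sinh_cosh : expS K = 1 + PowerSeries.X * (sinhDivS K + coshDivS K) := by
  ext k
  cases k with
  | zero => simp [expS, expCoeff]
  | succ k =>
    rw [map_add, PowerSeries.coeff_succ_X_mul, expS, PowerSeries.coeff_mk,
      PowerSeries.coeff_one, if_neg (Nat.succ_ne_zero k), map_add, sinhDivS, coshDivS,
      PowerSeries.coeff_mk, PowerSeries.coeff_mk, expCoeff]
    rcases Nat.even_or_odd k with h | h
    · simp [h, Nat.not_odd_iff_even.2 h]
    · simp [h, Nat.not_even_iff_odd.2 h]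

theorem expNegS_eq_sinh_cosh : expNegS K = 1 + PowerSeries.X * (coshDivS K - sinhDivS K) := by
  rw [expNegS, expS_eq_sinh_cosh, map_add, map_one, map_mul, map_add, PowerSeries.evalNegHom_X, evalNegHom_sinhDivS,
    evalNegHom_coshDivS]
  ring

theorem mcS_eq_sinh_cosh : mcS K = sinhDivS K - coshDivS K := by
  have h := X_mul_mcS (K := K)
  rw [expNegS_eq_sinh_cosh] at h
  refine mul_left_cancel₀ PowerSeries.X_ne_zero (b := mcS K) ?_
  rw [h]; ring

theorem evalNegHom_mcS : PowerSeries.evalNegHom (mcS K) = sinhDivS K + coshDivS K := by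
  rw [mcS_eq_sinh_cosh, map_sub, evalNegHom_sinhDivS, evalNegHom_coshDivS, sub_neg_eq_add]

/-- `e^{-z} (1 + F(z)) = (1 - e^{-z}) / z + (1 / sinh z - 1 / z)`. -/
theorem expNegS_mul_one_add_cothS : expNegS K * (1 + cothS K) = mcS K + cschS K := by
  have h1 : PowerSeries.X * (coshDivS K * coshDivS K - sinhDivS K * sinhDivS K) =
      -(2 * coshDivS K) := by
    have h := expS_mul_expNegS (K := K)
    rw [expS_eq_sinh_cosh, expNegS_eq_sinh_cosh] at h
    refine mul_left_cancel₀ PowerSeries.X_ne_zero ?_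
    linear_combination h
  have h2 := X_mul_oneSubSinhS (K := K)
  have h3 := sinhDivS_mul_inv (K := K)
  have h4 : expNegS K * (sinhDivS K + (coshDivS K + oneSubSinhS K)) =
      mcS K * sinhDivS K + oneSubSinhS K := by
    rw [mcS_eq_sinh_cosh, expNegS_eq_sinh_cosh]
    linear_combination h1 + (coshDivS K - sinhDivS K) * h2
  rw [cothS, cschS]
  linear_combination (sinhDivS K)⁻¹ * h4 - expNegS K * h3 + mcS K * h3

theorem X_mul_derivative_oneSubSinhS :
    PowerSeries.X * PowerSeries.derivative K (oneSubSinhS K) + 2 * oneSubSinhS K =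
      -coshDivS K := by
  ext k
  have h2 : (2 : PowerSeries K) * oneSubSinhS K = (2 : K) • oneSubSinhS K := by
    rw [two_smul, two_mul]
  rw [h2, map_add, PowerSeries.coeff_smul, map_neg, coshDivS, PowerSeries.coeff_mk]
  have hf : ((k + 2).factorial : K) = (k + 2) * (k + 1).factorial := by
    rw [Nat.factorial_succ]; push_cast; ring
  have h0 : ((k + 1).factorial : K) ≠ 0 := by exact_mod_cast (k + 1).factorial_ne_zero
  have h1 : (k : K) + 2 ≠ 0 := by exact_mod_cast (by omega : k + 2 ≠ 0)
  have hd : PowerSeries.coeff k (PowerSeries.X * PowerSeries.derivative K (oneSubSinhS K)) =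
      (k : K) * PowerSeries.coeff k (oneSubSinhS K) := by
    cases k with
    | zero => simp
    | succ k =>
      rw [PowerSeries.coeff_succ_X_mul, PowerSeries.coeff_derivative]; push_cast; ring
  rw [hd, oneSubSinhS, PowerSeries.coeff_mk, hf]
  split_ifs with h
  · rw [smul_eq_mul]; field_simp; ring
  · simp

end Hyperbolic

/-! ### Linear algebra of a reductive decomposition -/

section Reductive

variable {K : Type*} [Field K] {𝔤 : Type*} [LieRing 𝔤] [LieAlgebra K 𝔤]

namespace ReductiveDecomposition

variable (R : ReductiveDecomposition K 𝔤)

theorem proj_of_mem {x : 𝔤} (hx : x ∈ R.sub) : ((R.proj x : R.sub) : 𝔤) = x := by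
  have := Submodule.projectionOnto_apply_left R.isCompl ⟨x, hx⟩
  exact congrArg Subtype.val this

theorem proj_coe (z : R.sub) : R.proj (z : 𝔤) = z := Subtype.ext (R.proj_of_mem z.2)

theorem proj_eq_zero_iff {x : 𝔤} : R.proj x = 0 ↔ x ∈ R.compl :=
  Submodule.projectionOnto_apply_eq_zero_iff R.isCompl

theorem sub_proj_mem (x : 𝔤) : x - (R.proj x : 𝔤) ∈ R.compl := by
  rw [← proj_eq_zero_iff, map_sub, proj_coe, sub_self]

@[simp] theorem restr_apply (ξ : Dual K 𝔤) (z : R.sub) : restr R.sub ξ z = ξ z := rfl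

@[simp] theorem sec_apply (α : Dual K R.sub) (x : 𝔤) : R.sec α x = α (R.proj x) := rfl

@[simp] theorem restr_sec (α : Dual K R.sub) : restr R.sub (R.sec α) = α := by
  ext z
  rw [restr_apply, sec_apply, proj_coe]

theorem sec_mem (α : Dual K R.sub) : R.sec α ∈ R.complPerp := by
  rw [complPerp, Submodule.mem_dualAnnihilator]
  intro x hx
  rw [sec_apply, R.proj_eq_zero_iff.2 hx, map_zero]

theorem restr_eq_zero_iff {ξ : Dual K 𝔤} : restr R.sub ξ = 0 ↔ ξ ∈ R.subPerp := by
  rw [subPerp, Submodule.mem_dualAnnihilator]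
  exact ⟨fun h z hz => LinearMap.congr_fun h ⟨z, hz⟩, fun h => LinearMap.ext fun z => h z z.2⟩

theorem sec_restr {ξ : Dual K 𝔤} (hξ : ξ ∈ R.complPerp) : R.sec (restr R.sub ξ) = ξ := by
  ext x
  rw [complPerp, Submodule.mem_dualAnnihilator] at hξ
  have := hξ _ (R.sub_proj_mem x)
  rw [map_sub, sub_eq_zero] at this
  exact this.symm

theorem sub_sec_restr_mem (ξ : Dual K 𝔤) : ξ - R.sec (restr R.sub ξ) ∈ R.subPerp := by
  rw [← restr_eq_zero_iff, map_sub, restr_sec, sub_self]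

theorem mem_compl_iff {x : 𝔤} : x ∈ R.compl ↔ ∀ ζ ∈ R.complPerp, ζ x = 0 :=
  (Subspace.forall_mem_dualAnnihilator_apply_eq_zero_iff R.compl x).symm

theorem mem_sub_iff {x : 𝔤} : x ∈ R.sub ↔ ∀ ζ ∈ R.subPerp, ζ x = 0 :=
  (Subspace.forall_mem_dualAnnihilator_apply_eq_zero_iff R.sub.toSubmodule x).symm

theorem apply_of_mem_subPerp {ξ : Dual K 𝔤} (hξ : ξ ∈ R.subPerp) {x : 𝔤} (hx : x ∈ R.sub) :
    ξ x = 0 := (Submodule.mem_dualAnnihilator _).1 hξ x hx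

theorem proj_lie_coe (z : R.sub) (x : 𝔤) : R.proj ⁅(z : 𝔤), x⁆ = ⁅z, R.proj x⁆ := by
  have h1 : ⁅(z : 𝔤), x⁆ = ⁅(z : 𝔤), (R.proj x : 𝔤)⁆ + ⁅(z : 𝔤), x - (R.proj x : 𝔤)⁆ := by
    rw [← lie_add]; congr 1; abel
  rw [h1, map_add, R.proj_eq_zero_iff.2 (R.lie_mem _ z.2 _ (R.sub_proj_mem x)), add_zero]
  exact R.proj_coe ⁅z, R.proj x⁆

theorem coad_sec (z : R.sub) (α : Dual K R.sub) :
    coad K 𝔤 (z : 𝔤) (R.sec α) = R.sec (coad K R.sub z α) := by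
  ext x
  simp [proj_lie_coe]

theorem coad_mem_subPerp (z : R.sub) {ξ : Dual K 𝔤} (hξ : ξ ∈ R.subPerp) :
    coad K 𝔤 (z : 𝔤) ξ ∈ R.subPerp := by
  rw [← restr_eq_zero_iff]
  ext y
  exact R.apply_of_mem_subPerp hξ (R.sub.lie_mem z.2 y.2)

end ReductiveDecomposition

end Reductive

/-! ### Parity of the operator `ad_{sp}` on the double -/

section Canonical

variable {K : Type*} [Field K] [CharZero K] {𝔤 : Type*} [LieRing 𝔤] [LieAlgebra K 𝔤]
  [FiniteDimensional K 𝔤] {R : ReductiveDecomposition K 𝔤} {G : QuasiData K 𝔤}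
  (hG : G.IsLieQuasiBialgebra)
  {ι : Type*} [Fintype ι] [DecidableEq ι] (b : Basis ι K R.sub)

open FM ReductiveDecomposition

namespace Double

theorem fst_lie_inr (a : Dual K 𝔤) (X : Double hG) : fst hG ⁅inr hG a, X⁆ =
    -G.cocycle (fst hG X) a + (evalEquiv K 𝔤).symm (G.assoc a (snd hG X)) := by
  rw [fst_lie]; simp

theorem snd_lie_inr (a : Dual K 𝔤) (X : Double hG) : snd hG ⁅inr hG a, X⁆ =
    coad K 𝔤 (fst hG X) a + snd hG X ∘ₗ G.cocycle.flip a := by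
  rw [snd_lie]; simp

variable (R)

/-- The projection of the double to `𝔩`. -/
def prSub : End K (Double hG) := inl hG ∘ₗ R.sub.toSubmodule.subtype ∘ₗ R.proj ∘ₗ fst hG

/-- The projection of the double to `𝔪^⊥`. -/
def prPerp : End K (Double hG) := inr hG ∘ₗ R.sec ∘ₗ restr R.sub ∘ₗ snd hG

theorem prSub_apply (X : Double hG) : prSub R hG X = inl hG (R.proj (fst hG X) : 𝔤) := rfl

theorem prPerp_apply (X : Double hG) :
    prPerp R hG X = inr hG (R.sec (restr R.sub (snd hG X))) := rfl

variable {R}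

/-- `ad_{sα}` exchanges the components in `𝔩` and in `𝔪^⊥` of elements of the double; this and
`prPerp_lie` are where compatibility is used. -/
theorem prSub_lie (hcomp : R.IsCompatible G) (α : Dual K R.sub) (X : Double hG) :
    prSub R hG ⁅inr hG (R.sec α), X⁆ = ⁅inr hG (R.sec α), prPerp R hG X⁆ := by
  have h1 : R.proj (G.cocycle (fst hG X) (R.sec α)) = 0 :=
    R.proj_eq_zero_iff.2 (R.mem_compl_iff.2 fun ζ hζ =>
      hcomp.cocycle_complPerp _ ζ hζ _ (R.sec_mem α))
  set ξ := snd hG X with hξ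
  have h2 : R.proj ((evalEquiv K 𝔤).symm (G.assoc (R.sec α) (ξ - R.sec (restr R.sub ξ)))) = 0 := by
    refine R.proj_eq_zero_iff.2 (R.mem_compl_iff.2 fun ζ hζ => ?_)
    rw [QuasiData.apply_assocVec, G.assoc_swap_right,
      hcomp.assoc_mixed _ (R.sec_mem α) _ hζ _ (R.sub_sec_restr_mem ξ), neg_zero]
  have h3 : (evalEquiv K 𝔤).symm (G.assoc (R.sec α) (R.sec (restr R.sub ξ))) ∈ R.sub := by
    refine R.mem_sub_iff.2 fun ζ hζ => ?_
    rw [QuasiData.apply_assocVec, hcomp.assoc_mixed _ (R.sec_mem α) _ (R.sec_mem _) _ hζ]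
  apply ext' hG
  · rw [prSub_apply, fst_inl, fst_lie_inr, fst_lie_inr, prPerp_apply, fst_inr, snd_inr, map_zero,
      LinearMap.zero_apply, map_add, map_neg, h1, neg_zero, neg_zero, zero_add, zero_add, ← R.proj_of_mem h3,
      ← hξ]
    congr 1
    rw [← sub_eq_zero, ← map_sub, ← map_sub, ← map_sub, h2]
  · rw [prSub_apply, snd_inl, snd_lie_inr, prPerp_apply, fst_inr, snd_inr, map_zero,
      LinearMap.zero_apply, zero_add]
    ext x
    exact (hcomp.cocycle_complPerp x _ (R.sec_mem (restr R.sub (snd hG X))) _ (R.sec_mem α)).symm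

theorem prPerp_lie (hcomp : R.IsCompatible G) (α : Dual K R.sub) (X : Double hG) :
    prPerp R hG ⁅inr hG (R.sec α), X⁆ = ⁅inr hG (R.sec α), prSub R hG X⁆ := by
  apply ext' hG
  · rw [prPerp_apply, fst_inr, fst_lie_inr, prSub_apply, fst_inl, snd_inl,
      hcomp.cocycle_sub _ (R.proj _).2]
    simp
  · rw [prPerp_apply, snd_inr, snd_lie_inr, snd_lie_inr, prSub_apply, fst_inl, snd_inl,
      LinearMap.zero_comp, add_zero, coad_sec]
    congr 1
    ext z
    have h1 : R.proj ⁅fst hG X, (z : 𝔤)⁆ = ⁅R.proj (fst hG X), z⁆ := by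
      rw [← lie_skew (fst hG X), map_neg, proj_lie_coe, lie_skew]
    simp [hcomp.cocycle_sub _ z.2, h1]

variable (R) in
/-- The subspace `𝔩 ⊕ 𝔩^⊥` of the double. -/
def lagr : Submodule K (Double hG) :=
  R.sub.toSubmodule.comap (fst hG) ⊓ R.subPerp.comap (snd hG)

theorem mem_lagr {X : Double hG} : X ∈ lagr R hG ↔ fst hG X ∈ R.sub ∧ snd hG X ∈ R.subPerp :=
  Iff.rfl

/-- `𝔩 ⊕ 𝔩^⊥` is isotropic. -/
theorem pair_lagr {X Y : Double hG} (hX : X ∈ lagr R hG) (hY : Y ∈ lagr R hG) : pair hG X Y = 0 := by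
  rw [pair_apply, R.apply_of_mem_subPerp hX.2 hY.1, R.apply_of_mem_subPerp hY.2 hX.1, add_zero]

/-- `𝔩 ⊕ 𝔩^⊥` is a subalgebra of the double if `φ ≡ 0 mod 𝔩`. -/
theorem lie_mem_lagr (hcomp : R.IsCompatible G)
    (hφ : ∀ ξ ∈ R.subPerp, ∀ η ∈ R.subPerp, ∀ ζ ∈ R.subPerp, G.assoc ξ η ζ = 0)
    {X Y : Double hG} (hX : X ∈ lagr R hG) (hY : Y ∈ lagr R hG) : ⁅X, Y⁆ ∈ lagr R hG := by
  constructor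
  · refine R.mem_sub_iff.2 fun ζ hζ => ?_
    rw [fst_lie, hcomp.cocycle_sub _ hX.1, hcomp.cocycle_sub _ hY.1, map_add, map_sub, map_add,
      QuasiData.apply_assocVec, hφ _ hX.2 _ hY.2 _ hζ,
      R.apply_of_mem_subPerp hζ (R.sub.lie_mem hX.1 hY.1)]
    simp
  · change snd hG ⁅X, Y⁆ ∈ R.subPerp
    rw [← restr_eq_zero_iff]
    ext z
    rw [snd_lie, restr_apply]
    simp only [LinearMap.add_apply, LinearMap.neg_apply, coad_apply_apply, LinearMap.comp_apply,
      LinearMap.flip_apply, hcomp.cocycle_sub _ z.2,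
      R.apply_of_mem_subPerp hY.2 (R.sub.lie_mem hX.1 z.2),
      R.apply_of_mem_subPerp hX.2 (R.sub.lie_mem hY.1 z.2)]
    simp

/-- The coefficients of the linear map `p ↦ sp` from `𝔩*` to the double. -/
def secFam (j : ι) : Double hG := inr hG (R.sec (b.coord j))

theorem sum_secFam (ξ : Dual K 𝔤) :
    ∑ j, ξ (b j) • secFam hG b j = inr hG (R.sec (restr R.sub ξ)) := by
  simp only [secFam, ← map_smul, ← map_sum]
  congr 2
  refine b.ext fun i => ?_
  simp [LinearMap.sum_apply, Finsupp.single_apply]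

theorem linFam_secFam : linFam (secFam hG b) = lin (inr hG ∘ₗ R.sec) (taut b) := by
  ext n
  rw [linFam_coeff, lin_coeff, taut_eq, linFam_coeff, map_sum]
  refine Finset.sum_congr rfl fun j _ => ?_
  split_ifs
  · rfl
  · rw [map_zero]

theorem lin_adFam {N N' : End K (Double hG)}
    (h : ∀ α X, N ⁅inr hG (R.sec α), X⁆ = ⁅inr hG (R.sec α), N' X⁆) (f : FM ι (Double hG)) :
    lin N (adFam K (secFam hG b) f) = adFam K (secFam hG b) (lin N' f) := by
  ext n
  rw [lin_coeff, adFam_apply, adFam_apply, lie_coeff, lie_coeff, map_sum]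
  refine Finset.sum_congr rfl fun q _ => ?_
  rw [linFam_secFam]
  exact h _ _

/-- A power series of `ad_{sp}` commutes with the sum of the two projections, and changes the sign of
its argument when it passes their difference. -/
theorem parity_aux (hcomp : R.IsCompatible G) (c : PowerSeries K) (f : FM ι (Double hG)) :
    lin (prSub R hG + prPerp R hG) (ser (adFam K (secFam hG b)) c f) =
      ser (adFam K (secFam hG b)) c (lin (prSub R hG + prPerp R hG) f) ∧
    lin (prSub R hG - prPerp R hG) (ser (adFam K (secFam hG b)) c f) =
      ser (adFam K (secFam hG b)) (PowerSeries.evalNegHom c) (lin (prSub R hG - prPerp R hG) f) := by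
  have hT := raises_adFam (K := K) (secFam hG b)
  constructor
  · refine ser_intertwine hT hT (isLocal_lin _) (fun f => ?_) c f
    refine lin_adFam hG b (fun α X => ?_) f
    rw [LinearMap.add_apply, LinearMap.add_apply, prSub_lie hG hcomp, prPerp_lie hG hcomp, lie_add,
      add_comm]
  · rw [← ser_neg_op]
    refine ser_intertwine hT hT.neg (isLocal_lin _) (fun f => ?_) c f
    rw [LinearMap.neg_apply, ← map_neg]
    have : -lin (prSub R hG - prPerp R hG) f = lin (-(prSub R hG - prPerp R hG)) f := by
      ext n; simp
    rw [this]
    refine lin_adFam hG b (fun α X => ?_) f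
    rw [LinearMap.neg_apply, LinearMap.sub_apply, LinearMap.sub_apply, prSub_lie hG hcomp,
      prPerp_lie hG hcomp, neg_sub, lie_sub]

theorem lin_add_sub (f : FM ι (Double hG)) :
    lin (prSub R hG + prPerp R hG) f = lin (prSub R hG) f + lin (prPerp R hG) f ∧
    lin (prSub R hG - prPerp R hG) f = lin (prSub R hG) f - lin (prPerp R hG) f :=
  ⟨rfl, rfl⟩

/-- Odd power series of `ad_{sp}` exchange the components in `𝔩` and in `𝔪^⊥`. -/
theorem ser_odd (hcomp : R.IsCompatible G) {c : PowerSeries K}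
    (hc : PowerSeries.evalNegHom c = -c) (f : FM ι (Double hG)) :
    lin (prSub R hG) (ser (adFam K (secFam hG b)) c f) =
      ser (adFam K (secFam hG b)) c (lin (prPerp R hG) f) ∧
    lin (prPerp R hG) (ser (adFam K (secFam hG b)) c f) =
      ser (adFam K (secFam hG b)) c (lin (prSub R hG) f) := by
  obtain ⟨h1, h2⟩ := parity_aux hG b hcomp c f
  rw [hc, ser_neg] at h2
  simp only [(lin_add_sub hG _).1, (lin_add_sub hG _).2, map_add, map_sub,
    LinearMap.neg_apply] at h1 h2
  constructor
  · linear_combination (norm := module) (1 / 2 : K) • (h1 + h2)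
  · linear_combination (norm := module) (1 / 2 : K) • (h1 - h2)

/-- Even power series of `ad_{sp}` preserve the components in `𝔩` and in `𝔪^⊥`. -/
theorem ser_even (hcomp : R.IsCompatible G) {c : PowerSeries K}
    (hc : PowerSeries.evalNegHom c = c) (f : FM ι (Double hG)) :
    lin (prSub R hG) (ser (adFam K (secFam hG b)) c f) =
      ser (adFam K (secFam hG b)) c (lin (prSub R hG) f) ∧
    lin (prPerp R hG) (ser (adFam K (secFam hG b)) c f) =
      ser (adFam K (secFam hG b)) c (lin (prPerp R hG) f) := by
  obtain ⟨h1, h2⟩ := parity_aux hG b hcomp c f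
  rw [hc] at h2
  simp only [(lin_add_sub hG _).1, (lin_add_sub hG _).2, map_add, map_sub] at h1 h2
  constructor
  · linear_combination (norm := module) (1 / 2 : K) • (h1 + h2)
  · linear_combination (norm := module) (1 / 2 : K) • (h1 - h2)

end Double

end Canonical

/-! ### The canonical formal `ℓ`-matrix -/

section Canonical

variable {K : Type*} [Field K] [CharZero K] {𝔤 : Type*} [LieRing 𝔤] [LieAlgebra K 𝔤]
  [FiniteDimensional K 𝔤] {R : ReductiveDecomposition K 𝔤} {G : QuasiData K 𝔤}
  (hG : G.IsLieQuasiBialgebra)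
  {ι : Type*} [Fintype ι] [DecidableEq ι] (b : Basis ι K R.sub)

open FM ReductiveDecomposition

namespace Double

/-- Differentiation along a formal vector field, as a linear map. -/
def _root_.DynLie.FM.alongHom {V : Type*} [AddCommGroup V] [Module K V] {𝔩 : LieSubalgebra K 𝔤}
    (b : Basis ι K 𝔩) (v : FM ι (Dual K 𝔩)) : End K (FM ι V) where
  toFun := along b v
  map_add' := along_add b v
  map_smul' := along_smul b v

/-- The operator `ad_{sp}` on formal maps with values in the double. -/
def adSec : End K (FM ι (Double hG)) := adFam K (secFam hG b)

theorem raises_adSec : Raises (adSec hG b) := raises_adFam _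

/-- The constant formal map `sα`, as a map with values in the double. -/
def cstSec (α : Dual K R.sub) : FM ι (Double hG) := cst K (inr hG (R.sec α))

variable {hG}

@[simp] theorem prSub_cstSec (α : Dual K R.sub) :
    lin (prSub R hG) (cstSec hG α : FM ι (Double hG)) = 0 := by
  rw [cstSec, lin_cst, prSub_apply]; simp

@[simp] theorem prPerp_cstSec (α : Dual K R.sub) :
    lin (prPerp R hG) (cstSec hG α : FM ι (Double hG)) = cstSec hG α := by
  rw [cstSec, lin_cst, prPerp_apply]; simp

theorem pair_adSec (f g : FM ι (Double hG)) :
    mul₂ (pair hG) (adSec hG b f) g = mul₂ (pair hG) f ((-adSec hG b) g) := by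
  rw [adSec, LinearMap.neg_apply, adFam_apply, adFam_apply, mul₂_lie_left _ (pair_lie hG), map_neg]

/-- The adjoint of `c(ad_{sp})` for the invariant pairing is `c(-ad_{sp})`. -/
theorem pair_ser (c : PowerSeries K) (f g : FM ι (Double hG)) :
    mul₂ (pair hG) (ser (adSec hG b) c f) g =
      mul₂ (pair hG) f (ser (adSec hG b) (PowerSeries.evalNegHom c) g) := by
  rw [← ser_neg_op]
  exact ser_adjoint (raises_adSec hG b) (raises_adSec hG b).neg _ (pair_adSec b) c f g

theorem pair_cstSec_of_prPerp (α : Dual K R.sub) {f : FM ι (Double hG)}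
    (hf : lin (prPerp R hG) f = f) : mul₂ (pair hG) (cstSec hG α) f = 0 := by
  rw [← hf, cstSec, mul₂_cst_left]
  ext n
  simp [prPerp_apply, pair_apply]

/-- Even power series of `ad_{sp}` map `𝔪^⊥` to itself, so they do not contribute to the pairing of
`𝔪^⊥` with itself. -/
theorem pair_cstSec_even (hcomp : R.IsCompatible G) {c : PowerSeries K}
    (hc : PowerSeries.evalNegHom c = c) (α β : Dual K R.sub) :
    mul₂ (pair hG) (cstSec hG α) (ser (adSec hG b) c (cstSec hG β)) = 0 :=
  pair_cstSec_of_prPerp α (by rw [adSec, (ser_even hG b hcomp hc _).2, prPerp_cstSec])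

theorem coeff_mem_lagr_of_prSub {f : FM ι (Double hG)} (hf : lin (prSub R hG) f = f) (n) :
    f n ∈ lagr R hG := by
  rw [← hf, lin_coeff, prSub_apply, mem_lagr]
  simp

theorem pair_symm_fm (f g : FM ι (Double hG)) : mul₂ (pair hG) f g = mul₂ (pair hG) g f :=
  mul₂_symm _ (pair_symm hG) f g

theorem graph_add (l : FM ι (Dual K 𝔤 →ₗ[K] 𝔤)) (ξ η : Dual K 𝔤) :
    graph hG l (ξ + η) = graph hG l ξ + graph hG l η := by
  ext n
  simp only [graph, add_coeff, lin_coeff, ev_coeff, map_add]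
  abel

theorem graph_eq (l : FM ι (Dual K 𝔤 →ₗ[K] 𝔤)) (ξ : Dual K 𝔤) :
    graph hG l ξ = graph hG l (R.sec (restr R.sub ξ)) +
      graph hG l (ξ - R.sec (restr R.sub ξ)) := by
  rw [← graph_add]; congr 1; abel

theorem prSub_graph (l : FM ι (Dual K 𝔤 →ₗ[K] 𝔤)) (ξ : Dual K 𝔤) (n) :
    lin (prSub R hG) (graph hG l ξ) n = inl hG (R.proj (l n ξ) : 𝔤) := by
  rw [lin_coeff, prSub_apply, graph, add_coeff, lin_coeff, ev_coeff, cst_coeff]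
  split_ifs <;> simp

theorem prPerp_graph (l : FM ι (Dual K 𝔤 →ₗ[K] 𝔤)) {ξ : Dual K 𝔤} (hξ : ξ ∈ R.subPerp) :
    lin (prPerp R hG) (graph hG l ξ) = 0 := by
  ext n
  rw [lin_coeff, prPerp_apply, graph, add_coeff, lin_coeff, ev_coeff, cst_coeff]
  split_ifs <;> simp [R.restr_eq_zero_iff.2 hξ]

variable (hG) (R) in
/-- The defining relations of the formal canonical `ℓ`-matrix: `l_p sα = F(ad_{sp}) sα`, and
`l_p ξ + ξ ∈ Ad_{e^{sp}} 𝔤*` for `ξ ∈ 𝔩^⊥`. -/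
structure IsCanonical (l : FM ι (Dual K 𝔤 →ₗ[K] 𝔤)) : Prop where
  sec : ∀ α, lin (inl hG) (ev (R.sec α) l) = ser (adSec hG b) (cothS K) (cstSec hG α)
  perp : ∀ ξ ∈ R.subPerp, lin (fst hG) (ser (adSec hG b) (expNegS K) (graph hG l ξ)) = 0

namespace IsCanonical

variable {b} {l : FM ι (Dual K 𝔤 →ₗ[K] 𝔤)}

/-- The section `e^{-ad_{sp}} (l_p ξ + ξ)`. -/
def untwisted (_hl : IsCanonical R hG b l) (ξ : Dual K 𝔤) : FM ι (Double hG) :=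
  ser (adSec hG b) (expNegS K) (graph hG l ξ)

theorem exp_untwisted (hl : IsCanonical R hG b l) (ξ : Dual K 𝔤) :
    ser (adSec hG b) (expS K) (hl.untwisted ξ) = graph hG l ξ := exp_neg_exp _ _

theorem graph_sec (hl : IsCanonical R hG b l) (α : Dual K R.sub) : graph hG l (R.sec α) =
    ser (adSec hG b) (1 + cothS K) (cstSec hG α) := by
  rw [graph, hl.sec, ser_add, ser_one, LinearMap.add_apply, add_comm]
  rfl

theorem untwisted_sec (hl : IsCanonical R hG b l) (α : Dual K R.sub) : hl.untwisted (R.sec α) =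
    ser (adSec hG b) (mcS K) (cstSec hG α) + ser (adSec hG b) (cschS K) (cstSec hG α) := by
  rw [untwisted, graph_sec hl, ser_comp_apply (raises_adSec hG b), expNegS_mul_one_add_cothS,
    ser_add, LinearMap.add_apply]

theorem prSub_untwisted (hl : IsCanonical R hG b l) {ξ : Dual K 𝔤} (hξ : ξ ∈ R.subPerp) :
    lin (prSub R hG) (hl.untwisted ξ) = 0 := by
  have h := hl.perp ξ hξ
  ext n
  have h2 := congrArg (fun f : FM ι 𝔤 => f n) h
  simp only [lin_coeff, zero_coeff] at h2
  rw [lin_coeff, prSub_apply, untwisted, h2]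
  simp

/-- The component of `e^{-ad_{sp}} (l_p ξ + ξ)` in `𝔪^⊥` vanishes for `ξ ∈ 𝔩^⊥`: applying
`cosh ad_{sp}` to it gives the component of `l_p ξ + ξ` in `𝔪^⊥`, which is zero, and the series
`cosh` is invertible. -/
theorem prPerp_untwisted (hl : IsCanonical R hG b l) (hcomp : R.IsCompatible G)
    {ξ : Dual K 𝔤} (hξ : ξ ∈ R.subPerp) :
    lin (prPerp R hG) (hl.untwisted ξ) = 0 := by
  have hT := raises_adSec hG b
  set w := lin (prPerp R hG) (hl.untwisted ξ) with hw
  set cosh : PowerSeries K := 1 + PowerSeries.X * coshDivS K with hcosh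
  have hc1 : PowerSeries.evalNegHom cosh = cosh := by
    rw [hcosh, map_add, map_one, map_mul, PowerSeries.evalNegHom_X, evalNegHom_coshDivS]; ring
  have hs1 : PowerSeries.evalNegHom (PowerSeries.X * sinhDivS K) = -(PowerSeries.X * sinhDivS K) := by
    rw [map_mul, PowerSeries.evalNegHom_X, evalNegHom_sinhDivS]; ring
  have hw2 : lin (prPerp R hG) w = w := by
    rw [hw, lin_lin]; congr 2; ext1 X; simp [prPerp_apply]
  have hw3 : lin (prSub R hG) w = 0 := by
    rw [hw, lin_lin]; ext n; simp [prPerp_apply, prSub_apply]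
  have hsplit : (expS K) = cosh + PowerSeries.X * sinhDivS K := by
    rw [expS_eq_sinh_cosh, hcosh]; ring
  have h1 : lin (prPerp R hG) (graph hG l ξ) = ser (adSec hG b) cosh w := by
    rw [← exp_untwisted hl, hsplit, ser_add, LinearMap.add_apply, map_add]
    have e1 := (ser_even hG b hcomp hc1 (hl.untwisted ξ)).2
    have e2 := (ser_odd hG b hcomp hs1 (hl.untwisted ξ)).2
    rw [prSub_untwisted hl hξ, map_zero] at e2
    exact (congrArg₂ (· + ·) e1 e2).trans (add_zero _)
  rw [prPerp_graph _ hξ] at h1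
  have h2 : cosh⁻¹ * cosh = 1 := PowerSeries.inv_mul_cancel _ (by simp [hcosh])
  calc w = ser (adSec hG b) (cosh⁻¹ * cosh) w := by rw [h2, ser_one]; rfl
    _ = 0 := by rw [← ser_comp_apply hT, ← h1, map_zero]

theorem untwisted_mem (hl : IsCanonical R hG b l) (hcomp : R.IsCompatible G)
    {ξ : Dual K 𝔤} (hξ : ξ ∈ R.subPerp) (n) :
    fst hG (hl.untwisted ξ n) = 0 ∧ snd hG (hl.untwisted ξ n) ∈ R.subPerp := by
  refine ⟨congrArg (fun f : FM ι 𝔤 => f n) (hl.perp ξ hξ), ?_⟩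
  have h := congrArg (fun f : FM ι (Double hG) => restr R.sub (snd hG (f n)))
    (prPerp_untwisted hl hcomp hξ)
  simp only [lin_coeff, prPerp_apply, snd_inr, restr_sec, zero_coeff, map_zero] at h
  exact R.restr_eq_zero_iff.1 h

theorem untwisted_mem_lagr (hl : IsCanonical R hG b l) (hcomp : R.IsCompatible G)
    {ξ : Dual K 𝔤} (hξ : ξ ∈ R.subPerp) (n) :
    hl.untwisted ξ n ∈ lagr R hG := by
  obtain ⟨h1, h2⟩ := untwisted_mem hl hcomp hξ n
  exact ⟨by rw [SetLike.mem_coe, Submodule.mem_comap, h1]; exact zero_mem _, h2⟩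

/-- `l_p` maps `𝔩^⊥` to `𝔪`. -/
theorem apply_mem_compl (hl : IsCanonical R hG b l) (hcomp : R.IsCompatible G)
    {ξ : Dual K 𝔤} (hξ : ξ ∈ R.subPerp) (n) : l n ξ ∈ R.compl := by
  have h := parity_aux hG b hcomp (expS K) (hl.untwisted ξ)
  rw [(lin_add_sub hG _).1, (lin_add_sub hG (hl.untwisted ξ)).1, prSub_untwisted hl hξ,
    prPerp_untwisted hl hcomp hξ, add_zero, map_zero] at h
  have h1 : lin (prSub R hG) (graph hG l ξ) + lin (prPerp R hG) (graph hG l ξ) = 0 := by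
    rw [← exp_untwisted hl]; exact h.1
  rw [prPerp_graph _ hξ, add_zero] at h1
  have h2 := congrArg (fun f : FM ι (Double hG) => fst hG (f n)) h1
  simp only [prSub_graph, fst_inl, zero_coeff, map_zero] at h2
  rw [← R.proj_eq_zero_iff]
  exact Subtype.ext h2

/-- `l_p` maps `𝔪^⊥` to `𝔩`. -/
theorem apply_mem_sub (hl : IsCanonical R hG b l) (hcomp : R.IsCompatible G)
    (α : Dual K R.sub) (n) : l n (R.sec α) ∈ R.sub := by
  have h := (ser_odd hG b hcomp (evalNegHom_cothS (K := K)) (cstSec hG α)).1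
  rw [prPerp_cstSec] at h
  change lin (prSub R hG) (ser (adSec hG b) (cothS K) (cstSec hG α)) =
    ser (adSec hG b) (cothS K) (cstSec hG α) at h
  rw [← hl.sec, lin_lin] at h
  have h2 := congrArg (fun f : FM ι (Double hG) => fst hG (f n)) h
  simp only [lin_coeff, LinearMap.comp_apply, prSub_apply, fst_inl, ev_coeff] at h2
  rw [← h2]
  exact (R.proj _).2

/-- The graph of `l` is isotropic, so that `l` is skew-symmetric. On `𝔩^⊥` this holds because
`e^{ad_{sp}}` preserves the pairing; on `𝔪^⊥` because `(1 - F(z)) (1 + F(z))` is even. -/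
theorem pair_graph_graph (hl : IsCanonical R hG b l) (hcomp : R.IsCompatible G)
    (ξ η : Dual K 𝔤) :
    mul₂ (pair hG) (graph hG l ξ) (graph hG l η) = 0 := by
  have hT := raises_adSec hG b
  -- `l_p` maps `𝔪^⊥` to `𝔩` and `𝔩^⊥` to `𝔪`, so the mixed pairings vanish
  have hmix : ∀ α, ∀ η ∈ R.subPerp,
      mul₂ (pair hG) (graph hG l (R.sec α)) (graph hG l η) = 0 := by
    intro α η hη
    simp only [graph, map_add, LinearMap.add_apply, pair_lin_inl_lin_inl, pair_lin_inl_cst_inr,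
      pair_cst_lin_inl, pair_cst_cst, snd_inr]
    ext n
    simp [pair_apply, R.apply_of_mem_subPerp hη (apply_mem_sub hl hcomp α n),
      R.proj_eq_zero_iff.2 (apply_mem_compl hl hcomp hη n)]
  have h11 : ∀ α β, mul₂ (pair hG) (graph hG l (R.sec α)) (graph hG l (R.sec β)) = 0 := by
    intro α β
    rw [graph_sec hl, graph_sec hl, pair_ser, ser_comp_apply hT]
    refine pair_cstSec_even b hcomp ?_ α β
    rw [map_mul, map_add, map_one, evalNegHom_cothS, map_add, map_one, map_neg, evalNegHom_cothS]
    ring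
  have h22 : ∀ ξ ∈ R.subPerp, ∀ η ∈ R.subPerp,
      mul₂ (pair hG) (graph hG l ξ) (graph hG l η) = 0 := by
    intro ξ hξ η hη
    rw [← exp_untwisted hl, ← exp_untwisted hl]
    refine (exp_pairing _ _ (pair_lie hG) _ _).trans ?_
    exact mul₂_eq_zero_of_isotropic _ (fun x hx y hy => pair_lagr hG hx hy)
      (untwisted_mem_lagr hl hcomp hξ) (untwisted_mem_lagr hl hcomp hη)
  rw [graph_eq (R := R) l ξ, graph_eq (R := R) l η]
  simp only [map_add, LinearMap.add_apply]
  rw [h11, hmix _ _ (R.sub_sec_restr_mem η), pair_symm_fm, hmix _ _ (R.sub_sec_restr_mem ξ),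
    h22 _ (R.sub_sec_restr_mem ξ) _ (R.sub_sec_restr_mem η)]
  simp

theorem coeff_zero (hl : IsCanonical R hG b l) : l 0 = 0 := by
  have hT := raises_adSec hG b
  have hz : ∀ (c : PowerSeries K) (f : FM ι (Double hG)),
      ser (adSec hG b) c f 0 = PowerSeries.coeff 0 c • f 0 := by
    intro c f
    rw [ser_coeff_sum hT (N := 1) c f 0 (by simp)]
    simp
  have h1 : ∀ α, l 0 (R.sec α) = 0 := by
    intro α
    have h := congrArg (fun f : FM ι (Double hG) => fst hG (f 0)) (hl.sec α)
    simp only [lin_coeff, fst_inl, ev_coeff, hz] at h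
    rw [h, cstSec]
    simp
  have h2 : ∀ ξ ∈ R.subPerp, l 0 ξ = 0 := by
    intro ξ hξ
    have h := congrArg (fun f : FM ι 𝔤 => f 0) (hl.perp ξ hξ)
    simp only [lin_coeff, hz, graph, add_coeff, cst_zero_coeff, map_smul, map_add, fst_inl, fst_inr,
      ev_coeff, zero_coeff] at h
    have h3 : PowerSeries.coeff 0 (expNegS K) = 1 := by
      rw [expNegS, coeff_evalNegHom, expS, PowerSeries.coeff_mk, expCoeff]; simp
    rw [h3, one_smul, smul_zero, add_zero] at h
    exact h
  ext ξ
  have : ξ = R.sec (restr R.sub ξ) + (ξ - R.sec (restr R.sub ξ)) := by abel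
  rw [this, map_add, h1, h2 _ (R.sub_sec_restr_mem ξ)]
  simp

/-- The component of `e^{-ad_{sp}} (l_p ξ + ξ)` in `𝔩 ⊕ 𝔩^⊥`, complementary to the
Maurer--Cartan form. -/
def corr (hl : IsCanonical R hG b l) (ξ : Dual K 𝔤) : FM ι (Double hG) :=
  ser (adSec hG b) (cschS K) (cstSec hG (restr R.sub ξ)) +
    hl.untwisted (ξ - R.sec (restr R.sub ξ))

variable (R hG b) in
/-- The Maurer--Cartan form of `e^{sp}` in the direction `i*ξ`. -/
def mcSec (ξ : Dual K 𝔤) : FM ι (Double hG) :=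
  ser (adSec hG b) (mcS K) (cstSec hG (restr R.sub ξ))

theorem graph_eq_exp (hl : IsCanonical R hG b l) (ξ : Dual K 𝔤) :
    graph hG l ξ = ser (adSec hG b) (expS K) (mcSec R hG b ξ + hl.corr ξ) := by
  rw [mcSec, corr, ← add_assoc, ← untwisted_sec hl, map_add, exp_untwisted, exp_untwisted,
    ← graph_eq]

theorem corr_mem_lagr (hl : IsCanonical R hG b l) (hcomp : R.IsCompatible G) (ξ : Dual K 𝔤) (n) :
    hl.corr ξ n ∈ lagr R hG := by
  refine Submodule.add_mem _ (coeff_mem_lagr_of_prSub ?_ n)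
    (untwisted_mem_lagr hl hcomp (R.sub_sec_restr_mem ξ) n)
  have := (ser_odd hG b hcomp (evalNegHom_cschS (K := K)) (cstSec hG (restr R.sub ξ))).1
  rw [prPerp_cstSec] at this
  exact this

/-- The Maurer--Cartan form of `e^{sp}` is isotropic, since `(1 - e^{-z}) (e^z - 1) / z^2` is even. -/
theorem pair_mcSec_mcSec (hcomp : R.IsCompatible G) (ξ η : Dual K 𝔤) :
    mul₂ (pair hG) (mcSec R hG b ξ) (mcSec R hG b η) = 0 := by
  rw [mcSec, mcSec, pair_ser, ser_comp_apply (raises_adSec hG b)]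
  refine pair_cstSec_even b hcomp ?_ _ _
  rw [map_mul, evalNegHom_mcS, map_add, evalNegHom_sinhDivS, evalNegHom_coshDivS,
    ← sub_eq_add_neg, ← mcS_eq_sinh_cosh, mul_comm]

theorem pair_mcSec_corr_anti (hl : IsCanonical R hG b l) (hcomp : R.IsCompatible G)
    (ξ η : Dual K 𝔤) : mul₂ (pair hG) (mcSec R hG b ξ) (hl.corr η) =
      -mul₂ (pair hG) (mcSec R hG b η) (hl.corr ξ) := by
  have h1 := pair_graph_graph hl hcomp ξ η
  rw [graph_eq_exp hl, graph_eq_exp hl] at h1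
  have h2 := (exp_pairing (secFam hG b) (pair hG) (pair_lie hG) (mcSec R hG b ξ + hl.corr ξ)
    (mcSec R hG b η + hl.corr η)).symm.trans h1
  have h3 : mul₂ (pair hG) (hl.corr ξ) (hl.corr η) = 0 :=
    mul₂_eq_zero_of_isotropic _ (fun x hx y hy => pair_lagr hG hx hy) (corr_mem_lagr hl hcomp ξ)
      (corr_mem_lagr hl hcomp η)
  rw [map_add, map_add, LinearMap.add_apply, LinearMap.add_apply,
    pair_mcSec_mcSec hcomp, h3, zero_add, add_zero, pair_symm_fm (hl.corr ξ), add_comm] at h2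
  exact eq_neg_of_add_eq_zero_left h2

/-- Up to an even series, which does not contribute, the product of `(e^z - 1) / z` and
`1 / sinh z - 1 / z` is `(1 - sinh z / z) / z`. -/
theorem pair_mcSec_corr (hl : IsCanonical R hG b l) (hcomp : R.IsCompatible G) (ξ η : Dual K 𝔤) :
    mul₂ (pair hG) (mcSec R hG b ξ) (hl.corr η) = mul₂ (pair hG) (cstSec hG (restr R.sub ξ))
      (ser (adSec hG b) (oneSubSinhS K) (cstSec hG (restr R.sub η))) := by
  have hBpr : lin (prSub R hG + prPerp R hG) (mcSec R hG b ξ) = mcSec R hG b ξ := by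
    have := (parity_aux hG b hcomp (mcS K) (cstSec hG (restr R.sub ξ))).1
    rw [(lin_add_sub hG (cstSec hG (restr R.sub ξ))).1, prPerp_cstSec, prSub_cstSec, zero_add]
      at this
    exact this
  have h1 : mul₂ (pair hG) (mcSec R hG b ξ) (hl.untwisted (η - R.sec (restr R.sub η))) = 0 := by
    ext n
    rw [mul₂_coeff]
    refine Finset.sum_eq_zero fun q _ => ?_
    obtain ⟨u1, u2⟩ := untwisted_mem hl hcomp (R.sub_sec_restr_mem η) q.2
    have h3 := congrArg (fun f : FM ι (Double hG) => fst hG (f q.1)) hBpr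
    simp only [lin_coeff, LinearMap.add_apply, map_add, prSub_apply, prPerp_apply, fst_inl,
      fst_inr, add_zero] at h3
    rw [pair_apply, u1, map_zero, zero_add, ← h3]
    exact R.apply_of_mem_subPerp u2 (R.proj _).2
  have h2 : PowerSeries.evalNegHom (mcS K) * cschS K = oneSubSinhS K + coshDivS K * cschS K := by
    rw [evalNegHom_mcS, add_mul, cschS_mul_sinhDivS]
  have h3 : PowerSeries.evalNegHom (coshDivS K * cschS K) = coshDivS K * cschS K := by
    rw [map_mul, evalNegHom_coshDivS, evalNegHom_cschS, neg_mul_neg]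
  rw [corr, map_add, h1, add_zero, mcSec, pair_ser, ser_comp_apply (raises_adSec hG b), h2,
    ser_add, LinearMap.add_apply, map_add, pair_cstSec_even b hcomp h3, add_zero]

/-- The pairing of the Maurer--Cartan form with `corr` satisfies the differential equation of a
transgression along the Euler vector field: `f = (1 - sinh z / z) / z` satisfies
`z f' + 2 f = -(cosh z - 1) / z`, which is the odd part of `-(e^z - 1) / z`, and the even part does not
contribute. -/
theorem eul_pair_mcSec_corr (hl : IsCanonical R hG b l) (hcomp : R.IsCompatible G)
    (ξ η : Dual K 𝔤) : eul K (mul₂ (pair hG) (mcSec R hG b ξ) (hl.corr η)) +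
        (2 : K) • mul₂ (pair hG) (mcSec R hG b ξ) (hl.corr η) =
      -mul₂ (pair hG) (mcSec R hG b ξ) (cstSec hG (restr R.sub η)) := by
  have hT := raises_adSec hG b
  have h2 : (2 : PowerSeries K) * oneSubSinhS K = (2 : K) • oneSubSinhS K := by
    rw [two_smul, two_mul]
  have h1 := X_mul_derivative_oneSubSinhS (K := K)
  rw [h2] at h1
  have h3 : eul K (cstSec hG (restr R.sub ξ) : FM ι (Double hG)) = 0 := eul_cst _
  have h4 : eul K (cstSec hG (restr R.sub η) : FM ι (Double hG)) = 0 := eul_cst _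
  have h5 := pair_cstSec_even b hcomp (hG := hG) (evalNegHom_sinhDivS (K := K)) (restr R.sub ξ)
    (restr R.sub η)
  have h6 : eul K (ser (adSec hG b) (oneSubSinhS K) (cstSec hG (restr R.sub η))) =
      ser (adSec hG b) (PowerSeries.X * PowerSeries.derivative K (oneSubSinhS K))
        (cstSec hG (restr R.sub η)) := by
    refine (eul_ser hT (eul_adFam _) _ _).trans ?_
    rw [h4, map_zero, zero_add]
  rw [pair_mcSec_corr hl hcomp, eul_mul₂, h3, h6, map_zero, LinearMap.zero_apply, zero_add,
    ← map_smul, ← LinearMap.smul_apply, ← ser_smul, ← map_add, ← LinearMap.add_apply, ← ser_add,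
    h1, ser_neg, LinearMap.neg_apply, map_neg, mcSec, pair_ser, evalNegHom_mcS, ser_add,
    LinearMap.add_apply, map_add, h5, zero_add]

/-- The dynamical equation, in the form of the cyclic identity for the graph. -/
theorem cyclic (hl : IsCanonical R hG b l) (hcomp : R.IsCompatible G)
    (hφ : ∀ ξ ∈ R.subPerp, ∀ η ∈ R.subPerp, ∀ ζ ∈ R.subPerp, G.assoc ξ η ζ = 0)
    (ξ η ζ : Dual K 𝔤) :
    mul₂ (pair hG) (dξ b ξ (graph hG l η)) (graph hG l ζ) +
      mul₂ (pair hG) (dξ b η (graph hG l ζ)) (graph hG l ξ) +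
      mul₂ (pair hG) (dξ b ζ (graph hG l ξ)) (graph hG l η) =
      mul₂ (pair hG) ⁅graph hG l ξ, graph hG l η⁆ (graph hG l ζ) := by
  have ha : ∀ ξ : Dual K 𝔤, (cst K (∑ j, ξ (b j) • secFam hG b j) : FM ι (Double hG)) =
      cstSec hG (restr R.sub ξ) := fun ξ => by rw [sum_secFam]; rfl
  have h1 : ∀ ξ : Dual K 𝔤, mcSec R hG b ξ =
      mcForm K (secFam hG b) (∑ j, ξ (b j) • secFam hG b j) := fun ξ => by rw [mcForm, ha]; rfl
  have h2 : ∀ ξ η : Dual K 𝔤, eul K (mul₂ (pair hG) (mcSec R hG b ξ) (hl.corr η)) +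
        (2 : K) • mul₂ (pair hG) (mcSec R hG b ξ) (hl.corr η) =
      -mul₂ (pair hG) (mcSec R hG b ξ) (cst K (∑ j, η (b j) • secFam hG b j)) := fun ξ η => by
    rw [ha, eul_pair_mcSec_corr hl hcomp]
  have h3 : ∀ x ∈ lagr R hG, ∀ y ∈ lagr R hG, pair hG x y = 0 := fun x hx y hy =>
    pair_lagr hG hx hy
  have h4 : ∀ x ∈ lagr R hG, ∀ y ∈ lagr R hG, ⁅x, y⁆ ∈ lagr R hG := fun x hx y hy =>
    lie_mem_lagr hG hcomp hφ hx hy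
  have h5 : ∀ ξ, graph hG l ξ = ser (adFam K (secFam hG b)) (expS K) (mcSec R hG b ξ + hl.corr ξ) :=
    graph_eq_exp hl
  have key := cyclic_identity (X := Dual K 𝔤) (secFam hG b) (pair hG) (pair_symm hG) (pair_lie hG)
    (lagr R hG) h3 h4
    (fun ξ j => ξ (b j)) (mcSec R hG b) hl.corr (graph hG l) h1
    (corr_mem_lagr hl hcomp) h5 (pair_mcSec_mcSec hcomp)
    (pair_mcSec_corr_anti hl hcomp) h2 ξ η ζ
  exact key

/-- The Lie derivative `d_p f (ad*_z p) + [z, f_p]` of a formal map with values in the double. -/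
def equivOp (b : Basis ι K R.sub) (z : R.sub) : End K (FM ι (Double hG)) :=
  alongHom b (coadField b z) + mul₂ (lieBilin K (Double hG)) (cst K (inl hG (z : 𝔤)))

theorem equivOp_apply (z : R.sub) (f : FM ι (Double hG)) : equivOp b z f =
    along b (coadField b z) f + ⁅(cst K (inl hG (z : 𝔤)) : FM ι (Double hG)), f⁆ := rfl

theorem isLocal_equivOp (z : R.sub) : IsLocal (equivOp (hG := hG) b z) := fun k f hf =>
  (along_vanish b (coadField_zero b z) hf).add (isLocal_mul₂_left _ _ k f hf)

theorem lie_inl_cstSec (hcomp : R.IsCompatible G) (z : R.sub) (ξ : Dual K 𝔤) :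
    ⁅inl hG (z : 𝔤), inr hG ξ⁆ = -inr hG (coad K 𝔤 (z : 𝔤) ξ) := by
  rw [lie_inl_inr, hcomp.cocycle_sub _ z.2, LinearMap.zero_apply, map_zero, zero_sub]

theorem equivOp_adSec (hcomp : R.IsCompatible G) (z : R.sub) (f : FM ι (Double hG)) :
    equivOp b z (adSec hG b f) = adSec hG b (equivOp b z f) := by
  have h1 : along b (coadField b z) (linFam (secFam hG b)) +
      ⁅(cst K (inl hG (z : 𝔤)) : FM ι (Double hG)), linFam (secFam hG b)⁆ = 0 := by
    rw [linFam_secFam, along_lin, along_taut]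
    ext n
    rw [add_coeff, lie_cst_coeff (K := K), coadField, lin_coeff, lin_coeff, lin_coeff]
    simp only [LinearMap.comp_apply, lie_inl_cstSec hcomp, coad_sec]
    simp
  have h2 : along b (coadField b z) ⁅linFam (secFam hG b), f⁆ =
      ⁅along b (coadField b z) (linFam (secFam hG b)), f⁆ +
        ⁅linFam (secFam hG b), along b (coadField b z) f⁆ :=
    along_mul₂ b _ (lieBilin K (Double hG)) _ _
  rw [equivOp_apply, equivOp_apply, adSec, adFam_apply, adFam_apply, h2,
    leibniz_lie (cst K (inl hG (z : 𝔤)) : FM ι (Double hG)), lie_add,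
    eq_neg_of_add_eq_zero_left h1, neg_lie]
  abel

/-- The Lie derivative along `𝔩` commutes with power series of `ad_{sp}`, because `p ↦ sp` is
equivariant. -/
theorem equivOp_ser (hcomp : R.IsCompatible G) (z : R.sub) (c : PowerSeries K)
    (f : FM ι (Double hG)) :
    equivOp b z (ser (adSec hG b) c f) = ser (adSec hG b) c (equivOp b z f) :=
  ser_intertwine (raises_adSec hG b) (raises_adSec hG b) (isLocal_equivOp z)
    (equivOp_adSec hcomp z) c f

theorem equivOp_cst_inr (hcomp : R.IsCompatible G) (z : R.sub) (ξ : Dual K 𝔤) :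
    equivOp b z (cst K (inr hG ξ) : FM ι (Double hG)) = -cst K (inr hG (coad K 𝔤 (z : 𝔤) ξ)) := by
  rw [equivOp_apply, along_cst, zero_add, lie_cst_cst, lie_inl_cstSec hcomp, map_neg]

theorem equivOp_graph (hcomp : R.IsCompatible G) (l : FM ι (Dual K 𝔤 →ₗ[K] 𝔤)) (z : R.sub)
    (ξ : Dual K 𝔤) : equivOp b z (graph hG l ξ) = lin (inl hG)
      (ev ξ (along b (coadField b z) l + lin (adjAct K 𝔤 (z : 𝔤)) l)) -
        graph hG l (coad K 𝔤 (z : 𝔤) ξ) := by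
  rw [graph, map_add, equivOp_cst_inr hcomp, equivOp_apply, along_lin, ev, along_lin, graph]
  ext n
  simp only [add_coeff, sub_coeff, neg_coeff, lie_cst_coeff (K := K), lin_coeff, lie_inl_inl,
    ev_coeff, LinearMap.applyₗ_apply_apply, adjAct_apply_apply, LinearMap.add_apply, map_add]
  abel

/-- `p_𝔤 e^{-ad_{sp}} i_𝔤` is injective on formal maps. -/
theorem eq_zero_of_fst_exp {e : FM ι 𝔤}
    (h : lin (fst hG) (ser (adSec hG b) (expNegS K) (lin (inl hG) e)) = 0) : e = 0 := by
  have hT := raises_adSec hG b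
  set Φ : End K (FM ι 𝔤) :=
    lin (fst hG) ∘ₗ adSec hG b ∘ₗ ser (adSec hG b) (mcS K) ∘ₗ lin (inl hG) with hΦ
  have hr : Raises Φ := fun k f hf => isLocal_lin _ _ _ (hT _ _ (isLocal_ser hT _ _ _
    (isLocal_lin _ _ _ hf)))
  refine hr.eq_zero ?_
  have h1 : expNegS K = 1 - PowerSeries.X * mcS K := by rw [X_mul_mcS]; ring
  rw [h1, ser_sub, ser_one, LinearMap.sub_apply, map_sub, ← ser_comp_apply hT, ser_X hT] at h
  have h2 : lin (fst hG) ((1 : End K (FM ι (Double hG))) (lin (inl hG) e)) = e := rfl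
  rw [h2] at h
  exact (sub_eq_zero.1 h).symm

/-- The canonical `ℓ`-matrix is `𝔩`-equivariant: the defining relations are equivariant and determine
its values. -/
theorem equivariant (hl : IsCanonical R hG b l) (hcomp : R.IsCompatible G) (z : R.sub) :
    along b (coadField b z) l + cst K (G.cocycle z) + lin (adjAct K 𝔤 (z : 𝔤)) l = 0 := by
  rw [hcomp.cocycle_sub _ z.2, map_zero, add_zero]
  set E := along b (coadField b z) l + lin (adjAct K 𝔤 (z : 𝔤)) l with hE
  have h1 : ∀ α, ev (R.sec α) E = 0 := by
    intro α
    have h := equivOp_graph (hG := hG) (b := b) hcomp l z (R.sec α)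
    have h3 : equivOp b z (cstSec hG α : FM ι (Double hG)) = -cstSec hG (coad K R.sub z α) := by
      rw [cstSec, equivOp_cst_inr hcomp, coad_sec]; rfl
    rw [coad_sec, graph_sec hl, graph_sec hl, equivOp_ser hcomp, h3, map_neg, ← hE] at h
    rw [eq_comm, sub_eq_neg_self] at h
    exact congrArg (fun f => lin (fst hG) f) h
  have h2 : ∀ ξ ∈ R.subPerp, ev ξ E = 0 := by
    intro ξ hξ
    refine eq_zero_of_fst_exp (hG := hG) (b := b) ?_
    have h := equivOp_graph (hG := hG) (b := b) hcomp l z ξ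
    rw [eq_sub_iff_add_eq, ← hE] at h
    rw [← h, map_add, ← equivOp_ser hcomp, map_add, hl.perp _ (R.coad_mem_subPerp z hξ), add_zero]
    ext n
    obtain ⟨u1, u2⟩ := untwisted_mem hl hcomp hξ n
    have h5 : along b (coadField b z) (lin (fst hG) (hl.untwisted ξ)) = 0 := by
      have : lin (fst hG) (hl.untwisted ξ) = 0 := hl.perp _ hξ
      rw [this]; simp [along_eq]
    rw [equivOp_apply, map_add, ← along_lin]
    change (along b (coadField b z) (lin (fst hG) (hl.untwisted ξ)) + lin (fst hG)
      ⁅(cst K (inl hG (z : 𝔤)) : FM ι (Double hG)), hl.untwisted ξ⁆) n = _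
    rw [h5, zero_add, lin_coeff, lie_cst_coeff (K := K), fst_lie, u1]
    simp [hcomp.cocycle_sub _ z.2]
  refine ext_ev fun ξ => ?_
  have : ξ = R.sec (restr R.sub ξ) + (ξ - R.sec (restr R.sub ξ)) := by abel
  ext n
  rw [this, ev_coeff, map_add, ← ev_coeff, ← ev_coeff, h1, h2 _ (R.sub_sec_restr_mem ξ)]
  simp

/-- The canonical formal `ℓ`-matrix is dynamical if `φ ≡ 0 mod 𝔩`. -/
theorem isFormalDynl (hl : IsCanonical R hG b l) (hcomp : R.IsCompatible G)
    (hφ : ∀ ξ ∈ R.subPerp, ∀ η ∈ R.subPerp, ∀ ζ ∈ R.subPerp, G.assoc ξ η ζ = 0) :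
    G.IsFormalDynl b l.toFun := by
  have hskew := skew_of_pair_graph (hl.pair_graph_graph hcomp)
  refine (G.isFormalDynl_iff b l).2 ⟨hskew, fun ξ η ζ => ?_, hl.equivariant hcomp⟩
  rw [← sub_eq_zero, cycl_graph (hG := hG) b, hl.cyclic hcomp hφ, sub_self]

end IsCanonical

end Double

end Canonical

/-! ### Infinitesimal gauge transformations -/

section Infinitesimal

variable {K : Type*} [Field K] [CharZero K] {𝔤 : Type*} [LieRing 𝔤] [LieAlgebra K 𝔤]
  [FiniteDimensional K 𝔤]
  {ι : Type*} [Fintype ι] [DecidableEq ι] {𝔩 : LieSubalgebra K 𝔤} (b : Basis ι K 𝔩)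

namespace FM

/-- The map `A ↦ A*ξ`, where `A* : 𝔤* → 𝔩** = 𝔩` is the transpose of `A : 𝔩* → 𝔤`. -/
def contr (𝔩 : LieSubalgebra K 𝔤) (ξ : Dual K 𝔤) : (Dual K 𝔩 →ₗ[K] 𝔤) →ₗ[K] 𝔩 :=
  (evalEquiv K 𝔩).symm.toLinearMap ∘ₗ LinearMap.llcomp K (Dual K 𝔩) 𝔤 K ξ

@[simp] theorem apply_contr (ξ : Dual K 𝔤) (A : Dual K 𝔩 →ₗ[K] 𝔤) (α : Dual K 𝔩) :
    α (contr 𝔩 ξ A) = ξ (A α) := apply_evalEquiv_symm_apply K 𝔩 α _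

/-- The inclusion of `𝔩`, as a linear map. -/
abbrev incl (𝔩 : LieSubalgebra K 𝔤) : 𝔩 →ₗ[K] 𝔤 := 𝔩.toSubmodule.subtype

theorem apply_incl_contr (η ξ : Dual K 𝔤) (A : Dual K 𝔩 →ₗ[K] 𝔤) :
    η (incl 𝔩 (contr 𝔩 ξ A)) = ξ (A (restr 𝔩 η)) := apply_contr ξ A (restr 𝔩 η)

/-- The map `A ↦ i A*`, as a linear map. -/
def trIncl (𝔩 : LieSubalgebra K 𝔤) : (Dual K 𝔩 →ₗ[K] 𝔤) →ₗ[K] (Dual K 𝔤 →ₗ[K] 𝔤) where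
  toFun := transposeIncl 𝔩
  map_add' A A' := by
    ext ξ; simp [transposeIncl, LinearMap.dualMap_apply', LinearMap.comp_add]
  map_smul' c A := by
    ext ξ; simp [transposeIncl, LinearMap.dualMap_apply', LinearMap.comp_smul]

theorem trIncl_apply (A : Dual K 𝔩 →ₗ[K] 𝔤) (ξ : Dual K 𝔤) :
    trIncl 𝔩 A ξ = incl 𝔩 (contr 𝔩 ξ A) := rfl

theorem dξ_coeff {V : Type*} [AddCommGroup V] [Module K V] (ξ : Dual K 𝔤) (f : FM ι V) (n) :
    dξ b ξ f n = diff b f n (restr 𝔩 ξ) := by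
  rw [diff_coeff_apply, dξ, dird_apply, sum_coeff]
  rfl

/-- The formal vector field `p ↦ ad*_{z_p} p`. -/
def coadMul (z : FM ι 𝔩) : FM ι (Dual K 𝔩) := mul₂ (coad K 𝔩) z (taut b)

theorem coadMul_cst (z : 𝔩) : coadMul b (cst K z) = coadField b z := mul₂_cst_left _ _ _

theorem eval_coadMul_contr (ξ : Dual K 𝔤) (A : FM ι (Dual K 𝔩 →ₗ[K] 𝔤)) (w : 𝔩) :
    lin (Dual.eval K 𝔩 w) (coadMul b (lin (contr 𝔩 ξ) A)) =
      -lin ξ (mul₂ LinearMap.id A (coadField b w)) := by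
  ext n
  rw [neg_coeff, lin_coeff, lin_coeff, coadMul, mul₂_coeff, mul₂_coeff, map_sum, map_sum,
    ← Finset.sum_neg_distrib]
  refine Finset.sum_congr rfl fun q _ => ?_
  rw [lin_coeff, Dual.eval_apply, coad_apply_apply, ← lie_skew, map_neg, ← coad_apply_apply,
    apply_contr]
  rfl

/-- Equivariance of `S`, for variable elements of `𝔩`. -/
theorem along_coadMul {S : FM ι 𝔤}
    (hS : ∀ z : 𝔩, along b (coadField b z) S = -⁅(cst K (z : 𝔤) : FM ι 𝔤), S⁆) (z : FM ι 𝔩) :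
    along b (coadMul b z) S = -⁅lin (incl 𝔩) z, S⁆ := by
  have h := linearMap_ext (K := K)
    (φ := bil LinearMap.id (diff b S) ∘ₗ (bil (ι := ι) (coad K 𝔩)).flip (taut b))
    (ψ := -(bil (ι := ι) (lieBilin K 𝔤 ∘ₗ incl 𝔩)).flip S) (fun v => by
      rw [LinearMap.comp_apply, LinearMap.flip_apply, bil_apply, bil_apply, ← coadMul, coadMul_cst,
        ← along, hS, LinearMap.neg_apply, LinearMap.flip_apply, bil_apply, ← mul₂_lin_left, lin_cst]
      rfl)
  exact LinearMap.congr_fun h z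

variable (𝔩) in
/-- The formal covector field `p ↦ ad*_{S_p} ξ`. -/
def coadS (S : FM ι 𝔤) (ξ : Dual K 𝔤) : FM ι (Dual K 𝔤) := lin ((coad K 𝔤).flip ξ) S

/-- The formal map `p ↦ (d_p S)* ξ`. -/
def dualS (S : FM ι 𝔤) (ξ : Dual K 𝔤) : FM ι 𝔩 := lin (contr 𝔩 ξ) (diff b S)

theorem coadMul_dualS {S : FM ι 𝔤}
    (hS : ∀ z : 𝔩, along b (coadField b z) S = -⁅(cst K (z : 𝔤) : FM ι 𝔤), S⁆) (ξ : Dual K 𝔤) :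
    coadMul b (dualS b S ξ) = -lin (restr 𝔩) (coadS S ξ) := by
  refine FM.ext fun n => LinearMap.ext fun w => ?_
  have h := congrArg (fun f : FM ι K => f n) (eval_coadMul_contr b ξ (diff b S) w)
  rw [← along, hS] at h
  refine Eq.trans h ?_
  simp only [neg_coeff, lin_coeff, lie_cst_coeff (K := K), LinearMap.neg_apply, coadS, map_neg]
  rw [← map_neg, lie_skew]
  change _ = -(ξ ⁅S n, (w : 𝔤)⁆)
  rw [← map_neg, lie_skew]

theorem dξ_eq_along {V : Type*} [AddCommGroup V] [Module K V] (ξ : Dual K 𝔤) (f : FM ι V) :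
    dξ b ξ f = along b (cst K (restr 𝔩 ξ)) f := by
  rw [along_cst_field]; rfl

theorem lin_incl_dualS (S : FM ι 𝔤) (ξ η : Dual K 𝔤) :
    lin η (lin (incl 𝔩) (dualS b S ξ)) = lin ξ (dξ b η S) := by
  ext n
  rw [lin_coeff, lin_coeff, dualS, lin_coeff, apply_incl_contr, lin_coeff, dξ_coeff]

theorem dξ_ser_smul {V : Type*} [AddCommGroup V] [Module K V] (ξ : Dual K 𝔤)
    (a : MvPowerSeries ι K) (f : FM ι V) :
    dξ b ξ (a • f) = toSer (dξ b ξ (ofSer a)) • f + a • dξ b ξ f := by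
  rw [ser_smul_def, dξ, dird_mul₂]; rfl

end FM

open FM

namespace QuasiData

/-- The derivative of the gauge action of `e^{τS}` at `τ = 0`. -/
def infGauge (G : QuasiData K 𝔤) (S : FM ι 𝔤) (l : FM ι (Dual K 𝔤 →ₗ[K] 𝔤)) :
    FM ι (Dual K 𝔤 →ₗ[K] 𝔤) :=
  mul₂ (adjAct K 𝔤) S l + lin G.cocycle S
    + lin (LinearMap.lcomp K 𝔤 (restr 𝔩)) (diff b S) - lin (trIncl 𝔩) (diff b S)

end QuasiData

namespace Double

variable {G : QuasiData K 𝔤} (hG : G.IsLieQuasiBialgebra)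

/-- The section `p ↦ l_p μ_p + μ_p` of the graph, for a formal map `μ` with values in `𝔤*`. -/
def graphMul (l : FM ι (Dual K 𝔤 →ₗ[K] 𝔤)) (μ : FM ι (Dual K 𝔤)) : FM ι (Double hG) :=
  lin (inl hG) (mul₂ LinearMap.id l μ) + lin (inr hG) μ

/-- The coordinates of a formal map with values in `𝔤*`. -/
def coords (μ : FM ι (Dual K 𝔤)) (i : Fin (finrank K (Dual K 𝔤))) : MvPowerSeries ι K :=
  toSer (lin ((finBasis K (Dual K 𝔤)).coord i) μ)

theorem graphMul_eq_sum (l : FM ι (Dual K 𝔤 →ₗ[K] 𝔤)) (μ : FM ι (Dual K 𝔤)) :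
    graphMul hG l μ = ∑ i, coords μ i • graph hG l (finBasis K (Dual K 𝔤) i) := by
  have h1 : mul₂ LinearMap.id l μ = ∑ i, coords μ i • ev (finBasis K (Dual K 𝔤) i) l := by
    conv_lhs => rw [eq_sum_basis (finBasis K (Dual K 𝔤)) μ, map_sum]
    refine Finset.sum_congr rfl fun i _ => ?_
    rw [mul₂_ser_smul_right, mul₂_cst_right]; rfl
  have h2 : lin (inr hG) μ = ∑ i, coords μ i • cst K (inr hG (finBasis K (Dual K 𝔤) i)) := by
    conv_lhs => rw [eq_sum_basis (finBasis K (Dual K 𝔤)) μ, map_sum]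
    refine Finset.sum_congr rfl fun i _ => ?_
    rw [lin_ser_smul, lin_cst]; rfl
  rw [graphMul, h1, h2, map_sum, ← Finset.sum_add_distrib]
  simp only [lin_ser_smul, graph, smul_add]

theorem along_eq_sum_coords (μ : FM ι (Dual K 𝔤)) (f : FM ι (Double hG)) :
    along b (lin (restr 𝔩) μ) f = ∑ i, coords μ i • dξ b (finBasis K (Dual K 𝔤) i) f := by
  conv_lhs => rw [eq_sum_basis (finBasis K (Dual K 𝔤)) μ, map_sum, along, map_sum]
  refine Finset.sum_congr rfl fun i _ => ?_
  rw [lin_ser_smul, lin_cst, mul₂_ser_smul_right, dξ_eq_along]; rfl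

/-- The variation of the graph under an infinitesimal gauge transformation: the bracket with `S`, a
section of the graph that cancels its component in `𝔤*`, and the variation by `dS i* - i (dS)*`. -/
theorem lin_inl_infGauge (S : FM ι 𝔤) (l : FM ι (Dual K 𝔤 →ₗ[K] 𝔤)) (ξ : Dual K 𝔤) :
    lin (inl hG) (ev ξ (G.infGauge b S l)) = ⁅lin (inl hG) S, graph hG l ξ⁆ +
      graphMul hG l (coadS S ξ) +
      lin (inl hG) (dξ b ξ S - lin (incl 𝔩) (dualS b S ξ)) := by
  rw [graph, lie_add, lie_lin_inl, lie_lin_inl_cst_inr, graphMul, coadS, lie_eq_mul₂ (K := K)]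
  have h1 : ev ξ (mul₂ (adjAct K 𝔤) S l) = mul₂ (lieBilin K 𝔤) S (ev ξ l) +
      mul₂ LinearMap.id l (lin ((coad K 𝔤).flip ξ) S) := by
    rw [← mul₂_flip LinearMap.id]
    ext n
    simp only [ev_coeff, add_coeff, mul₂_coeff, LinearMap.sum_apply, ← Finset.sum_add_distrib]
    rfl
  have h2 : ev ξ (lin (LinearMap.lcomp K 𝔤 (restr 𝔩)) (diff b S)) = dξ b ξ S := by
    ext n; rw [dξ_coeff]; rfl
  have h3 : ev ξ (lin (trIncl 𝔩) (diff b S)) = lin (incl 𝔩) (dualS b S ξ) := rfl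
  have h4 : ev ξ (lin G.cocycle S) = lin (G.cocycle.flip ξ) S := rfl
  have h5 : ev ξ (G.infGauge b S l) = ev ξ (mul₂ (adjAct K 𝔤) S l) + ev ξ (lin G.cocycle S) +
      ev ξ (lin (LinearMap.lcomp K 𝔤 (restr 𝔩)) (diff b S)) - ev ξ (lin (trIncl 𝔩) (diff b S)) := by
    rw [QuasiData.infGauge]; simp only [ev, map_sub, map_add]
  rw [h5, h1, h2, h3, h4]
  simp only [map_add, map_sub]
  abel

variable (l : FM ι (Dual K 𝔤 →ₗ[K] 𝔤))

/-- The failure of the dynamical equation for `l`. -/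
def defect (ξ η ζ : Dual K 𝔤) : FM ι K :=
  mul₂ (pair hG) (dξ b ξ (graph hG l η)) (graph hG l ζ) +
    mul₂ (pair hG) (dξ b η (graph hG l ζ)) (graph hG l ξ) +
    mul₂ (pair hG) (dξ b ζ (graph hG l ξ)) (graph hG l η) -
    mul₂ (pair hG) ⁅graph hG l ξ, graph hG l η⁆ (graph hG l ζ)

/-- The derivative of the failure of the dynamical equation when the sections of the graph vary by
`M`. -/
def defectVar (M : Dual K 𝔤 → FM ι (Double hG)) (ξ η ζ : Dual K 𝔤) : FM ι K :=
  mul₂ (pair hG) (dξ b ξ (M η)) (graph hG l ζ) + mul₂ (pair hG) (dξ b ξ (graph hG l η)) (M ζ) +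
    (mul₂ (pair hG) (dξ b η (M ζ)) (graph hG l ξ) +
      mul₂ (pair hG) (dξ b η (graph hG l ζ)) (M ξ)) +
    (mul₂ (pair hG) (dξ b ζ (M ξ)) (graph hG l η) +
      mul₂ (pair hG) (dξ b ζ (graph hG l ξ)) (M η)) -
    (mul₂ (pair hG) ⁅M ξ, graph hG l η⁆ (graph hG l ζ) +
      mul₂ (pair hG) ⁅graph hG l ξ, M η⁆ (graph hG l ζ) +
      mul₂ (pair hG) ⁅graph hG l ξ, graph hG l η⁆ (M ζ))

theorem defectVar_add (M N : Dual K 𝔤 → FM ι (Double hG)) (ξ η ζ : Dual K 𝔤) :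
    defectVar b hG l (fun ξ => M ξ + N ξ) ξ η ζ =
      defectVar b hG l M ξ η ζ + defectVar b hG l N ξ η ζ := by
  simp only [defectVar, map_add, lie_add, add_lie, LinearMap.add_apply]
  abel

variable {hG} {l}

theorem dξ_lie (ξ : Dual K 𝔤) (f g : FM ι (Double hG)) :
    dξ b ξ ⁅f, g⁆ = ⁅dξ b ξ f, g⁆ + ⁅f, dξ b ξ g⁆ := dird_lie _ _ _

theorem pair_lie_fm (f g h : FM ι (Double hG)) :
    mul₂ (pair hG) ⁅f, g⁆ h = -mul₂ (pair hG) g ⁅f, h⁆ := mul₂_lie_left _ (pair_lie hG) f g h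

theorem pair_symm_fm' (f g : FM ι (Double hG)) : mul₂ (pair hG) f g = mul₂ (pair hG) g f :=
  mul₂_symm _ (pair_symm hG) f g

theorem pair_lie_rotate (f g h : FM ι (Double hG)) :
    mul₂ (pair hG) ⁅f, g⁆ h = mul₂ (pair hG) ⁅g, h⁆ f := by
  rw [← lie_skew f g, map_neg, LinearMap.neg_apply, pair_lie_fm, neg_neg, pair_symm_fm']

/-- A bracket with a constant leaves the failure of the dynamical equation unchanged; for variable `Y`
only the derivatives of `Y` contribute. -/
theorem defectVar_lie (Y : FM ι (Double hG)) (ξ η ζ : Dual K 𝔤) :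
    defectVar b hG l (fun ξ => ⁅Y, graph hG l ξ⁆) ξ η ζ =
      mul₂ (pair hG) ⁅dξ b ξ Y, graph hG l η⁆ (graph hG l ζ) +
      mul₂ (pair hG) ⁅dξ b η Y, graph hG l ζ⁆ (graph hG l ξ) +
      mul₂ (pair hG) ⁅dξ b ζ Y, graph hG l ξ⁆ (graph hG l η) := by
  have h1 : ∀ f g : FM ι (Double hG),
      mul₂ (pair hG) f ⁅Y, g⁆ = -mul₂ (pair hG) ⁅Y, f⁆ g := by
    intro f g; rw [pair_lie_fm, neg_neg]
  have h2 : ⁅⁅Y, graph hG l ξ⁆, graph hG l η⁆ + ⁅graph hG l ξ, ⁅Y, graph hG l η⁆⁆ =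
      ⁅Y, ⁅graph hG l ξ, graph hG l η⁆⁆ := (leibniz_lie _ _ _).symm
  have h3 := congrArg (fun f => mul₂ (pair hG) f (graph hG l ζ)) h2
  simp only [map_add, LinearMap.add_apply] at h3
  simp only [defectVar, dξ_lie, map_add, LinearMap.add_apply, h1]
  linear_combination (norm := module) -h3

/-- Variation of the failure of the dynamical equation in the direction of a section of `𝔤`. -/
theorem defectVar_inl (y : Dual K 𝔤 → FM ι 𝔤) (ξ η ζ : Dual K 𝔤) :
    defectVar b hG l (fun ξ => lin (inl hG) (y ξ)) ξ η ζ =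
      lin ζ (dξ b ξ (y η)) + lin ξ (dξ b η (y ζ)) + lin η (dξ b ζ (y ξ)) -
      (mul₂ (pair hG) ⁅lin (inl hG) (y ξ), graph hG l η⁆ (graph hG l ζ) +
      mul₂ (pair hG) ⁅lin (inl hG) (y η), graph hG l ζ⁆ (graph hG l ξ) +
      mul₂ (pair hG) ⁅lin (inl hG) (y ζ), graph hG l ξ⁆ (graph hG l η)) := by
  have h1 : ∀ (ξ η : Dual K 𝔤) (f : FM ι 𝔤),
      mul₂ (pair hG) (dξ b ξ (graph hG l η)) (lin (inl hG) f) = 0 := by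
    intro ξ η f
    rw [graph, map_add, dξ_lin, dξ_cst, add_zero, pair_lin_inl_lin_inl]
  have h2 : ∀ (f : FM ι 𝔤) ζ, mul₂ (pair hG) (lin (inl hG) f) (graph hG l ζ) = lin ζ f := by
    intro f ζ
    rw [graph, map_add, pair_lin_inl_lin_inl, pair_lin_inl_cst_inr, zero_add]
  simp only [defectVar, dξ_lin, h1, h2, add_zero]
  rw [pair_lie_rotate (graph hG l ξ) (lin (inl hG) (y η)),
    ← pair_lie_rotate (lin (inl hG) (y ζ))]

/-- A reparametrization of the graph acts linearly on the failure of the dynamical equation, up to the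
derivatives along the corresponding vector fields. -/
theorem defectVar_graphMul (hl : ∀ ξ η : Dual K 𝔤, lin ξ (ev η l) = -lin η (ev ξ l))
    (μ : Dual K 𝔤 → FM ι (Dual K 𝔤)) (ξ η ζ : Dual K 𝔤) :
    defectVar b hG l (fun ξ => graphMul hG l (μ ξ)) ξ η ζ =
      ∑ i, coords (μ ξ) i • defect b hG l (finBasis K (Dual K 𝔤) i) η ζ +
      ∑ i, coords (μ η) i • defect b hG l ξ (finBasis K (Dual K 𝔤) i) ζ +
      ∑ i, coords (μ ζ) i • defect b hG l ξ η (finBasis K (Dual K 𝔤) i) -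
      (mul₂ (pair hG) (along b (lin (restr 𝔩) (μ ξ)) (graph hG l η)) (graph hG l ζ) +
      mul₂ (pair hG) (along b (lin (restr 𝔩) (μ η)) (graph hG l ζ)) (graph hG l ξ) +
      mul₂ (pair hG) (along b (lin (restr 𝔩) (μ ζ)) (graph hG l ξ)) (graph hG l η)) := by
  have hiso := pair_graph (hG := hG) hl
  have h1 : ∀ (α : Dual K 𝔤) (ν : FM ι (Dual K 𝔤)) (β : Dual K 𝔤),
      mul₂ (pair hG) (dξ b α (graphMul hG l ν)) (graph hG l β) =
      ∑ i, coords ν i • mul₂ (pair hG) (dξ b α (graph hG l (finBasis K (Dual K 𝔤) i)))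
        (graph hG l β) := by
    intro α ν β
    rw [graphMul_eq_sum, map_sum, map_sum, LinearMap.sum_apply]
    refine Finset.sum_congr rfl fun i _ => ?_
    rw [dξ_ser_smul, map_add, LinearMap.add_apply, mul₂_ser_smul_left, mul₂_ser_smul_left, hiso,
      smul_zero, zero_add]
  have h2 : ∀ (ν : FM ι (Dual K 𝔤)) (f : FM ι (Double hG)), mul₂ (pair hG) f (graphMul hG l ν) =
      ∑ i, coords ν i • mul₂ (pair hG) f (graph hG l (finBasis K (Dual K 𝔤) i)) := by
    intro ν f
    rw [graphMul_eq_sum, map_sum]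
    simp only [mul₂_ser_smul_right]
  have h3 : ∀ (ν : FM ι (Dual K 𝔤)) (f g : FM ι (Double hG)),
      mul₂ (pair hG) ⁅graphMul hG l ν, f⁆ g =
      ∑ i, coords ν i • mul₂ (pair hG) ⁅graph hG l (finBasis K (Dual K 𝔤) i), f⁆ g := by
    intro ν f g
    rw [pair_lie_rotate, pair_symm_fm', pair_symm_fm', h2]
    refine Finset.sum_congr rfl fun i _ => ?_
    rw [← pair_lie_rotate]
  have h4 : ∀ (ν : FM ι (Dual K 𝔤)) (f g : FM ι (Double hG)),
      mul₂ (pair hG) (along b (lin (restr 𝔩) ν) f) g =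
      ∑ i, coords ν i • mul₂ (pair hG) (dξ b (finBasis K (Dual K 𝔤) i) f) g := by
    intro ν f g
    rw [along_eq_sum_coords, map_sum, LinearMap.sum_apply]
    simp only [mul₂_ser_smul_left]
  have h5 : ∀ (ν : FM ι (Dual K 𝔤)) (f g : FM ι (Double hG)),
      mul₂ (pair hG) ⁅f, graphMul hG l ν⁆ g =
      ∑ i, coords ν i • mul₂ (pair hG) ⁅f, graph hG l (finBasis K (Dual K 𝔤) i)⁆ g := by
    intro ν f g
    rw [pair_lie_rotate, h3]
    refine Finset.sum_congr rfl fun i _ => ?_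
    rw [← pair_lie_rotate]
  simp only [defectVar, defect, h1, h2, h3, h4, h5, smul_add, smul_sub, Finset.sum_add_distrib,
    Finset.sum_sub_distrib]
  abel

/-- Equivariance of `l`, for variable elements of `𝔩`, in the form used here. -/
theorem pair_equivariant (hl : ∀ ξ η : Dual K 𝔤, lin ξ (ev η l) = -lin η (ev ξ l))
    (he : ∀ z : 𝔩, along b (coadField b z) l + cst K (G.cocycle z) + lin (adjAct K 𝔤 (z : 𝔤)) l = 0)
    (z : FM ι 𝔩) (ξ η : Dual K 𝔤) :
    mul₂ (pair hG) ⁅lin (inl hG) (lin (incl 𝔩) z), graph hG l ξ⁆ (graph hG l η) =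
      -mul₂ (pair hG) (along b (coadMul b z) (graph hG l ξ)) (graph hG l η) := by
  have h := linearMap_ext (K := K)
    (φ := (bil (ι := ι) (pair hG)).flip (graph hG l η) ∘ₗ
      (bil (ι := ι) (lieBilin K (Double hG) ∘ₗ inl hG ∘ₗ incl 𝔩)).flip (graph hG l ξ))
    (ψ := -((bil (ι := ι) (pair hG)).flip (graph hG l η) ∘ₗ
      bil LinearMap.id (diff b (graph hG l ξ)) ∘ₗ (bil (ι := ι) (coad K 𝔩)).flip (taut b)))
    (fun v => by
      have e1 : ⁅(cst K (inl hG (v : 𝔤)) : FM ι (Double hG)), graph hG l ξ⁆ +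
          along b (coadField b v) (graph hG l ξ) = -graph hG l (coad K 𝔤 (v : 𝔤) ξ) := by
        have h2 := congrArg (ev ξ) (he v)
        simp only [ev_add, ev_cst] at h2
        have h3 : ev ξ (lin (adjAct K 𝔤 (v : 𝔤)) l) =
            lin (lieBilin K 𝔤 v) (ev ξ l) + ev (coad K 𝔤 (v : 𝔤) ξ) l := rfl
        have h4 : ev ξ (0 : FM ι (Dual K 𝔤 →ₗ[K] 𝔤)) = 0 := rfl
        have h5 : ⁅(cst K (inl hG (v : 𝔤)) : FM ι (Double hG)), lin (inl hG) (ev ξ l)⁆ =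
            lin (inl hG) (lin (lieBilin K 𝔤 v) (ev ξ l)) := by
          ext n; rw [lie_cst_coeff (K := K)]; exact lie_inl_inl hG _ _
        have h6 : along b (coadField b v) (ev ξ l) = ev ξ (along b (coadField b v) l) :=
          along_lin b _ _ _
        rw [graph, lie_add, h5, along_add, along_cst, along_lin, h6, lie_cst_cst, lie_inl_inr, graph]
        rw [h3, h4] at h2
        have h7 := congrArg (lin (inl hG)) h2
        simp only [map_add, lin_cst, map_zero] at h7
        simp only [map_sub]
        linear_combination (norm := module) h7
      have e2 := congrArg (fun f => mul₂ (pair hG) f (graph hG l η)) e1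
      simp only [map_add, map_neg, LinearMap.add_apply, LinearMap.neg_apply,
        pair_graph (hG := hG) hl, neg_zero] at e2
      change mul₂ (pair hG) (mul₂ (lieBilin K (Double hG)) (lin (inl hG ∘ₗ incl 𝔩) (cst K v))
          (graph hG l ξ)) (graph hG l η) = -mul₂ (pair hG) (mul₂ LinearMap.id
          (diff b (graph hG l ξ)) (mul₂ (coad K 𝔩) (cst K v) (taut b))) (graph hG l η)
      rw [← coadMul, coadMul_cst, ← along, lin_cst]
      exact eq_neg_of_add_eq_zero_left e2)
  exact LinearMap.congr_fun h z

/-- Under an infinitesimal gauge transformation, the failure of the dynamical equation changes by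
the coadjoint action. -/
theorem defectVar_infGauge {S : FM ι 𝔤}
    (hS : ∀ z : 𝔩, along b (coadField b z) S = -⁅(cst K (z : 𝔤) : FM ι 𝔤), S⁆)
    (hl : ∀ ξ η : Dual K 𝔤, lin ξ (ev η l) = -lin η (ev ξ l))
    (he : ∀ z : 𝔩, along b (coadField b z) l + cst K (G.cocycle z) + lin (adjAct K 𝔤 (z : 𝔤)) l = 0)
    (ξ η ζ : Dual K 𝔤) :
    defectVar b hG l (fun ξ => lin (inl hG) (ev ξ (G.infGauge b S l))) ξ η ζ =
      ∑ i, coords (coadS S ξ) i • defect b hG l (finBasis K (Dual K 𝔤) i) η ζ +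
      ∑ i, coords (coadS S η) i • defect b hG l ξ (finBasis K (Dual K 𝔤) i) ζ +
      ∑ i, coords (coadS S ζ) i • defect b hG l ξ η (finBasis K (Dual K 𝔤) i) := by
  simp only [lin_inl_infGauge, defectVar_add, defectVar_lie, defectVar_inl,
    defectVar_graphMul b hl]
  -- equivariance of `l` and of `S` turns the term with `(dS)* ξ ∈ 𝔩` into the derivative along
  -- the vector field `i* ad*_S ξ`
  have h1 : ∀ ξ η ζ, mul₂ (pair hG) ⁅lin (inl hG) (dξ b ξ S - lin (incl 𝔩) (dualS b S ξ)),
      graph hG l η⁆ (graph hG l ζ) =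
      mul₂ (pair hG) ⁅dξ b ξ (lin (inl hG) S), graph hG l η⁆ (graph hG l ζ) -
        mul₂ (pair hG) (along b (lin (restr 𝔩) (coadS S ξ)) (graph hG l η)) (graph hG l ζ) := by
    intro ξ η ζ
    rw [map_sub, sub_lie, map_sub, LinearMap.sub_apply, pair_equivariant b hl he, coadMul_dualS b hS,
      along_field_neg, map_neg, LinearMap.neg_apply, neg_neg, dξ_lin]
  -- the second derivatives of `S` cancel in the cyclic sum
  have h2 : ∀ ξ η ζ, lin ζ (dξ b ξ (dξ b η S - lin (incl 𝔩) (dualS b S η))) =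
      lin ζ (dξ b ξ (dξ b η S)) - lin η (dξ b ξ (dξ b ζ S)) := by
    intro ξ η ζ
    rw [map_sub, map_sub, ← dξ_lin, ← dξ_lin, ← dξ_lin, lin_incl_dualS, dξ_lin, dξ_lin, dξ_lin]
  have h3 : ∀ ξ η : Dual K 𝔤, dξ b ξ (dξ b η S) = dξ b η (dξ b ξ S) := fun ξ η => dird_comm _ _ _
  rw [h1, h1, h1, h2, h2, h2, h3 η ξ, h3 ζ η, h3 ζ ξ]
  abel

/-- Infinitesimal gauge transformations preserve skew-symmetry. -/
theorem pair_infGauge (S : FM ι 𝔤) (ξ η : Dual K 𝔤) :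
    mul₂ (pair hG) (lin (inl hG) (ev ξ (G.infGauge b S l))) (graph hG l η) +
      mul₂ (pair hG) (graph hG l ξ) (lin (inl hG) (ev η (G.infGauge b S l))) =
      ∑ i, coords (coadS S ξ) i •
        mul₂ (pair hG) (graph hG l (finBasis K (Dual K 𝔤) i)) (graph hG l η) +
      ∑ i, coords (coadS S η) i •
        mul₂ (pair hG) (graph hG l ξ) (graph hG l (finBasis K (Dual K 𝔤) i)) := by
  have h2 : ∀ (f : FM ι 𝔤) ζ, mul₂ (pair hG) (lin (inl hG) f) (graph hG l ζ) = lin ζ f := by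
    intro f ζ
    rw [graph, map_add, pair_lin_inl_lin_inl, pair_lin_inl_cst_inr, zero_add]
  rw [lin_inl_infGauge, lin_inl_infGauge, graphMul_eq_sum, graphMul_eq_sum]
  simp only [map_add, LinearMap.add_apply, map_sum, LinearMap.sum_apply, mul₂_ser_smul_left,
    mul₂_ser_smul_right]
  rw [pair_symm_fm' (graph hG l ξ) (lin (inl hG) _), h2, h2, pair_lie_fm]
  simp only [map_sub, lin_incl_dualS]
  abel

end Double

end Infinitesimal

/-! ### Formal maps depending differentiably on a parameter -/

section Parameter

variable {K : Type*} [RCLike K] {ι : Type*} [Fintype ι] [DecidableEq ι]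
  {V W Z : Type*} [AddCommGroup V] [Module K V] [AddCommGroup W] [Module K W]
  [AddCommGroup Z] [Module K Z]

namespace FM

/-- `f'` is the derivative of the family `f` of formal maps, coefficient by coefficient and through
all linear functionals. -/
def HasD (f f' : K → FM ι V) : Prop :=
  ∀ (n : ι →₀ ℕ) (φ : Dual K V) (t : K), HasDerivAt (fun τ => φ (f τ n)) (φ (f' t n)) t

namespace HasD

variable {f f' g g' : K → FM ι V}

theorem const (f : FM ι V) : HasD (fun _ : K => f) (fun _ => 0) := fun n φ t => by
  simpa using hasDerivAt_const t (φ (f n))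

theorem add (hf : HasD f f') (hg : HasD g g') : HasD (fun τ => f τ + g τ) (fun τ => f' τ + g' τ) :=
  fun n φ t => by simpa using (hf n φ t).fun_add (hg n φ t)

theorem sub (hf : HasD f f') (hg : HasD g g') : HasD (fun τ => f τ - g τ) (fun τ => f' τ - g' τ) :=
  fun n φ t => by simpa using (hf n φ t).fun_sub (hg n φ t)

theorem lin (L : V →ₗ[K] W) (hf : HasD f f') :
    HasD (fun τ => FM.lin L (f τ)) (fun τ => FM.lin L (f' τ)) :=
  fun n φ t => hf n (φ ∘ₗ L) t

theorem mul₂ [FiniteDimensional K V] (B : V →ₗ[K] W →ₗ[K] Z) {h h' : K → FM ι W} (hf : HasD f f')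
    (hh : HasD h h') : HasD (fun τ => FM.mul₂ B (f τ) (h τ))
      (fun τ => FM.mul₂ B (f' τ) (h τ) + FM.mul₂ B (f τ) (h' τ)) := fun n φ t => by
  set e := finBasis K V
  have key : ∀ (v : V) (w : W), φ (B v w) = ∑ i, e.coord i v * φ (B (e i) w) := by
    intro v w
    have h := congrArg (fun v => φ (B v w)) (e.sum_repr v)
    simp only [map_sum, map_smul, LinearMap.sum_apply, LinearMap.smul_apply, smul_eq_mul] at h
    exact h.symm
  simp only [mul₂_coeff, add_coeff, map_add, map_sum, ← Finset.sum_add_distrib]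
  refine HasDerivAt.fun_sum fun q _ => ?_
  have h1 : (fun τ => φ (B (f τ q.1) (h τ q.2))) =
      fun τ => ∑ i, e.coord i (f τ q.1) * φ (B (e i) (h τ q.2)) := funext fun τ => key _ _
  rw [h1, key, key, ← Finset.sum_add_distrib]
  refine HasDerivAt.fun_sum fun i _ => ?_
  exact (hf q.1 (e.coord i) t).mul (hh q.2 (φ ∘ₗ B (e i)) t)

theorem dird (α : ι → K) (hf : HasD f f') :
    HasD (fun τ => FM.dird α (f τ)) (fun τ => FM.dird α (f' τ)) := fun n φ t => by
  simp only [dird_apply, sum_coeff, smul_coeff, pd_coeff, map_sum, map_smul, smul_eq_mul]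
  refine HasDerivAt.fun_sum fun j _ => HasDerivAt.const_mul _ (HasDerivAt.const_mul _ ?_)
  exact hf _ φ t

theorem ser {T : End K (FM ι V)} (hT : Raises T)
    (hTD : ∀ g g' : K → FM ι V, HasD g g' → HasD (fun τ => T (g τ)) (fun τ => T (g' τ)))
    {c c' : K → PowerSeries K}
    (hc : ∀ k t, HasDerivAt (fun τ => PowerSeries.coeff k (c τ)) (PowerSeries.coeff k (c' t)) t)
    (hf : HasD f f') : HasD (fun τ => FM.ser T (c τ) (f τ))
      (fun τ => FM.ser T (c' τ) (f τ) + FM.ser T (c τ) (f' τ)) := fun n φ t => by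
  have hpow : ∀ k, HasD (fun τ => (T ^ k) (f τ)) (fun τ => (T ^ k) (f' τ)) := by
    intro k
    induction k with
    | zero => exact hf
    | succ k ih => simpa only [pow_succ', Module.End.mul_apply] using hTD _ _ ih
  simp only [add_coeff, ser_coeff_sum hT _ _ n (Nat.lt_succ_self _), map_add, map_sum, map_smul,
    smul_eq_mul, ← Finset.sum_add_distrib]
  refine HasDerivAt.fun_sum fun k _ => ?_
  exact (hc k t).mul (hpow k n φ t)

end HasD

/-- A family of formal maps that vanishes at one parameter vanishes identically if its derivative
vanishes to higher order than the family itself. -/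
theorem eq_zero_of_hasD [FiniteDimensional K V] {X : Type*} {f f' : X → K → FM ι V}
    (h : ∀ x, HasD (f x) (f' x)) (h0 : ∀ x, f x 0 = 0)
    (hv : ∀ k, (∀ x t, Vanish k (f x t)) → ∀ x t, Vanish (k + 1) (f' x t)) (x : X) (t : K) :
    f x t = 0 := by
  have key : ∀ k, ∀ x t, Vanish k (f x t) := by
    intro k
    induction k with
    | zero => exact fun x t => vanish_zero _
    | succ k ih =>
      intro x t n hn
      have h1 := hv k ih
      have h2 : ∀ (φ : Dual K V), φ (f x t n) = φ (f x 0 n) := fun φ => by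
        refine is_const_of_deriv_eq_zero (𝕜 := K) (f := fun τ => φ (f x τ n)) (fun τ => ?_)
          (fun τ => ?_) t 0
        · exact (h x n φ τ).differentiableAt
        · rw [(h x n φ τ).deriv, h1 x τ n hn, map_zero]
      rw [← Module.forall_dual_apply_eq_zero_iff K]
      intro φ
      rw [h2, h0, zero_coeff, map_zero]
  exact FM.ext fun n => key (n.degree + 1) x t n (Nat.lt_succ_self _)

/-- The series `e^{τz}`. -/
def expTau (τ : K) : PowerSeries K := PowerSeries.mk fun k => τ ^ k * ((k.factorial : K))⁻¹

/-- The series `(e^{τz} - 1) / z`. -/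
def expSubTau (τ : K) : PowerSeries K :=
  PowerSeries.mk fun k => τ ^ (k + 1) * (((k + 1).factorial : K))⁻¹

theorem X_mul_expSubTau (τ : K) : PowerSeries.X * expSubTau τ = expTau τ - 1 := by
  ext k
  cases k with
  | zero => simp [expTau]
  | succ k =>
    rw [PowerSeries.coeff_succ_X_mul, map_sub, PowerSeries.coeff_one, if_neg k.succ_ne_zero, expTau,
      expSubTau, PowerSeries.coeff_mk, PowerSeries.coeff_mk, sub_zero]

theorem hasDerivAt_aux (k : ℕ) (t : K) : HasDerivAt
    (fun τ : K => τ ^ (k + 1) * (((k + 1).factorial : K))⁻¹) (t ^ k * ((k.factorial : K))⁻¹) t := by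
  have h := (hasDerivAt_pow (k + 1) t).mul_const ((((k + 1).factorial : K))⁻¹)
  refine h.congr_deriv ?_
  have h1 : ((k.factorial : ℕ) : K) ≠ 0 := by exact_mod_cast k.factorial_ne_zero
  have h2 : (k : K) + 1 ≠ 0 := by exact_mod_cast k.succ_ne_zero
  rw [Nat.factorial_succ]
  push_cast
  field_simp

theorem hasDerivAt_expTau (k : ℕ) (t : K) : HasDerivAt
    (fun τ => PowerSeries.coeff k (expTau τ)) (PowerSeries.coeff k (PowerSeries.X * expTau t)) t := by
  cases k with
  | zero => simpa [expTau] using hasDerivAt_const t (1 : K)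
  | succ k =>
    simp only [PowerSeries.coeff_succ_X_mul, expTau, PowerSeries.coeff_mk]
    exact hasDerivAt_aux k t

theorem hasDerivAt_expSubTau (k : ℕ) (t : K) : HasDerivAt
    (fun τ => PowerSeries.coeff k (expSubTau τ)) (PowerSeries.coeff k (expTau t)) t := by
  simp only [expTau, expSubTau, PowerSeries.coeff_mk]
  exact hasDerivAt_aux k t

theorem expTau_one : expTau (1 : K) = expS K := by
  ext k; simp [expTau, expS, expCoeff]

theorem expSubTau_one : expSubTau (1 : K) = PowerSeries.mk (expSubOneDivCoeff K) := by
  ext k; simp [expSubTau, expSubOneDivCoeff]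

theorem expTau_zero : expTau (0 : K) = 1 := by
  ext k
  rw [expTau, PowerSeries.coeff_mk, PowerSeries.coeff_one]
  cases k <;> simp

theorem expSubTau_zero : expSubTau (0 : K) = 0 := by
  ext k; simp [expSubTau]

theorem hasD_mul₂_const [FiniteDimensional K W] (B : W →ₗ[K] End K V) (S : FM ι W)
    (g g' : K → FM ι V) (h : HasD g g') :
    HasD (fun τ => mul₂ (B : W →ₗ[K] V →ₗ[K] V) S (g τ))
      (fun τ => mul₂ (B : W →ₗ[K] V →ₗ[K] V) S (g' τ)) := by
  have := (HasD.const S).mul₂ (B : W →ₗ[K] V →ₗ[K] V) h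
  simpa using this

end FM

end Parameter

/-! ### The one-parameter family of gauge transformations -/

section Invariance

variable {K : Type*} [RCLike K] {𝔤 : Type*} [LieRing 𝔤] [LieAlgebra K 𝔤]
  [FiniteDimensional K 𝔤]
  {ι : Type*} [Fintype ι] [DecidableEq ι] {𝔩 : LieSubalgebra K 𝔤} (b : Basis ι K 𝔩)
  {V W : Type*} [AddCommGroup V] [Module K V] [AddCommGroup W] [Module K W]

namespace FM

/-- The operators of multiplication by `S`, for two pointwise commuting actions, commute. -/
theorem mul₂_comm {B C : 𝔤 →ₗ[K] End K V} (h : ∀ x y v, B x (C y v) = C y (B x v)) (S : FM ι 𝔤)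
    (f : FM ι V) :
    mul₂ (B : 𝔤 →ₗ[K] V →ₗ[K] V) S (mul₂ (C : 𝔤 →ₗ[K] V →ₗ[K] V) S f) =
      mul₂ (C : 𝔤 →ₗ[K] V →ₗ[K] V) S (mul₂ (B : 𝔤 →ₗ[K] V →ₗ[K] V) S f) := by
  have h1 : ∀ x : 𝔤, ∀ g : FM ι V, lin (B x) (mul₂ (C : 𝔤 →ₗ[K] V →ₗ[K] V) S g) =
      mul₂ (C : 𝔤 →ₗ[K] V →ₗ[K] V) S (lin (B x) g) := by
    intro x g
    rw [lin_mul₂, mul₂_lin_right]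
    exact mul₂_congr (fun y v => h x y v) _ _
  have h2 := linearMap_ext (K := K)
    (φ := (bil (ι := ι) (B : 𝔤 →ₗ[K] V →ₗ[K] V)).flip (mul₂ (C : 𝔤 →ₗ[K] V →ₗ[K] V) S f))
    (ψ := bil (ι := ι) (C : 𝔤 →ₗ[K] V →ₗ[K] V) S ∘ₗ
      (bil (ι := ι) (B : 𝔤 →ₗ[K] V →ₗ[K] V)).flip f) (fun x => by
      change mul₂ (B : 𝔤 →ₗ[K] V →ₗ[K] V) (cst K x) _ =
        mul₂ (C : 𝔤 →ₗ[K] V →ₗ[K] V) S (mul₂ (B : 𝔤 →ₗ[K] V →ₗ[K] V) (cst K x) f)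
      rw [mul₂_cst_left, mul₂_cst_left, h1])
  exact LinearMap.congr_fun h2 S

/-- Composition of linear maps into `𝔤` with the adjoint action. -/
abbrev adLeft (K : Type*) [Field K] (W 𝔤 : Type*) [AddCommGroup W] [Module K W] [LieRing 𝔤]
    [LieAlgebra K 𝔤] : 𝔤 →ₗ[K] End K (W →ₗ[K] 𝔤) := LinearMap.llcomp K W 𝔤 𝔤 ∘ₗ lieBilin K 𝔤

/-- Composition of linear maps from `𝔤*` with the coadjoint action. -/
abbrev coadRight (K : Type*) [Field K] (𝔤 : Type*) [LieRing 𝔤] [LieAlgebra K 𝔤] :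
    𝔤 →ₗ[K] End K (Dual K 𝔤 →ₗ[K] 𝔤) :=
  (LinearMap.llcomp K (Dual K 𝔤) (Dual K 𝔤) 𝔤).flip ∘ₗ coad K 𝔤

/-- The operator on formal maps given by the action of `S`. -/
def opS (B : 𝔤 →ₗ[K] End K V) (S : FM ι 𝔤) : End K (FM ι V) := mul₂ (B : 𝔤 →ₗ[K] V →ₗ[K] V) S

/-- Adjointness with respect to a pairing passes to formal maps. -/
theorem opS_adjoint {Z : Type*} [AddCommGroup Z] [Module K Z] {B : V →ₗ[K] W →ₗ[K] Z}
    {C : 𝔤 →ₗ[K] End K V} {D : 𝔤 →ₗ[K] End K W} (h : ∀ x v w, B (C x v) w = B v (D x w))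
    (S : FM ι 𝔤) (f : FM ι V) (g : FM ι W) : mul₂ B (opS C S f) g = mul₂ B f (opS D S g) := by
  have h2 := linearMap_ext (K := K)
    (φ := (bil (ι := ι) B).flip g ∘ₗ (bil (ι := ι) (C : 𝔤 →ₗ[K] V →ₗ[K] V)).flip f)
    (ψ := bil (ι := ι) B f ∘ₗ (bil (ι := ι) (D : 𝔤 →ₗ[K] W →ₗ[K] W)).flip g) (fun x => by
      change mul₂ B (mul₂ (C : 𝔤 →ₗ[K] V →ₗ[K] V) (cst K x) f) g =
        mul₂ B f (mul₂ (D : 𝔤 →ₗ[K] W →ₗ[K] W) (cst K x) g)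
      rw [mul₂_cst_left, mul₂_cst_left, mul₂_lin_left, mul₂_lin_right]
      exact mul₂_congr (fun v w => h x v w) _ _)
  exact LinearMap.congr_fun h2 S

theorem raises_opS (B : 𝔤 →ₗ[K] End K V) {S : FM ι 𝔤} (hS : S 0 = 0) : Raises (opS B S) :=
  raises_mul₂ B hS

theorem opS_adjAct (S : FM ι 𝔤) (f : FM ι (Dual K 𝔤 →ₗ[K] 𝔤)) :
    opS (adjAct K 𝔤) S f = opS (adLeft K (Dual K 𝔤) 𝔤) S f + opS (coadRight K 𝔤) S f := by
  ext1 n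
  simp only [opS, add_coeff, mul₂_coeff, ← Finset.sum_add_distrib]
  rfl

theorem opS_adLeft_coadRight (S : FM ι 𝔤) (f : FM ι (Dual K 𝔤 →ₗ[K] 𝔤)) :
    opS (adLeft K (Dual K 𝔤) 𝔤) S (opS (coadRight K 𝔤) S f) =
      opS (coadRight K 𝔤) S (opS (adLeft K (Dual K 𝔤) 𝔤) S f) :=
  mul₂_comm (fun _ _ _ => rfl) S f

theorem lcomp_opS (S : FM ι 𝔤) (A : FM ι (Dual K 𝔩 →ₗ[K] 𝔤)) :
    lin (LinearMap.lcomp K 𝔤 (restr 𝔩)) (opS (adLeft K (Dual K 𝔩) 𝔤) S A) =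
      opS (adLeft K (Dual K 𝔤) 𝔤) S (lin (LinearMap.lcomp K 𝔤 (restr 𝔩)) A) := by
  rw [opS, opS, lin_mul₂, mul₂_lin_right]
  exact mul₂_congr (fun _ _ => rfl) _ _

theorem opS_trIncl (S : FM ι 𝔤) (A : FM ι (Dual K 𝔩 →ₗ[K] 𝔤)) :
    opS (coadRight K 𝔤) S (lin (trIncl 𝔩) A) =
      lin (trIncl 𝔩) (opS (adLeft K (Dual K 𝔩) 𝔤) S A) := by
  rw [opS, opS, lin_mul₂, mul₂_lin_right]
  exact mul₂_congr (fun _ _ => rfl) _ _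

theorem ser_zero (T : End K (FM ι V)) : ser T (0 : PowerSeries K) = 0 := by
  simpa using ser_smul T 0 0

theorem apply_ser_expSubTau {T : End K (FM ι V)} (hT : Raises T) (τ : K) (f : FM ι V) :
    T (ser T (expSubTau τ) f) = ser T (expTau τ) f - f := by
  have h : ∀ g, T g = ser T PowerSeries.X g := fun g => by rw [ser_X hT]
  rw [h, ser_comp_apply hT, X_mul_expSubTau, ser_sub, ser_one]
  rfl

theorem ser_X_mul {T : End K (FM ι V)} (hT : Raises T) (c : PowerSeries K) (f : FM ι V) :
    ser T (PowerSeries.X * c) f = T (ser T c f) := by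
  rw [← ser_comp_apply hT, ser_X hT]

/-- Integrated equivariance of `S`: the coadjoint action of `e^{τS}` on constants. -/
theorem restr_exp_coad {S : FM ι 𝔤} (hS0 : S 0 = 0)
    (hS : ∀ z : 𝔩, along b (coadField b z) S = -⁅(cst K (z : 𝔤) : FM ι 𝔤), S⁆) (τ : K)
    (ξ : Dual K 𝔤) :
    lin (restr 𝔩) (ser (opS (coad K 𝔤) S) (expTau τ) (cst K ξ)) =
      cst K (restr 𝔩 ξ) - coadMul b (lin (contr 𝔩 ξ)
        (ser (opS (adLeft K (Dual K 𝔩) 𝔤) S) (expSubTau τ) (diff b S))) := by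
  set A := ser (opS (adLeft K (Dual K 𝔩) 𝔤) S) (expSubTau τ) (diff b S)
  set Tad := opS (LieAlgebra.ad K 𝔤 : 𝔤 →ₗ[K] End K 𝔤) S
  have hTad : Raises Tad := raises_opS _ hS0
  refine FM.ext fun n => LinearMap.ext fun w => ?_
  have h1 : lin (Dual.eval K 𝔤 (w : 𝔤)) (ser (opS (coad K 𝔤) S) (expTau τ) (cst K ξ)) =
      lin ξ (ser Tad (expTau τ) (cst K (w : 𝔤))) := by
    have h := ser_adjoint (T := opS (coad K 𝔤) S) (T' := Tad) (raises_opS _ hS0) hTad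
      (LinearMap.id : Dual K 𝔤 →ₗ[K] 𝔤 →ₗ[K] K) (fun f g => opS_adjoint (fun _ _ _ => rfl) S f g)
      (expTau τ) (cst K ξ) (cst K (w : 𝔤))
    rw [mul₂_cst_left, mul₂_cst_right] at h
    exact h
  have h2 : mul₂ LinearMap.id A (coadField b w) =
      ser Tad (expTau τ) (cst K (w : 𝔤)) - cst K (w : 𝔤) := by
    have h := ser_intertwine (T := opS (adLeft K (Dual K 𝔩) 𝔤) S) (T' := Tad) (raises_opS _ hS0) hTad
      (Φ := (mul₂ (LinearMap.id : (Dual K 𝔩 →ₗ[K] 𝔤) →ₗ[K] Dual K 𝔩 →ₗ[K] 𝔤)).flip (coadField b w))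
      (isLocal_mul₂_right _ _) (fun f => by
        exact mul₂_assoc (fun _ _ _ => rfl) _ _ _) (expSubTau τ) (diff b S)
    rw [LinearMap.flip_apply, LinearMap.flip_apply, ← along, hS] at h
    refine h.trans ?_
    rw [lie_skew]
    have h3 : ⁅S, (cst K (w : 𝔤) : FM ι 𝔤)⁆ = Tad (cst K (w : 𝔤)) := rfl
    rw [h3]
    have h4 : ser Tad (expSubTau τ) (Tad (cst K (w : 𝔤))) =
        Tad (ser Tad (expSubTau τ) (cst K (w : 𝔤))) := by
      rw [← ser_X_mul hTad, mul_comm, ← ser_comp_apply hTad, ser_X hTad]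
    rw [h4, apply_ser_expSubTau hTad]
  have h5 := congrArg (fun f : FM ι K => f n) (eval_coadMul_contr b ξ A w)
  rw [h2] at h5
  have h6 := congrArg (fun f : FM ι K => f n) h1
  simp only [lin_coeff, neg_coeff, sub_coeff, Dual.eval_apply, map_sub] at h5 h6
  rw [sub_coeff, LinearMap.sub_apply, h5, lin_coeff]
  have h7 : ξ ((cst K (w : 𝔤) : FM ι 𝔤) n) = (cst K (restr 𝔩 ξ) : FM ι (Dual K 𝔩)) n w := by
    rw [cst_coeff, cst_coeff]; split_ifs
    · rfl
    · simp
  rw [← h7]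
  refine h6.trans ?_
  ring

/-- Precomposition with a power series of the coadjoint action, evaluated at `ξ`. -/
theorem ev_opS_coadRight (S : FM ι 𝔤) (hS0 : S 0 = 0) (c : PowerSeries K)
    (f : FM ι (Dual K 𝔤 →ₗ[K] 𝔤)) (ξ : Dual K 𝔤) :
    ev ξ (ser (opS (coadRight K 𝔤) S) c f) =
      mul₂ LinearMap.id f (ser (opS (coad K 𝔤) S) c (cst K ξ)) := by
  rw [← ser_adjoint (T := opS (coadRight K 𝔤) S) (raises_opS _ hS0) (raises_opS _ hS0)
    (LinearMap.id : (Dual K 𝔤 →ₗ[K] 𝔤) →ₗ[K] Dual K 𝔤 →ₗ[K] 𝔤) (fun f g => opS_adjoint (fun _ _ _ => rfl) S f g) c f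
    (cst K ξ), mul₂_cst_right]
  rfl

/-- The gauge transform of `l` by `e^{τS}`. -/
def gaugeFlow (G : QuasiData K 𝔤) (S : FM ι 𝔤) (l : FM ι (Dual K 𝔤 →ₗ[K] 𝔤)) (τ : K) :
    FM ι (Dual K 𝔤 →ₗ[K] 𝔤) :=
  ser (opS (adjAct K 𝔤) S) (expTau τ) l +
    (ser (opS (coadRight K 𝔤) S) (expTau τ) (lin (LinearMap.lcomp K 𝔤 (restr 𝔩))
      (ser (opS (adLeft K (Dual K 𝔩) 𝔤) S) (expSubTau τ) (diff b S))) -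
      lin (trIncl 𝔩) (ser (opS (adLeft K (Dual K 𝔩) 𝔤) S) (expSubTau τ) (diff b S))) +
    ser (opS (adjAct K 𝔤) S) (expSubTau τ) (lin G.cocycle S)

theorem gaugeFlow_zero (G : QuasiData K 𝔤) (S : FM ι 𝔤) (l : FM ι (Dual K 𝔤 →ₗ[K] 𝔤)) :
    gaugeFlow b G S l 0 = l := by
  simp [gaugeFlow, expTau_zero, expSubTau_zero, ser_one, ser_zero]

theorem gaugeFlow_one (G : QuasiData K 𝔤) {S : FM ι 𝔤} (hS0 : S 0 = 0)
    (l : FM ι (Dual K 𝔤 →ₗ[K] 𝔤)) :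
    gaugeFlow b G S l 1 = ⟨G.gaugeTransform b S.toFun l.toFun⟩ := by
  have hA : FM.mk (logDeriv b S.toFun) =
      ser (opS (adLeft K (Dual K 𝔩) 𝔤) S) (expSubTau 1) (diff b S) := by
    rw [expSubTau_one]
    exact opSeries_eq_ser _ _ _ _ hS0
  have h1 : FM.mk (FormalMap.opSeries (expCoeff K) (adjAct K 𝔤) S.toFun l.toFun) =
      ser (opS (adjAct K 𝔤) S) (expTau 1) l := by
    rw [expTau_one]
    exact opSeries_eq_ser _ _ _ _ hS0
  have h2 : FM.mk (G.gaugePi S.toFun) =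
      ser (opS (adjAct K 𝔤) S) (expSubTau 1) (lin G.cocycle S) := by
    rw [expSubTau_one]
    exact opSeries_eq_ser _ _ _ _ hS0
  have h3 : FM.mk (FormalMap.opSeries (expCoeff K) (coadRight K 𝔤) S.toFun
      (fun n => logDeriv b S.toFun n ∘ₗ restr 𝔩)) =
      ser (opS (coadRight K 𝔤) S) (expTau 1) (lin (LinearMap.lcomp K 𝔤 (restr 𝔩))
        (FM.mk (logDeriv b S.toFun))) := by
    rw [expTau_one]
    exact opSeries_eq_ser _ _ _ _ hS0
  rw [gaugeFlow, ← hA, ← h1, ← h2, ← h3]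
  rfl

/-- The gauge transforms by `e^{τS}` solve the differential equation given by infinitesimal gauge
transformations. -/
theorem hasD_gaugeFlow (G : QuasiData K 𝔤) {S : FM ι 𝔤} (hS0 : S 0 = 0)
    (hS : ∀ z : 𝔩, along b (coadField b z) S = -⁅(cst K (z : 𝔤) : FM ι 𝔤), S⁆)
    (l : FM ι (Dual K 𝔤 →ₗ[K] 𝔤)) :
    HasD (gaugeFlow b G S l) (fun τ => G.infGauge b S (gaugeFlow b G S l τ)) := by
  have hT : Raises (opS (adjAct K 𝔤) S) := raises_opS _ hS0
  have hTL : Raises (opS (adLeft K (Dual K 𝔩) 𝔤) S) := raises_opS _ hS0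
  have hTR : Raises (opS (coadRight K 𝔤) S) := raises_opS _ hS0
  have hTL1 : Raises (opS (adLeft K (Dual K 𝔤) 𝔤) S) := raises_opS _ hS0
  have d1 := HasD.ser hT (hasD_mul₂_const (adjAct K 𝔤) S) hasDerivAt_expTau (HasD.const l)
  have d2 := HasD.ser hT (hasD_mul₂_const (adjAct K 𝔤) S) hasDerivAt_expSubTau
    (HasD.const (lin G.cocycle S))
  have dA := HasD.ser hTL (hasD_mul₂_const (adLeft K (Dual K 𝔩) 𝔤) S) hasDerivAt_expSubTau
    (HasD.const (diff b S))
  have d3 := HasD.ser hTR (hasD_mul₂_const (coadRight K 𝔤) S) hasDerivAt_expTau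
    (dA.lin (LinearMap.lcomp K 𝔤 (restr 𝔩)))
  have d4 := (d1.add (d3.sub (dA.lin (trIncl 𝔩)))).add d2
  refine (congrArg (HasD (gaugeFlow b G S l)) (funext fun τ => ?_)).mp d4
  simp only [map_zero, add_zero]
  -- `dS i* Ad*_{e^{τS}} = dS i* - [S, i A*]`, by the equivariance of `S`
  have key : ser (opS (coadRight K 𝔤) S) (expTau τ)
        (lin (LinearMap.lcomp K 𝔤 (restr 𝔩)) (diff b S)) =
      lin (LinearMap.lcomp K 𝔤 (restr 𝔩)) (diff b S) - opS (adLeft K (Dual K 𝔤) 𝔤) S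
        (lin (trIncl 𝔩) (ser (opS (adLeft K (Dual K 𝔩) 𝔤) S) (expSubTau τ) (diff b S))) := by
    refine ext_ev fun ξ => ?_
    rw [ev_opS_coadRight S hS0]
    set A := ser (opS (adLeft K (Dual K 𝔩) 𝔤) S) (expSubTau τ) (diff b S)
    have e1 : ∀ g : FM ι (Dual K 𝔤), mul₂ LinearMap.id
        (lin (LinearMap.lcomp K 𝔤 (restr 𝔩)) (diff b S)) g = along b (lin (restr 𝔩) g) S :=
      fun g => mul₂_congr (fun _ _ => rfl) _ _
    rw [e1, restr_exp_coad b hS0 hS, sub_eq_add_neg, along_field_add, along_field_neg,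
      along_coadMul b hS]
    have e2 : along b (cst K (restr 𝔩 ξ)) S =
        ev ξ (lin (LinearMap.lcomp K 𝔤 (restr 𝔩)) (diff b S)) := mul₂_cst_right _ _ _
    have e3 : ⁅S, lin (incl 𝔩) (lin (contr 𝔩 ξ) A)⁆ =
        ev ξ (opS (adLeft K (Dual K 𝔤) 𝔤) S (lin (trIncl 𝔩) A)) := by
      rw [opS, ev, lin_mul₂, mul₂_lin_right, lie_eq_mul₂ (K := K), mul₂_lin_right, mul₂_lin_right]
      exact mul₂_congr (fun _ _ => rfl) _ _
    rw [e2, neg_neg, ← lie_skew, e3, ← sub_eq_add_neg]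
    exact (map_sub (lin _) _ _).symm
  have hc : ∀ f, opS (adLeft K (Dual K 𝔤) 𝔤) S (ser (opS (coadRight K 𝔤) S) (expTau τ) f) =
      ser (opS (coadRight K 𝔤) S) (expTau τ) (opS (adLeft K (Dual K 𝔤) 𝔤) S f) := fun f =>
    ser_intertwine hTR hTR (isLocal_mul₂_left _ _) (opS_adLeft_coadRight S) _ f
  have k1 := apply_ser_expSubTau hTL τ (diff b S)
  have k2 := apply_ser_expSubTau hT τ (lin G.cocycle S)
  rw [ser_X_mul hT, ser_X_mul hTR]
  rw [QuasiData.infGauge, gaugeFlow]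
  change _ = opS (adjAct K 𝔤) S _ + _ + _ - _
  set A := ser (opS (adLeft K (Dual K 𝔩) 𝔤) S) (expSubTau τ) (diff b S)
  set AE := ser (opS (adLeft K (Dual K 𝔩) 𝔤) S) (expTau τ) (diff b S)
  rw [map_add, map_add, k2, map_sub, opS_adjAct S (ser (opS (coadRight K 𝔤) S) (expTau τ) _),
    opS_adjAct S (lin (trIncl 𝔩) _), opS_trIncl, hc, ← lcomp_opS, k1, map_sub, map_sub, map_sub, key]
  abel

end FM

end Invariance

/-! ### Gauge transformations preserve dynamical `ℓ`-matrices -/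

section GaugeInvariance

variable {K : Type*} [RCLike K] {𝔤 : Type*} [LieRing 𝔤] [LieAlgebra K 𝔤]
  [FiniteDimensional K 𝔤]
  {ι : Type*} [Fintype ι] [DecidableEq ι] {𝔩 : LieSubalgebra K 𝔤} (b : Basis ι K 𝔩)
  {V W : Type*} [AddCommGroup V] [Module K V] [AddCommGroup W] [Module K W]

namespace FM

/-- The infinitesimal action of `z ∈ 𝔩` on formal maps with values in a space on which `z` acts
by `ρ`. A formal map is equivariant if it is annihilated for every `z`. -/
def eqv (z : 𝔩) (ρ : End K V) : FM ι V →ₗ[K] FM ι V :=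
  (mul₂ LinearMap.id).flip (coadField b z) ∘ₗ
    { toFun := diff b
      map_add' := fun f g => by
        refine FM.ext fun n => LinearMap.ext fun α => ?_
        simp [diff_coeff_apply, Finset.sum_add_distrib]
      map_smul' := fun c f => by
        refine FM.ext fun n => LinearMap.ext fun α => ?_
        simp [diff_coeff_apply, Finset.smul_sum, smul_comm c] } + lin ρ

theorem eqv_apply (z : 𝔩) (ρ : End K V) (f : FM ι V) :
    eqv b z ρ f = along b (coadField b z) f + lin ρ f := rfl

theorem isLocal_eqv (z : 𝔩) (ρ : End K V) : IsLocal (eqv b z ρ : FM ι V →ₗ[K] FM ι V) :=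
  fun k f hf => by
    rw [eqv_apply]
    exact (along_vanish b (coadField_zero b z) hf).add (isLocal_lin ρ k f hf)

theorem eqv_lin (z : 𝔩) {ρ : End K V} {ρ' : End K W} {N : V →ₗ[K] W} (h : ∀ v, ρ' (N v) = N (ρ v))
    (f : FM ι V) : eqv b z ρ' (lin N f) = lin N (eqv b z ρ f) := by
  rw [eqv_apply, eqv_apply, along_lin, map_add]
  congr 1
  exact FM.ext fun n => h (f n)

/-- The operators given by an equivariant `S` commute with the action of `𝔩`. -/
theorem eqv_opS {S : FM ι 𝔤}
    (hS : ∀ z : 𝔩, along b (coadField b z) S = -⁅(cst K (z : 𝔤) : FM ι 𝔤), S⁆)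
    {z : 𝔩} {ρ : End K V} {B : 𝔤 →ₗ[K] End K V}
    (h : ∀ x v, ρ (B x v) = B ⁅(z : 𝔤), x⁆ v + B x (ρ v)) (f : FM ι V) :
    eqv b z ρ (opS B S f) = opS B S (eqv b z ρ f) := by
  have h1 : lin ρ (opS B S f) = opS B ⁅(cst K (z : 𝔤) : FM ι 𝔤), S⁆ f + opS B S (lin ρ f) := by
    ext n
    change ρ (mul₂ (B : 𝔤 →ₗ[K] V →ₗ[K] V) S f n) =
      mul₂ (B : 𝔤 →ₗ[K] V →ₗ[K] V) ⁅(cst K (z : 𝔤) : FM ι 𝔤), S⁆ f n +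
        mul₂ (B : 𝔤 →ₗ[K] V →ₗ[K] V) S (lin ρ f) n
    rw [mul₂_coeff, mul₂_coeff, mul₂_coeff, map_sum,
      ← Finset.sum_add_distrib]
    refine Finset.sum_congr rfl fun q _ => ?_
    rw [lie_cst_coeff (K := K), lin_coeff]
    exact h _ _
  have h2 : along b (coadField b z) (opS B S f) =
      -opS B ⁅(cst K (z : 𝔤) : FM ι 𝔤), S⁆ f + opS B S (along b (coadField b z) f) := by
    rw [opS, along_mul₂, hS, map_neg, LinearMap.neg_apply, opS]
  rw [eqv_apply, eqv_apply, h1, map_add, h2]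
  abel

/-- Power series of the operators given by an equivariant `S` commute with the action of `𝔩`. -/
theorem eqv_ser {S : FM ι 𝔤} (hS0 : S 0 = 0)
    (hS : ∀ z : 𝔩, along b (coadField b z) S = -⁅(cst K (z : 𝔤) : FM ι 𝔤), S⁆)
    {z : 𝔩} {ρ : End K V} {B : 𝔤 →ₗ[K] End K V}
    (h : ∀ x v, ρ (B x v) = B ⁅(z : 𝔤), x⁆ v + B x (ρ v)) (c : PowerSeries K) (f : FM ι V) :
    eqv b z ρ (ser (opS B S) c f) = ser (opS B S) c (eqv b z ρ f) :=
  ser_intertwine (raises_opS B hS0) (raises_opS B hS0) (isLocal_eqv b z ρ)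
    (eqv_opS b hS h) c f

/-- The action of `z ∈ 𝔩` on linear maps from `𝔩*` to `𝔤`. -/
def adjActSub (z : 𝔩) : End K (Dual K 𝔩 →ₗ[K] 𝔤) :=
  LinearMap.llcomp K (Dual K 𝔩) 𝔤 𝔤 (lieBilin K 𝔤 z) +
    (LinearMap.llcomp K (Dual K 𝔩) (Dual K 𝔩) 𝔤).flip (coad K 𝔩 z)

theorem adjActSub_apply (z : 𝔩) (A : Dual K 𝔩 →ₗ[K] 𝔤) (α : Dual K 𝔩) :
    adjActSub z A α = ⁅(z : 𝔤), A α⁆ + A (coad K 𝔩 z α) := rfl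

/-- The differential of an equivariant map is equivariant. -/
theorem eqv_diff (z : 𝔩) (ρ : End K 𝔤) (hρ : ρ = lieBilin K 𝔤 z) (S : FM ι 𝔤) :
    eqv b z (adjActSub z) (diff b S) = diff b (eqv b z ρ S) := by
  subst hρ
  refine ext_ev fun α => ?_
  have h1 : ∀ f : FM ι 𝔤, ev α (diff b f) = dird (fun j => α (b j)) f := fun f => by
    rw [← along_cst_field b]; exact (mul₂_cst_right LinearMap.id (diff b f) α).symm
  have h2 : ev α (eqv b z (adjActSub z) (diff b S)) =
      along b (coadField b z) (ev α (diff b S)) + (lin (lieBilin K 𝔤 z) (ev α (diff b S)) +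
        along b (cst K (coad K 𝔩 z α)) S) := by
    rw [eqv_apply, ev_add, ev, ← along_lin, along_cst_field]
    congr 1
    refine FM.ext fun n => ?_
    rw [add_coeff, ← along_cst_field, along, mul₂_cst_right]
    rfl
  rw [h2, h1, h1, eqv_apply, map_add, dird_along, dird_lin, coadField, dird_lin, taut_eq,
    dird_linFam, lin_cst]
  have h3 : ∑ j, α (b j) • b.coord j = α := by
    refine b.ext fun i => ?_
    simp
  rw [h3]
  abel

/-- Gauge transformations preserve equivariance: the terms with `A` are equivariant, and the failures of
`Ad l Ad*` and of the group cocycle to be so add up to `-ϖ_z`. -/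
theorem eqv_gaugeFlow {G : QuasiData K 𝔤} (hG : G.IsLieQuasiBialgebra) {S : FM ι 𝔤}
    (hS0 : S 0 = 0)
    (hS : ∀ z : 𝔩, along b (coadField b z) S = -⁅(cst K (z : 𝔤) : FM ι 𝔤), S⁆)
    {l : FM ι (Dual K 𝔤 →ₗ[K] 𝔤)}
    (he : ∀ z : 𝔩, along b (coadField b z) l + cst K (G.cocycle z) + lin (adjAct K 𝔤 (z : 𝔤)) l = 0)
    (τ : K) (z : 𝔩) :
    along b (coadField b z) (gaugeFlow b G S l τ) + cst K (G.cocycle z) +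
      lin (adjAct K 𝔤 (z : 𝔤)) (gaugeFlow b G S l τ) = 0 := by
  -- the actions on the spaces of linear maps, and the maps between these spaces, are equivariant
  have a1 : ∀ (x : 𝔤) (T : Dual K 𝔤 →ₗ[K] 𝔤), adjAct K 𝔤 (z : 𝔤) (adjAct K 𝔤 x T) =
      adjAct K 𝔤 ⁅(z : 𝔤), x⁆ T + adjAct K 𝔤 x (adjAct K 𝔤 (z : 𝔤) T) := by
    intro x T; rw [adjAct_lie]; abel
  have a2 : ∀ (x : 𝔤) (T : Dual K 𝔤 →ₗ[K] 𝔤), adjAct K 𝔤 (z : 𝔤) (coadRight K 𝔤 x T) =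
      coadRight K 𝔤 ⁅(z : 𝔤), x⁆ T + coadRight K 𝔤 x (adjAct K 𝔤 (z : 𝔤) T) := by
    intro x T
    refine LinearMap.ext fun ξ => ?_
    rw [LinearMap.add_apply, adjAct_apply_apply]
    change ⁅(z : 𝔤), T (coad K 𝔤 x ξ)⁆ + T (coad K 𝔤 x (coad K 𝔤 z ξ)) =
      T (coad K 𝔤 ⁅(z : 𝔤), x⁆ ξ) + adjAct K 𝔤 (z : 𝔤) T (coad K 𝔤 x ξ)
    rw [adjAct_apply_apply, coad_lie, map_sub]
    abel
  have a3 : ∀ (x : 𝔤) (A : Dual K 𝔩 →ₗ[K] 𝔤), adjActSub z (adLeft K (Dual K 𝔩) 𝔤 x A) =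
      adLeft K (Dual K 𝔩) 𝔤 ⁅(z : 𝔤), x⁆ A + adLeft K (Dual K 𝔩) 𝔤 x (adjActSub z A) := by
    intro x A
    refine LinearMap.ext fun α => ?_
    change ⁅(z : 𝔤), ⁅x, A α⁆⁆ + ⁅x, A (coad K 𝔩 z α)⁆ =
      ⁅⁅(z : 𝔤), x⁆, A α⁆ + ⁅x, ⁅(z : 𝔤), A α⁆ + A (coad K 𝔩 z α)⁆
    rw [lie_add, leibniz_lie (z : 𝔤) x (A α)]
    abel
  have c1 : ∀ A : Dual K 𝔩 →ₗ[K] 𝔤, adjAct K 𝔤 (z : 𝔤) (LinearMap.lcomp K 𝔤 (restr 𝔩) A) =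
      LinearMap.lcomp K 𝔤 (restr 𝔩) (adjActSub z A) := by
    intro A
    refine LinearMap.ext fun ξ => ?_
    rw [adjAct_apply_apply]
    rfl
  have c2 : ∀ A : Dual K 𝔩 →ₗ[K] 𝔤, adjAct K 𝔤 (z : 𝔤) (trIncl 𝔩 A) =
      trIncl 𝔩 (adjActSub z A) := by
    intro A
    refine LinearMap.ext fun ξ => ext_dual (K := K) fun η => ?_
    rw [adjAct_apply_apply, map_add, trIncl_apply, trIncl_apply, trIncl_apply, apply_incl_contr,
      apply_incl_contr, adjActSub_apply, ← coad_apply_apply, apply_incl_contr, map_add, add_comm]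
    rfl
  have hdS : eqv b z (adjActSub z) (diff b S) = 0 := by
    rw [eqv_diff b z _ rfl, eqv_apply, hS z]
    have : lin (lieBilin K 𝔤 z) S = ⁅(cst K (z : 𝔤) : FM ι 𝔤), S⁆ := by
      rw [lie_eq_mul₂ (K := K), mul₂_cst_left]
    rw [this, neg_add_cancel]
    exact FM.ext fun n => LinearMap.ext fun α => by simp [diff_coeff_apply]
  have hA := eqv_ser b hS0 hS a3 (expSubTau τ) (diff b S)
  rw [hdS, map_zero] at hA
  have hl : eqv b z (adjAct K 𝔤 (z : 𝔤)) l = -cst K (G.cocycle z) := by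
    rw [eqv_apply]; linear_combination (norm := module) he z
  -- by the cocycle condition, `ϖ_S` fails to be equivariant by `S · ϖ_z`
  have hϖ : eqv b z (adjAct K 𝔤 (z : 𝔤)) (lin G.cocycle S) =
      opS (adjAct K 𝔤) S (cst K (G.cocycle z)) := by
    rw [eqv_apply, along_lin, hS]
    ext1 n
    rw [opS, mul₂_cst_right]
    simp only [add_coeff, lin_coeff, neg_coeff, lie_cst_coeff (K := K), map_neg, hG.cocycle_lie,
      LinearMap.flip_apply]
    abel
  have key : eqv b z (adjAct K 𝔤 (z : 𝔤)) (gaugeFlow b G S l τ) = -cst K (G.cocycle z) := by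
    have hT : Raises (opS (adjAct K 𝔤) S) := raises_opS _ hS0
    rw [gaugeFlow, map_add, map_add, map_sub, eqv_ser b hS0 hS a1, eqv_ser b hS0 hS a1,
      eqv_ser b hS0 hS a2, eqv_lin b z c1, eqv_lin b z c2, hA, hl, hϖ]
    have h4 : ser (opS (adjAct K 𝔤) S) (expSubTau τ) (opS (adjAct K 𝔤) S (cst K (G.cocycle z))) =
        opS (adjAct K 𝔤) S (ser (opS (adjAct K 𝔤) S) (expSubTau τ) (cst K (G.cocycle z))) := by
      rw [← ser_X_mul hT, mul_comm, ← ser_comp_apply hT, ser_X hT]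
    rw [h4, apply_ser_expSubTau hT]
    simp only [map_zero, map_neg]
    abel
  rw [eqv_apply] at key
  linear_combination (norm := module) key

end FM

open FM

namespace Double

variable {G : QuasiData K 𝔤} {hG : G.IsLieQuasiBialgebra}

theorem hasD_graph {l l' : K → FM ι (Dual K 𝔤 →ₗ[K] 𝔤)} (h : HasD l l') (ξ : Dual K 𝔤) :
    HasD (fun τ => graph hG (l τ) ξ) (fun τ => lin (inl hG) (ev ξ (l' τ))) := by
  have := ((h.lin (LinearMap.applyₗ ξ)).lin (inl hG)).add (HasD.const (cst K (inr hG ξ)))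
  simp only [add_zero] at this
  exact this

theorem vanish_coords {S : FM ι 𝔤} (hS0 : S 0 = 0) (ξ : Dual K 𝔤) (i) :
    Vanish 1 (ofSer (coords (coadS S ξ) i)) := vanish_one (by
  change (finBasis K (Dual K 𝔤)).coord i (coad K 𝔤 (S 0) ξ) = 0
  rw [hS0]; simp)

/-- The graph stays isotropic along the gauge flow: its pairings satisfy a linear differential equation
with coefficients that vanish at the origin. -/
theorem pair_graph_gaugeFlow {S : FM ι 𝔤} (hS0 : S 0 = 0)
    (hS : ∀ z : 𝔩, along b (coadField b z) S = -⁅(cst K (z : 𝔤) : FM ι 𝔤), S⁆)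
    {l : FM ι (Dual K 𝔤 →ₗ[K] 𝔤)} (hl : ∀ ξ η : Dual K 𝔤, lin ξ (ev η l) = -lin η (ev ξ l))
    (τ : K) (ξ η : Dual K 𝔤) :
    mul₂ (pair hG) (graph hG (gaugeFlow b G S l τ) ξ) (graph hG (gaugeFlow b G S l τ) η) = 0 := by
  have hd := hasD_gaugeFlow b G hS0 hS l
  refine eq_zero_of_hasD (X := Dual K 𝔤 × Dual K 𝔤)
    (f := fun x τ => mul₂ (pair hG) (graph hG (gaugeFlow b G S l τ) x.1)
      (graph hG (gaugeFlow b G S l τ) x.2)) (fun x => (hasD_graph hd x.1).mul₂ (pair hG)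
        (hasD_graph hd x.2)) (fun x => ?_) (fun k hk x t => ?_) (ξ, η) τ
  · simp only [gaugeFlow_zero]
    exact pair_graph hl _ _
  · rw [pair_infGauge]
    refine Vanish.add (Vanish.sum _ fun i _ => ?_) (Vanish.sum _ fun i _ => ?_)
    · rw [add_comm k]
      exact ser_smul_vanish (vanish_coords hS0 _ _) (hk (_, _) t)
    · rw [add_comm k]
      exact ser_smul_vanish (vanish_coords hS0 _ _) (hk (_, _) t)

/-- The derivative of the failure of the dynamical equation, by the Leibniz rule. -/
theorem hasD_defect {l l' : K → FM ι (Dual K 𝔤 →ₗ[K] 𝔤)} (h : HasD l l') (ξ η ζ : Dual K 𝔤) :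
    HasD (fun τ => defect b hG (l τ) ξ η ζ)
      (fun τ => defectVar b hG (l τ) (fun ξ => lin (inl hG) (ev ξ (l' τ))) ξ η ζ) := by
  have hd : ∀ ξ η, HasD (fun τ => dξ b ξ (graph hG (l τ) η))
      (fun τ => dξ b ξ (lin (inl hG) (ev η (l' τ)))) := fun ξ η => (hasD_graph h η).dird _
  have h1 : ∀ ξ η ζ, HasD (fun τ => mul₂ (pair hG) (dξ b ξ (graph hG (l τ) η)) (graph hG (l τ) ζ))
      (fun τ => mul₂ (pair hG) (dξ b ξ (lin (inl hG) (ev η (l' τ)))) (graph hG (l τ) ζ) +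
        mul₂ (pair hG) (dξ b ξ (graph hG (l τ) η)) (lin (inl hG) (ev ζ (l' τ)))) :=
    fun ξ η ζ => (hd ξ η).mul₂ (pair hG) (hasD_graph h ζ)
  have h2 : HasD (fun τ => ⁅graph hG (l τ) ξ, graph hG (l τ) η⁆)
      (fun τ => ⁅lin (inl hG) (ev ξ (l' τ)), graph hG (l τ) η⁆ +
        ⁅graph hG (l τ) ξ, lin (inl hG) (ev η (l' τ))⁆) :=
    (hasD_graph h ξ).mul₂ (lieBilin K (Double hG)) (hasD_graph h η)
  have h3 := h2.mul₂ (pair hG) (hasD_graph h ζ)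
  have h4 := (((h1 ξ η ζ).add (h1 η ζ ξ)).add (h1 ζ ξ η)).sub h3
  simp only [map_add, LinearMap.add_apply] at h4
  exact h4

/-- The dynamical equation persists along the gauge flow: its failure satisfies a linear differential
equation with coefficients that vanish at the origin. -/
theorem defect_gaugeFlow {S : FM ι 𝔤} (hS0 : S 0 = 0)
    (hS : ∀ z : 𝔩, along b (coadField b z) S = -⁅(cst K (z : 𝔤) : FM ι 𝔤), S⁆)
    {l : FM ι (Dual K 𝔤 →ₗ[K] 𝔤)} (hl : ∀ ξ η : Dual K 𝔤, lin ξ (ev η l) = -lin η (ev ξ l))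
    (he : ∀ z : 𝔩, along b (coadField b z) l + cst K (G.cocycle z) + lin (adjAct K 𝔤 (z : 𝔤)) l = 0)
    (h0 : ∀ ξ η ζ, defect b hG l ξ η ζ = 0) (τ : K) (ξ η ζ : Dual K 𝔤) :
    defect b hG (gaugeFlow b G S l τ) ξ η ζ = 0 := by
  have hd := hasD_gaugeFlow b G hS0 hS l
  refine eq_zero_of_hasD (X := Dual K 𝔤 × Dual K 𝔤 × Dual K 𝔤)
    (f := fun x τ => defect b hG (gaugeFlow b G S l τ) x.1 x.2.1 x.2.2)
    (fun x => hasD_defect b hd x.1 x.2.1 x.2.2) (fun x => ?_) (fun k hk x t => ?_) (ξ, η, ζ) τ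
  · simp only [gaugeFlow_zero]
    exact h0 _ _ _
  · have hsk := skew_of_pair_graph (hG := hG) (pair_graph_gaugeFlow b hS0 hS hl t)
    have hev := eqv_gaugeFlow b hG hS0 hS he t
    have h1 := defectVar_infGauge (hG := hG) b hS hsk hev x.1 x.2.1 x.2.2
    rw [h1]
    have hs : ∀ (μ : Dual K 𝔤) (D : Fin (finrank K (Dual K 𝔤)) → FM ι K), (∀ i, Vanish k (D i)) →
        Vanish (k + 1) (∑ i, coords (coadS S μ) i • D i) := fun μ D hD =>
      Vanish.sum _ fun i _ => by
        rw [add_comm k]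
        exact ser_smul_vanish (vanish_coords hS0 μ i) (hD i)
    have hk' : ∀ ξ η ζ, Vanish k (defect b hG (gaugeFlow b G S l t) ξ η ζ) := fun ξ η ζ =>
      hk (ξ, η, ζ) t
    exact ((hs _ _ fun i => hk' _ _ _).add (hs _ _ fun i => hk' _ _ _)).add
      (hs _ _ fun i => hk' _ _ _)

end Double

namespace QuasiData

variable {G : QuasiData K 𝔤}

theorem isFormalDynl_iff_defect (hG : G.IsLieQuasiBialgebra) (l : FM ι (Dual K 𝔤 →ₗ[K] 𝔤)) :
    G.IsFormalDynl b l.toFun ↔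
    (∀ ξ η : Dual K 𝔤, lin ξ (ev η l) = -lin η (ev ξ l)) ∧
    (∀ ξ η ζ : Dual K 𝔤, Double.defect b hG l ξ η ζ = 0) ∧
    ∀ z : 𝔩, along b (coadField b z) l + cst K (G.cocycle z) + lin (adjAct K 𝔤 (z : 𝔤)) l = 0 := by
  rw [isFormalDynl_iff]
  refine and_congr_right fun h1 => and_congr_left fun _ => forall₃_congr fun ξ η ζ => ?_
  have h2 := Double.cycl_graph (hG := hG) (l := l) b ξ η ζ
  rw [← sub_eq_zero, h2, Double.defect]

theorem isFormalDynl_gaugeFlow (hG : G.IsLieQuasiBialgebra) {S : FM ι 𝔤} (hS0 : S 0 = 0)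
    (hS : ∀ z : 𝔩, along b (coadField b z) S = -⁅(cst K (z : 𝔤) : FM ι 𝔤), S⁆)
    {l : FM ι (Dual K 𝔤 →ₗ[K] 𝔤)} (hl : G.IsFormalDynl b l.toFun) (τ : K) :
    G.IsFormalDynl b (gaugeFlow b G S l τ).toFun := by
  rw [isFormalDynl_iff_defect b hG] at hl ⊢
  obtain ⟨h1, h2, h3⟩ := hl
  exact ⟨Double.skew_of_pair_graph (hG := hG) (Double.pair_graph_gaugeFlow b hS0 hS h1 τ),
    Double.defect_gaugeFlow b hS0 hS h1 h3 h2 τ, eqv_gaugeFlow b hG hS0 hS h3 τ⟩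

/-- Gauge transformations map formal dynamical `ℓ`-matrices to formal dynamical `ℓ`-matrices. -/
theorem IsFormalDynl.gaugeTransform (hG : G.IsLieQuasiBialgebra) {S : FormalMap ι 𝔤}
    (hS : IsGaugeExponent b S) {l : FormalMap ι (Dual K 𝔤 →ₗ[K] 𝔤)} (hl : G.IsFormalDynl b l) :
    G.IsFormalDynl b (G.gaugeTransform b S l) := by
  obtain ⟨hS0, hSe⟩ := (isGaugeExponent_iff b S).1 hS
  have h1 := isFormalDynl_gaugeFlow b hG (S := ⟨S⟩) (l := ⟨l⟩) hS0 hSe hl 1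
  rw [gaugeFlow_one b G (S := ⟨S⟩) hS0 ⟨l⟩] at h1
  exact h1

end QuasiData

end GaugeInvariance

/-! ### Gauge transformations to leading order -/

section Perturbation

variable {K : Type*} [RCLike K] {𝔤 : Type*} [LieRing 𝔤] [LieAlgebra K 𝔤]
  [FiniteDimensional K 𝔤]
  {ι : Type*} [Fintype ι] [DecidableEq ι] {𝔩 : LieSubalgebra K 𝔤} (b : Basis ι K 𝔩)
  {V W : Type*} [AddCommGroup V] [Module K V] [AddCommGroup W] [Module K W]

namespace FM

theorem Vanish.neg {k : ℕ} {f : FM ι V} (hf : Vanish k f) : Vanish k (-f) := fun n hn => by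
  rw [neg_coeff, hf n hn, neg_zero]

theorem Vanish.sub {k : ℕ} {f g : FM ι V} (hf : Vanish k f) (hg : Vanish k g) :
    Vanish k (f - g) := by
  rw [sub_eq_add_neg]; exact hf.add hg.neg

/-- A sequence of formal maps whose successive differences vanish to increasing order has a
limit. -/
theorem exists_limit {P : ℕ → FM ι V → Prop} {S₀ : FM ι V} (h₀ : P 0 S₀)
    (step : ∀ k S, P k S → ∃ S', P (k + 1) S' ∧ Vanish (k + 2) (S' - S)) :
    ∃ S, ∀ k, ∃ S', P k S' ∧ Vanish (k + 2) (S - S') := by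
  choose! F hF using step
  set s : ℕ → FM ι V := fun k => Nat.rec S₀ F k
  have hs : ∀ k, P k (s k) := by
    intro k
    induction k with
    | zero => exact h₀
    | succ k ih => exact (hF k _ ih).1
  have hd : ∀ k, Vanish (k + 2) (s (k + 1) - s k) := fun k => (hF k _ (hs k)).2
  have hm : ∀ m k, Vanish (k + 2) (s (k + m) - s k) := by
    intro m
    induction m with
    | zero => intro k n _; simp
    | succ m ih =>
      intro k
      have h1 := ((hd (k + m)).mono (by omega : k + 2 ≤ k + m + 2)).add (ih k)
      rwa [sub_add_sub_cancel] at h1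
  refine ⟨⟨fun n => s n.degree n⟩, fun k => ⟨s k, hs k, fun n hn => ?_⟩⟩
  rw [sub_coeff, mk_apply, sub_eq_zero]
  rcases le_total n.degree k with h | h
  · obtain ⟨m, rfl⟩ := Nat.exists_eq_add_of_le h
    have := hm m n.degree n (by omega)
    rw [sub_coeff, sub_eq_zero] at this
    exact this.symm
  · obtain ⟨m, hm'⟩ := Nat.exists_eq_add_of_le h
    have := hm m k n hn
    rw [sub_coeff, sub_eq_zero] at this
    rw [hm']; exact this

/-- The leading term of a power series of operators. -/
theorem ser_sub_vanish {T : End K (FM ι V)} (hT : Raises T) {c : PowerSeries K}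
    (hc : PowerSeries.coeff 0 c = 1) {k : ℕ} {f : FM ι V} (hf : Vanish k f) :
    Vanish (k + 1) (ser T c f - f) := fun n hn => by
  rw [sub_coeff, ser_coeff_sum hT _ _ n (Nat.lt_succ_self _), Finset.sum_range_succ', hc]
  rw [Finset.sum_eq_zero fun i _ => ?_]
  · simp
  · rw [hT.pow (i + 1) k f hf n (by omega), smul_zero]

theorem opS_pow_sub_vanish (B : 𝔤 →ₗ[K] End K V) {S S' : FM ι 𝔤} (hS' : S' 0 = 0) {k : ℕ}
    (h : Vanish k (S' - S)) (f : FM ι V) (i : ℕ) :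
    Vanish k ((opS B S' ^ i) f - (opS B S ^ i) f) := by
  induction i with
  | zero => intro n _; simp
  | succ i ih =>
    have h1 : (opS B S' ^ (i + 1)) f - (opS B S ^ (i + 1)) f =
        opS B S' ((opS B S' ^ i) f - (opS B S ^ i) f) + opS B (S' - S) ((opS B S ^ i) f) := by
      rw [pow_succ', pow_succ', Module.End.mul_apply, Module.End.mul_apply, map_sub]
      simp only [opS, map_sub, LinearMap.sub_apply]
      abel
    rw [h1]
    exact ((raises_opS B hS' k _ ih).mono (Nat.le_succ k)).add
      (h.mul₂ (B : 𝔤 →ₗ[K] V →ₗ[K] V) (vanish_zero _))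

theorem ser_opS_sub_vanish (B : 𝔤 →ₗ[K] End K V) {S S' : FM ι 𝔤} (hS : S 0 = 0) (hS' : S' 0 = 0)
    {k : ℕ} (h : Vanish k (S' - S)) (c : PowerSeries K) (f : FM ι V) :
    Vanish k (ser (opS B S') c f - ser (opS B S) c f) := fun n hn => by
  rw [sub_coeff, ser_coeff_sum (raises_opS B hS') _ _ n (Nat.lt_succ_self _),
    ser_coeff_sum (raises_opS B hS) _ _ n (Nat.lt_succ_self _), ← Finset.sum_sub_distrib]
  refine Finset.sum_eq_zero fun i _ => ?_
  have := opS_pow_sub_vanish B hS' h f i n hn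
  rw [sub_coeff] at this
  rw [← smul_sub, this, smul_zero]

theorem diff_sub (f g : FM ι V) : diff b (f - g) = diff b f - diff b g :=
  FM.ext fun n => LinearMap.ext fun α => by
    simp [diff_coeff_apply, smul_sub, Finset.sum_sub_distrib]

theorem diff_zero : diff b (0 : FM ι V) = 0 :=
  FM.ext fun n => LinearMap.ext fun α => by simp [diff_coeff_apply]

theorem diff_vanish {k : ℕ} {f : FM ι V} (hf : Vanish (k + 1) f) : Vanish k (diff b f) :=
  fun n hn => LinearMap.ext fun α => by
    rw [diff_coeff_apply, LinearMap.zero_apply]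
    exact Finset.sum_eq_zero fun j _ => by rw [pd_vanish hf j n hn, smul_zero]

/-- The map `Σ ↦ dΣ i* - i (dΣ)*`, the linear part of the gauge action. -/
def linGauge (S : FM ι 𝔤) : FM ι (Dual K 𝔤 →ₗ[K] 𝔤) :=
  lin (LinearMap.lcomp K 𝔤 (restr 𝔩)) (diff b S) - lin (trIncl 𝔩) (diff b S)

theorem coeff_zero_expTau_one : PowerSeries.coeff 0 (expTau (1 : K)) = 1 := by simp [expTau]

theorem coeff_zero_expSubTau_one : PowerSeries.coeff 0 (expSubTau (1 : K)) = 1 := by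
  simp [expSubTau]

/-- A change of the gauge parameter in degree `> k` changes the gauge transform in degree `≤ k` by
the linear part of the action. -/
theorem gaugeFlow_perturb (G : QuasiData K 𝔤) {S S' : FM ι 𝔤} (hS : S 0 = 0) (hS' : S' 0 = 0)
    {k : ℕ} (h : Vanish (k + 1) (S' - S)) (l : FM ι (Dual K 𝔤 →ₗ[K] 𝔤)) :
    Vanish (k + 1) (gaugeFlow b G S' l 1 - gaugeFlow b G S l 1 - linGauge b (S' - S)) := by
  have t1 := ser_opS_sub_vanish (adjAct K 𝔤) hS hS' h (expTau 1) l
  have t4 : Vanish (k + 1) (ser (opS (adjAct K 𝔤) S') (expSubTau 1) (lin G.cocycle S') -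
      ser (opS (adjAct K 𝔤) S) (expSubTau 1) (lin G.cocycle S)) := by
    have h1 := (isLocal_ser (raises_opS (adjAct K 𝔤) hS') (expSubTau 1) _ _
      (isLocal_lin G.cocycle _ _ h)).add
      (ser_opS_sub_vanish (adjAct K 𝔤) hS hS' h (expSubTau 1) (lin G.cocycle S))
    rw [map_sub, map_sub, sub_add_sub_cancel] at h1
    exact h1
  have hd := diff_vanish b h
  have tA := (ser_sub_vanish (raises_opS (adLeft K (Dual K 𝔩) 𝔤) hS') coeff_zero_expSubTau_one
    hd).add (ser_opS_sub_vanish (adLeft K (Dual K 𝔩) 𝔤) hS hS' h (expSubTau 1) (diff b S))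
  rw [diff_sub, map_sub, ← diff_sub] at tA
  rw [gaugeFlow, gaugeFlow, linGauge]
  set A' := ser (opS (adLeft K (Dual K 𝔩) 𝔤) S') (expSubTau 1) (diff b S')
  set A := ser (opS (adLeft K (Dual K 𝔩) 𝔤) S) (expSubTau 1) (diff b S)
  set dD := diff b (S' - S)
  have tA' : Vanish (k + 1) (A' - A - dD) := by
    have e : A' - A - dD = A' - ser (opS (adLeft K (Dual K 𝔩) 𝔤) S') (expSubTau 1) (diff b S) - dD +
      (ser (opS (adLeft K (Dual K 𝔩) 𝔤) S') (expSubTau 1) (diff b S) - A) := by abel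
    rw [e]; exact tA
  have tAk : Vanish k (A' - A) := by
    have h1 := (tA'.mono (Nat.le_succ k)).add hd
    rwa [sub_add_cancel] at h1
  have t2 := (ser_sub_vanish (raises_opS (coadRight K 𝔤) hS') coeff_zero_expTau_one
    (isLocal_lin (LinearMap.lcomp K 𝔤 (restr 𝔩)) _ _ tAk)).add
    (ser_opS_sub_vanish (coadRight K 𝔤) hS hS' h (expTau 1)
      (lin (LinearMap.lcomp K 𝔤 (restr 𝔩)) A))
  have t3 := (isLocal_lin (LinearMap.lcomp K 𝔤 (restr 𝔩)) _ _ tA').sub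
    (isLocal_lin (trIncl 𝔩) _ _ tA')
  have := ((t1.add t4).add t2).add t3
  simp only [map_sub] at this ⊢
  refine (congrArg (Vanish (k + 1)) ?_).mp this
  abel

theorem gaugeFlow_zero_exponent (G : QuasiData K 𝔤) (l : FM ι (Dual K 𝔤 →ₗ[K] 𝔤)) :
    gaugeFlow b G 0 l 1 = l := by
  have h : ∀ (B : 𝔤 →ₗ[K] End K (Dual K 𝔤 →ₗ[K] 𝔤)) (f : FM ι (Dual K 𝔤 →ₗ[K] 𝔤)),
      ser (opS B (0 : FM ι 𝔤)) (expTau 1) f = f := by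
    intro B f
    ext1 n
    have h0 : opS B (0 : FM ι 𝔤) = 0 := map_zero (mul₂ (B : 𝔤 →ₗ[K] _ →ₗ[K] _))
    rw [ser_coeff_sum (raises_opS B rfl) _ _ n (Nat.lt_succ_self _), Finset.sum_range_succ',
      coeff_zero_expTau_one, Finset.sum_eq_zero fun i _ => ?_]
    · simp
    · rw [h0, zero_pow i.succ_ne_zero]; simp
  simp [gaugeFlow, h, diff_zero]

/-- The value of a gauge transform at the origin. -/
theorem gaugeFlow_coeff_zero (G : QuasiData K 𝔤) {S : FM ι 𝔤} (hS : S 0 = 0)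
    (l : FM ι (Dual K 𝔤 →ₗ[K] 𝔤)) :
    gaugeFlow b G S l 1 0 = l 0 + diff b S 0 ∘ₗ restr 𝔩 - trIncl 𝔩 (diff b S 0) := by
  have h := gaugeFlow_perturb b G (S := 0) (S' := S) rfl hS (k := 0)
    (vanish_one (by rw [sub_zero, hS])) l 0 (by simp)
  rw [gaugeFlow_zero_exponent, sub_coeff, sub_coeff, sub_zero, sub_sub, sub_eq_zero] at h
  rw [h, linGauge, sub_coeff, lin_coeff, lin_coeff, add_sub_assoc]
  rfl

end FM

end Perturbation

/-! ### Closed formal maps are exact -/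

section Homotopy

variable {K : Type*} [RCLike K] {𝔤 : Type*} [LieRing 𝔤] [LieAlgebra K 𝔤]
  [FiniteDimensional K 𝔤] (R : ReductiveDecomposition K 𝔤)
  {ι : Type*} [Fintype ι] [DecidableEq ι] (b : Basis ι K R.sub)

namespace FM

/-- The contraction `p ↦ D_p(s p)` with the Euler vector field. -/
def contractEuler (D : FM ι (Dual K 𝔤 →ₗ[K] 𝔤)) : FM ι 𝔤 :=
  mul₂ LinearMap.id D (lin R.sec (taut b))

theorem sum_coord_smul (ξ : Dual K 𝔤) :
    ∑ j, ξ (b j) • b.coord j = restr R.sub ξ := by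
  refine b.ext fun i => ?_
  simp [LinearMap.sum_apply, Finsupp.single_apply]

theorem dξ_contractEuler (D : FM ι (Dual K 𝔤 →ₗ[K] 𝔤)) (ξ : Dual K 𝔤) :
    dξ b ξ (contractEuler R b D) =
      ∑ j, (var j : MvPowerSeries ι K) • dξ b ξ (ev (R.sec (b.coord j)) D) +
        ev (R.sec (restr R.sub ξ)) D := by
  rw [contractEuler, dξ, dird_mul₂, dird_lin, taut_eq, dird_linFam, sum_coord_smul, lin_cst,
    mul₂_cst_right, linFam_eq K, map_sum, map_sum]
  congr 1
  refine Finset.sum_congr rfl fun j _ => ?_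
  rw [lin_ser_smul, lin_cst, mul₂_ser_smul_right, mul₂_cst_right]
  have h := dird_lin (fun j => ξ (b j : 𝔤)) (LinearMap.applyₗ (R.sec (b.coord j))) D
  rw [ev, h]
  rfl

theorem eul_eq_sum_dξ {V : Type*} [AddCommGroup V] [Module K V] (f : FM ι V) :
    eul K f = ∑ j, (var j : MvPowerSeries ι K) • dξ b (R.sec (b.coord j)) f := by
  rw [eul_eq_sum]
  refine Finset.sum_congr rfl fun j _ => ?_
  rw [dξ, dird_apply, Finset.sum_eq_single j]
  · have h : R.sec (b.coord j) (b j : 𝔤) = 1 := by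
      rw [R.sec_apply, R.proj_coe]; simp
    rw [h, one_smul]
  · intro i _ hi
    have h : R.sec (b.coord j) (b i : 𝔤) = 0 := by
      rw [R.sec_apply, R.proj_coe]; simp [hi]
    rw [h, zero_smul]
  · simp

variable {D : FM ι (Dual K 𝔤 →ₗ[K] 𝔤)}

/-- Cartan's formula for the contraction with the Euler vector field. -/
theorem cartan_contractEuler (hsk : ∀ ξ η : Dual K 𝔤, lin ξ (ev η D) = -lin η (ev ξ D)) {k : ℕ}
    (hcl : ∀ ξ η ζ : Dual K 𝔤, Vanish k (lin ζ (dξ b ξ (ev η D)) + lin ξ (dξ b η (ev ζ D)) +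
      lin η (dξ b ζ (ev ξ D)))) (ξ η : Dual K 𝔤) :
    Vanish (k + 1) (lin η (dξ b ξ (contractEuler R b D)) - lin ξ (dξ b η (contractEuler R b D)) -
      (eul K (lin η (ev ξ D)) + lin η (ev (R.sec (restr R.sub ξ)) D) -
        lin ξ (ev (R.sec (restr R.sub η)) D))) := by
  have h1 : Vanish (k + 1) (∑ j, (var j : MvPowerSeries ι K) •
      (lin (R.sec (b.coord j)) (dξ b ξ (ev η D)) + lin ξ (dξ b η (ev (R.sec (b.coord j)) D)) +
      lin η (dξ b (R.sec (b.coord j)) (ev ξ D)))) := by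
    refine Vanish.sum _ fun j _ => ?_
    rw [add_comm k]
    refine ser_smul_vanish (vanish_one ?_) (hcl ξ η _)
    rw [ofSer_var, if_neg]
    intro h
    have := DFunLike.congr_fun h j
    simp at this
  refine (congrArg (Vanish (k + 1)) ?_).mp h1.neg
  have h2 : ∀ j, lin (R.sec (b.coord j)) (dξ b ξ (ev η D)) =
      -lin η (dξ b ξ (ev (R.sec (b.coord j)) D)) := by
    intro j
    rw [← dξ_lin, hsk, map_neg, dξ_lin]
  rw [eul_eq_sum_dξ R b (lin η (ev ξ D)), dξ_contractEuler, dξ_contractEuler]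
  simp only [h2, map_add, map_sum, lin_ser_smul, smul_add, smul_neg, Finset.sum_add_distrib,
    Finset.sum_neg_distrib, dξ_lin]
  abel

/-- A primitive `Σ` for a closed skew formal map `D` that vanishes to order `k`, see
`linGauge_homotopy`. It is the contraction with the Euler vector field, divided by `k + 1` on `𝔪` and
by `k + 2` on `𝔩`. -/
def homotopy (k : ℕ) (D : FM ι (Dual K 𝔤 →ₗ[K] 𝔤)) : FM ι 𝔤 :=
  lin (((k : K) + 1)⁻¹ • LinearMap.id +
    (((k : K) + 2)⁻¹ - ((k : K) + 1)⁻¹) • (incl R.sub ∘ₗ R.proj)) (contractEuler R b D)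

/-- A closed skew formal map that vanishes to order `k > 0` is of the form `dΣ i* - i (dΣ)*` in
degree `k`. By Cartan's formula, the Lie derivative along the Euler vector field acts on the
component of `D` in `⋀² 𝔩` by `k + 2`, on that in `𝔩 ⊗ 𝔪` by `k + 1`, and on that in `⋀² 𝔪` by `k`;
the last component has no contraction and hence vanishes. -/
theorem linGauge_homotopy (hsk : ∀ ξ η : Dual K 𝔤, lin ξ (ev η D) = -lin η (ev ξ D)) {k : ℕ}
    (hk : k ≠ 0) (hv : Vanish k D)
    (hcl : ∀ ξ η ζ : Dual K 𝔤, Vanish k (lin ζ (dξ b ξ (ev η D)) + lin ξ (dξ b η (ev ζ D)) +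
      lin η (dξ b ζ (ev ξ D)))) : Vanish (k + 1) (linGauge b (homotopy R b k D) - D) := by
  intro n hn
  refine LinearMap.ext fun ξ => ext_dual (K := K) fun η => ?_
  set h : Dual K 𝔤 → Dual K 𝔤 → K := fun ξ η => η (dξ b ξ (contractEuler R b D) n)
  set P : Dual K 𝔤 → Dual K 𝔤 := fun ξ => R.sec (restr R.sub ξ)
  set ω : Dual K 𝔤 → Dual K 𝔤 → K := fun ξ η => η (D n ξ)
  have hω : ∀ ξ η, ω ξ η = -ω η ξ := fun ξ η => congrArg (fun f : FM ι K => f n) (hsk η ξ)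
  -- Cartan's formula in degree `k`; in lower degrees `D` vanishes
  have hI : ∀ ξ η, h ξ η - h η ξ = (k : K) * ω ξ η + ω (P ξ) η + ω ξ (P η) := by
    intro ξ η
    have h1 := cartan_contractEuler R b hsk hcl ξ η n hn
    simp only [sub_coeff, add_coeff, lin_coeff, eul_coeff, ev_coeff, smul_eq_mul] at h1
    have h2 : (n.degree : K) * η (D n ξ) = k * η (D n ξ) := by
      rcases Nat.lt_or_ge n.degree k with h3 | h3
      · rw [hv n h3]; simp
      · rw [le_antisymm (Nat.lt_succ_iff.1 hn) h3]
    have h4 := hω ξ (P η)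
    simp only [h, ω, P] at h4 ⊢
    linear_combination h1 + h2 - h4
  have hP : ∀ ξ η, h ξ η = h (P ξ) η := by
    intro ξ η
    simp only [h, P]
    rw [dξ_eq_along, dξ_eq_along, R.restr_sec]
  have hPP : ∀ ξ, P (P ξ) = P ξ := fun ξ => by simp only [P, R.restr_sec]
  have hh : ∀ ξ η η', h ξ (η - η') = h ξ η - h ξ η' := fun _ _ _ => rfl
  have hPs : ∀ ξ, P (ξ - P ξ) = 0 := fun ξ => by
    change R.sec (restr R.sub (ξ - P ξ)) = 0
    rw [map_sub, map_sub]
    exact sub_eq_zero.2 (hPP ξ).symm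
  have h0 : ∀ ξ η, h (ξ - P ξ) η = 0 := by
    intro ξ η
    rw [hP, hPs]
    have e : dξ b (0 : Dual K 𝔤) (contractEuler R b D) = 0 := by
      rw [dξ_eq_along, map_zero, map_zero]
      exact map_zero (mul₂ LinearMap.id _)
    simp only [h, e]; simp
  have hω1 : ∀ ξ ξ' η, ω (ξ - ξ') η = ω ξ η - ω ξ' η := fun ξ ξ' η => by simp [ω]
  have hω2 : ∀ ξ η η', ω ξ (η - η') = ω ξ η - ω ξ η' := fun _ _ _ => rfl
  have hω0 : ∀ η, ω 0 η = 0 := fun η => by simp [ω]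
  have hω0' : ∀ ξ, ω ξ 0 = 0 := fun _ => rfl
  -- Cartan's formula for the components of `ξ` and `η` in `𝔪^⊥` and in `𝔩^⊥`
  have e1 := hI (P ξ) (P η)
  have e2 := hI (P ξ) (η - P η)
  have e3 := hI (P η) (ξ - P ξ)
  have e4 := hI (ξ - P ξ) (η - P η)
  simp only [h0, hPs, hPP, hω0, hω0', hω1, hω2, hh, ← hP] at e1 e2 e3 e4
  have hk1 : (k : K) + 1 ≠ 0 := by exact_mod_cast k.succ_ne_zero
  have hk2 : (k : K) + 2 ≠ 0 := by exact_mod_cast (k + 1).succ_ne_zero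
  have hk0 : (k : K) ≠ 0 := by exact_mod_cast hk
  -- the component in `⋀² 𝔪` vanishes
  have e5 : ω ξ η - ω ξ (P η) - (ω (P ξ) η - ω (P ξ) (P η)) = 0 := by
    have : (k : K) * (ω ξ η - ω ξ (P η) - (ω (P ξ) η - ω (P ξ) (P η))) = 0 := by
      linear_combination -e4
    exact (mul_eq_zero.1 this).resolve_left hk0
  have hgoal : η (linGauge b (homotopy R b k D) n ξ) =
      ((k : K) + 1)⁻¹ * h ξ η + (((k : K) + 2)⁻¹ - ((k : K) + 1)⁻¹) * h ξ (P η) -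
      (((k : K) + 1)⁻¹ * h η ξ + (((k : K) + 2)⁻¹ - ((k : K) + 1)⁻¹) * h η (P ξ)) := by
    have g1 : ∀ ξ η : Dual K 𝔤, η (diff b (homotopy R b k D) n (restr R.sub ξ)) =
        ((k : K) + 1)⁻¹ * h ξ η + (((k : K) + 2)⁻¹ - ((k : K) + 1)⁻¹) * h ξ (P η) := by
      intro ξ η
      rw [← dξ_coeff, homotopy, dξ_lin, lin_coeff]
      simp only [LinearMap.add_apply, LinearMap.smul_apply, map_add, map_smul, smul_eq_mul]
      rfl
    rw [linGauge, sub_coeff, LinearMap.sub_apply, map_sub, lin_coeff, lin_coeff, trIncl_apply,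
      apply_incl_contr, g1, ← g1 ξ η]
    rfl
  rw [sub_coeff, LinearMap.sub_apply, map_sub, hgoal]
  change _ - ω ξ η = _
  have s1 := hω (P η) (P ξ)
  have s2 := hω (P η) ξ
  simp only [LinearMap.zero_apply, map_zero]
  have hc : ((k : K) + 1)⁻¹ * ((k : K) + 1) = 1 := inv_mul_cancel₀ hk1
  have hd : ((k : K) + 2)⁻¹ * ((k : K) + 2) = 1 := inv_mul_cancel₀ hk2
  linear_combination ((k : K) + 1)⁻¹ * e2 - ((k : K) + 1)⁻¹ * e3 + ((k : K) + 2)⁻¹ * e1 +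
    (ω (P ξ) η - ω (P ξ) (P η) - (ω (P η) ξ - ω (P η) (P ξ))) * hc + ω (P ξ) (P η) * hd - e5 +
    s1 - s2

theorem contractEuler_vanish {k : ℕ} (hv : Vanish k D) : Vanish (k + 1) (contractEuler R b D) :=
  hv.mul₂ _ (vanish_one (by rw [lin_coeff, taut_zero, map_zero]))

/-- The primitive is equivariant if the formal map is, since `p ↦ sp` and the projection to `𝔩` are. -/
theorem eqv_homotopy (k : ℕ) (he : ∀ z : R.sub, eqv b z (adjAct K 𝔤 (z : 𝔤)) D = 0) (z : R.sub) :
    eqv b z (lieBilin K 𝔤 z) (homotopy R b k D) = 0 := by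
  have h1 : eqv b z (lieBilin K 𝔤 z) (contractEuler R b D) = 0 := by
    have e1 : ∀ (A : FM ι (Dual K 𝔤 →ₗ[K] 𝔤)) (f : FM ι (Dual K 𝔤)), lin (lieBilin K 𝔤 z)
        (mul₂ LinearMap.id A f) = mul₂ LinearMap.id (lin (adjAct K 𝔤 (z : 𝔤)) A) f -
          mul₂ LinearMap.id A (lin (coad K 𝔤 (z : 𝔤)) f) := by
      intro A f
      rw [eq_sub_iff_add_eq]
      ext1 n
      rw [add_coeff, lin_coeff, mul₂_coeff, mul₂_coeff, mul₂_coeff, map_sum,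
        ← Finset.sum_add_distrib]
      rfl
    have e2 : lin (coad K 𝔤 (z : 𝔤)) (lin R.sec (taut b)) = lin R.sec (coadField b z) := by
      rw [coadField, lin_lin, lin_lin]
      exact FM.ext fun n => R.coad_sec z _
    have e3 := congrArg (fun A => mul₂ (LinearMap.id : (Dual K 𝔤 →ₗ[K] 𝔤) →ₗ[K] _) A
      (lin R.sec (taut b))) (he z)
    simp only [eqv_apply, map_add, LinearMap.add_apply, map_zero, LinearMap.zero_apply] at e3
    rw [eqv_apply, contractEuler, along_mul₂, e1, e2, along_lin, along_taut]
    linear_combination (norm := module) e3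
  rw [homotopy, eqv_lin b z (ρ := lieBilin K 𝔤 z), h1, map_zero]
  intro x
  have h2 : ⁅(z : 𝔤), ((R.proj x : R.sub) : 𝔤)⁆ = (R.proj ⁅(z : 𝔤), x⁆ : R.sub) := by
    rw [R.proj_lie_coe]; rfl
  simp only [LinearMap.add_apply, LinearMap.smul_apply, map_add, map_smul, LinearMap.id_apply]
  congr 2

end FM

end Homotopy

/-! ### Gauge equivalence is decided at the origin -/

section Classification

variable {K : Type*} [RCLike K] {𝔤 : Type*} [LieRing 𝔤] [LieAlgebra K 𝔤]
  [FiniteDimensional K 𝔤] {R : ReductiveDecomposition K 𝔤}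
  {ι : Type*} [Fintype ι] [DecidableEq ι] (b : Basis ι K R.sub)
  {G : QuasiData K 𝔤}

open FM

/-- The difference of two dynamical `ℓ`-matrices that agree in degree `< k` is closed in
degree `k`. -/
theorem closed_sub {l m : FM ι (Dual K 𝔤 →ₗ[K] 𝔤)} (hl : G.IsFormalDynl b l.toFun)
    (hm : G.IsFormalDynl b m.toFun) {k : ℕ} (hv : Vanish k (l - m)) (ξ η ζ : Dual K 𝔤) :
    Vanish k (lin ζ (dξ b ξ (ev η (l - m))) + lin ξ (dξ b η (ev ζ (l - m))) +
      lin η (dξ b ζ (ev ξ (l - m)))) := by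
  obtain ⟨-, h1, -⟩ := (G.isFormalDynl_iff b l).1 hl
  obtain ⟨-, h2, -⟩ := (G.isFormalDynl_iff b m).1 hm
  have h3 := (h1 ξ η ζ).trans (h2 ξ η ζ).symm
  have hq : ∀ ξ η ζ : Dual K 𝔤, Vanish k (lin ζ ⁅ev ξ l, ev η l⁆ + lin (ζ ∘ₗ G.cocycle.flip η) (ev ξ l) -
      (lin ζ ⁅ev ξ m, ev η m⁆ + lin (ζ ∘ₗ G.cocycle.flip η) (ev ξ m))) := by
    intro ξ η ζ
    have hvξ : ∀ ξ, Vanish k (ev ξ (l - m)) := fun ξ => isLocal_lin _ _ _ hv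
    have v1 : Vanish k (lin ζ ⁅ev ξ (l - m), ev η l⁆) :=
      isLocal_lin _ _ _ ((hvξ ξ).mul₂ (lieBilin K 𝔤) (vanish_zero _))
    have v2 : Vanish k (lin ζ ⁅ev ξ m, ev η (l - m)⁆) :=
      isLocal_lin _ _ _ (isLocal_mul₂_left (lieBilin K 𝔤) _ _ _ (hvξ η))
    have v3 : Vanish k (lin (ζ ∘ₗ G.cocycle.flip η) (ev ξ (l - m))) := isLocal_lin _ _ _ (hvξ ξ)
    refine (congrArg (Vanish k) ?_).mp ((v1.add v2).add v3)
    have e : ∀ ξ, ev ξ (l - m) = ev ξ l - ev ξ m := fun ξ => map_sub (lin (LinearMap.applyₗ ξ)) l m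
    rw [e, e]
    simp only [sub_lie, lie_sub, map_sub]
    abel
  refine (congrArg (Vanish k) ?_).mp (((hq ξ η ζ).add (hq η ζ ξ)).add (hq ζ ξ η))
  have e : ∀ ξ, ev ξ (l - m) = ev ξ l - ev ξ m := fun ξ => map_sub (lin (LinearMap.applyₗ ξ)) l m
  simp only [cdybeTerm_eq] at h3
  simp only [e, map_sub]
  linear_combination (norm := module) -h3

/-- Equivariance of a dynamical `ℓ`-matrix, in terms of the action of `𝔩`. -/
theorem eqv_of_isFormalDynl {l : FM ι (Dual K 𝔤 →ₗ[K] 𝔤)} (hl : G.IsFormalDynl b l.toFun)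
    (z : R.sub) : eqv b z (adjAct K 𝔤 (z : 𝔤)) l = -cst K (G.cocycle z) := by
  rw [eqv_apply]
  linear_combination (norm := module) ((G.isFormalDynl_iff b l).1 hl).2.2 z

theorem eqv_lie_iff (z : R.sub) (S : FM ι 𝔤) : eqv b z (lieBilin K 𝔤 z) S = 0 ↔
    along b (coadField b z) S = -⁅(cst K (z : 𝔤) : FM ι 𝔤), S⁆ := by
  rw [eqv_apply, ← eq_neg_iff_add_eq_zero, lie_eq_mul₂ (K := K), mul₂_cst_left]

theorem eqv_lin_taut {A : Dual K R.sub →ₗ[K] 𝔤} {z : R.sub} (hA : adjActSub z A = 0) :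
    eqv b z (lieBilin K 𝔤 z) (lin A (taut b)) = 0 := by
  rw [eqv_apply, along_lin, along_taut, coadField, lin_lin, lin_lin, ← LinearMap.add_apply]
  refine FM.ext fun n => ?_
  have h := LinearMap.congr_fun hA (taut b n)
  rw [adjActSub_apply, add_comm] at h
  exact h

theorem diff_lin_taut (A : Dual K R.sub →ₗ[K] 𝔤) : diff b (lin A (taut b)) 0 = A := by
  refine LinearMap.ext fun α => ?_
  simp only [diff_coeff_apply, pd_lin, lin_coeff, taut_eq, pd_linFam, cst_zero_coeff]
  simp only [← map_smul, ← map_sum]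
  congr 1
  refine b.ext fun i => ?_
  simp

/-- If two dynamical `ℓ`-matrices differ at the origin by `A i* - i A*` with `A` equivariant, they
are gauge equivalent. The exponent is found degree by degree. -/
theorem exists_gaugeFlow_eq (hG : G.IsLieQuasiBialgebra) {l l' : FM ι (Dual K 𝔤 →ₗ[K] 𝔤)}
    (hl : G.IsFormalDynl b l.toFun) (hl' : G.IsFormalDynl b l'.toFun)
    {A : Dual K R.sub →ₗ[K] 𝔤} (hA : ∀ z : R.sub, adjActSub z A = 0)
    (h0 : l' 0 = l 0 + A ∘ₗ restr R.sub - trIncl R.sub A) :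
    ∃ S : FM ι 𝔤, S 0 = 0 ∧ (∀ z : R.sub, eqv b z (lieBilin K 𝔤 z) S = 0) ∧
      gaugeFlow b G S l 1 = l' := by
  set P : ℕ → FM ι 𝔤 → Prop := fun k S => S 0 = 0 ∧
    (∀ z : R.sub, eqv b z (lieBilin K 𝔤 z) S = 0) ∧ Vanish (k + 1) (l' - gaugeFlow b G S l 1)
  -- in degree zero, the linear exponent `p ↦ A p` does it
  have hbase : P 0 (lin A (taut b)) := by
    refine ⟨?_, fun z => ?_, ?_⟩
    · rw [lin_coeff, taut_zero, map_zero]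
    · exact eqv_lin_taut b (hA z)
    · have hS0 : lin A (taut b) 0 = 0 := by rw [lin_coeff, taut_zero, map_zero]
      refine vanish_one ?_
      rw [sub_coeff, gaugeFlow_coeff_zero b G hS0, h0]
      rw [diff_lin_taut, sub_self]
  -- the term of lowest degree of the difference is removed by its primitive
  have hstep : ∀ k S, P k S → ∃ S', P (k + 1) S' ∧ Vanish (k + 2) (S' - S) := by
    rintro k S ⟨hS0, hSe, hSv⟩
    have hm := QuasiData.isFormalDynl_gaugeFlow b hG hS0 (fun z => (eqv_lie_iff b z S).1 (hSe z)) hl 1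
    have hsk : ∀ ξ η : Dual K 𝔤, lin ξ (ev η (l' - gaugeFlow b G S l 1)) =
        -lin η (ev ξ (l' - gaugeFlow b G S l 1)) := fun ξ η =>
      FM.ext fun n => (skewMaps K 𝔤).sub_mem (hl'.skew n) (hm.skew n) ξ η
    have hE : ∀ z : R.sub, eqv b z (adjAct K 𝔤 (z : 𝔤)) (l' - gaugeFlow b G S l 1) = 0 := fun z => by
      rw [map_sub, eqv_of_isFormalDynl b hl', eqv_of_isFormalDynl b hm, sub_self]
    set D := l' - gaugeFlow b G S l 1 with hD
    have h1 := linGauge_homotopy R b hsk k.succ_ne_zero hSv (closed_sub b hl' hm hSv)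
    have h2 : Vanish (k + 2) (homotopy R b (k + 1) D) :=
      isLocal_lin _ _ _ (contractEuler_vanish R b hSv)
    have hS0' : (S + homotopy R b (k + 1) D) 0 = 0 := by
      rw [add_coeff, hS0, h2 0 (by simp), add_zero]
    refine ⟨S + homotopy R b (k + 1) D, ⟨hS0', fun z => ?_, ?_⟩, ?_⟩
    · rw [map_add, hSe, eqv_homotopy R b _ hE, add_zero]
    · have h3 := gaugeFlow_perturb b G hS0 hS0' (k := k + 1) (by rwa [add_sub_cancel_left]) l
      rw [add_sub_cancel_left] at h3
      refine (congrArg (Vanish (k + 2)) ?_).mp (h3.add h1).neg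
      rw [hD]; abel
    · rwa [add_sub_cancel_left]
  obtain ⟨S, hS⟩ := exists_limit hbase hstep
  have hS0 : S 0 = 0 := by
    obtain ⟨S', h1, h2⟩ := hS 0
    have := h2 0 (by simp)
    rwa [sub_coeff, h1.1, sub_zero] at this
  refine ⟨S, hS0, fun z => ?_, ?_⟩
  · refine eq_zero_of_vanish fun k => ?_
    obtain ⟨S', h1, h2⟩ := hS k
    have := isLocal_eqv b z (lieBilin K 𝔤 z) _ _ h2
    rw [map_sub, h1.2.1, sub_zero] at this
    exact this.mono (by omega)
  · refine (sub_eq_zero.1 (eq_zero_of_vanish fun k => ?_)).symm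
    obtain ⟨S', h1, h2⟩ := hS k
    have h3 := gaugeFlow_perturb b G h1.1 hS0 h2 l
    have h4 : Vanish (k + 1) (linGauge b (S - S')) :=
      (isLocal_lin _ _ _ (diff_vanish b h2)).sub (isLocal_lin _ _ _ (diff_vanish b h2))
    refine (congrArg (Vanish k) ?_).mp
      ((h1.2.2.sub ((h3.mono (Nat.le_succ _)).add h4)).mono (Nat.le_succ k))
    abel

end Classification

/-! ### The moduli space -/

section Moduli

variable {K : Type*} [RCLike K] {𝔤 : Type*} [LieRing 𝔤] [LieAlgebra K 𝔤]
  [FiniteDimensional K 𝔤] {R : ReductiveDecomposition K 𝔤}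
  {ι : Type*} [Fintype ι] [DecidableEq ι] (b : Basis ι K R.sub)
  {G : QuasiData K 𝔤}

open FM

/-- Gauge equivalence is decided by the values at the origin. -/
theorem gaugeEquiv_iff (hG : G.IsLieQuasiBialgebra) (l l' : G.Dynl b) : G.GaugeEquiv b l l' ↔
    ∃ A : Dual K R.sub →ₗ[K] 𝔤, (∀ z : R.sub, adjActSub z A = 0) ∧
      l'.1 0 = l.1 0 + A ∘ₗ restr R.sub - trIncl R.sub A := by
  constructor
  · rintro ⟨S, hS, h⟩
    obtain ⟨hS0, hSe⟩ := (isGaugeExponent_iff b S).1 hS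
    refine ⟨diff b ⟨S⟩ 0, fun z => ?_, ?_⟩
    · have h1 := eqv_diff b z _ rfl (FM.mk S)
      rw [(eqv_lie_iff b z _).2 (hSe z), diff_zero] at h1
      have h2 : eqv b z (adjActSub z) (diff b (FM.mk S)) 0 = 0 := by rw [h1]; rfl
      rw [eqv_apply, add_coeff, lin_coeff] at h2
      have h3 : along b (coadField b z) (diff b (FM.mk S)) 0 = 0 := by
        rw [along, mul₂_coeff, Finsupp.antidiagonal_zero, Finset.sum_singleton, coadField_zero,
          map_zero]
      rwa [h3, zero_add] at h2
    · have h1 := gaugeFlow_coeff_zero b G (S := ⟨S⟩) hS0 ⟨l.1⟩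
      rw [gaugeFlow_one b G (S := ⟨S⟩) hS0 ⟨l.1⟩] at h1
      rw [h]
      exact h1
  · rintro ⟨A, hA, h0⟩
    obtain ⟨S, hS0, hSe, h⟩ := exists_gaugeFlow_eq b hG (l := ⟨l.1⟩) (l' := ⟨l'.1⟩) l.2 l'.2 hA h0
    refine ⟨S.toFun, (isGaugeExponent_iff b S.toFun).2 ⟨hS0, fun z => (eqv_lie_iff b z _).1 (hSe z)⟩,
      ?_⟩
    rw [gaugeFlow_one b G hS0] at h
    exact (congrArg FM.toFun h).symm

/-- Gauge equivalence is an equivalence relation, as the maps `A i* - i A*` with `A` equivariant form a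
subspace. -/
theorem gaugeEquiv_equivalence (hG : G.IsLieQuasiBialgebra) : Equivalence (G.GaugeEquiv b) where
  refl l := (gaugeEquiv_iff b hG l l).2 ⟨0, fun z => map_zero _, by simp⟩
  symm {l l'} h := by
    obtain ⟨A, hA, h⟩ := (gaugeEquiv_iff b hG l l').1 h
    refine (gaugeEquiv_iff b hG l' l).2 ⟨-A, fun z => by rw [map_neg, hA, neg_zero], ?_⟩
    rw [h, map_neg, LinearMap.neg_comp]; abel
  trans {l l' l''} h h' := by
    obtain ⟨A, hA, h⟩ := (gaugeEquiv_iff b hG l l').1 h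
    obtain ⟨A', hA', h'⟩ := (gaugeEquiv_iff b hG l' l'').1 h'
    refine (gaugeEquiv_iff b hG l l'').2 ⟨A + A', fun z => by rw [map_add, hA, hA', add_zero], ?_⟩
    rw [h', h, map_add, LinearMap.add_comp]; abel

variable {b}

/-- The value at the origin of a dynamical `ℓ`-matrix is `𝔩`-invariant. -/
theorem adjAct_coeff_zero (hcomp : R.IsCompatible G) {l : FormalMap ι (Dual K 𝔤 →ₗ[K] 𝔤)}
    (hl : G.IsFormalDynl b l) (z : R.sub) : adjAct K 𝔤 (z : 𝔤) (l 0) = 0 := by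
  have h := congrArg (fun f : FM ι (Dual K 𝔤 →ₗ[K] 𝔤) => f 0) (((G.isFormalDynl_iff b ⟨l⟩).1 hl).2.2 z)
  simp only [add_coeff, lin_coeff, cst_zero_coeff, zero_coeff, mk_apply, hcomp.cocycle_sub _ z.2,
    add_zero] at h
  have h3 : along b (coadField b z) (FM.mk l) 0 = 0 := by
    rw [along, mul₂_coeff, Finsupp.antidiagonal_zero, Finset.sum_singleton, coadField_zero,
      map_zero]
  rwa [h3, zero_add] at h

theorem coad_comp_skew {t : Dual K 𝔤 →ₗ[K] 𝔤} {z : 𝔤} (h : adjAct K 𝔤 z t = 0) (ξ : Dual K 𝔤) :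
    ⁅z, t ξ⁆ = -t (coad K 𝔤 z ξ) := by
  have := LinearMap.congr_fun h ξ
  rw [adjAct_apply_apply] at this
  exact eq_neg_of_add_eq_zero_left this

/-- A skew invariant map can be normalized by adding `A i* - i A*` for an equivariant `A`. -/
theorem exists_isNormalized {t : Dual K 𝔤 →ₗ[K] 𝔤} (ht : t ∈ skewMaps K 𝔤)
    (hinv : ∀ z : R.sub, adjAct K 𝔤 (z : 𝔤) t = 0) :
    ∃ A : Dual K R.sub →ₗ[K] 𝔤, (∀ z : R.sub, adjActSub z A = 0) ∧
      R.IsNormalized (t + A ∘ₗ restr R.sub - trIncl R.sub A) := by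
  -- `A = -t s` on the `𝔪`-component and `-t s / 2` on the `𝔩`-component, because `A i*` and `-i A*`
  -- agree on the component of `t` in `⋀² 𝔩`
  refine ⟨((2 : K)⁻¹ • (incl R.sub ∘ₗ R.proj) - LinearMap.id) ∘ₗ t ∘ₗ R.sec, fun z => ?_, ?_⟩
  · refine LinearMap.ext fun α => ?_
    have h1 := coad_comp_skew (hinv z) (R.sec α)
    have h2 := R.proj_lie_coe z (t (R.sec α))
    rw [R.coad_sec] at h1
    have h3 : ⁅(z : 𝔤), ((R.proj (t (R.sec α)) : R.sub) : 𝔤)⁆ =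
        (R.proj ⁅(z : 𝔤), t (R.sec α)⁆ : R.sub) := by rw [h2]; rfl
    rw [adjActSub_apply]
    simp only [LinearMap.comp_apply, LinearMap.sub_apply, LinearMap.smul_apply, LinearMap.id_apply,
      lie_sub, lie_smul, LinearMap.zero_apply]
    have h4 : ⁅(z : 𝔤), incl R.sub (R.proj (t (R.sec α)))⁆ = 
        -incl R.sub (R.proj (t (R.sec (coad K R.sub z α)))) := by
      refine h3.trans ?_
      rw [h1, map_neg]; rfl
    rw [h4, h1]
    module
  · set A : Dual K R.sub →ₗ[K] 𝔤 := ((2 : K)⁻¹ • (incl R.sub ∘ₗ R.proj) - LinearMap.id) ∘ₗ t ∘ₗ R.sec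
    set t' := t + A ∘ₗ restr R.sub - trIncl R.sub A
    have ht' : ∀ ξ η : Dual K 𝔤, η (t' ξ) = η (t ξ) + η (A (restr R.sub ξ)) - ξ (A (restr R.sub η)) := by
      intro ξ η
      simp only [t', LinearMap.sub_apply, LinearMap.add_apply, map_sub, map_add, trIncl_apply,
        apply_incl_contr]
      rfl
    have hA : ∀ (ξ : Dual K 𝔤) α, ξ (A α) =
        2⁻¹ * R.sec (restr R.sub ξ) (t (R.sec α)) - ξ (t (R.sec α)) := by
      intro ξ α
      simp only [A, LinearMap.comp_apply, LinearMap.sub_apply, LinearMap.smul_apply,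
        LinearMap.id_apply, map_sub, map_smul, smul_eq_mul]
      rfl
    have key : ∀ ξ ∈ R.complPerp, ∀ η : Dual K 𝔤, η (t' ξ) = 0 := by
      intro ξ hξ η
      have s1 := ht (R.sec (restr R.sub η)) ξ
      have s2 := ht ξ (R.sec (restr R.sub η))
      rw [ht', hA, hA, R.sec_restr hξ, s2]
      ring
    refine ⟨fun ξ hξ => ext_dual (K := K) fun η => by rw [key ξ hξ, map_zero], fun ξ hξ => ?_⟩
    refine R.mem_compl_iff.2 fun ζ hζ => ?_
    have s1 := key ζ hζ ξ
    have s2 := ht ξ ζ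
    rw [ht'] at s1 ⊢
    linear_combination -s1 + s2

/-- Two normalized maps that differ by `A i* - i A*` are equal. -/
theorem eq_of_isNormalized {t t' : Dual K 𝔤 →ₗ[K] 𝔤} (ht : R.IsNormalized t)
    (ht' : R.IsNormalized t') {A : Dual K R.sub →ₗ[K] 𝔤}
    (h : t' = t + A ∘ₗ restr R.sub - trIncl R.sub A) : t' = t := by
  have h1 : ∀ ξ η : Dual K 𝔤, η (t' ξ) - η (t ξ) = η (A (restr R.sub ξ)) - ξ (A (restr R.sub η)) := by
    intro ξ η
    rw [h]
    simp only [LinearMap.sub_apply, LinearMap.add_apply, map_sub, map_add, trIncl_apply,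
      apply_incl_contr, LinearMap.comp_apply]
    ring
  have h2 : ∀ ξ ∈ R.complPerp, ∀ η : Dual K 𝔤, η (t' ξ) - η (t ξ) = 0 := by
    intro ξ hξ η
    rw [ht.1 ξ hξ, ht'.1 ξ hξ, map_zero, sub_zero]
  refine LinearMap.ext fun ξ => ext_dual (K := K) fun η => sub_eq_zero.1 ?_
  have e1 := h2 _ (R.sec_mem (restr R.sub ξ)) η
  have e2 := h2 _ (R.sec_mem (restr R.sub η)) (ξ - R.sec (restr R.sub ξ))
  rw [h1] at e1 e2 ⊢
  have e3 : restr R.sub (ξ - R.sec (restr R.sub ξ)) = 0 :=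
    R.restr_eq_zero_iff.2 (R.sub_sec_restr_mem ξ)
  rw [R.restr_sec] at e1 e2
  rw [e3, map_zero, map_zero, LinearMap.sub_apply] at e2
  linear_combination e1 - e2

/-- A normalized value at the origin is a point of the variety. -/
theorem mem_variety (hcomp : R.IsCompatible G) {l : FormalMap ι (Dual K 𝔤 →ₗ[K] 𝔤)}
    (hl : G.IsFormalDynl b l) (hn : R.IsNormalized (l 0)) :
    (⟨l 0, hl.skew 0⟩ : skewMaps K 𝔤) ∈ R.variety G := by
  refine ⟨hn, fun z hz => adjAct_coeff_zero hcomp hl ⟨z, hz⟩, fun ξ hξ η hη ζ hζ => ?_⟩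
  have h := congrArg (fun f : FM ι K => f 0) (((G.isFormalDynl_iff b ⟨l⟩).1 hl).2.1 ξ η ζ)
  simp only [add_coeff, cst_zero_coeff] at h
  have h1 : ∀ ξ η ζ : Dual K 𝔤, ξ ∈ R.subPerp → FM.mk (G.cdybeTerm b l ξ η ζ) 0 =
      -(ζ (⁅l 0 ξ, l 0 η⁆ + G.cocycle (l 0 ξ) η)) := by
    intro ξ η ζ hξ
    have h2 := congrArg (fun f : FM ι K => f 0) (cdybeTerm_eq b G ⟨l⟩ ξ η ζ)
    simp only [sub_coeff, lin_coeff, dξ_coeff, R.restr_eq_zero_iff.2 hξ, map_zero, lie_coeff,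
      Finsupp.antidiagonal_zero, Finset.sum_singleton] at h2
    refine h2.trans ?_
    rw [map_add]
    change 0 - ζ ⁅l 0 ξ, l 0 η⁆ - ζ (G.cocycle (l 0 ξ) η) = _
    ring
  rw [h1 ξ η ζ hξ, h1 η ζ ξ hη, h1 ζ ξ η hζ] at h
  rw [G.twistAssoc_apply]
  linear_combination -h

/-- Every gauge class contains a dynamical `ℓ`-matrix whose value at the origin is normalized. -/
theorem exists_normalized_representative (hG : G.IsLieQuasiBialgebra) (hcomp : R.IsCompatible G)
    (C : G.Moduli b) : ∃ l : G.Dynl b, R.IsNormalized (l.1 0) ∧ Quot.mk _ l = C := by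
  induction C using Quot.ind with
  | mk l =>
    obtain ⟨A, hA, hn⟩ := exists_isNormalized (l.2.skew 0) (adjAct_coeff_zero hcomp l.2)
    -- the linear map `A` itself is the exponent of a gauge transformation
    have hS0 : lin A (taut b) 0 = 0 := by rw [lin_coeff, taut_zero, map_zero]
    have hS : IsGaugeExponent b (lin A (taut b)).toFun := (isGaugeExponent_iff b _).2 ⟨hS0, fun z =>
      (eqv_lie_iff b z _).1 (eqv_lin_taut b (hA z))⟩
    refine ⟨⟨_, l.2.gaugeTransform b hG hS⟩, ?_, (Quot.sound ⟨_, hS, rfl⟩).symm⟩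
    have h1 := gaugeFlow_coeff_zero b G hS0 ⟨l.1⟩
    rw [gaugeFlow_one b G hS0 ⟨l.1⟩, diff_lin_taut] at h1
    change R.IsNormalized ((FM.mk (G.gaugeTransform b (lin A (taut b)).toFun l.1)) 0)
    rw [h1]
    exact hn

/-- The classification of the moduli space, given that every point of the variety is the value at
the origin of a dynamical `ℓ`-matrix. -/
theorem exists_moduli_bijection (hG : G.IsLieQuasiBialgebra) (hcomp : R.IsCompatible G)
    (hex : ∀ ρ : R.variety G, ∃ l : G.Dynl b, l.1 0 = ρ.1.1) :
    ∃ f : G.Moduli b → R.variety G,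
      (∀ l : G.Dynl b, R.IsNormalized (l.1 0) →
        ((f (Quot.mk _ l) : skewMaps K 𝔤) : Dual K 𝔤 →ₗ[K] 𝔤) = l.1 0) ∧
      Function.Bijective f := by
  choose r hr hrC using exists_normalized_representative (b := b) hG hcomp
  have hf : ∀ l : G.Dynl b, R.IsNormalized (l.1 0) → (r (Quot.mk _ l)).1 0 = l.1 0 := by
    intro l hl
    have h1 := (gaugeEquiv_equivalence b hG).eqvGen_iff.1 (Quot.eqvGen_exact (hrC (Quot.mk _ l)))
    obtain ⟨A, -, h2⟩ := (gaugeEquiv_iff b hG _ _).1 h1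
    exact (eq_of_isNormalized (hr _) hl h2).symm
  refine ⟨fun C => ⟨_, mem_variety hcomp (r C).2 (hr C)⟩, hf, fun C C' h => ?_, fun ρ => ?_⟩
  · rw [← hrC C, ← hrC C']
    refine Quot.sound ((gaugeEquiv_iff b hG _ _).2 ⟨0, fun z => map_zero _, ?_⟩)
    have h0 : (r C).1 0 = (r C').1 0 := congrArg (fun ρ : R.variety G => ρ.1.1) h
    simp [h0]
  · obtain ⟨l, hl⟩ := hex ρ
    refine ⟨Quot.mk _ l, Subtype.ext (Subtype.ext ?_)⟩
    exact (hf l (by rw [hl]; exact ρ.2.1)).trans hl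

end Moduli

/-! ### Taylor series of analytic maps -/

section Taylor

variable {K : Type*} [RCLike K] {ι : Type*} [Fintype ι]

/-- The monomial `x^n`. -/
def mon (x : ι → K) (n : ι →₀ ℕ) : K := ∏ j, x j ^ n j

theorem mon_zero (x : ι → K) : mon x 0 = 1 := by simp [mon]

theorem mon_add (x : ι → K) (n m : ι →₀ ℕ) : mon x (n + m) = mon x n * mon x m := by
  simp [mon, pow_add, Finset.prod_mul_distrib]

theorem mon_smul (t : K) (x : ι → K) (n : ι →₀ ℕ) : mon (t • x) n = t ^ n.degree * mon x n := by
  simp [mon, mul_pow, Finset.prod_mul_distrib, Finset.prod_pow_eq_pow_sum, Finsupp.degree_eq_sum]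

variable [DecidableEq ι]

theorem mon_single (x : ι → K) (j : ι) : mon x (Finsupp.single j 1) = x j := by
  rw [mon, Finset.prod_eq_single j]
  · simp
  · intro i _ hi; simp [Ne.symm hi]
  · simp

theorem mon_sum {α : Type*} (x : ι → K) (s : Finset α) (i : α → ι) :
    mon x (∑ a ∈ s, Finsupp.single (i a) 1) = ∏ a ∈ s, x (i a) := by
  classical
  induction s using Finset.induction_on with
  | empty => simp [mon_zero]
  | insert a s ha ih => rw [Finset.sum_insert ha, Finset.prod_insert ha, mon_add, ih, mon_single]

theorem degree_preimage (k : ℕ) : (Finsupp.degree ⁻¹' {k} : Set (ι →₀ ℕ)) =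
    ↑((Finset.univ : Finset ι).finsuppAntidiag k) := by
  ext n
  simp [Finset.mem_finsuppAntidiag, Finsupp.degree_eq_sum]

theorem _root_.HasSum.congr_terms {α M : Type*} [AddCommMonoid M] [TopologicalSpace M] {f g : α → M}
    {a : M} (h : HasSum f a) (hfg : ∀ n, f n = g n) : HasSum g a := funext hfg ▸ h

/-- A scalar multivariate power series that sums to zero near the origin is zero. -/
theorem eq_zero_of_hasSum_zero {a : (ι →₀ ℕ) → K}
    (h : ∀ᶠ x in 𝓝 (0 : ι → K), HasSum (fun n => mon x n * a n) 0) (n : ι →₀ ℕ) : a n = 0 := by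
  obtain ⟨ε, hε, hb⟩ := Metric.eventually_nhds_iff_ball.1 h
  set k := n.degree with hk
  set S := (Finset.univ : Finset ι).finsuppAntidiag k
  -- the homogeneous components vanish on the ball, by uniqueness in one variable
  have h1 : ∀ x ∈ Metric.ball (0 : ι → K) ε, ∑ m ∈ S, mon x m * a m = 0 := by
    intro x hx
    set c : ℕ → K := fun k => ∑' m : (Finsupp.degree ⁻¹' {k} : Set (ι →₀ ℕ)), mon x m * a m
    have h2 : HasFPowerSeriesAt (0 : K → K) (FormalMultilinearSeries.ofScalars K c) 0 := by
      rw [hasFPowerSeriesAt_iff]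
      filter_upwards [Metric.closedBall_mem_nhds (0 : K) one_pos] with t ht
      have htx : t • x ∈ Metric.ball (0 : ι → K) ε := by
        rw [mem_ball_zero_iff] at hx ⊢
        rw [mem_closedBall_zero_iff] at ht
        rw [norm_smul]
        exact (mul_le_of_le_one_left (norm_nonneg x) ht).trans_lt hx
      have h3 := (hb _ htx).tsum_fiberwise Finsupp.degree
      refine h3.congr_terms fun k => ?_
      rw [FormalMultilinearSeries.coeff_ofScalars, smul_eq_mul, ← tsum_mul_left]
      refine tsum_congr fun m => ?_
      have hm : (m : ι →₀ ℕ).degree = k := m.2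
      rw [mon_smul, hm, mul_assoc]
    have h4 : c k = 0 := by
      have := h2.eq_zero
      rw [← FormalMultilinearSeries.coeff_ofScalars (p := c) (n := k), this]
      rfl
    have h5 : c k = ∑ m ∈ S, mon x m * a m := by
      simp only [c]
      rw [degree_preimage]
      exact Finset.tsum_subtype S fun m => mon x m * a m
    rw [← h5, h4]
  have h6 : (∑ m ∈ S, MvPolynomial.monomial m (a m)) = 0 := by
    refine MvPolynomial.funext_set (fun _ => Metric.ball (0 : K) ε)
      (fun _ => infinite_of_mem_nhds 0 (Metric.ball_mem_nhds _ hε)) fun x hx => ?_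
    rw [map_sum, map_zero, ← h1 x ?_]
    · refine Finset.sum_congr rfl fun m _ => ?_
      rw [MvPolynomial.eval_monomial, mul_comm, Finsupp.prod_fintype _ _ (fun _ => pow_zero _)]
      rfl
    · rw [ball_pi _ hε]
      exact hx
  have h7 := congrArg (MvPolynomial.coeff n) h6
  rw [MvPolynomial.coeff_sum, Finset.sum_eq_single n] at h7
  · simpa using h7
  · intro m _ hm
    rw [MvPolynomial.coeff_monomial, if_neg hm]
  · intro hn
    exact absurd (by simp [S, Finset.mem_finsuppAntidiag, hk, Finsupp.degree_eq_sum]) hn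

/-- An analytic function is the sum of its Taylor series. -/
theorem exists_hasSum_of_analyticAt {F : (ι → K) → K} (hF : AnalyticAt K F 0) :
    ∃ a : (ι →₀ ℕ) → K, ∀ᶠ x in 𝓝 (0 : ι → K), HasSum (fun n => mon x n * a n) (F x) := by
  obtain ⟨p, r, hp⟩ := hF
  obtain ⟨ρ, hρ0, hρ⟩ := ENNReal.lt_iff_exists_nnreal_btwn.1 hp.r_pos
  have hρ0' : (0 : ℝ) < ρ := by exact_mod_cast hρ0
  set N : ℝ := Fintype.card ι + 1
  have hN : 0 < N := by positivity
  set cnt : (Σ k, Fin k → ι) → (ι →₀ ℕ) := fun i => ∑ a, Finsupp.single (i.2 a) 1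
  set q : (Σ k, Fin k → ι) → K := fun i => p i.1 (fun a => Pi.single (i.2 a) 1)
  refine ⟨fun n => ∑' i : cnt ⁻¹' {n}, q i, ?_⟩
  filter_upwards [Metric.ball_mem_nhds (0 : ι → K) (div_pos hρ0' hN)] with x hx
  rw [mem_ball_zero_iff] at hx
  have hxN : ‖x‖ * N < ρ := (lt_div_iff₀ hN).1 hx
  have hxρ : ‖x‖ < ρ := by
    refine lt_of_le_of_lt ?_ hxN
    have : 1 ≤ N := by simp [N]
    nlinarith [norm_nonneg x]
  have hsum : HasSum (fun k => p k fun _ => x) (F x) := by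
    have h1 : x ∈ Metric.eball (0 : ι → K) r := by
      rw [Metric.mem_eball, edist_zero_right]
      refine lt_trans ?_ hρ
      rw [← ofReal_norm, ENNReal.ofReal_lt_iff_lt_toReal (norm_nonneg _) ENNReal.coe_ne_top]
      exact hxρ
    simpa using hp.hasSum h1
  have hexp : ∀ k, p k (fun _ => x) = ∑ i : Fin k → ι, (∏ a, x (i a)) * q ⟨k, i⟩ := by
    intro k
    have h1 : (fun _ : Fin k => x) = fun _ => ∑ j, x j • (Pi.single j 1 : ι → K) := by
      funext _
      exact pi_eq_sum_univ' x
    rw [h1, ContinuousMultilinearMap.map_sum]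
    refine Finset.sum_congr rfl fun i _ => ?_
    rw [ContinuousMultilinearMap.map_smul_univ, smul_eq_mul]
  have hbound : ∀ i : (Σ k, Fin k → ι), ‖(∏ a, x (i.2 a)) * q i‖ ≤ ‖x‖ ^ i.1 * ‖p i.1‖ := by
    intro i
    rw [norm_mul]
    refine mul_le_mul ?_ ?_ (norm_nonneg _) (pow_nonneg (norm_nonneg _) _)
    · rw [norm_prod]
      refine (Finset.prod_le_prod (fun _ _ => norm_nonneg _) fun a _ => norm_le_pi_norm x _).trans ?_
      simp
    · refine (ContinuousMultilinearMap.le_opNorm _ _).trans ?_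
      refine mul_le_of_le_one_right (norm_nonneg _) (Finset.prod_le_one (fun _ _ => norm_nonneg _) ?_)
      intro a _
      rw [Pi.norm_single]
      simp
  have hsummable : Summable fun i : (Σ k, Fin k → ι) => (∏ a, x (i.2 a)) * q i := by
    refine Summable.of_norm ?_
    rw [summable_sigma_of_nonneg (fun _ => norm_nonneg _)]
    refine ⟨fun k => Summable.of_finite, ?_⟩
    have h1 := p.summable_norm_mul_pow (r := ρ) (hρ.trans_le hp.r_le)
    refine Summable.of_nonneg_of_le (fun k => tsum_nonneg fun _ => norm_nonneg _) (fun k => ?_) h1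
    rw [tsum_fintype]
    have h2 : ∑ i : Fin k → ι, ‖(∏ a, x (i a)) * q ⟨k, i⟩‖ ≤ ∑ _i : Fin k → ι, ‖x‖ ^ k * ‖p k‖ :=
      Finset.sum_le_sum fun i _ => hbound ⟨k, i⟩
    refine h2.trans ?_
    rw [Finset.sum_const, Finset.card_univ, Fintype.card_fun, Fintype.card_fin, nsmul_eq_mul]
    push_cast
    rw [← mul_assoc, ← mul_pow, mul_comm]
    refine mul_le_mul_of_nonneg_left (pow_le_pow_left₀ (by positivity) ?_ k) (norm_nonneg _)
    refine le_trans ?_ hxN.le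
    rw [mul_comm]
    exact mul_le_mul_of_nonneg_left (by simp [N]) (norm_nonneg _)
  have h2 : HasSum (fun i : (Σ k, Fin k → ι) => (∏ a, x (i.2 a)) * q i) (F x) :=
    HasSum.sigma_of_hasSum hsum (fun k => by
      rw [hexp k]
      exact hasSum_fintype _) hsummable
  refine (h2.tsum_fiberwise cnt).congr_terms fun n => ?_
  rw [← tsum_mul_left]
  refine tsum_congr fun i => ?_
  have hi : cnt i = n := i.2
  have hm : mon x n = ∏ a, x ((i : Σ k, Fin k → ι).2 a) := 
    (congrArg (mon x) hi).symm.trans (mon_sum _ _ _)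
  rw [hm]

theorem hasSum_mul_antidiagonal {x : ι → K} {a c : (ι →₀ ℕ) → K} {A C : K}
    (ha : HasSum (fun n => mon x n * a n) A) (hc : HasSum (fun n => mon x n * c n) C) :
    HasSum (fun n => mon x n * ∑ q ∈ antidiagonal n, a q.1 * c q.2) (A * C) := by
  obtain ⟨f, hf⟩ : ∃ f : (ι →₀ ℕ) → K, f = fun n => mon x n * a n := ⟨_, rfl⟩
  obtain ⟨g, hg⟩ : ∃ g : (ι →₀ ℕ) → K, g = fun n => mon x n * c n := ⟨_, rfl⟩
  rw [← hf] at ha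
  rw [← hg] at hc
  have hfn : Summable fun n => ‖f n‖ := ha.summable.norm
  have hgn : Summable fun n => ‖g n‖ := hc.summable.norm
  have h1 : Summable fun q : (ι →₀ ℕ) × (ι →₀ ℕ) => f q.1 * g q.2 :=
    summable_mul_of_summable_norm hfn hgn
  have h2 : (∑' n, f n) * ∑' n, g n = ∑' n, ∑ q ∈ antidiagonal n, f q.1 * g q.2 :=
    ha.summable.tsum_mul_tsum_eq_tsum_sum_antidiagonal hc.summable h1
  rw [ha.tsum_eq, hc.tsum_eq] at h2
  have h3 : HasSum (fun n => ∑ q ∈ antidiagonal n, f q.1 * g q.2) (A * C) := by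
    rw [h2]
    exact (summable_sum_mul_antidiagonal_of_summable_mul h1).hasSum
  refine h3.congr_terms fun n => ?_
  rw [Finset.mul_sum]
  refine Finset.sum_congr rfl fun q hq => ?_
  rw [← HasAntidiagonal.mem_antidiagonal.1 hq, mon_add, hf, hg]
  ring

variable {V W Z : Type*} [AddCommGroup V] [Module K V] [AddCommGroup W] [Module K W]
  [AddCommGroup Z] [Module K Z]

namespace FM

/-- The formal map `f` is the Taylor series at the origin of `F`, tested on linear functionals. -/
def HasTaylor (f : FM ι V) (F : (ι → K) → V) : Prop :=
  ∀ φ : Dual K V, ∀ᶠ x in 𝓝 (0 : ι → K), HasSum (fun n => mon x n * φ (f n)) (φ (F x))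

namespace HasTaylor

variable {f g : FM ι V} {F H : (ι → K) → V}

theorem congr (hf : HasTaylor f F) (h : ∀ᶠ x in 𝓝 (0 : ι → K), F x = H x) : HasTaylor f H :=
  fun φ => by
    filter_upwards [hf φ, h] with x hx hF
    rwa [hF] at hx

theorem add (hf : HasTaylor f F) (hg : HasTaylor g H) : HasTaylor (f + g) (fun x => F x + H x) :=
  fun φ => by
    filter_upwards [hf φ, hg φ] with x hx hy
    simpa [mul_add] using hx.add hy

theorem lin (L : V →ₗ[K] W) (hf : HasTaylor f F) : HasTaylor (FM.lin L f) (fun x => L (F x)) :=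
  fun φ => hf (φ ∘ₗ L)

theorem smul (c : K) (hf : HasTaylor f F) : HasTaylor (c • f) (fun x => c • F x) :=
  hf.lin (c • (LinearMap.id : V →ₗ[K] V))

theorem neg (hf : HasTaylor f F) : HasTaylor (-f) (fun x => -F x) :=
  hf.lin (-(LinearMap.id : V →ₗ[K] V))

theorem sub (hf : HasTaylor f F) (hg : HasTaylor g H) : HasTaylor (f - g) (fun x => F x - H x) := by
  simpa only [sub_eq_add_neg] using hf.add hg.neg

theorem sum {α : Type*} (s : Finset α) {f : α → FM ι V} {F : α → (ι → K) → V}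
    (h : ∀ i ∈ s, HasTaylor (f i) (F i)) : HasTaylor (∑ i ∈ s, f i) (fun x => ∑ i ∈ s, F i x) := by
  intro φ
  filter_upwards [(Filter.eventually_all_finset s).2 fun i hi => h i hi φ] with x hx
  simpa [Finset.mul_sum] using hasSum_sum hx

theorem mul₂ [FiniteDimensional K V] (B : V →ₗ[K] W →ₗ[K] Z) {g : FM ι W} {H : (ι → K) → W}
    (hf : HasTaylor f F) (hg : HasTaylor g H) :
    HasTaylor (FM.mul₂ B f g) (fun x => B (F x) (H x)) := fun φ => by
  set e := finBasis K V
  have key : ∀ (v : V) (w : W), φ (B v w) = ∑ i, e.coord i v * φ (B (e i) w) := by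
    intro v w
    have h := congrArg (fun v => φ (B v w)) (e.sum_repr v)
    simp only [map_sum, map_smul, LinearMap.sum_apply, LinearMap.smul_apply, smul_eq_mul] at h
    exact h.symm
  filter_upwards [Filter.eventually_all.2 fun i => hf (e.coord i),
    Filter.eventually_all.2 fun i => hg (φ ∘ₗ B (e i))] with x hx hy
  rw [key]
  refine (hasSum_sum fun i (_ : i ∈ Finset.univ) =>
    hasSum_mul_antidiagonal (hx i) (hy i)).congr_terms fun n => ?_
  rw [mul₂_coeff, map_sum, ← Finset.mul_sum, Finset.sum_comm]
  congr 1
  exact Finset.sum_congr rfl fun q _ => (key _ _).symm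

theorem unique (hf : HasTaylor f F) (hg : HasTaylor g H)
    (h : ∀ᶠ x in 𝓝 (0 : ι → K), F x = H x) : f = g := by
  refine FM.ext fun n => sub_eq_zero.1 ?_
  rw [← Module.forall_dual_apply_eq_zero_iff K]
  intro φ
  refine eq_zero_of_hasSum_zero (a := fun n => φ (f n - g n)) ?_ n
  filter_upwards [hf.sub hg φ, h] with x hx hFH
  rwa [hFH, sub_self, map_zero] at hx

end HasTaylor

theorem hasTaylor_cst (v : V) : HasTaylor (K := K) (cst K v : FM ι V) (fun _ => v) := fun φ =>
  Filter.Eventually.of_forall fun x => by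
    have h : HasSum (fun n => mon x n * φ ((cst K v : FM ι V) n))
        (mon x 0 * φ ((cst K v : FM ι V) 0)) :=
      hasSum_single 0 fun n hn => by rw [cst_coeff, if_neg hn]; simp
    rwa [mon_zero, cst_coeff, if_pos rfl, one_mul] at h

theorem hasTaylor_linFam (c : ι → V) : HasTaylor (K := K) (linFam c) (fun x => ∑ j, x j • c j) := fun φ =>
  Filter.Eventually.of_forall fun x => by
    simp only [linFam_coeff, map_sum, Finset.mul_sum]
    refine hasSum_sum fun j _ => ?_
    have h : HasSum (fun n => mon x n * φ (if n = Finsupp.single j 1 then c j else 0))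
        (mon x (Finsupp.single j 1) *
          φ (if Finsupp.single j 1 = Finsupp.single j 1 then c j else 0)) :=
      hasSum_single (Finsupp.single j 1) fun n hn => by rw [if_neg hn]; simp
    rwa [if_pos rfl, mon_single, ← smul_eq_mul, ← map_smul] at h

/-- Weak analyticity of a map from `K^ι` to a finite-dimensional space. -/
def WeakAnalyticAt (F : (ι → K) → V) (x : ι → K) : Prop := ∀ φ : Dual K V, AnalyticAt K (φ ∘ F) x

theorem exists_hasTaylor [FiniteDimensional K V] {F : (ι → K) → V} (hF : WeakAnalyticAt (K := K) F 0) :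
    ∃ f : FM ι V, HasTaylor f F := by
  set e := finBasis K V
  choose a ha using fun i => exists_hasSum_of_analyticAt (hF (e.coord i))
  refine ⟨⟨fun n => ∑ i, a i n • e i⟩, fun φ => ?_⟩
  filter_upwards [Filter.eventually_all.2 ha] with x hx
  have h1 := hasSum_sum fun i (_ : i ∈ Finset.univ) => (hx i).mul_right (φ (e i))
  have h2 : φ (F x) = ∑ i, e.coord i (F x) * φ (e i) := by
    conv_lhs => rw [← e.sum_repr (F x), map_sum]
    simp
  rw [h2]
  refine h1.congr_terms fun n => ?_
  rw [mk_apply, map_sum, Finset.mul_sum]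
  refine Finset.sum_congr rfl fun i _ => ?_
  rw [map_smul, smul_eq_mul, mul_assoc]

end FM

end Taylor

/-! ### Entire functions of endomorphisms -/

/-- The coefficients `c_k` are bounded by those of the exponential series. -/
def FactorialBound {K : Type*} [RCLike K] (c : ℕ → K) : Prop :=
  ∀ k, ‖c k‖ ≤ ((k.factorial : ℝ))⁻¹

section NormedAlgebra

variable {K : Type*} [RCLike K] {A : Type*} [NormedRing A] [NormedAlgebra K A]
  [FiniteDimensional K A]

theorem radius_ofScalars_eq_top {c : ℕ → K} (hc : FactorialBound c) :
    (FormalMultilinearSeries.ofScalars A c).radius = ⊤ := by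
  refine FormalMultilinearSeries.radius_eq_top_of_summable_norm _ fun r => ?_
  have h1 : Summable fun k : ℕ =>
      ‖ContinuousMultilinearMap.mkPiAlgebraFin K 0 A‖ * (if k = 0 then (1 : ℝ) else 0)
        + (r : ℝ) ^ k / k.factorial :=
    ((hasSum_ite_eq 0 (1 : ℝ)).summable.mul_left _).add (Real.summable_pow_div_factorial r)
  refine Summable.of_nonneg_of_le (fun k => by positivity) (fun k => ?_) h1
  have h2 : ‖FormalMultilinearSeries.ofScalars A c k‖ ≤
      ‖c k‖ * ‖ContinuousMultilinearMap.mkPiAlgebraFin K k A‖ :=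
    norm_smul_le (c k) (ContinuousMultilinearMap.mkPiAlgebraFin K k A)
  have h3 := hc k
  rcases Nat.eq_zero_or_pos k with rfl | hk
  · simp only [pow_zero, mul_one, if_true, Nat.factorial_zero, Nat.cast_one, div_one, inv_one] at *
    have := mul_le_mul_of_nonneg_right h3
      (norm_nonneg (ContinuousMultilinearMap.mkPiAlgebraFin K 0 A))
    linarith
  · have h4 := ContinuousMultilinearMap.norm_mkPiAlgebraFin_le_of_pos (𝕜 := K) (A := A) hk
    rw [if_neg hk.ne', mul_zero, zero_add, div_eq_inv_mul]
    refine mul_le_mul_of_nonneg_right (h2.trans ?_) (by positivity)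
    exact (mul_le_of_le_one_right (norm_nonneg _) h4).trans h3

theorem hasSum_ofScalarsSum {c : ℕ → K} (hc : FactorialBound c) (L : A →ₗ[K] K) (a : A) :
    HasSum (fun k => c k * L (a ^ k)) (L (FormalMultilinearSeries.ofScalarsSum c a)) := by
  have := FiniteDimensional.complete K A
  have h := (FormalMultilinearSeries.ofScalars A c).hasSum (x := a)
    (by rw [radius_ofScalars_eq_top hc]; simp)
  refine (h.map L L.continuous_of_finiteDimensional).congr_terms fun k => ?_
  rw [Function.comp_apply, FormalMultilinearSeries.ofScalars_apply_eq, map_smul, smul_eq_mul]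

variable {E : Type*} [NormedAddCommGroup E] [NormedSpace K E]

theorem analyticAt_of_dual {M : Type*} [NormedAddCommGroup M] [NormedSpace K M]
    [FiniteDimensional K M] {F : E → M} {x : E}
    (h : ∀ L : Dual K M, AnalyticAt K (fun x => L (F x)) x) : AnalyticAt K F x := by
  set e := finBasis K M
  have h1 : AnalyticAt K (fun x => ∑ i, e.coord i (F x) • e i) x :=
    Finset.analyticAt_fun_sum _ fun i _ => (h (e.coord i)).smul analyticAt_const
  refine h1.congr (Filter.Eventually.of_forall fun x => ?_)
  exact e.sum_repr (F x)

theorem analyticAt_dual {M : Type*} [NormedAddCommGroup M] [NormedSpace K M]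
    [FiniteDimensional K M] {F : E → M} {x : E} (h : AnalyticAt K F x) (L : Dual K M) :
    AnalyticAt K (fun x => L (F x)) x :=
  (L.toContinuousLinearMap.analyticAt _).comp h

theorem analyticAt_ofScalarsSum {c : ℕ → K} (hc : FactorialBound c) {F : E → A} {x : E}
    (h : ∀ L : Dual K A, AnalyticAt K (fun x => L (F x)) x) (L : Dual K A) :
    AnalyticAt K (fun x => L (FormalMultilinearSeries.ofScalarsSum c (F x))) x := by
  have := FiniteDimensional.complete K A
  have h1 := (FormalMultilinearSeries.ofScalars A c).hasFPowerSeriesOnBall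
    (by rw [radius_ofScalars_eq_top hc]; simp)
  have h2 : AnalyticAt K (FormalMultilinearSeries.ofScalarsSum c) (F x) :=
    h1.analyticAt_of_mem (by rw [radius_ofScalars_eq_top hc]; simp)
  exact analyticAt_dual (h2.comp (analyticAt_of_dual h)) L

theorem analyticAt_ringInverse {F : E → A} {x : E}
    (h : ∀ L : Dual K A, AnalyticAt K (fun x => L (F x)) x) (hx : IsUnit (F x)) (L : Dual K A) :
    AnalyticAt K (fun x => L (Ring.inverse (F x))) x := by
  have := FiniteDimensional.complete K A
  obtain ⟨u, hu⟩ := hx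
  have h2 : AnalyticAt K Ring.inverse (F x) := by rw [← hu]; exact analyticAt_inverse u
  exact analyticAt_dual (h2.comp (analyticAt_of_dual h)) L

theorem isOpen_isUnit_of_dual {F : E → A}
    (h : ∀ x, ∀ L : Dual K A, AnalyticAt K (fun x => L (F x)) x) : IsOpen {x | IsUnit (F x)} := by
  have := FiniteDimensional.complete K A
  have h1 : Continuous F := continuous_iff_continuousAt.2 fun x =>
    (analyticAt_of_dual (h x)).continuousAt
  exact Units.isOpen.preimage h1

end NormedAlgebra

section MatrixFn

variable {K : Type*} [RCLike K] {m : Type*} [Fintype m] [DecidableEq m]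

/-- The matrix `∑_k c_k A^k`, with entrywise sums. -/
def matFn (c : ℕ → K) (A : Matrix m m K) : Matrix m m K :=
  Matrix.of fun i j => ∑' k : ℕ, c k * (A ^ k) i j

theorem hasSum_matFn {c : ℕ → K} (hc : FactorialBound c) (L : Matrix m m K →ₗ[K] K)
    (A : Matrix m m K) : HasSum (fun k => c k * L (A ^ k)) (L (matFn c A)) := by
  let : NormedRing (Matrix m m K) := Matrix.linftyOpNormedRing
  let : NormedAlgebra K (Matrix m m K) := Matrix.linftyOpNormedAlgebra
  have h1 : matFn c A = FormalMultilinearSeries.ofScalarsSum c A := by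
    ext i j
    exact (hasSum_ofScalarsSum hc (Matrix.entryLinearMap K K i j) A).tsum_eq
  rw [h1]
  exact hasSum_ofScalarsSum hc L A

theorem analyticAt_matFn {E : Type*} [NormedAddCommGroup E] [NormedSpace K E] {c : ℕ → K}
    (hc : FactorialBound c) {F : E → Matrix m m K} {x : E}
    (h : ∀ L : Dual K (Matrix m m K), AnalyticAt K (fun x => L (F x)) x)
    (L : Dual K (Matrix m m K)) : AnalyticAt K (fun x => L (matFn c (F x))) x := by
  let : NormedRing (Matrix m m K) := Matrix.linftyOpNormedRing
  let : NormedAlgebra K (Matrix m m K) := Matrix.linftyOpNormedAlgebra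
  have h1 : matFn c = FormalMultilinearSeries.ofScalarsSum (E := Matrix m m K) c := by
    ext A i j
    exact (hasSum_ofScalarsSum hc (Matrix.entryLinearMap K K i j) A).tsum_eq
  rw [h1]
  exact analyticAt_ofScalarsSum hc h L

theorem analyticAt_matrix_inverse {E : Type*} [NormedAddCommGroup E] [NormedSpace K E]
    {F : E → Matrix m m K} {x : E}
    (h : ∀ L : Dual K (Matrix m m K), AnalyticAt K (fun x => L (F x)) x) (hx : IsUnit (F x))
    (L : Dual K (Matrix m m K)) : AnalyticAt K (fun x => L (Ring.inverse (F x))) x :=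
  letI : NormedRing (Matrix m m K) := Matrix.linftyOpNormedRing
  letI : NormedAlgebra K (Matrix m m K) := Matrix.linftyOpNormedAlgebra
  analyticAt_ringInverse h hx L

theorem isOpen_isUnit_matrix {E : Type*} [NormedAddCommGroup E] [NormedSpace K E]
    {F : E → Matrix m m K}
    (h : ∀ x, ∀ L : Dual K (Matrix m m K), AnalyticAt K (fun x => L (F x)) x) :
    IsOpen {x | IsUnit (F x)} :=
  letI : NormedRing (Matrix m m K) := Matrix.linftyOpNormedRing
  letI : NormedAlgebra K (Matrix m m K) := Matrix.linftyOpNormedAlgebra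
  isOpen_isUnit_of_dual h

end MatrixFn

section EntireFn

open FM

variable {K : Type*} [RCLike K] {V W : Type*} [AddCommGroup V] [Module K V] [FiniteDimensional K V]
  [AddCommGroup W] [Module K W] [FiniteDimensional K W] {ι : Type*} [Fintype ι]

theorem entireFn_eq (c : ℕ → K) (T : End K V) : entireFn c T =
    Matrix.toLin (finBasis K V) (finBasis K V)
      (matFn c (LinearMap.toMatrix (finBasis K V) (finBasis K V) T)) := by
  simp only [entireFn, matFn, LinearMap.toMatrix_pow]

theorem hasSum_entireFn {c : ℕ → K} (hc : FactorialBound c) (L : End K V →ₗ[K] K) (T : End K V) :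
    HasSum (fun k => c k * L (T ^ k)) (L (entireFn c T)) := by
  rw [entireFn_eq]
  refine (hasSum_matFn hc (L ∘ₗ (Matrix.toLin (finBasis K V) (finBasis K V)).toLinearMap)
    _).congr_terms fun k => ?_
  rw [LinearMap.comp_apply, LinearEquiv.coe_coe, LinearMap.toMatrix_pow, Matrix.toLin_toMatrix]

/-- Evaluation of an endomorphism at `v`, paired with `φ`. -/
def evalPair (φ : Dual K V) (v : V) : End K V →ₗ[K] K := φ ∘ₗ LinearMap.applyₗ v

theorem hasSum_entireFn_apply {c : ℕ → K} (hc : FactorialBound c) (T : End K V) (φ : Dual K V)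
    (v : V) : HasSum (fun k => c k * φ ((T ^ k) v)) (φ (entireFn c T v)) :=
  hasSum_entireFn hc (evalPair φ v) T

theorem entireFn_intertwine {c : ℕ → K} (hc : FactorialBound c) {T : End K V} {T' : End K W}
    {J : V →ₗ[K] W} (h : ∀ v, J (T v) = T' (J v)) (v : V) :
    J (entireFn c T v) = entireFn c T' (J v) := by
  have hk : ∀ k : ℕ, J ((T ^ k) v) = (T' ^ k) (J v) := by
    intro k
    induction k with
    | zero => simp
    | succ k ih => rw [pow_succ', pow_succ', Module.End.mul_apply, Module.End.mul_apply, h, ih]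
  rw [← sub_eq_zero, ← Module.forall_dual_apply_eq_zero_iff K]
  intro φ
  have h1 := hasSum_entireFn_apply hc T (φ ∘ₗ J) v
  have h2 := hasSum_entireFn_apply hc T' φ (J v)
  simp only [LinearMap.comp_apply, hk] at h1
  rw [map_sub, h1.unique h2, sub_self]

theorem FactorialBound.shift {c : ℕ → K} (hc : FactorialBound c) (N : ℕ) :
    FactorialBound fun k => c (k + N) := fun k =>
  (hc (k + N)).trans (inv_anti₀ (by positivity)
    (by exact_mod_cast Nat.factorial_le (Nat.le_add_right k N)))

theorem FactorialBound.neg_pow {c : ℕ → K} (hc : FactorialBound c) :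
    FactorialBound fun k => (-1) ^ k * c k := fun k => by
  have := hc k
  simpa using this

/-- The Taylor polynomial of order `N` and the remainder, which is divisible by `T^N`. -/
theorem entireFn_eq_add {c : ℕ → K} (hc : FactorialBound c) (T : End K V) (N : ℕ) (v : V) :
    entireFn c T v = (∑ k ∈ range N, c k • (T ^ k) v) +
      (T ^ N) (entireFn (fun k => c (k + N)) T v) := by
  rw [← sub_eq_zero, ← Module.forall_dual_apply_eq_zero_iff K]
  intro φ
  have h1 := hasSum_entireFn_apply hc T φ v
  have h2 := hasSum_entireFn_apply (hc.shift N) T (φ ∘ₗ T ^ N) v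
  have h3 := (hasSum_nat_add_iff' N).2 h1
  simp only [LinearMap.comp_apply, ← Module.End.mul_apply, ← pow_add] at h2
  simp only [add_comm _ N] at h2 h3
  have h4 := h3.unique h2
  rw [map_sub, map_add, map_sum]
  simp only [map_smul, smul_eq_mul, add_comm _ N]
  rw [Module.End.mul_apply] at h4
  rw [← h4]
  ring

theorem entireFn_neg {c : ℕ → K} (hc : FactorialBound c) (T : End K V) :
    entireFn c (-T) = entireFn (fun k => (-1) ^ k * c k) T := by
  ext v
  rw [← sub_eq_zero, ← Module.forall_dual_apply_eq_zero_iff K]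
  intro φ
  have h1 := hasSum_entireFn_apply hc (-T) φ v
  have h2 := hasSum_entireFn_apply hc.neg_pow T φ v
  have h3 : ∀ k : ℕ, c k * φ (((-T) ^ k) v) = (-1) ^ k * c k * φ ((T ^ k) v) := by
    intro k
    rw [neg_pow, Module.End.mul_apply]
    rcases Nat.even_or_odd k with h | h <;> simp [h.neg_one_pow]
  rw [map_sub, (h1.congr_terms h3).unique h2, sub_self]

theorem entireFn_zero {c : ℕ → K} (hc : FactorialBound c) : entireFn c (0 : End K V) = c 0 • 1 := by
  ext v
  rw [entireFn_eq_add hc 0 1]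
  simp

theorem FM.WeakAnalyticAt.lin {F : (ι → K) → V} {x : ι → K} (L : V →ₗ[K] W)
    (h : WeakAnalyticAt F x) : WeakAnalyticAt (fun x => L (F x)) x := fun φ => h (φ ∘ₗ L)

theorem FM.WeakAnalyticAt.sub {F H : (ι → K) → V} {x : ι → K} (h : WeakAnalyticAt F x)
    (h' : WeakAnalyticAt H x) : WeakAnalyticAt (fun x => F x - H x) x := fun φ => by
  have := (h φ).sub (h' φ)
  refine this.congr (Filter.Eventually.of_forall fun x => ?_)
  simp

theorem FM.WeakAnalyticAt.mul₂ {Z : Type*} [AddCommGroup Z] [Module K Z] (B : V →ₗ[K] W →ₗ[K] Z)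
    {F : (ι → K) → V} {H : (ι → K) → W} {x : ι → K} (h : WeakAnalyticAt F x)
    (h' : WeakAnalyticAt H x) : WeakAnalyticAt (fun x => B (F x) (H x)) x := fun φ => by
  set e := finBasis K V
  have h1 : AnalyticAt K (fun x => ∑ i, e.coord i (F x) * φ (B (e i) (H x))) x :=
    Finset.analyticAt_fun_sum _ fun i _ => (h (e.coord i)).mul (h' (φ ∘ₗ B (e i)))
  refine h1.congr (Filter.Eventually.of_forall fun x => ?_)
  have := congrArg (fun v => φ (B v (H x))) (e.sum_repr (F x))
  simp only [map_sum, map_smul, LinearMap.sum_apply, LinearMap.smul_apply, smul_eq_mul] at this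
  exact this

theorem weakAnalyticAt_linearMap (A : (ι → K) →ₗ[K] V) (x : ι → K) : WeakAnalyticAt A x := fun φ =>
  ((φ ∘ₗ A).toContinuousLinearMap).analyticAt x

theorem FM.WeakAnalyticAt.entireFn {c : ℕ → K} (hc : FactorialBound c) {A : (ι → K) → End K V}
    {x : ι → K} (h : WeakAnalyticAt A x) : WeakAnalyticAt (fun x => entireFn c (A x)) x := fun L => by
  simp only [entireFn_eq]
  exact analyticAt_matFn hc (F := fun x => LinearMap.toMatrix (finBasis K V) (finBasis K V) (A x))
    (fun L => h (L ∘ₗ (LinearMap.toMatrix (finBasis K V) (finBasis K V)).toLinearMap))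
    (L ∘ₗ (Matrix.toLin (finBasis K V) (finBasis K V)).toLinearMap)

theorem isUnit_toMatrix_iff (T : End K V) :
    IsUnit (LinearMap.toMatrix (finBasis K V) (finBasis K V) T) ↔ IsUnit T :=
  MulEquiv.isUnit_map (LinearMap.toMatrixAlgEquiv (finBasis K V))

theorem toMatrix_ringInverse (T : End K V) :
    LinearMap.toMatrix (finBasis K V) (finBasis K V) (Ring.inverse T) =
      Ring.inverse (LinearMap.toMatrix (finBasis K V) (finBasis K V) T) := by
  by_cases h : IsUnit T
  · refine ((Ring.eq_mul_inverse_iff_mul_eq _ 1 _ ((isUnit_toMatrix_iff T).2 h)).2 ?_).trans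
      (one_mul _)
    rw [← LinearMap.toMatrix_mul, Ring.inverse_mul_cancel _ h, LinearMap.toMatrix_one]
  · rw [Ring.inverse_non_unit _ h, Ring.inverse_non_unit _ (mt (isUnit_toMatrix_iff T).1 h), map_zero]

theorem FM.WeakAnalyticAt.inverse {A : (ι → K) → End K V} {x : ι → K} (h : WeakAnalyticAt A x)
    (hx : IsUnit (A x)) : WeakAnalyticAt (fun x => Ring.inverse (A x)) x := fun L => by
  refine (analyticAt_matrix_inverse
    (F := fun x => LinearMap.toMatrix (finBasis K V) (finBasis K V) (A x))
    (fun L => h (L ∘ₗ (LinearMap.toMatrix (finBasis K V) (finBasis K V)).toLinearMap))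
    ((isUnit_toMatrix_iff _).2 hx)
    (L ∘ₗ (Matrix.toLin (finBasis K V) (finBasis K V)).toLinearMap)).congr
    (Filter.Eventually.of_forall fun x => ?_)
  simp [← toMatrix_ringInverse]

theorem isOpen_isUnit {A : (ι → K) → End K V} (h : ∀ x, WeakAnalyticAt A x) :
    IsOpen {x | IsUnit (A x)} := by
  simp only [← isUnit_toMatrix_iff (K := K)]
  exact isOpen_isUnit_matrix fun x L =>
    h x (L ∘ₗ (LinearMap.toMatrix (finBasis K V) (finBasis K V)).toLinearMap)

end EntireFn

/-! ### The spectrum condition -/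

section Spectrum

variable {K : Type*} [RCLike K]

/-- The embedding of `K` into `ℂ`, as a ring homomorphism. -/
def toComplex (K : Type*) [RCLike K] : K →+* ℂ where
  toFun := RCLike.map K ℂ
  map_one' := by simp
  map_zero' := by simp
  map_add' := map_add _
  map_mul' z w := by
    simp only [RCLike.map_apply, RCLike.mul_re, RCLike.mul_im]
    apply Complex.ext <;> simp

theorem continuous_toComplex : Continuous (toComplex K) := (RCLike.map K ℂ).continuous

theorem factorialBound_sinhDivCoeff : FactorialBound (sinhDivCoeff K) := fun k => by
  rw [sinhDivCoeff]
  split_ifs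
  · rw [norm_inv, RCLike.norm_natCast]
    exact inv_anti₀ (by positivity) (by exact_mod_cast Nat.factorial_le (Nat.le_succ k))
  · rw [norm_zero]; positivity

theorem factorialBound_expCoeff : FactorialBound (expCoeff K) := fun k => by
  rw [expCoeff, norm_inv, RCLike.norm_natCast]

theorem factorialBound_coshSubSinhCoeff : FactorialBound (coshSubSinhCoeff K) := fun k => by
  rw [coshSubSinhCoeff]
  split_ifs
  · have h1 : (((k + 1).factorial : K)⁻¹ - ((k + 2).factorial : K)⁻¹) =
        ((((k + 1).factorial : ℝ)⁻¹ - ((k + 2).factorial : ℝ)⁻¹ : ℝ) : K) := by push_cast; rfl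
    have h2 : ((k + 2).factorial : ℝ)⁻¹ ≤ ((k + 1).factorial : ℝ)⁻¹ :=
      inv_anti₀ (by positivity) (by exact_mod_cast Nat.factorial_le (Nat.le_succ _))
    have h3 : ((k + 1).factorial : ℝ)⁻¹ ≤ (k.factorial : ℝ)⁻¹ :=
      inv_anti₀ (by positivity) (by exact_mod_cast Nat.factorial_le (Nat.le_succ _))
    have h4 : (0 : ℝ) ≤ ((k + 2).factorial : ℝ)⁻¹ := by positivity
    rw [h1, RCLike.norm_ofReal, abs_of_nonneg (by linarith)]
    linarith
  · rw [norm_zero]; positivity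

theorem toComplex_sinhDivCoeff (k : ℕ) : toComplex K (sinhDivCoeff K k) = sinhDivCoeff ℂ k := by
  rw [sinhDivCoeff, sinhDivCoeff]
  split_ifs <;> simp

theorem toComplex_matFn {m : Type*} [Fintype m] [DecidableEq m] {c : ℕ → K} (hc : FactorialBound c)
    (A : Matrix m m K) : (toComplex K).mapMatrix (matFn c A) =
      matFn (fun k => toComplex K (c k)) ((toComplex K).mapMatrix A) := by
  ext i j
  have h := (hasSum_matFn hc (Matrix.entryLinearMap K K i j) A).map (toComplex K) continuous_toComplex
  refine (h.congr_terms fun k => ?_).tsum_eq.symm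
  rw [← map_pow]
  simp

/-- `sinh z / z` vanishes exactly on `iπℤ ∖ {0}`. -/
theorem hasSum_sinhDiv_zero_iff {z s : ℂ} (h : HasSum (fun k => sinhDivCoeff ℂ k * z ^ k) s) :
    s = 0 ↔ ∃ k : ℤ, k ≠ 0 ∧ z = Complex.I * Real.pi * k := by
  have h1 : z * s = Complex.sinh z := by
    refine (h.mul_left z).unique ?_
    have h2 := Complex.hasSum_sinh z
    have hinj : Function.Injective fun n : ℕ => 2 * n := fun a b hab => by
      simpa using hab
    refine (hinj.hasSum_iff ?_).1 (h2.congr_terms fun n => ?_)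
    · intro k hk
      have : ¬ Even k := fun ⟨r, hr⟩ => hk ⟨r, by simp only; omega⟩
      simp [sinhDivCoeff, this]
    · simp only [Function.comp_apply, sinhDivCoeff, if_pos (even_two_mul n)]
      rw [pow_succ]
      field_simp
  by_cases hz : z = 0
  · subst hz
    have h3 : s = 1 := by
      refine h.unique ?_
      have := hasSum_single (f := fun k => sinhDivCoeff ℂ k * (0 : ℂ) ^ k) 0 (fun k hk => by simp [hk])
      simpa [sinhDivCoeff] using this
    simp [h3, Real.pi_ne_zero]
  · have h4 : s = 0 ↔ Complex.sinh z = 0 := by rw [← h1]; simp [hz]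
    have h5 : Complex.sinh z = Complex.sin (-z * Complex.I) * Complex.I := by
      rw [← Complex.sinh_mul_I, mul_assoc, Complex.I_mul_I]; simp
    rw [h4, h5, mul_eq_zero, or_iff_left Complex.I_ne_zero, Complex.sin_eq_zero_iff]
    constructor
    · rintro ⟨k, hk⟩
      have hzk : z = Complex.I * Real.pi * k := by
        linear_combination Complex.I * hk + z * Complex.I_sq
      refine ⟨k, ?_, hzk⟩
      rintro rfl
      exact hz (by simpa using hzk)
    · rintro ⟨k, -, hk⟩
      exact ⟨k, by rw [hk]; linear_combination -(Real.pi * k : ℂ) * Complex.I_sq⟩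

theorem matFn_mulVec_of_eigen {m : Type*} [Fintype m] [DecidableEq m] {c : ℕ → ℂ}
    (hc : FactorialBound c) {A : Matrix m m ℂ} {v : m → ℂ} {z : ℂ} (hv : A.mulVec v = z • v)
    (i : m) : HasSum (fun k => c k * (z ^ k * v i)) ((matFn c A).mulVec v i) := by
  have hk : ∀ k : ℕ, (A ^ k).mulVec v = z ^ k • v := by
    intro k
    induction k with
    | zero => simp
    | succ k ih =>
      rw [pow_succ, ← Matrix.mulVec_mulVec, hv, Matrix.mulVec_smul, ih, smul_smul, pow_succ']
  set L : Matrix m m ℂ →ₗ[ℂ] ℂ := LinearMap.proj i ∘ₗ (Matrix.mulVecBilin ℂ ℂ).flip v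
  refine (hasSum_matFn hc L A).congr_terms fun k => ?_
  simp [L, hk]

theorem matFn_comm {m : Type*} [Fintype m] [DecidableEq m] {c : ℕ → K} (hc : FactorialBound c)
    (A : Matrix m m K) : matFn c A * A = A * matFn c A := by
  ext i j
  have h1 := hasSum_matFn hc (Matrix.entryLinearMap K K i j ∘ₗ LinearMap.mulRight K A) A
  have h2 := hasSum_matFn hc (Matrix.entryLinearMap K K i j ∘ₗ LinearMap.mulLeft K A) A
  refine h1.unique (h2.congr_terms fun k => ?_)
  simp only [LinearMap.comp_apply, LinearMap.mulLeft_apply, LinearMap.mulRight_apply,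
    (Commute.self_pow A k).eq]

/-- `sinh A / A` is singular if and only if `A` has an eigenvalue in `iπℤ ∖ {0}`: the kernel of
`sinh A / A` is invariant under `A`, so it contains an eigenvector of `A` if it is not zero. -/
theorem det_matFn_sinhDiv_eq_zero_iff {m : Type*} [Fintype m] [DecidableEq m] (A : Matrix m m ℂ) :
    (matFn (sinhDivCoeff ℂ) A).det = 0 ↔
      ∃ k : ℤ, k ≠ 0 ∧ A.charpoly.eval (Complex.I * Real.pi * k) = 0 := by
  have hc := factorialBound_sinhDivCoeff (K := ℂ)
  have heig : ∀ {v : m → ℂ} {z : ℂ}, v ≠ 0 → A.mulVec v = z • v →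
      ((matFn (sinhDivCoeff ℂ) A).mulVec v = 0 ↔ ∃ k : ℤ, k ≠ 0 ∧ z = Complex.I * Real.pi * k) := by
    intro v z hv hz
    obtain ⟨i, hi⟩ : ∃ i, v i ≠ 0 := by
      by_contra! h
      exact hv (funext h)
    set S := matFn (sinhDivCoeff ℂ) A
    have h1 : ∀ j, HasSum (fun k => sinhDivCoeff ℂ k * (z ^ k * v j)) (S.mulVec v j) :=
      matFn_mulVec_of_eigen hc hz
    have h2 : HasSum (fun k => sinhDivCoeff ℂ k * z ^ k) (S.mulVec v i * (v i)⁻¹) :=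
      ((h1 i).mul_right (v i)⁻¹).congr_terms fun k => by field_simp
    rw [← hasSum_sinhDiv_zero_iff h2]
    constructor
    · intro h
      rw [h]; simp
    · intro h
      rw [h] at h2
      funext j
      refine (h1 j).unique ?_
      simpa [mul_assoc] using h2.mul_right (v j)
  have hroot : ∀ z : ℂ, A.charpoly.eval z = 0 ↔ ∃ v ≠ 0, A.mulVec v = z • v := by
    intro z
    rw [Matrix.eval_charpoly, ← Matrix.exists_mulVec_eq_zero_iff]
    refine exists_congr fun v => and_congr_right fun _ => ?_
    rw [Matrix.sub_mulVec, sub_eq_zero, eq_comm, Matrix.scalar_apply, ← Matrix.smul_one_eq_diagonal,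
      Matrix.smul_mulVec, Matrix.one_mulVec]
  constructor
  · intro hdet
    obtain ⟨v, hv, hSv⟩ := Matrix.exists_mulVec_eq_zero_iff.2 hdet
    -- the kernel of `S` is invariant under `A`, hence contains an eigenvector
    set N := LinearMap.ker (Matrix.toLin' (matFn (sinhDivCoeff ℂ) A)) with hN
    have hinv : ∀ w ∈ N, Matrix.toLin' A w ∈ N := by
      intro w hw
      rw [hN, LinearMap.mem_ker, Matrix.toLin'_apply] at hw ⊢
      rw [Matrix.toLin'_apply, Matrix.mulVec_mulVec, matFn_comm hc, ← Matrix.mulVec_mulVec, hw,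
        Matrix.mulVec_zero]
    have : Nontrivial N := ⟨⟨⟨v, by rw [hN, LinearMap.mem_ker, Matrix.toLin'_apply, hSv]⟩, 0,
      fun h => hv (congrArg Subtype.val h)⟩⟩
    obtain ⟨z, hz⟩ := Module.End.exists_eigenvalue ((Matrix.toLin' A).restrict hinv)
    obtain ⟨w, hw⟩ := hz.exists_hasEigenvector
    have hw0 : (w : m → ℂ) ≠ 0 := fun h => hw.2 (Subtype.ext h)
    have hwz : A.mulVec (w : m → ℂ) = z • (w : m → ℂ) := by
      have := congrArg Subtype.val hw.apply_eq_smul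
      simpa using this
    have hSw : (matFn (sinhDivCoeff ℂ) A).mulVec (w : m → ℂ) = 0 := by
      have h := LinearMap.mem_ker.1 w.2
      rwa [Matrix.toLin'_apply] at h
    obtain ⟨k, hk, rfl⟩ := (heig hw0 hwz).1 hSw
    exact ⟨k, hk, (hroot _).2 ⟨w, hw0, hwz⟩⟩
  · rintro ⟨k, hk, h⟩
    obtain ⟨v, hv, hvz⟩ := (hroot _).1 h
    exact Matrix.exists_mulVec_eq_zero_iff.1 ⟨v, hv, (heig hv hvz).2 ⟨k, hk, rfl⟩⟩

/-- The spectrum of `T` avoids `iπℤ ∖ {0}` if and only if `sinh T / T` is invertible. Over `ℝ` this is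
proved by passing to complex matrices. -/
theorem spectrumAvoids_iff {V : Type*} [AddCommGroup V] [Module K V] [FiniteDimensional K V]
    (T : End K V) : SpectrumAvoids T ↔ IsUnit (entireFn (sinhDivCoeff K) T) := by
  set A := LinearMap.toMatrix (finBasis K V) (finBasis K V) T with hA
  have h1 : IsUnit (entireFn (sinhDivCoeff K) T) ↔ (matFn (sinhDivCoeff K) A).det ≠ 0 := by
    rw [← isUnit_toMatrix_iff, entireFn_eq, LinearMap.toMatrix_toLin, Matrix.isUnit_iff_isUnit_det,
      isUnit_iff_ne_zero]
  have h2 : toComplex K (matFn (sinhDivCoeff K) A).det =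
      (matFn (sinhDivCoeff ℂ) ((toComplex K).mapMatrix A)).det := by
    rw [RingHom.map_det, toComplex_matFn factorialBound_sinhDivCoeff]
    simp only [toComplex_sinhDivCoeff]
  have h3 : ∀ z : ℂ, T.charpoly.sum (fun n a => RCLike.map K ℂ a * z ^ n) =
      ((toComplex K).mapMatrix A).charpoly.eval z := by
    intro z
    rw [RingHom.mapMatrix_apply, Matrix.charpoly_map, Polynomial.eval_map, Polynomial.eval₂_eq_sum,
      hA, LinearMap.charpoly_toMatrix]
    rfl
  rw [h1, ← map_ne_zero (toComplex K), h2, Ne, det_matFn_sinhDiv_eq_zero_iff]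
  simp only [SpectrumAvoids, h3]
  push Not
  rfl

end Spectrum

/-! ### Taylor series of entire functions of a linear family of operators -/

section Transfer

open FM

variable {K : Type*} [RCLike K] {ι : Type*} [Fintype ι] [DecidableEq ι]
  {V W : Type*} [AddCommGroup V] [Module K V] [FiniteDimensional K V]
  [AddCommGroup W] [Module K W] [FiniteDimensional K W]

/-- The formal operator series `∑_k c_k B(S)^k` along a linear family `S_x = ∑_j x_j Z_j` is the
Taylor series of the entire function with coefficients `c_k` evaluated at `B(S_x)`. -/
theorem FM.HasTaylor.ser_entireFn (B : W →ₗ[K] End K V) (Z : ι → W) {c : ℕ → K}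
    (hc : FactorialBound c) {f : FM ι V} {F : (ι → K) → V} (hf : HasTaylor f F) :
    HasTaylor (ser (FM.mul₂ (B : W →ₗ[K] V →ₗ[K] V) (linFam Z) : End K (FM ι V))
      (PowerSeries.mk c) f) (fun x => entireFn c (B (∑ j, x j • Z j)) (F x)) := by
  set T : End K (FM ι V) := FM.mul₂ (B : W →ₗ[K] V →ₗ[K] V) (linFam Z) with hT
  set S : (ι → K) → W := fun x => ∑ j, x j • Z j with hS
  have hraise : Raises T := raises_mul₂ B (linFam_zero_coeff Z)
  have hTf : ∀ {g : FM ι V} {H : (ι → K) → V}, HasTaylor g H →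
      HasTaylor (T g) (fun x => B (S x) (H x)) := fun {g H} hg =>
    HasTaylor.mul₂ (B : W →ₗ[K] V →ₗ[K] V) (hasTaylor_linFam Z) hg
  have hTk : ∀ (k : ℕ) {g : FM ι V} {H : (ι → K) → V}, HasTaylor g H →
      HasTaylor ((T ^ k) g) (fun x => (B (S x) ^ k) (H x)) := by
    intro k g H hg
    induction k with
    | zero => simpa using hg
    | succ k ih => simpa only [pow_succ', Module.End.mul_apply] using hTf ih
  -- the entire function itself has a Taylor series
  have hE : ∀ {c : ℕ → K}, FactorialBound c → ∃ e : FM ι (End K V),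
      HasTaylor e (fun x => entireFn c (B (S x))) := by
    intro c hc
    have h1 : WeakAnalyticAt (fun x : ι → K => B (S x)) 0 :=
      weakAnalyticAt_linearMap (V := End K V) (B ∘ₗ Fintype.linearCombination K Z) 0
    exact exists_hasTaylor (h1.entireFn hc)
  obtain ⟨e, he⟩ := hE hc
  have h0 : HasTaylor (FM.mul₂ (LinearMap.id : End K V →ₗ[K] V →ₗ[K] V) e f)
      (fun x => entireFn c (B (S x)) (F x)) := HasTaylor.mul₂ _ he hf
  have heq : ser T (PowerSeries.mk c) f =
      FM.mul₂ (LinearMap.id : End K V →ₗ[K] V →ₗ[K] V) e f := by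
    ext n
    -- compare with the Taylor polynomial of order `N`: the remainder is divisible by `T^N`, and
    -- so it does not contribute in degree `< N`
    obtain ⟨N, hN⟩ : ∃ N, N = n.degree + 1 := ⟨_, rfl⟩
    obtain ⟨e', he'⟩ := hE (hc.shift N)
    have h1 : HasTaylor ((∑ k ∈ range N, c k • (T ^ k) f) +
        (T ^ N) (FM.mul₂ (LinearMap.id : End K V →ₗ[K] V →ₗ[K] V) e' f))
        (fun x => (∑ k ∈ range N, c k • (B (S x) ^ k) (F x)) +
          (B (S x) ^ N) (entireFn (fun k => c (k + N)) (B (S x)) (F x))) :=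
      HasTaylor.add (HasTaylor.sum _ fun k _ => (hTk k hf).smul (c k))
        (hTk N (HasTaylor.mul₂ (LinearMap.id : End K V →ₗ[K] V →ₗ[K] V) he' hf))
    have h2 := h0.unique h1 (Filter.Eventually.of_forall fun x => entireFn_eq_add hc _ N _)
    have h3 : ((T ^ N) (FM.mul₂ (LinearMap.id : End K V →ₗ[K] V →ₗ[K] V) e' f)) n = 0 := by
      refine hraise.pow N 0 _ (fun m hm => absurd hm (Nat.not_lt_zero _)) n ?_
      omega
    rw [h2, add_coeff, h3, add_zero, ser_coeff_sum hraise _ _ n (N := N) (by omega), sum_coeff]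
    simp
  rw [heq]
  exact h0

end Transfer

section Point

variable {K : Type*} [Field K] {𝔤 : Type*} [LieRing 𝔤] [LieAlgebra K 𝔤]
  {ι : Type*} [Fintype ι] {𝔩 : LieSubalgebra K 𝔤} (b : Basis ι K 𝔩)

theorem point_add (x y : ι → K) : point b (x + y) = point b x + point b y := by
  simp [point, add_smul, Finset.sum_add_distrib]

theorem point_smul (c : K) (x : ι → K) : point b (c • x) = c • point b x := by
  simp [point, Finset.smul_sum, mul_smul]

theorem point_zero : point b (0 : ι → K) = 0 := by simp [point]

end Point

/-! ### The analytic canonical `ℓ`-matrix -/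

section CanonicalAnalytic

open FM ReductiveDecomposition QuasiData

variable {K : Type*} [RCLike K] {𝔤 : Type*} [LieRing 𝔤] [LieAlgebra K 𝔤]
  [FiniteDimensional K 𝔤] {R : ReductiveDecomposition K 𝔤} {G : QuasiData K 𝔤}
  {ι : Type*} [Fintype ι] [DecidableEq ι] (b : Basis ι K R.sub)

variable (R) in
/-- The inclusion `(z, β) ↦ (z, sβ)` of the double of `𝔩` into the double of `𝔤`. -/
def subDouble : (R.sub × Dual K R.sub) →ₗ[K] 𝔤 × Dual K 𝔤 :=
  R.sub.toSubmodule.subtype.prodMap R.sec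

/-- Compatibility makes the inclusion `(z, β) ↦ (z, sβ)` intertwine `ad_p` and `ad_{sp}`. -/
theorem subDouble_adDouble (hcomp : R.IsCompatible G) (p : Dual K R.sub)
    (X : R.sub × Dual K R.sub) : subDouble R ((R.subData G).adDouble (0, p) X) =
      G.adDouble (0, R.sec p) (subDouble R X) := by
  obtain ⟨z, β⟩ := X
  rw [adDouble_apply, adDouble_apply]
  refine Prod.ext ?_ ?_
  · have h1 := hcomp.cocycle_sub (z : 𝔤) z.2
    have h3 : (R.sub.toSubmodule.subtype ((evalEquiv K R.sub).symm
        ((R.subData G).assoc p β)) : 𝔤) = (evalEquiv K 𝔤).symm (G.assoc (R.sec p) (R.sec β)) := by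
      refine ext_dual (K := K) fun ζ => ?_
      have h2 := hcomp.assoc_mixed _ (R.sec_mem p) _ (R.sec_mem β) _ (R.sub_sec_restr_mem ζ)
      rw [map_sub, sub_eq_zero] at h2
      rw [apply_assocVec, h2]
      exact (R.subData G).apply_assocVec p β (restr R.sub ζ)
    simp only [subDouble, doubleBracket, LinearMap.prodMap_apply, map_add, map_sub, h3]
    simp [h1, subData]
  · refine LinearMap.ext fun x => ?_
    have h2 := hcomp.cocycle_complPerp x _ (R.sec_mem β) _ (R.sec_mem p)
    simp only [subDouble, doubleBracket, LinearMap.prodMap_apply]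
    simp [h2, subData, proj_lie_coe]

end CanonicalAnalytic

section LCan

open FM ReductiveDecomposition QuasiData

variable {K : Type*} [RCLike K] {ι : Type*} [Fintype ι]

/-- Weak analyticity of a family of linear maps can be tested pointwise. -/
theorem FM.WeakAnalyticAt.of_apply {V W : Type*} [AddCommGroup V] [Module K V]
    [FiniteDimensional K V] [AddCommGroup W] [Module K W] {F : (ι → K) → V →ₗ[K] W} {x : ι → K}
    (h : ∀ v, WeakAnalyticAt (fun x => F x v) x) : WeakAnalyticAt F x := fun L => by
  set e := finBasis K V
  have h1 : AnalyticAt K (fun x => ∑ i, L ((e.coord i).smulRight (F x (e i)))) x :=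
    Finset.analyticAt_fun_sum _ fun i _ => h (e i) (L ∘ₗ LinearMap.smulRightₗ (e.coord i))
  refine h1.congr (Filter.Eventually.of_forall fun x => ?_)
  have h2 : F x = ∑ i, (e.coord i).smulRight (F x (e i)) := by
    refine e.ext fun j => ?_
    simp [Finsupp.single_apply]
  exact (map_sum L _ _).symm.trans (congrArg L h2.symm)

theorem FM.WeakAnalyticAt.of_linear {V : Type*} [AddCommGroup V] [Module K V] {F : (ι → K) → V}
    (hadd : ∀ x y, F (x + y) = F x + F y) (hsmul : ∀ (c : K) x, F (c • x) = c • F x) (x : ι → K) :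
    WeakAnalyticAt F x := fun L =>
  (((⟨⟨fun x => L (F x), fun x y => by rw [hadd, map_add]⟩, fun c x => by
    exact (congrArg L (hsmul c x)).trans (map_smul L c _)⟩ : (ι → K) →ₗ[K] K)).toContinuousLinearMap).analyticAt x

theorem FM.WeakAnalyticAt.neg {V : Type*} [AddCommGroup V] [Module K V] {F : (ι → K) → V}
    {x : ι → K} (h : WeakAnalyticAt F x) : WeakAnalyticAt (fun x => -F x) x := fun φ =>
  (h φ).neg.congr (Filter.Eventually.of_forall fun x => (map_neg φ (F x)).symm)

variable {𝔤 : Type*} [LieRing 𝔤] [LieAlgebra K 𝔤]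
  [FiniteDimensional K 𝔤] {R : ReductiveDecomposition K 𝔤} (G : QuasiData K 𝔤)
  (b : Basis ι K R.sub)

theorem weakAnalyticAt_adDouble {𝔥 : Type*} [LieRing 𝔥] [LieAlgebra K 𝔥] [FiniteDimensional K 𝔥]
    (H : QuasiData K 𝔥) (L : Dual K R.sub →ₗ[K] Dual K 𝔥) (x : ι → K) :
    WeakAnalyticAt (fun x => H.adDouble (0, L (point b x))) x := by
  refine .of_linear (fun x y => ?_) (fun c x => ?_) x
  · refine LinearMap.ext fun X => ?_
    rw [LinearMap.add_apply, adDouble_apply, adDouble_apply, adDouble_apply, point_add, map_add,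
      ← doubleBracket_add_left]
    simp
  · refine LinearMap.ext fun X => ?_
    rw [LinearMap.smul_apply, adDouble_apply, adDouble_apply, point_smul, map_smul,
      ← doubleBracket_smul_left]
    simp

theorem weakAnalyticAt_AdExpNegSec_apply (X : 𝔤 × Dual K 𝔤) (x : ι → K) :
    WeakAnalyticAt (fun x => G.AdExpNegSec R (point b x) X) x := by
  have h1 := (weakAnalyticAt_adDouble b G R.sec x).neg.entireFn factorialBound_expCoeff
  exact h1.lin (LinearMap.applyₗ X)

theorem weakAnalyticAt_adBlock (x : ι → K) :
    WeakAnalyticAt (fun x => G.adBlock R (point b x)) x :=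
  .of_apply fun v => (weakAnalyticAt_AdExpNegSec_apply G b (v, 0) x).lin (LinearMap.fst K 𝔤 (Dual K 𝔤))

theorem weakAnalyticAt_entireFn_adSub {c : ℕ → K} (hc : FactorialBound c) (x : ι → K) :
    WeakAnalyticAt (fun x => entireFn c ((R.subData G).adDouble (0, point b x))) x :=
  (weakAnalyticAt_adDouble b (R.subData G) LinearMap.id x).entireFn hc

theorem mem_lcanDomain_iff (p : Dual K R.sub) : p ∈ G.lcanDomain R ↔
    IsUnit (entireFn (sinhDivCoeff K) ((R.subData G).adDouble (0, p))) ∧ IsUnit (G.adBlock R p) := by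
  rw [lcanDomain, Set.mem_ofPred_eq, spectrumAvoids_iff, spectrum.zero_notMem_iff]

/-- The domain is the preimage of the invertible operators under continuous maps. -/
theorem isOpen_lcanDomain : IsOpen {x : ι → K | point b x ∈ G.lcanDomain R} := by
  simp only [mem_lcanDomain_iff, Set.ofPred_and]
  exact (isOpen_isUnit fun x =>
      weakAnalyticAt_entireFn_adSub G b factorialBound_sinhDivCoeff x).inter
    (isOpen_isUnit (weakAnalyticAt_adBlock G b))

theorem zero_mem_lcanDomain : (0 : Dual K R.sub) ∈ G.lcanDomain R := by
  have h0 : ∀ {𝔥 : Type _} [LieRing 𝔥] [LieAlgebra K 𝔥] [FiniteDimensional K 𝔥]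
      (H : QuasiData K 𝔥), H.adDouble 0 = 0 := by
    intro 𝔥 _ _ _ H
    refine LinearMap.ext fun X => ?_
    have h := H.doubleBracket_smul_left 0 0 X
    rwa [zero_smul, zero_smul] at h
  have h1 : (R.subData G).adDouble (0, (0 : Dual K R.sub)) = 0 := h0 _
  have h2 : G.adDouble (0, R.sec 0) = 0 := by rw [map_zero]; exact h0 _
  rw [mem_lcanDomain_iff, h1, entireFn_zero factorialBound_sinhDivCoeff]
  constructor
  · simp [sinhDivCoeff]
  · have h3 : G.adBlock R 0 = 1 := by
      refine LinearMap.ext fun v => ?_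
      have h4 : -G.adDouble (0, R.sec 0) = 0 := by
        rw [h2]
        exact LinearMap.ext fun X => neg_zero
      rw [adBlock, AdExpNegSec, h4, entireFn_zero factorialBound_expCoeff]
      simp [expCoeff]
    rw [h3]
    exact isUnit_one

theorem cothSubInv_apply {V : Type*} [AddCommGroup V] [Module K V] [FiniteDimensional K V]
    {T : End K V} (hT : IsUnit (entireFn (sinhDivCoeff K) T)) (v : V) :
    entireFn (sinhDivCoeff K) T (cothSubInv T v) = entireFn (coshSubSinhCoeff K) T v := by
  rw [cothSubInv, ← Module.End.mul_apply, ← mul_assoc, Ring.mul_inverse_cancel _ hT, one_mul]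

theorem weakAnalyticAt_cothSubInv_apply {x : ι → K} (hx : point b x ∈ G.lcanDomain R)
    (X : R.sub × Dual K R.sub) :
    WeakAnalyticAt (fun x => cothSubInv ((R.subData G).adDouble (0, point b x)) X) x := by
  have hu := ((mem_lcanDomain_iff G _).1 hx).1
  have h1 := (weakAnalyticAt_entireFn_adSub G b factorialBound_sinhDivCoeff x).inverse hu
  have h2 := (weakAnalyticAt_entireFn_adSub G b factorialBound_coshSubSinhCoeff x).lin
    (LinearMap.applyₗ X)
  exact h1.mul₂ (LinearMap.id : End K (R.sub × Dual K R.sub) →ₗ[K] _ →ₗ[K] _) h2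

/-- `l^can` is analytic on its domain. -/
theorem weakAnalyticAt_lcan {x : ι → K} (hx : point b x ∈ G.lcanDomain R) :
    WeakAnalyticAt (fun x => G.lcan R (point b x)) x := by
  refine .of_apply fun η => ?_
  have h1 := (weakAnalyticAt_cothSubInv_apply G b hx (0, restr R.sub η)).lin
    (R.sub.toSubmodule.subtype ∘ₗ LinearMap.fst K R.sub (Dual K R.sub))
  have h2 := (weakAnalyticAt_AdExpNegSec_apply G b (0, η - R.sec (restr R.sub η)) x).lin
    (LinearMap.fst K 𝔤 (Dual K 𝔤))
  have h3 := (weakAnalyticAt_adBlock G b x).inverse ((mem_lcanDomain_iff G _).1 hx).2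
  exact h1.sub (h3.mul₂ (LinearMap.id : End K 𝔤 →ₗ[K] _ →ₗ[K] _) h2)

theorem isAnalyticOnOpen_lcan : IsAnalyticOnOpen b (G.lcan R) (G.lcanDomain R) :=
  ⟨isOpen_lcanDomain G b, fun ξ ζ _ hx =>
    weakAnalyticAt_lcan G b hx (ζ ∘ₗ LinearMap.applyₗ ξ)⟩

theorem lcan_sec (p α : Dual K R.sub) : G.lcan R p (R.sec α) =
    ((cothSubInv ((R.subData G).adDouble (0, p)) (0, α)).1 : 𝔤) := by
  have h : restr R.sub (R.sec α) = α := by simp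
  have h0 : ((0, 0) : 𝔤 × Dual K 𝔤) = 0 := rfl
  simp [lcan, rAM, h, h0]

theorem lcan_of_mem_subPerp (p : Dual K R.sub) {ξ : Dual K 𝔤} (hξ : ξ ∈ R.subPerp) :
    G.lcan R p ξ = -Ring.inverse (G.adBlock R p) (G.AdExpNegSec R p (0, ξ)).1 := by
  have h : restr R.sub ξ = 0 := R.restr_eq_zero_iff.2 hξ
  simp [lcan, h]

/-- `l^can_p ξ + ξ` lies in `Ad_{e^{sp}} 𝔤*` for `ξ ∈ 𝔩^⊥`. -/
theorem fst_AdExpNegSec_lcan {p : Dual K R.sub} (hp : p ∈ G.lcanDomain R) {ξ : Dual K 𝔤}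
    (hξ : ξ ∈ R.subPerp) : (G.AdExpNegSec R p (G.lcan R p ξ, ξ)).1 = 0 := by
  have h1 : ((G.lcan R p ξ, ξ) : 𝔤 × Dual K 𝔤) = (G.lcan R p ξ, 0) + (0, ξ) := by simp
  have h2 : (G.AdExpNegSec R p (G.lcan R p ξ, 0)).1 = G.adBlock R p (G.lcan R p ξ) := rfl
  rw [h1, map_add, Prod.fst_add, h2, lcan_of_mem_subPerp G p hξ, map_neg, ← Module.End.mul_apply,
    Ring.mul_inverse_cancel _ ((mem_lcanDomain_iff G p).1 hp).2, Module.End.one_apply, neg_add_cancel]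

end LCan

/-! ### The Taylor series of the canonical `ℓ`-matrix -/

section LCanTaylor

open FM ReductiveDecomposition QuasiData Double

variable {K : Type*} [RCLike K] {ι : Type*} [Fintype ι] [DecidableEq ι]

theorem FM.HasTaylor.eventually_forall {V : Type*} [AddCommGroup V] [Module K V]
    [FiniteDimensional K V] {f : FM ι V} {F : (ι → K) → V} (h : HasTaylor f F) :
    ∀ᶠ x in 𝓝 (0 : ι → K), ∀ φ : Dual K V, HasSum (fun n => mon x n * φ (f n)) (φ (F x)) := by
  set e := finBasis K V
  filter_upwards [Filter.eventually_all.2 fun i => h (e.coord i)] with x hx φ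
  have key : ∀ v, φ v = ∑ i, e.coord i v * φ (e i) := fun v => by
    conv_lhs => rw [← e.sum_repr v, map_sum]
    simp
  rw [key]
  refine (hasSum_sum fun i (_ : i ∈ Finset.univ) => (hx i).mul_right (φ (e i))).congr_terms
    fun n => ?_
  rw [key (f n), Finset.mul_sum]
  exact Finset.sum_congr rfl fun i _ => mul_assoc _ _ _

variable {𝔤 : Type*} [LieRing 𝔤] [LieAlgebra K 𝔤]
  [FiniteDimensional K 𝔤] {R : ReductiveDecomposition K 𝔤} {G : QuasiData K 𝔤}
  (hG : G.IsLieQuasiBialgebra) (b : Basis ι K R.sub)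

/-- The identity map from `𝔤 × 𝔤*` to the double. -/
def Double.ofProd : (𝔤 × Dual K 𝔤) →ₗ[K] Double hG :=
  inl hG ∘ₗ LinearMap.fst K 𝔤 (Dual K 𝔤) + inr hG ∘ₗ LinearMap.snd K 𝔤 (Dual K 𝔤)

theorem Double.fst_ofProd (X : 𝔤 × Dual K 𝔤) : fst hG (ofProd hG X) = X.1 := by simp [ofProd]

theorem Double.snd_ofProd (X : 𝔤 × Dual K 𝔤) : snd hG (ofProd hG X) = X.2 := by simp [ofProd]

theorem Double.ofProd_eq (X : 𝔤 × Dual K 𝔤) : ofProd hG X = X :=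
  ext' hG (fst_ofProd hG X) (snd_ofProd hG X)

theorem Double.ofProd_adDouble (Y X : 𝔤 × Dual K 𝔤) :
    ofProd hG (G.adDouble Y X) = LieAlgebra.ad K (Double hG) (ofProd hG Y) (ofProd hG X) := by
  rw [ofProd_eq, ofProd_eq, ofProd_eq]; rfl

/-- Taylor series of entire functions of `ad_{sp}`. -/
theorem hasTaylor_ser_adSec {c : ℕ → K} (hc : FactorialBound c) {f : FM ι (Double hG)}
    {F : (ι → K) → Double hG} (hf : HasTaylor f F) :
    HasTaylor (ser (adSec hG b) (PowerSeries.mk c) f)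
      (fun x => entireFn c (LieAlgebra.ad K (Double hG) (ofProd hG (0, R.sec (point b x)))) (F x)) := by
  have h := hf.ser_entireFn (LieAlgebra.ad K (Double hG) : Double hG →ₗ[K] End K (Double hG))
    (secFam hG b) hc
  refine h.congr (Filter.Eventually.of_forall fun x => ?_)
  have e : ∑ j, x j • secFam hG b j = ofProd hG (0, R.sec (point b x)) := by
    simp [secFam, point, ofProd, map_sum]
  simp only [e]
  rfl

/-- Entire functions of the adjoint operators on the two models of the double agree. -/
theorem entireFn_ad_ofProd {c : ℕ → K} (hc : FactorialBound c) (ξ : Dual K 𝔤) (X : 𝔤 × Dual K 𝔤) :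
    entireFn c (LieAlgebra.ad K (Double hG) (ofProd hG (0, ξ))) (ofProd hG X) =
      ofProd hG (entireFn c (G.adDouble (0, ξ)) X) :=
  (entireFn_intertwine hc (T := G.adDouble (0, ξ)) (J := ofProd hG)
    (fun X => ofProd_adDouble hG (0, ξ) X) X).symm

theorem expNegS_eq_mk : expNegS K = PowerSeries.mk fun k => (-1) ^ k * expCoeff K k := by
  ext k
  rw [expNegS, coeff_evalNegHom, expS, PowerSeries.coeff_mk, PowerSeries.coeff_mk]

theorem cosh_add_eq_mk : coshDivS K + oneSubSinhS K = PowerSeries.mk (coshSubSinhCoeff K) := by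
  ext k
  rw [map_add, coshDivS, oneSubSinhS, PowerSeries.coeff_mk, PowerSeries.coeff_mk,
    PowerSeries.coeff_mk, coshSubSinhCoeff]
  split_ifs <;> simp [sub_eq_add_neg]

/-- The Taylor series of `l^can` satisfies the relations of the formal canonical `ℓ`-matrix. -/
theorem isCanonical_of_hasTaylor (hcomp : R.IsCompatible G) {l : FM ι (Dual K 𝔤 →ₗ[K] 𝔤)}
    (hl : HasTaylor l (fun x => G.lcan R (point b x))) : IsCanonical R hG b l := by
  have hev : ∀ ξ : Dual K 𝔤, HasTaylor (ev ξ l) (fun x => G.lcan R (point b x) ξ) := fun ξ =>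
    hl.lin (LinearMap.applyₗ ξ)
  have hdom : ∀ᶠ x in 𝓝 (0 : ι → K), point b x ∈ G.lcanDomain R :=
    (isOpen_lcanDomain G b).mem_nhds (by
      rw [Set.mem_ofPred_eq, point_zero]
      exact zero_mem_lcanDomain G)
  have h0 : point b (0 : ι → K) ∈ G.lcanDomain R := hdom.self_of_nhds
  refine ⟨fun α => ?_, fun ξ hξ => ?_⟩
  · obtain ⟨f, hf⟩ := exists_hasTaylor
      ((weakAnalyticAt_cothSubInv_apply G b h0 (0, α)).lin (ofProd hG ∘ₗ subDouble R))
    have h1 := hasTaylor_ser_adSec hG b factorialBound_sinhDivCoeff hf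
    have h2 := hasTaylor_ser_adSec hG b factorialBound_coshSubSinhCoeff
      (hasTaylor_cst (K := K) (ι := ι) (inr hG (R.sec α)))
    -- `F(ad_p) (0, α)` is characterized by `(sinh z / z) F(z) = (cosh z - sinh z / z) / z`
    have h3 : ser (adSec hG b) (sinhDivS K) f =
        ser (adSec hG b) (coshDivS K + oneSubSinhS K) (cstSec hG α) := by
      rw [cosh_add_eq_mk]
      refine h1.unique h2 ?_
      filter_upwards [hdom] with x hx
      have hu := ((mem_lcanDomain_iff G _).1 hx).1
      have hJ : ∀ {c : ℕ → K}, FactorialBound c → ∀ X,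
          entireFn c (LieAlgebra.ad K (Double hG) (ofProd hG (0, R.sec (point b x))))
            (ofProd hG (subDouble R X)) =
          ofProd hG (subDouble R (entireFn c ((R.subData G).adDouble (0, point b x)) X)) := by
        intro c hc X
        rw [entireFn_ad_ofProd hG hc, entireFn_intertwine hc (subDouble_adDouble hcomp (point b x))]
      have hα : inr hG (R.sec α) = ofProd hG (subDouble R (0, α)) := by
        simp [ofProd, subDouble]
      rw [LinearMap.comp_apply, hJ factorialBound_sinhDivCoeff, cothSubInv_apply hu, hα,
        hJ factorialBound_coshSubSinhCoeff]
    have h4 : f = ser (adSec hG b) (cothS K) (cstSec hG α) := by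
      have hT := raises_adSec hG b
      have h5 := congrArg (ser (adSec hG b) (sinhDivS K)⁻¹) h3
      rw [ser_comp_apply hT, ser_comp_apply hT, mul_comm _ (sinhDivS K), sinhDivS_mul_inv, ser_one,
        mul_comm] at h5
      exact h5
    have h6 : lin (prSub R hG) f = f := by
      rw [h4, adSec, (ser_odd hG b hcomp evalNegHom_cothS _).1, prPerp_cstSec]
    rw [← h4, ← h6]
    refine ((hev _).lin (inl hG)).unique (hf.lin (prSub R hG)) (Filter.Eventually.of_forall fun x => ?_)
    rw [lcan_sec, LinearMap.comp_apply, prSub_apply, fst_ofProd]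
    simp [subDouble, proj_coe]
  · have h1 : HasTaylor (graph hG l ξ) (fun x => ofProd hG (G.lcan R (point b x) ξ, ξ)) := by
      refine (((hev ξ).lin (inl hG)).add (hasTaylor_cst (inr hG ξ))).congr
        (Filter.Eventually.of_forall fun x => ?_)
      simp [ofProd]
    have h2 := (hasTaylor_ser_adSec hG b factorialBound_expCoeff.neg_pow h1).lin (fst hG)
    rw [← expNegS_eq_mk] at h2
    have h3 : (0 : FM ι 𝔤) = cst K (0 : 𝔤) := by ext n; simp
    rw [h3]
    refine h2.unique (hasTaylor_cst 0) ?_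
    filter_upwards [hdom] with x hx
    rw [entireFn_ad_ofProd hG factorialBound_expCoeff.neg_pow, fst_ofProd, ← entireFn_neg
      factorialBound_expCoeff]
    exact fst_AdExpNegSec_lcan G hx hξ

/-- The Taylor series of `l^can + ρ`, with `l^can` formed from the twist by `ρ`, is a dynamical
`ℓ`-matrix whose value at the origin is `ρ`. -/
theorem exists_canonical_dynl (hG : G.IsLieQuasiBialgebra) (hcomp : R.IsCompatible G) (ρ : R.variety G) :
    ∃ l : G.Dynl b, IsTaylorSeries b (fun p => (G.twist ρ).lcan R p + ρ) l.1 ∧ l.1 0 = ρ.1.1 := by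
  have hG' := hG.twist ρ.1
  have hcomp' := hcomp.twist ρ
  have h0 : point b (0 : ι → K) ∈ (G.twist ρ).lcanDomain R := by
    rw [point_zero]
    exact zero_mem_lcanDomain _
  obtain ⟨l, hl⟩ := exists_hasTaylor (weakAnalyticAt_lcan (G.twist ρ) b h0)
  have hcan := isCanonical_of_hasTaylor hG' b hcomp' hl
  have hdyn := hcan.isFormalDynl hcomp' ρ.2.2.2
  refine ⟨⟨(l + cst K ρ.1.1).toFun, hdyn.add_cst⟩, ?_, ?_⟩
  · filter_upwards [(hl.add (hasTaylor_cst ρ.1.1)).eventually_forall] with x hx ξ ζ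
    exact hx (ζ ∘ₗ LinearMap.applyₗ ξ)
  · change (l + cst K ρ.1.1 : FM ι (Dual K 𝔤 →ₗ[K] 𝔤)) 0 = ρ.1.1
    rw [add_coeff, hcan.coeff_zero, cst_zero_coeff, zero_add]

end LCanTaylor

end DynLie

theorem mainTheorem2 {K : Type*} [RCLike K] {𝔤 : Type*} [LieRing 𝔤] [LieAlgebra K 𝔤]
    [FiniteDimensional K 𝔤] (R : DynLie.ReductiveDecomposition K 𝔤)
    (G : DynLie.QuasiData K 𝔤) (hG : G.IsLieQuasiBialgebra) (hcomp : R.IsCompatible G)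
    {ι : Type*} [Fintype ι] [DecidableEq ι] (b : Module.Basis ι K R.sub) :
    Equivalence (G.GaugeEquiv b) ∧
    ∃ f : G.Moduli b → R.variety G,
      (∀ C : G.Moduli b, ∃ l : G.Dynl b, R.IsNormalized (l.1 0) ∧ Quot.mk _ l = C) ∧
      (∀ l : G.Dynl b, R.IsNormalized (l.1 0) →
        ((f (Quot.mk _ l) : DynLie.skewMaps K 𝔤) : Module.Dual K 𝔤 →ₗ[K] 𝔤) = l.1 0) ∧
      Function.Bijective f ∧
      ∀ ρ : R.variety G,
        (0 : Module.Dual K R.sub) ∈ (G.twist ρ).lcanDomain R ∧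
        DynLie.IsAnalyticOnOpen b ((G.twist ρ).lcan R) ((G.twist ρ).lcanDomain R) ∧
        ∃ l : G.Dynl b,
          DynLie.IsTaylorSeries b (fun p => (G.twist ρ).lcan R p + ρ) l.1 ∧
          f (Quot.mk _ l) = ρ := by
  have hex := DynLie.exists_canonical_dynl b hG hcomp
  obtain ⟨f, hf, hbij⟩ := DynLie.exists_moduli_bijection (b := b) hG hcomp fun ρ =>
    (hex ρ).imp fun l hl => hl.2
  refine ⟨DynLie.gaugeEquiv_equivalence b hG, f,
    DynLie.exists_normalized_representative hG hcomp, hf, hbij, fun ρ => ?_⟩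
  refine ⟨DynLie.zero_mem_lcanDomain _, DynLie.isAnalyticOnOpen_lcan _ b, ?_⟩
  obtain ⟨l, hl, hl0⟩ := hex ρ
  refine ⟨l, hl, Subtype.ext (Subtype.ext ?_)⟩
  exact (hf l (by rw [hl0]; exact ρ.2.1)).trans hl0
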